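/- A \emph{polyhedron} is a nonempty bounded closed regular set $P\subset\mathbb R^3$ ($P$ is the closure of its interior) whose boundary lies on finitely many planes; it need be neither convex nor connected. Its \emph{facets} $F_1,\dots,F_n$ are the connected components of the set of boundary points near which $P$ coincides with a half-space, and $\nu(F_i)\neq 0$ is a normal vector of $F_i$ pointing into $P$. The pair $(F_i,d)$, $d\in\mathbb R^3$, is \emph{valid} ($d$ is a valid pull-out direction when $F_i$ is the top facet) if $d\cdot\nu(F_i)<0$ and $d\cdot\nu(F_j)\ge 0$ for all $j\ne i$; the facet $F_i$ is a \emph{valid top facet} if $(F_i,d)$ is valid for some $d$. A \emph{covering set} is a set of open hemispheres $\bar h(F_i)=\{d\in S^2 : d\cdot\nu(F_i)<0\}$ whose union is the unit sphere $S^2$. The model of computation is the real RAM (arrays of real numbers and of natural numbers; unit cost for each arithmetic operation $+,-,\cdot,/$ on reals and $+,-$ on naturals, comparison, memory access, assignment, test and procedure call; no floor function and no roots). The input is $n$ together with the list of the inward facet normals $\nu(F_1),\dots,\nu(F_n)$. (AllFSD) There is a real-RAM program that, for every polyhedron with $n$ facets, halts within $O(n)$ steps and outputs a covering set of at most $12$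 hemispheres, the list of all valid top facets, and, for each valid top facet, one valid pull-out direction. (AllFAD) There is a real-RAM program that, for every polyhedron with $n$ facets, halts within $O(n\log n)$ steps and outputs a covering set of at most $12$ hemispheres, the list of all valid top facets, and, for each valid top facet $F_i$, the set of all its valid pull-out directions, in boundary representation: irredundant vectors $v_0,\dots,v_{c-1}$ whose nonzero nonnegative combinations are exactly the $d$ with $(F_i,d)$ valid, listed in counterclockwise order (that is, the corners, in cyclic order, of the spherical convex polygon, arc or point formed by the valid directions). The constants in $O(\cdot)$ are absolute. -/

import Mathlib

/-! ### Polyhedra, facets, inward normals -/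

/-- Three-dimensional Euclidean space. -/
abbrev E3 := EuclideanSpace ℝ (Fin 3)

/-- A (solid) polyhedron: a nonempty bounded closed regular set (no dangling edges or facets)
whose boundary lies on finitely many planes.  It need be neither convex nor connected.  Since the
boundary of `P` meets no open cell of the arrangement of these planes, such a `P` is a finite union
of full-dimensional convex polytopes. -/
structure IsPolyhedron (P : Set E3) : Prop where
  nonempty : P.Nonempty
  isCompact : IsCompact P
  regular : closure (interior P) = P
  planar : ∃ H : Finset (E3 × ℝ), (∀ h ∈ H, h.1 ≠ 0) ∧
    frontier P ⊆ ⋃ h ∈ H, {x : E3 | inner ℝ h.1 x = h.2}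

/-- `ν ≠ 0` is an inward normal of `P` at the boundary point `x`: near `x`, the set `P` coincides
with the closed half-space bounded by the plane through `x` orthogonal to `ν`, on the side of `ν`.
(Only the direction of `ν` matters; it is not required to have length one.) -/
def IsInwardNormalAt (P : Set E3) (x ν : E3) : Prop :=
  ν ≠ 0 ∧ ∀ᶠ y in nhds x, (y ∈ P ↔ 0 ≤ inner ℝ ν (y - x))

/-- The boundary points near which the boundary of `P` is flat, that is, the boundary points that
are on no edge and no vertex. -/
def flatBoundary (P : Set E3) : Set E3 :=
  {x | ∃ ν, IsInwardNormalAt P x ν}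

/-- The facets of `P`, taken relatively open: the connected components of the flat boundary. -/
def facets (P : Set E3) : Set (Set E3) :=
  {F | ∃ x ∈ flatBoundary P, F = connectedComponentIn (flatBoundary P) x}

/-- A polyhedron with exactly `n` facets `F₀, …, Fₙ₋₁`, together with an inward normal vector (of
arbitrary length) of each facet. -/
structure Polyhedron (n : ℕ) where
  carrier : Set E3
  isPolyhedron : IsPolyhedron carrier
  facet : Fin n → Set E3
  facet_injective : Function.Injective facet
  range_facet : Set.range facet = facets carrier
  normal : Fin n → E3
  normal_spec : ∀ i, ∀ x ∈ facet i, IsInwardNormalAt carrier x (normal i)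

namespace Polyhedron

variable {n : ℕ} (P : Polyhedron n)

/-- `(Fᵢ, d)` is a valid pair: `d` is a valid pull-out direction when `Fᵢ` is the top facet. -/
def IsValidPair (i : Fin n) (d : E3) : Prop :=
  inner ℝ d (P.normal i) < 0 ∧ ∀ j, j ≠ i → 0 ≤ inner ℝ d (P.normal j)

/-- `Fᵢ` is a valid top facet. -/
def IsValidTopFacet (i : Fin n) : Prop :=
  ∃ d : E3, P.IsValidPair i d

/-- The open hemisphere of the directions that point out of `P` at `Fᵢ`. -/
def openHemisphere (i : Fin n) : Set E3 :=
  {d | d ∈ Metric.sphere (0 : E3) 1 ∧ inner ℝ d (P.normal i) < 0}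

/-- The open hemispheres of the facets with index in `S` cover the whole unit sphere. -/
def IsCoveringSet (S : Set (Fin n)) : Prop :=
  (⋃ i ∈ S, P.openHemisphere i) = Metric.sphere (0 : E3) 1

end Polyhedron

/-- The vectors `v₀, …, v_{c-1}` are a boundary description of the set `D` of directions (a
spherical convex polygon, an arc or a point, seen as a set of nonzero vectors): the elements of `D`
are the nonzero nonnegative combinations of the `vₖ`; none of the `vₖ` is redundant, so that they
span exactly the extreme rays of the cone (the corners of the polygon); and they are listed in
cyclic counterclockwise order, all other corners being strictly to the left of each side
`vₖ vₖ₊₁`. -/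
structure IsBoundaryDescription (D : Set E3) {c : ℕ} (v : Fin c → E3) : Prop where
  generates : ∀ d, d ∈ D ↔ d ≠ 0 ∧ ∃ a : Fin c → ℝ, (∀ k, 0 ≤ a k) ∧ d = ∑ k, a k • v k
  irredundant : ∀ k, ¬ ∃ a : Fin c → ℝ, (∀ l, 0 ≤ a l) ∧ a k = 0 ∧ v k = ∑ l, a l • v l
  cyclic : ∀ k k' l : Fin c, (k' : ℕ) = ((k : ℕ) + 1) % c → l ≠ k → l ≠ k' →
    0 < Matrix.det (Matrix.of ![⇑(v k), ⇑(v k'), ⇑(v l)])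

/-! ### The real RAM

Programs are finite texts of a small imperative language.  The memory consists of arrays of real
numbers and arrays of natural numbers (an array is named by a numeral in the program text; cells
are addressed by computed natural numbers).  Every arithmetic operation, comparison, memory access,
assignment, test and procedure call costs one time unit.  There is no rounding of reals to
integers, no root extraction, and no multiplication of natural numbers. -/

namespace RealRAM

/-- The memory: `nat b i` and `real b i` are the cells number `i` of the arrays named `b`. -/
structure State where
  nat : ℕ → ℕ → ℕ
  real : ℕ → ℕ → ℝ

/-- Index expressions; `sub` is truncated subtraction. -/
inductive NExp where
  | const (k : ℕ)
  | get (b : ℕ) (i : NExp)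
  | add (e f : NExp)
  | sub (e f : NExp)

/-- Real expressions, with rational constants; the quotient by `0` is `0`. -/
inductive RExp where
  | const (q : ℚ)
  | get (b : ℕ) (i : NExp)
  | add (e f : RExp)
  | sub (e f : RExp)
  | mul (e f : RExp)
  | div (e f : RExp)

/-- Tests. -/
inductive BExp where
  | natLt (e f : NExp)
  | realLt (e f : RExp)
  | not (b : BExp)
  | and (b c : BExp)

/-- Commands.  `call k` executes procedure number `k` of the program on the common memory;
procedures may be recursive. -/
inductive Cmd where
  | skip
  | setNat (b : ℕ) (i e : NExp)
  | setReal (b : ℕ) (i : NExp) (e : RExp)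
  | seq (c d : Cmd)
  | cond (t : BExp) (c d : Cmd)
  | loop (t : BExp) (c : Cmd)
  | call (k : ℕ)

/-- A program: a finite list of procedures and a main command. -/
structure Program where
  procs : List Cmd
  main : Cmd

def NExp.eval (σ : State) : NExp → ℕ
  | .const k => k
  | .get b i => σ.nat b (i.eval σ)
  | .add e f => e.eval σ + f.eval σ
  | .sub e f => e.eval σ - f.eval σ

noncomputable def RExp.eval (σ : State) : RExp → ℝ
  | .const q => (q : ℝ)
  | .get b i => σ.real b (i.eval σ)
  | .add e f => e.eval σ + f.eval σ
  | .sub e f => e.eval σ - f.eval σ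
  | .mul e f => e.eval σ * f.eval σ
  | .div e f => e.eval σ / f.eval σ

/-- The test succeeds in the state `σ`. -/
def BExp.Holds (σ : State) : BExp → Prop
  | .natLt e f => e.eval σ < f.eval σ
  | .realLt e f => e.eval σ < f.eval σ
  | .not b => ¬ b.Holds σ
  | .and b c => b.Holds σ ∧ c.Holds σ

/-- Evaluation time of an expression: its number of nodes. -/
def NExp.cost : NExp → ℕ
  | .const _ => 1
  | .get _ i => i.cost + 1
  | .add e f => e.cost + f.cost + 1
  | .sub e f => e.cost + f.cost + 1

/-- Evaluation time of an expression: its number of nodes. -/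
def RExp.cost : RExp → ℕ
  | .const _ => 1
  | .get _ i => i.cost + 1
  | .add e f => e.cost + f.cost + 1
  | .sub e f => e.cost + f.cost + 1
  | .mul e f => e.cost + f.cost + 1
  | .div e f => e.cost + f.cost + 1

/-- Evaluation time of an expression: its number of nodes. -/
def BExp.cost : BExp → ℕ
  | .natLt e f => e.cost + f.cost + 1
  | .realLt e f => e.cost + f.cost + 1
  | .not b => b.cost + 1
  | .and b c => b.cost + c.cost + 1

/-- Store `x` in cell `i` of the array `b` of naturals. -/
def State.setNat (σ : State) (b i x : ℕ) : State :=
  { σ with nat := fun b' i' => if b' = b ∧ i' = i then x else σ.nat b' i' }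

/-- Store `x` in cell `i` of the array `b` of reals. -/
noncomputable def State.setReal (σ : State) (b i : ℕ) (x : ℝ) : State :=
  { σ with real := fun b' i' => if b' = b ∧ i' = i then x else σ.real b' i' }

/-- `Exec procs c σ t τ`: started in memory `σ`, the command `c` terminates after exactly `t` time
units with memory `τ`.  (Execution is deterministic: `t` and `τ` are determined by `c` and `σ`.) -/
inductive Exec (procs : List Cmd) : Cmd → State → ℕ → State → Prop
  | skip (σ : State) : Exec procs .skip σ 1 σ
  | setNat (b : ℕ) (i e : NExp) (σ : State) :
      Exec procs (.setNat b i e) σ (i.cost + e.cost + 1) (σ.setNat b (i.eval σ) (e.eval σ))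
  | setReal (b : ℕ) (i : NExp) (e : RExp) (σ : State) :
      Exec procs (.setReal b i e) σ (i.cost + e.cost + 1) (σ.setReal b (i.eval σ) (e.eval σ))
  | seq {c d : Cmd} {σ τ ρ : State} {s t : ℕ} :
      Exec procs c σ s τ → Exec procs d τ t ρ → Exec procs (.seq c d) σ (s + t) ρ
  | condTrue {b : BExp} {c d : Cmd} {σ τ : State} {t : ℕ} :
      b.Holds σ → Exec procs c σ t τ → Exec procs (.cond b c d) σ (b.cost + t + 1) τ
  | condFalse {b : BExp} {c d : Cmd} {σ τ : State} {t : ℕ} :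
      ¬ b.Holds σ → Exec procs d σ t τ → Exec procs (.cond b c d) σ (b.cost + t + 1) τ
  | loopDone {b : BExp} {c : Cmd} {σ : State} :
      ¬ b.Holds σ → Exec procs (.loop b c) σ (b.cost + 1) σ
  | loopStep {b : BExp} {c : Cmd} {σ τ ρ : State} {s t : ℕ} :
      b.Holds σ → Exec procs c σ s τ → Exec procs (.loop b c) τ t ρ →
      Exec procs (.loop b c) σ (b.cost + s + t + 1) ρ
  | call {k : ℕ} {c : Cmd} {σ τ : State} {t : ℕ} :
      procs[k]? = some c → Exec procs c σ t τ → Exec procs (.call k) σ (t + 1) τ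

/-- Started in memory `σ`, the program `p` halts after exactly `t` time units with memory `τ`. -/
def Program.Runs (p : Program) (σ : State) (t : ℕ) (τ : State) : Prop :=
  Exec p.procs p.main σ t τ

/-- The vector whose coordinates are in the cells `i` of the arrays `b`, `b + 1`, `b + 2`. -/
noncomputable def State.vec (σ : State) (b i : ℕ) : E3 :=
  !₂[σ.real b i, σ.real (b + 1) i, σ.real (b + 2) i]

end RealRAM

/-! ### Input and output conventions -/

namespace Polyhedron

open RealRAM

variable {n : ℕ} (P : Polyhedron n)

/-- The input: `n` is in cell `0` of the natural array `0`, and the coordinates of the inward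
normal of `Fᵢ` are in the cells `i` of the real arrays `0`, `1`, `2`.  All other cells are `0`. -/
noncomputable def input : State where
  nat := fun b i => if b = 0 ∧ i = 0 then n else 0
  real := fun b i => if h : b < 3 ∧ i < n then P.normal ⟨i, h.2⟩ ⟨b, h.1⟩ else 0

/-- The memory `σ` contains a covering set of at most 12 hemispheres: their number `m` is in cell
`0` of the natural array `1`, and the indices of their facets are in the cells `0, …, m - 1` of the
natural array `2`. -/
def OutputsCoveringSet (σ : State) : Prop :=
  σ.nat 1 0 ≤ 12 ∧ (∀ k < σ.nat 1 0, σ.nat 2 k < n) ∧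
    P.IsCoveringSet {i : Fin n | ∃ k < σ.nat 1 0, σ.nat 2 k = (i : ℕ)}

/-- The memory `σ` contains the list of all valid top facets, without repetition: their number `m`
is in cell `0` of the natural array `3`, and their indices are in the cells `0, …, m - 1` of the
natural array `4`. -/
def OutputsValidTopFacets (σ : State) : Prop :=
  (∀ k < σ.nat 3 0, ∀ l < σ.nat 3 0, σ.nat 4 k = σ.nat 4 l → k = l) ∧
  (∀ k < σ.nat 3 0, σ.nat 4 k < n) ∧
  ∀ i : Fin n, P.IsValidTopFacet i ↔ ∃ k < σ.nat 3 0, σ.nat 4 k = (i : ℕ)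

/-- The memory `σ` contains a solution of the problem "all facets, single direction": the valid top
facets and, for the `k`-th of them, a valid pull-out direction, with its coordinates in the cells
`k` of the real arrays `3`, `4`, `5`. -/
def OutputsAllFSD (σ : State) : Prop :=
  P.OutputsValidTopFacets σ ∧
    ∀ k < σ.nat 3 0, ∀ i : Fin n, σ.nat 4 k = (i : ℕ) → P.IsValidPair i (σ.vec 3 k)

/-- The memory `σ` contains a solution of the problem "all facets, all directions": the valid top
facets and, for the `k`-th of them, a boundary description of the set of all its valid pull-out
directions, formed by the vectors number `s, s + 1, …, s + c - 1` of the real arrays `3`, `4`, `5`,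
where `s` and `c` are in the cells `k` of the natural arrays `5` and `6`. -/
def OutputsAllFAD (σ : State) : Prop :=
  P.OutputsValidTopFacets σ ∧
    ∀ k < σ.nat 3 0, ∀ i : Fin n, σ.nat 4 k = (i : ℕ) →
      IsBoundaryDescription {d | P.IsValidPair i d}
        (fun j : Fin (σ.nat 6 k) => σ.vec 3 (σ.nat 5 k + j))

end Polyhedron

namespace RealRAM

/-! ### Reading and writing memory -/

/-! Write ν_j for the inward normals. The geometric input is `Polyhedron.exists_inner_neg`: a
generic line in a direction d ≠ 0 through the interior of P has a last point in P, near which the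
boundary lies in a single plane, so that d leaves P through a facet and d·ν_j < 0 for some j. Hence
(F_i, d) is valid if and only if d ≠ 0 and d·ν_j ≥ 0 for all j ≠ i (`isValidPair_iff`); the strict
inequality for i is automatic. What remains is homogeneous linear programming in dimension three on
the list of normals.

The procedure `lp` decides in linear time whether the constraints d·ν_j ≥ 0, with one index possibly
skipped, have a nonzero solution. It returns a solution, or twelve of the constraints whose only
common solution is 0. In coordinates d = y v + a q₁ + b q₂ with v orthogonal to no normal, each
constraint becomes, after scaling, a lower or an upper bound for y by a linear function of (a, b). A
point (a, b) admits some y exactly if the minimum over the lower family plus the minimum over the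
upper family is nonnegative. If the test fails, the two minimizers form a pair of constraints whose
sum is negative there and which thus excludes an open half-plane of points. Six such pairs suffice:
one forces a ≥ 0, two exclude the points with a = 0 and b ≠ 0, two confine b / a to an interval, and
the last excludes this interval (`Evidence.infeasible`). That is the source of the number twelve.
The interval is narrowed by prune and search: consecutive functions of a family are paired, their
crossings are collected, an approximate median of the crossings is tested, and every pair that does
not cross in the remaining interval loses its larger member. A fixed fraction of the functions
disappears in each round, so the total time is linear.

With nothing skipped there is no nonzero solution, and the twelve returned facets form a covering
set. A facet outside this set cannot be a valid top facet, because omitting its constraint keeps all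
twelve. So at most twelve candidates remain, and one further run of `lp` for each of them, with its
own constraint skipped, yields a valid direction or refutes it. This proves (AllFSD).

For (AllFAD), a valid direction is moved parallel to F_i in two steps until two constraints are
tight, which gives an extreme ray v of the cone of valid directions. In a basis adapted to v, the
constraints that are tight at v only restrict b / a to an interval, while every other constraint is
a lower bound for y. The section a = 1 is therefore the region above the negative of a lower
envelope of lines over an interval. The envelope is found by sorting the lines by slope and scanning
them with a stack; its breakpoints and v are the corners. Sorting is the only step that takes more
than linear time.

The programs are verified with the total correctness judgement `Run`, which carries a time budget.
Loops are paid for by a potential, and `Frame` records which arrays a command can change. -/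

@[simp] theorem State.setNat_nat_same (σ : State) (b i x : ℕ) :
    (σ.setNat b i x).nat b = Function.update (σ.nat b) i x := by
  funext k
  by_cases h : k = i <;> simp [State.setNat, Function.update, h]

@[simp] theorem State.setNat_nat_ne (σ : State) {b b' : ℕ} (i x : ℕ) (h : b' ≠ b) :
    (σ.setNat b i x).nat b' = σ.nat b' := by
  funext k
  simp [State.setNat, h]

@[simp] theorem State.setNat_real (σ : State) (b i x : ℕ) : (σ.setNat b i x).real = σ.real := rfl

@[simp] theorem State.setReal_real_same (σ : State) (b i : ℕ) (x : ℝ) :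
    (σ.setReal b i x).real b = Function.update (σ.real b) i x := by
  funext k
  by_cases h : k = i <;> simp [State.setReal, Function.update, h]

@[simp] theorem State.setReal_real_ne (σ : State) {b b' : ℕ} (i : ℕ) (x : ℝ) (h : b' ≠ b) :
    (σ.setReal b i x).real b' = σ.real b' := by
  funext k
  simp [State.setReal, h]

@[simp] theorem State.setReal_nat (σ : State) (b i : ℕ) (x : ℝ) :
    (σ.setReal b i x).nat = σ.nat := rfl

/-! ### Notation for program texts -/

instance (k : ℕ) : OfNat NExp k := ⟨.const k⟩
instance : Add NExp := ⟨.add⟩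
instance : Sub NExp := ⟨.sub⟩
instance (k : ℕ) : OfNat RExp k := ⟨.const k⟩
instance : Add RExp := ⟨.add⟩
instance : Sub RExp := ⟨.sub⟩
instance : Mul RExp := ⟨.mul⟩
instance : Div RExp := ⟨.div⟩

/-- The natural variable in cell `0` of the array `b`. -/
def nv (b : ℕ) : NExp := .get b 0
/-- The real variable in cell `0` of the array `b`. -/
def rv (b : ℕ) : RExp := .get b 0
/-- Assignment to the natural variable `b`. -/
def setN (b : ℕ) (e : NExp) : Cmd := .setNat b 0 e
/-- Assignment to the real variable `b`. -/
def setR (b : ℕ) (e : RExp) : Cmd := .setReal b 0 e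

infixr:30 " ;; " => Cmd.seq

def BExp.or (b c : BExp) : BExp := .not (.and (.not b) (.not c))
def BExp.le (e f : RExp) : BExp := .not (.realLt f e)
def BExp.natNe (e f : NExp) : BExp := .or (.natLt e f) (.natLt f e)

section eval
variable (σ : State)

@[simp] theorem eval_ofNat (k : ℕ) : NExp.eval σ (no_index (OfNat.ofNat k)) = OfNat.ofNat k := rfl
@[simp] theorem eval_natAdd (e f : NExp) : NExp.eval σ (e + f) = e.eval σ + f.eval σ := rfl
@[simp] theorem eval_natSub (e f : NExp) : NExp.eval σ (e - f) = e.eval σ - f.eval σ := rfl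
@[simp] theorem eval_natGet (b : ℕ) (e : NExp) : (NExp.get b e).eval σ = σ.nat b (e.eval σ) := rfl
@[simp] theorem eval_nv (b : ℕ) : (nv b).eval σ = σ.nat b 0 := rfl
@[simp] theorem eval_realOfNat (k : ℕ) : RExp.eval σ (no_index (OfNat.ofNat k)) = ((OfNat.ofNat k : ℕ) : ℝ) := by
  show ((k : ℚ) : ℝ) = (k : ℝ)
  simp
@[simp] theorem eval_realAdd (e f : RExp) : RExp.eval σ (e + f) = e.eval σ + f.eval σ := rfl
@[simp] theorem eval_realSub (e f : RExp) : RExp.eval σ (e - f) = e.eval σ - f.eval σ := rfl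
@[simp] theorem eval_realMul (e f : RExp) : RExp.eval σ (e * f) = e.eval σ * f.eval σ := rfl
@[simp] theorem eval_realDiv (e f : RExp) : RExp.eval σ (e / f) = e.eval σ / f.eval σ := rfl
@[simp] theorem eval_realGet (b : ℕ) (e : NExp) :
    (RExp.get b e).eval σ = σ.real b (e.eval σ) := rfl
@[simp] theorem eval_rv (b : ℕ) : (rv b).eval σ = σ.real b 0 := rfl
@[simp] theorem holds_natLt (e f : NExp) : (BExp.natLt e f).Holds σ ↔ e.eval σ < f.eval σ := Iff.rfl
@[simp] theorem holds_realLt (e f : RExp) :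
    (BExp.realLt e f).Holds σ ↔ e.eval σ < f.eval σ := Iff.rfl
@[simp] theorem holds_not (b : BExp) : (BExp.not b).Holds σ ↔ ¬ b.Holds σ := Iff.rfl
@[simp] theorem holds_and (b c : BExp) : (BExp.and b c).Holds σ ↔ b.Holds σ ∧ c.Holds σ := Iff.rfl
@[simp] theorem holds_or (b c : BExp) : (BExp.or b c).Holds σ ↔ b.Holds σ ∨ c.Holds σ := by
  simp only [BExp.or, holds_not, holds_and]; tauto
@[simp] theorem holds_le (e f : RExp) : (BExp.le e f).Holds σ ↔ e.eval σ ≤ f.eval σ := by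
  simp [BExp.le]
@[simp] theorem holds_natNe (e f : NExp) : (BExp.natNe e f).Holds σ ↔ e.eval σ ≠ f.eval σ := by
  simp only [BExp.natNe, holds_or, holds_natLt]; omega

end eval

/-! ### Loop-free commands -/

/-- Commands without loops and calls. -/
def Cmd.simple : Cmd → Bool
  | .skip => true
  | .setNat _ _ _ => true
  | .setReal _ _ _ => true
  | .seq c d => c.simple && d.simple
  | .cond _ c d => c.simple && d.simple
  | .loop _ _ => false
  | .call _ => false

open Classical in
/-- The memory after the execution of a loop-free command. -/
noncomputable def Cmd.den : Cmd → State → State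
  | .skip, σ => σ
  | .setNat b i e, σ => σ.setNat b (i.eval σ) (e.eval σ)
  | .setReal b i e, σ => σ.setReal b (i.eval σ) (e.eval σ)
  | .seq c d, σ => d.den (c.den σ)
  | .cond t c d, σ => if t.Holds σ then c.den σ else d.den σ
  | .loop _ _, σ => σ
  | .call _, σ => σ

/-- A bound for the execution time of a loop-free command. -/
def Cmd.bound : Cmd → ℕ
  | .skip => 1
  | .setNat _ i e => i.cost + e.cost + 1
  | .setReal _ i e => i.cost + e.cost + 1
  | .seq c d => c.bound + d.bound
  | .cond t c d => t.cost + (c.bound + d.bound) + 1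
  | .loop _ _ => 0
  | .call _ => 0

section den
variable (σ : State)
@[simp] theorem den_skip : Cmd.skip.den σ = σ := rfl
@[simp] theorem den_setNat (b : ℕ) (i e : NExp) :
    (Cmd.setNat b i e).den σ = σ.setNat b (i.eval σ) (e.eval σ) := rfl
@[simp] theorem den_setReal (b : ℕ) (i : NExp) (e : RExp) :
    (Cmd.setReal b i e).den σ = σ.setReal b (i.eval σ) (e.eval σ) := rfl
@[simp] theorem den_setN (b : ℕ) (e : NExp) : (setN b e).den σ = σ.setNat b 0 (e.eval σ) := rfl
@[simp] theorem den_setR (b : ℕ) (e : RExp) : (setR b e).den σ = σ.setReal b 0 (e.eval σ) := rfl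
@[simp] theorem den_seq (c d : Cmd) : (Cmd.seq c d).den σ = d.den (c.den σ) := rfl
theorem den_cond_pos {t : BExp} (h : t.Holds σ) (c d : Cmd) : (Cmd.cond t c d).den σ = c.den σ := by
  simp [Cmd.den, h]
theorem den_cond_neg {t : BExp} (h : ¬ t.Holds σ) (c d : Cmd) :
    (Cmd.cond t c d).den σ = d.den σ := by
  simp [Cmd.den, h]
end den

/-- Without loops and calls every command halts, so its effect is the total function `Cmd.den`. The
bound charges both branches of a test and therefore does not depend on the memory. -/
theorem Exec.of_simple (procs : List Cmd) : ∀ {c : Cmd}, c.simple = true → ∀ σ : State,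
    ∃ t ≤ c.bound, Exec procs c σ t (c.den σ)
  | .skip, _, σ => ⟨1, le_rfl, .skip σ⟩
  | .setNat b i e, _, σ => ⟨_, le_rfl, .setNat b i e σ⟩
  | .setReal b i e, _, σ => ⟨_, le_rfl, .setReal b i e σ⟩
  | .seq c d, h, σ => by
    simp only [Cmd.simple, Bool.and_eq_true] at h
    obtain ⟨s, hs, hc⟩ := Exec.of_simple procs h.1 σ
    obtain ⟨t, ht, hd⟩ := Exec.of_simple procs h.2 (c.den σ)
    exact ⟨s + t, Nat.add_le_add hs ht, .seq hc hd⟩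
  | .cond b c d, h, σ => by
    simp only [Cmd.simple, Bool.and_eq_true] at h
    by_cases hb : b.Holds σ
    · obtain ⟨s, hs, hc⟩ := Exec.of_simple procs h.1 σ
      refine ⟨b.cost + s + 1, by simp only [Cmd.bound]; omega, ?_⟩
      rw [den_cond_pos σ hb]
      exact .condTrue hb hc
    · obtain ⟨s, hs, hc⟩ := Exec.of_simple procs h.2 σ
      refine ⟨b.cost + s + 1, by simp only [Cmd.bound]; omega, ?_⟩
      rw [den_cond_neg σ hb]
      exact .condFalse hb hc

/-! ### Total correctness with time bounds -/

/-- Started in `σ`, the command `c` halts within `T` steps in a memory that satisfies `Q`. -/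
def Run (c : Cmd) (σ : State) (T : ℕ) (Q : State → Prop) : Prop :=
  ∃ t ≤ T, ∃ τ, Exec [] c σ t τ ∧ Q τ

theorem Run.mono {c : Cmd} {σ : State} {T T' : ℕ} {Q Q' : State → Prop} (h : Run c σ T Q)
    (hT : T ≤ T') (hQ : ∀ τ, Q τ → Q' τ) : Run c σ T' Q' := by
  obtain ⟨t, ht, τ, he, hq⟩ := h
  exact ⟨t, ht.trans hT, τ, he, hQ τ hq⟩

theorem Run.simple {c : Cmd} (hc : c.simple = true) {σ : State} {Q : State → Prop}
    (h : Q (c.den σ)) : Run c σ c.bound Q := by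
  obtain ⟨t, ht, he⟩ := Exec.of_simple [] hc σ
  exact ⟨t, ht, _, he, h⟩

theorem Run.seq {c d : Cmd} {σ : State} {S T : ℕ} {Q Q' : State → Prop} (h : Run c σ S Q)
    (h' : ∀ τ, Q τ → Run d τ T Q') : Run (c ;; d) σ (S + T) Q' := by
  obtain ⟨s, hs, τ, hc, hq⟩ := h
  obtain ⟨t, ht, ρ, hd, hq'⟩ := h' τ hq
  exact ⟨s + t, Nat.add_le_add hs ht, ρ, .seq hc hd, hq'⟩

theorem Run.cond {b : BExp} {c d : Cmd} {σ : State} {T : ℕ} {Q : State → Prop}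
    (hc : b.Holds σ → Run c σ T Q) (hd : ¬ b.Holds σ → Run d σ T Q) :
    Run (.cond b c d) σ (b.cost + T + 1) Q := by
  by_cases hb : b.Holds σ
  · obtain ⟨t, ht, τ, he, hq⟩ := hc hb
    exact ⟨_, by omega, τ, .condTrue hb he, hq⟩
  · obtain ⟨t, ht, τ, he, hq⟩ := hd hb
    exact ⟨_, by omega, τ, .condFalse hb he, hq⟩

/-- Loops with a potential `Φ` that pays for the iterations. -/
theorem Run.loop {b : BExp} {c : Cmd} (I : State → Prop) (Φ T : State → ℕ)
    (step : ∀ σ, I σ → b.Holds σ →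
      Run c σ (T σ) (fun τ => I τ ∧ T σ + (b.cost + 1) + Φ τ ≤ Φ σ))
    {σ : State} (h : I σ) :
    Run (.loop b c) σ (Φ σ + (b.cost + 1)) (fun τ => I τ ∧ ¬ b.Holds τ) := by
  induction hn : Φ σ using Nat.strong_induction_on generalizing σ with
  | _ n ih =>
    by_cases hb : b.Holds σ
    · obtain ⟨s, hs, τ, hc, hI, hΦ⟩ := step σ h hb
      obtain ⟨t, ht, ρ, hd, hq⟩ := ih (Φ τ) (by omega) hI rfl
      exact ⟨_, by omega, ρ, .loopStep hb hc hd, hq⟩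
    · exact ⟨_, by omega, σ, .loopDone hb, h, hb⟩

/-- Loops with a measure and a constant time for each iteration. -/
theorem Run.loopMeasure {b : BExp} {c : Cmd} (I : State → Prop) (μ : State → ℕ) (T : ℕ)
    (step : ∀ σ, I σ → b.Holds σ → Run c σ T (fun τ => I τ ∧ μ τ < μ σ))
    {σ : State} (h : I σ) :
    Run (.loop b c) σ ((T + b.cost + 1) * (μ σ + 1)) (fun τ => I τ ∧ ¬ b.Holds τ) := by
  refine (Run.loop (b := b) (c := c) I (fun σ => (T + (b.cost + 1)) * μ σ) (fun _ => T) ?_ h).mono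
    ?_ (fun _ => id)
  · intro τ hτ hb
    refine (step τ hτ hb).mono le_rfl fun ρ hρ => ⟨hρ.1, ?_⟩
    have := Nat.mul_le_mul_left (T + (b.cost + 1)) (Nat.succ_le_of_lt hρ.2)
    rw [Nat.mul_succ] at this
    omega
  · simp only [Nat.mul_add]; ring_nf; omega

/-! Rules for time bounds of the form `K * m` with a common `m > 0`. -/

theorem Run.simpleL {c : Cmd} (hc : c.simple = true) {σ : State} {m : ℕ} (hm : 0 < m)
    {Q : State → Prop} (h : Q (c.den σ)) : Run c σ (c.bound * m) Q :=
  (Run.simple hc h).mono (Nat.le_mul_of_pos_right _ hm) fun _ => id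

theorem Run.seqL {c d : Cmd} {σ : State} {K K' m : ℕ} {Q Q' : State → Prop} (h : Run c σ (K * m) Q)
    (h' : ∀ τ, Q τ → Run d τ (K' * m) Q') : Run (c ;; d) σ ((K + K') * m) Q' :=
  (Run.seq h h').mono (Nat.add_mul _ _ _).ge fun _ => id

theorem Run.condL {b : BExp} {c d : Cmd} {σ : State} {K K' m : ℕ} (hm : 0 < m) {Q : State → Prop}
    (hc : b.Holds σ → Run c σ (K * m) Q) (hd : ¬ b.Holds σ → Run d σ (K' * m) Q) :
    Run (.cond b c d) σ ((b.cost + 1 + (K + K')) * m) Q := by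
  refine (Run.cond (T := (K + K') * m)
    (fun h => (hc h).mono (Nat.mul_le_mul_right _ (Nat.le_add_right _ _)) fun _ => id)
    (fun h => (hd h).mono (Nat.mul_le_mul_right _ (Nat.le_add_left _ _)) fun _ => id)).mono ?_
    fun _ => id
  rw [Nat.add_mul (b.cost + 1)]
  have := Nat.le_mul_of_pos_right (b.cost + 1) hm
  omega

/-- `for v := 0 to bound - 1 do body`. -/
def forN (v : ℕ) (bound : NExp) (body : Cmd) : Cmd :=
  setN v 0 ;; .loop (.natLt (nv v) bound) (body ;; setN v (nv v + 1))

theorem Run.forN {v : ℕ} {bound : NExp} {body : Cmd} (I : ℕ → State → Prop) (N T : ℕ)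
    {σ : State} (h0 : I 0 (σ.setNat v 0 0))
    (hN : ∀ i τ, I i τ → τ.nat v 0 = i ∧ bound.eval τ = N)
    (step : ∀ i τ, i < N → I i τ →
      Run body τ T (fun ρ => I (i + 1) (ρ.setNat v 0 (ρ.nat v 0 + 1)))) :
    Run (forN v bound body) σ
      ((setN v 0).bound + (T + (setN v (nv v + 1)).bound + (BExp.natLt (nv v) bound).cost + 1) *
        (N + 1)) (I N) := by
  refine Run.seq (Run.simple rfl rfl) ?_
  rintro τ rfl
  refine (Run.loopMeasure (fun τ => ∃ i ≤ N, I i τ) (fun τ => N - τ.nat v 0)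
    (T + (setN v (nv v + 1)).bound) ?_ ⟨0, Nat.zero_le _, h0⟩).mono ?_ ?_
  · rintro τ ⟨i, hi, hI⟩ hb
    obtain ⟨h1, h2⟩ := hN i τ hI
    simp only [holds_natLt, eval_nv, h1, h2] at hb
    refine Run.seq (step i τ hb hI) fun ρ hρ => Run.simple rfl ?_
    have h3 := hN _ _ hρ
    simp only [den_setN, eval_natAdd, eval_nv, eval_ofNat]
    refine ⟨⟨i + 1, hb, hρ⟩, ?_⟩
    rw [h3.1, h1]
    omega
  · exact Nat.mul_le_mul_left _ (by simp)
  · rintro τ ⟨⟨i, hi, hI⟩, hb⟩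
    obtain ⟨h1, h2⟩ := hN i τ hI
    simp only [holds_natLt, eval_nv, h1, h2] at hb
    obtain rfl : i = N := by omega
    exact hI

/-- The time for one iteration of a `for` loop whose body takes time `T`. -/
def forCost (v : ℕ) (bound : NExp) (T : ℕ) : ℕ :=
  (setN v 0).bound + (T + (setN v (nv v + 1)).bound + (BExp.natLt (nv v) bound).cost + 1)

theorem Run.forN_linear {v : ℕ} {bound : NExp} {body : Cmd} (I : ℕ → State → Prop) (N T : ℕ)
    {σ : State} (h0 : I 0 (σ.setNat v 0 0))
    (hN : ∀ i τ, I i τ → τ.nat v 0 = i ∧ bound.eval τ = N)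
    (step : ∀ i τ, i < N → I i τ →
      Run body τ T (fun ρ => I (i + 1) (ρ.setNat v 0 (ρ.nat v 0 + 1)))) :
    Run (RealRAM.forN v bound body) σ (forCost v bound T * (N + 1)) (I N) := by
  refine (Run.forN I N T h0 hN step).mono ?_ fun _ => id
  rw [forCost, Nat.add_mul (setN v 0).bound]
  exact Nat.add_le_add_right (Nat.le_mul_of_pos_right _ (Nat.succ_pos _)) _

theorem Run.forN_simple {v : ℕ} {bound : NExp} {body : Cmd} (hb : body.simple = true)
    (I : ℕ → State → Prop) (N : ℕ)
    {σ : State} (h0 : I 0 (σ.setNat v 0 0))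
    (hN : ∀ i τ, I i τ → τ.nat v 0 = i ∧ bound.eval τ = N)
    (step : ∀ i τ, i < N → I i τ →
      I (i + 1) ((body.den τ).setNat v 0 ((body.den τ).nat v 0 + 1))) :
    Run (RealRAM.forN v bound body) σ (forCost v bound body.bound * (N + 1)) (I N) :=
  Run.forN_linear I N _ h0 hN fun i τ hi hI => Run.simple hb (step i τ hi hI)

/-! ### Frames -/

/-- The arrays of naturals that occur on the left of an assignment. -/
def Cmd.natW : Cmd → List ℕ
  | .setNat b _ _ => [b]
  | .seq c d => c.natW ++ d.natW
  | .cond _ c d => c.natW ++ d.natW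
  | .loop _ c => c.natW
  | _ => []

/-- The arrays of reals that occur on the left of an assignment. -/
def Cmd.realW : Cmd → List ℕ
  | .setReal b _ _ => [b]
  | .seq c d => c.realW ++ d.realW
  | .cond _ c d => c.realW ++ d.realW
  | .loop _ c => c.realW
  | _ => []

/-- Since the list of procedures is empty, no call can be executed, and the arrays assigned in the
text are the only ones that can change. The lists of these arrays are computable, so frame
conditions can be discharged by `decide`. -/
theorem Exec.frame {c : Cmd} {σ τ : State} {t : ℕ} (h : Exec [] c σ t τ) :
    (∀ b ∉ c.natW, τ.nat b = σ.nat b) ∧ (∀ b ∉ c.realW, τ.real b = σ.real b) := by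
  induction h with
  | skip => simp
  | setNat b i e σ =>
    refine ⟨fun b' hb => ?_, fun _ _ => rfl⟩
    exact State.setNat_nat_ne _ _ _ (by simpa [Cmd.natW] using hb)
  | setReal b i e σ =>
    refine ⟨fun _ _ => rfl, fun b' hb => ?_⟩
    exact State.setReal_real_ne _ _ _ (by simpa [Cmd.realW] using hb)
  | seq _ _ ih ih' =>
    simp only [Cmd.natW, Cmd.realW, List.mem_append, not_or]
    exact ⟨fun b hb => (ih'.1 b hb.2).trans (ih.1 b hb.1),
      fun b hb => (ih'.2 b hb.2).trans (ih.2 b hb.1)⟩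
  | condTrue _ _ ih =>
    simp only [Cmd.natW, Cmd.realW, List.mem_append, not_or]
    exact ⟨fun b hb => ih.1 b hb.1, fun b hb => ih.2 b hb.1⟩
  | condFalse _ _ ih =>
    simp only [Cmd.natW, Cmd.realW, List.mem_append, not_or]
    exact ⟨fun b hb => ih.1 b hb.2, fun b hb => ih.2 b hb.2⟩
  | loopDone => simp
  | loopStep _ _ _ ih ih' =>
    exact ⟨fun b hb => (ih'.1 b hb).trans (ih.1 b hb), fun b hb => (ih'.2 b hb).trans (ih.2 b hb)⟩
  | call h => simp at h

/-- The memories agree outside the given arrays. -/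
def Frame (N R : List ℕ) (σ τ : State) : Prop :=
  (∀ b ∉ N, τ.nat b = σ.nat b) ∧ ∀ b ∉ R, τ.real b = σ.real b

theorem Run.frame {c : Cmd} {σ : State} {T : ℕ} {Q : State → Prop} (h : Run c σ T Q) :
    Run c σ T (fun τ => Q τ ∧ Frame c.natW c.realW σ τ) := by
  obtain ⟨t, ht, τ, he, hq⟩ := h
  exact ⟨t, ht, τ, he, hq, he.frame⟩

/-! ### Array segments as lists -/

/-- The list `A r, A (r + 1), …, A (r + c - 1)`. -/
def seg {α : Type*} (A : ℕ → α) : ℕ → ℕ → List α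
  | _, 0 => []
  | r, c + 1 => A r :: seg A (r + 1) c

section seg
variable {α : Type*} (A : ℕ → α)

@[simp] theorem seg_zero (r : ℕ) : seg A r 0 = [] := rfl
theorem seg_cons (r c : ℕ) : seg A r (c + 1) = A r :: seg A (r + 1) c := rfl

theorem seg_append (r c d : ℕ) : seg A r (c + d) = seg A r c ++ seg A (r + c) d := by
  induction c generalizing r with
  | zero => simp
  | succ c ih =>
    rw [show c + 1 + d = (c + d) + 1 by ring, seg_cons, seg_cons, ih,
      show r + 1 + c = r + (c + 1) by ring]
    simp

theorem seg_snoc (r c : ℕ) : seg A r (c + 1) = seg A r c ++ [A (r + c)] := seg_append A r c 1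

@[simp] theorem length_seg (r c : ℕ) : (seg A r c).length = c := by
  induction c generalizing r with
  | zero => rfl
  | succ c ih => simp [seg_cons, ih]

theorem mem_seg {r c : ℕ} {x : α} : x ∈ seg A r c ↔ ∃ i < c, A (r + i) = x := by
  induction c generalizing r with
  | zero => simp
  | succ c ih =>
    rw [seg_snoc]
    constructor
    · intro h
      rcases List.mem_append.1 h with h | h
      · obtain ⟨i, hi, rfl⟩ := ih.1 h
        exact ⟨i, by omega, rfl⟩
      · exact ⟨c, by omega, (List.mem_singleton.1 h).symm⟩
    · rintro ⟨i, hi, rfl⟩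
      rcases Nat.lt_succ_iff_lt_or_eq.1 hi with h | rfl
      · exact List.mem_append_left _ (ih.2 ⟨i, h, rfl⟩)
      · simp

variable {A}

theorem seg_congr {B : ℕ → α} {r r' c : ℕ} (h : ∀ i < c, A (r + i) = B (r' + i)) :
    seg A r c = seg B r' c := by
  induction c with
  | zero => rfl
  | succ c ih =>
    rw [seg_snoc, seg_snoc, ih fun i hi => h i (by omega), h c (by omega)]

theorem getElem_seg {r c i : ℕ} (h : i < (seg A r c).length) : (seg A r c)[i] = A (r + i) := by
  induction c generalizing r i with
  | zero => simp at h
  | succ c ih =>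
    cases i with
    | zero => simp [seg_cons]
    | succ i =>
      simp only [seg_cons, List.getElem_cons_succ]
      rw [ih]
      congr 1; ring

theorem seg_map {β : Type*} (f : α → β) (r c : ℕ) : (seg A r c).map f = seg (fun i => f (A i)) r c := by
  induction c generalizing r with
  | zero => rfl
  | succ c ih => simp [seg_cons, ih]

end seg

end RealRAM


namespace RealRAM

/-! ### Bottom-up merge sort -/

/-- Merging of lists of keys with payload. -/
noncomputable def mergeL (a b : List (ℝ × ℕ)) : List (ℝ × ℕ) :=
  List.merge a b (fun x y => decide (x.1 ≤ y.1))

/-- Merge `c` consecutive pairs of runs of length `s`, starting from cell `o`. -/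
noncomputable def passL (A : ℕ → ℝ × ℕ) (s : ℕ) : ℕ → ℕ → List (ℝ × ℕ)
  | _, 0 => []
  | o, c + 1 => mergeL (seg A o s) (seg A (o + s) s) ++ passL A s (o + s + s) c

/-- The items to be sorted: the keys are in the real array `30`, the payload in the natural
array `40`. -/
def State.item (σ : State) (i : ℕ) : ℝ × ℕ := (σ.real 30 i, σ.nat 40 i)

def State.item' (σ : State) (i : ℕ) : ℝ × ℕ := (σ.real 31 i, σ.nat 41 i)

def passNext : Cmd :=
  .cond (.not (.natLt (nv 47) (nv 44 + nv 43 + nv 43)))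
    (setN 44 (nv 47) ;; setN 45 (nv 47) ;; setN 46 (nv 47 + nv 43)) .skip

def passStep : Cmd :=
  .cond (.or (.not (.natLt (nv 46) (nv 44 + nv 43 + nv 43)))
      (.and (.natLt (nv 45) (nv 44 + nv 43)) (.le (.get 30 (nv 45)) (.get 30 (nv 46)))))
    (.setReal 31 (nv 47) (.get 30 (nv 45)) ;; .setNat 41 (nv 47) (.get 40 (nv 45)) ;;
      setN 45 (nv 45 + 1))
    (.setReal 31 (nv 47) (.get 30 (nv 46)) ;; .setNat 41 (nv 47) (.get 40 (nv 46)) ;;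
      setN 46 (nv 46 + 1))

/-- Cell 44 is the start of the current pair of runs, 45 and 46 are the read heads in its two
halves, and 47 is the write head. The field `out` says that the items written so far, the merge of
the two unread remainders and the merges of the untouched pairs make up the final list. -/
structure PassInv (A : ℕ → ℝ × ℕ) (M s : ℕ) (target : List (ℝ × ℕ)) (k : ℕ) (σ : State) :
    Prop where
  item : σ.item = A
  len : σ.nat 42 0 = M
  run : σ.nat 43 0 = s
  cur : σ.nat 47 0 = k
  lo1 : σ.nat 44 0 ≤ σ.nat 45 0
  hi1 : σ.nat 45 0 ≤ σ.nat 44 0 + s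
  lo2 : σ.nat 44 0 + s ≤ σ.nat 46 0
  hi2 : σ.nat 46 0 ≤ σ.nat 44 0 + s + s
  sum : σ.nat 45 0 + σ.nat 46 0 = k + σ.nat 44 0 + s
  out : ∃ c, M = σ.nat 44 0 + s + s + 2 * s * c ∧
    seg σ.item' 0 k ++ (mergeL (seg A (σ.nat 45 0) (σ.nat 44 0 + s - σ.nat 45 0))
      (seg A (σ.nat 46 0) (σ.nat 44 0 + s + s - σ.nat 46 0)) ++
        passL A s (σ.nat 44 0 + s + s) c) = target

theorem mergeL_nil_nil : mergeL [] [] = [] := by simp [mergeL]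

theorem passNext_inv {A : ℕ → ℝ × ℕ} {M s : ℕ} {target : List (ℝ × ℕ)} {k : ℕ} {σ : State}
    (h : PassInv A M s target k σ) (hk : k < M) :
    PassInv A M s target k (passNext.den σ) ∧
      k < (passNext.den σ).nat 44 0 + s + s := by
  obtain ⟨h1, h2, h3, h4, h5, h6, h7, h8, h9, c, hc, hout⟩ := h
  by_cases hlt : k < σ.nat 44 0 + s + s
  · rw [show passNext.den σ = σ from den_cond_neg σ (by simpa [h3, h4] using hlt) _ _]
    exact ⟨⟨h1, h2, h3, h4, h5, h6, h7, h8, h9, c, hc, hout⟩, hlt⟩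
  · have e : passNext.den σ = ((σ.setNat 44 0 k).setNat 45 0 k).setNat 46 0 (k + s) := by
      rw [passNext, den_cond_pos σ (by simpa [h3, h4] using hlt)]
      simp [h3, h4]
    have hk' : k = σ.nat 44 0 + s + s := by omega
    have hi : σ.nat 45 0 = σ.nat 44 0 + s := by omega
    have hj : σ.nat 46 0 = σ.nat 44 0 + s + s := by omega
    -- If no pair were left, `M` would equal `k`.
    obtain _ | c := c
    · omega
    have hs : 0 < s := by
      by_contra hs
      obtain rfl : s = 0 := by omega
      simp at hc
      omega
    rw [e]
    refine ⟨⟨h1, by simpa using h2, by simpa using h3, by simpa using h4, by simp, by simp, by simp,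
      by simp, by simp; omega, c, ?_, ?_⟩, by simp; omega⟩
    · simp
      rw [hc, hk']
      ring
    · rw [← hout, hi, hj]
      simp only [Nat.sub_self, seg_zero, mergeL_nil_nil, List.nil_append, passL, ← hk']
      simp only [State.setNat_nat_same, Function.update_self, ne_eq, Nat.reduceEqDiff,
        not_false_eq_true, State.setNat_nat_ne]
      rw [Nat.add_sub_cancel_left, show k + s + s - (k + s) = s by omega]
      rfl

theorem passStep_inv {A : ℕ → ℝ × ℕ} {M s : ℕ} {target : List (ℝ × ℕ)} {k : ℕ} {σ : State}
    (h : PassInv A M s target k σ) (hk : k < σ.nat 44 0 + s + s) :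
    PassInv A M s target (k + 1)
      ((passStep.den σ).setNat 47 0 ((passStep.den σ).nat 47 0 + 1)) := by
  obtain ⟨h1, h2, h3, h4, h5, h6, h7, h8, h9, c, hc, hout⟩ := h
  have hA : ∀ i, (σ.real 30 i, σ.nat 40 i) = A i := fun i => by rw [← h1]; rfl
  have hA1 : ∀ i, σ.real 30 i = (A i).1 := fun i => by rw [← h1]; rfl
  have hseg : ∀ (τ : State) (i : ℕ), τ.item' = Function.update σ.item' k (A i) →
      seg τ.item' 0 (k + 1) = seg σ.item' 0 k ++ [A i] := by
    intro τ i hτ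
    rw [seg_snoc, hτ]
    congr 1
    · refine seg_congr fun l hl => ?_
      rw [Function.update_of_ne (by omega)]
    · simp
  have hitem : ∀ (a m l : ℕ), a ≠ 41 → l ≠ 41 → ∀ (x : ℝ) (y m' : ℕ), (x, y) = A m →
      ((((σ.setReal 31 k x).setNat 41 k y).setNat a 0 m').setNat l 0 (k + 1)).item' =
        Function.update σ.item' k (A m) := by
    intro a m l ha hl x y m' hxy
    funext i
    rw [← hxy]
    by_cases hi : i = k
    · subst hi
      simp [State.item', State.setNat_nat_ne _ _ _ (Ne.symm ha),
        State.setNat_nat_ne _ _ _ (Ne.symm hl)]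
    · simp [State.item', State.setNat_nat_ne _ _ _ (Ne.symm ha),
        State.setNat_nat_ne _ _ _ (Ne.symm hl), hi]
  by_cases hi : ¬ (σ.nat 46 0 < σ.nat 44 0 + s + s) ∨ (σ.nat 45 0 < σ.nat 44 0 + s ∧
      (A (σ.nat 45 0)).1 ≤ (A (σ.nat 46 0)).1)
  · have e : passStep.den σ = (((σ.setReal 31 k (σ.real 30 (σ.nat 45 0))).setNat 41 k
        (σ.nat 40 (σ.nat 45 0))).setNat 45 0 (σ.nat 45 0 + 1)) := by
      rw [passStep, den_cond_pos σ (by simpa [h3, hA1, -not_lt] using hi)]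
      simp [h4]
    have hlt : σ.nat 45 0 < σ.nat 44 0 + s := by
      rcases hi with hi | hi
      · omega
      · exact hi.1
    rw [e]
    refine ⟨h1, by simpa using h2, by simpa using h3, by simp [h4], by simp; omega,
      by simp; omega, by simpa using h7, by simpa using h8, by simp; omega, c, by simpa using hc, ?_⟩
    rw [← hout, hseg _ (σ.nat 45 0)]
    · simp only [State.setNat_nat_same, Function.update_self, ne_eq, Nat.reduceEqDiff,
        not_false_eq_true, State.setNat_nat_ne, State.setReal_nat, List.append_assoc]
      congr 1
      rw [← List.append_assoc]
      congr 1
      rw [show σ.nat 44 0 + s - σ.nat 45 0 = (σ.nat 44 0 + s - (σ.nat 45 0 + 1)) + 1 by omega,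
        seg_cons]
      by_cases hj : σ.nat 46 0 < σ.nat 44 0 + s + s
      · rw [show σ.nat 44 0 + s + s - σ.nat 46 0 =
          (σ.nat 44 0 + s + s - (σ.nat 46 0 + 1)) + 1 by omega, seg_cons, mergeL, mergeL,
          List.cons_merge_cons]
        rw [if_pos (by simpa using (hi.resolve_left (by omega)).2)]
        rfl
      · rw [show σ.nat 44 0 + s + s - σ.nat 46 0 = 0 by omega]
        simp [mergeL]
    · have := hitem 45 (σ.nat 45 0) 47 (by decide) (by decide) _ _ (σ.nat 45 0 + 1)
        (hA (σ.nat 45 0))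
      simpa [h4] using this
  · have e : passStep.den σ = (((σ.setReal 31 k (σ.real 30 (σ.nat 46 0))).setNat 41 k
        (σ.nat 40 (σ.nat 46 0))).setNat 46 0 (σ.nat 46 0 + 1)) := by
      rw [passStep, den_cond_neg σ (by simpa [h3, hA1, -not_lt] using hi)]
      simp [h4]
    push Not at hi
    obtain ⟨hj, hi⟩ := hi
    rw [e]
    refine ⟨h1, by simpa using h2, by simpa using h3, by simp [h4], by simpa using h5,
      by simpa using h6, by simp; omega, by simp; omega, by simp; omega, c, by simpa using hc, ?_⟩
    rw [← hout, hseg _ (σ.nat 46 0)]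
    · simp only [State.setNat_nat_same, Function.update_self, ne_eq, Nat.reduceEqDiff,
        not_false_eq_true, State.setNat_nat_ne, State.setReal_nat, List.append_assoc]
      congr 1
      rw [← List.append_assoc]
      congr 1
      rw [show σ.nat 44 0 + s + s - σ.nat 46 0 =
          (σ.nat 44 0 + s + s - (σ.nat 46 0 + 1)) + 1 by omega, seg_cons]
      by_cases hlt : σ.nat 45 0 < σ.nat 44 0 + s
      · rw [show σ.nat 44 0 + s - σ.nat 45 0 = (σ.nat 44 0 + s - (σ.nat 45 0 + 1)) + 1 by omega,
          seg_cons, mergeL, mergeL, List.cons_merge_cons]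
        rw [if_neg (by simpa using hi hlt)]
        rfl
      · rw [show σ.nat 44 0 + s - σ.nat 45 0 = 0 by omega]
        simp [mergeL]
    · have := hitem 46 (σ.nat 46 0) 47 (by decide) (by decide) _ _ (σ.nat 46 0 + 1)
        (hA (σ.nat 46 0))
      simpa [h4] using this

def passMerge : Cmd := forN 47 (nv 42) (passNext ;; passStep)

def passCopy : Cmd :=
  forN 47 (nv 42)
    (.setReal 30 (nv 47) (.get 31 (nv 47)) ;; .setNat 40 (nv 47) (.get 41 (nv 47)))

/-- One pass of merge sort: the first `nv 42` items form runs of length `nv 43`. -/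
def pass : Cmd := (setN 44 0 ;; setN 45 0 ;; setN 46 (nv 43)) ;; passMerge ;; passCopy

theorem length_mergeL (a b : List (ℝ × ℕ)) : (mergeL a b).length = a.length + b.length := by
  simp [mergeL, List.length_merge]

theorem length_passL (A : ℕ → ℝ × ℕ) (s o c : ℕ) : (passL A s o c).length = 2 * s * c := by
  induction c generalizing o with
  | zero => rfl
  | succ c ih => simp [passL, length_mergeL, ih]; ring

theorem passCopy_run (σ : State) (M : ℕ) (hM : σ.nat 42 0 = M) :
    Run passCopy σ (forCost 47 (nv 42) (Cmd.bound (.setReal 30 (nv 47) (.get 31 (nv 47)) ;;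
      .setNat 40 (nv 47) (.get 41 (nv 47)))) * (M + 1))
      (fun τ => ∀ i < M, τ.item i = σ.item' i) := by
  refine (Run.forN_simple rfl (fun k τ => τ.nat 47 0 = k ∧ τ.nat 42 0 = M ∧ τ.item' = σ.item' ∧
    ∀ i < k, τ.item i = σ.item' i) M ?_ ?_ ?_).mono le_rfl fun τ hτ => hτ.2.2.2
  · exact ⟨by simp, by simpa using hM, rfl, by simp⟩
  · exact fun i τ h => ⟨h.1, by simp [h.2.1]⟩
  · rintro k τ hk ⟨h1, h2, h3, h4⟩
    refine ⟨by simp [h1], by simpa using h2, by rw [← h3]; rfl, fun i hi => ?_⟩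
    have := congrFun h3 k
    by_cases hik : i = k
    · subst hik
      rw [← this]
      simp [State.item, State.item', h1]
    · rw [← h4 i (by omega)]
      simp [State.item, h1, hik]

theorem pass_run : ∃ C, ∀ (σ : State) (M s c : ℕ), σ.nat 42 0 = M → σ.nat 43 0 = s →
    M = 2 * s * c → 0 < c → Run pass σ (C * (M + 1))
      (fun τ => seg τ.item 0 M = passL σ.item s 0 c ∧ τ.nat 42 0 = M ∧ τ.nat 43 0 = s) := by
  -- The constant stays a metavariable and is determined by the time rules applied below. Later run
  -- lemmas use the same device.
  apply Exists.intro
  intro σ M s c hM hs hc hc0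
  apply Run.seqL (Run.simpleL rfl (Nat.succ_pos _) rfl)
  rintro τ rfl
  refine Run.seqL (Run.forN_simple rfl
    (fun k τ => PassInv σ.item M s (passL σ.item s 0 c) k τ) M ?_ (fun i τ h => ⟨h.cur, h.len⟩) ?_)
    (fun τ hτ => (passCopy_run τ M hτ.len).frame.mono le_rfl fun ρ hρ => ⟨?_, ?_, ?_⟩)
  · obtain ⟨c, rfl⟩ : ∃ c', c = c' + 1 := ⟨c - 1, by omega⟩
    refine ⟨rfl, by simpa using hM, by simpa using hs, by simp, by simp, by simp, by simp [hs],
      by simp [hs], by simp [hs], c, ?_, ?_⟩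
    · simp [hc]; ring
    · simp [hs, passL]
  · intro k τ hk h
    obtain ⟨h, h'⟩ := passNext_inv h hk
    exact passStep_inv h h'
  · obtain ⟨h1, h2, h3, h4, h5, h6, h7, h8, h9, c', hc', hout⟩ := hτ
    rw [← List.append_assoc] at hout
    -- The part already written is as long as the target, so the unread remainders must be empty.
    have := congrArg List.length hout
    rw [seg_congr (B := τ.item') (r' := 0) fun i hi => by simpa using hρ.1 i hi]
    rw [length_passL, ← hc, List.length_append, List.length_append] at this
    simp only [length_seg] at this
    have h10 : ∀ l : List (ℝ × ℕ), l.length = 0 → l = [] := fun l => List.length_eq_zero_iff.1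
    rw [← hout, h10 (mergeL _ _) (by omega), h10 (passL _ _ _ _) (by omega)]
    simp
  · rw [hρ.2.1 42 (by decide)]; exact hτ.len
  · rw [hρ.2.1 43 (by decide)]; exact hτ.run

end RealRAM


namespace RealRAM

/-! ### Lists of sorted runs -/

/-- Combine consecutive pairs. -/
def pairUp {α : Type*} (f : α → α → α) : List α → List α
  | a :: b :: l => f a b :: pairUp f l
  | l => l

/-- The items in odd positions. -/
def decimate {α : Type*} : List α → List α
  | _ :: b :: l => b :: decimate l
  | _ => []

abbrev SortedK (l : List (ℝ × ℕ)) : Prop := l.Pairwise fun a b => a.1 ≤ b.1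

theorem sortedK_mergeL {a b : List (ℝ × ℕ)} (ha : SortedK a) (hb : SortedK b) :
    SortedK (mergeL a b) := by
  have := List.pairwise_merge (le := fun x y : ℝ × ℕ => decide (x.1 ≤ y.1))
    (by intro a b c; simpa using fun h h' => le_trans h h')
    (by intro a b; simpa using le_total _ _) a b
    (by simpa using ha) (by simpa using hb)
  simpa [mergeL] using this

theorem mergeL_perm (a b : List (ℝ × ℕ)) : (mergeL a b).Perm (a ++ b) := List.merge_perm_append ..

theorem length_pairUp {α : Type*} (f : α → α → α) (c : ℕ) :
    ∀ l : List α, l.length = 2 * c → (pairUp f l).length = c := by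
  induction c with
  | zero => intro l hl; simp [List.length_eq_zero_iff.1 hl, pairUp]
  | succ c ih =>
    intro l hl
    match l, hl with
    | a :: b :: l, hl =>
      simp only [List.length_cons] at hl
      simp [pairUp, ih l (by omega)]

theorem pairUp_forall {α : Type*} {f : α → α → α} {P Q : α → Prop}
    (h : ∀ a b, P a → P b → Q (f a b)) (c : ℕ) :
    ∀ l : List α, l.length = 2 * c → (∀ a ∈ l, P a) → ∀ a ∈ pairUp f l, Q a := by
  induction c with
  | zero => intro l hl; simp [List.length_eq_zero_iff.1 hl, pairUp]
  | succ c ih =>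
    intro l hl hP
    match l, hl, hP with
    | a :: b :: l, hl, hP =>
      simp only [List.length_cons] at hl
      simp only [List.mem_cons, forall_eq_or_imp] at hP
      simp only [pairUp, List.mem_cons, forall_eq_or_imp]
      exact ⟨h a b hP.1 hP.2.1, ih l (by omega) hP.2.2⟩

theorem map_pairUp {α β : Type*} {f : α → α → α} {g : β → β → β} {φ : α → β}
    (h : ∀ a b, φ (f a b) = g (φ a) (φ b)) :
    ∀ l : List α, (pairUp f l).map φ = pairUp g (l.map φ)
  | a :: b :: l => by simp [pairUp, h, map_pairUp h l]
  | [a] => rfl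
  | [] => rfl

theorem flatten_pairUp_append {α : Type*} : ∀ l : List (List α),
    (pairUp (· ++ ·) l).flatten = l.flatten
  | a :: b :: l => by simp [pairUp, flatten_pairUp_append l]
  | [a] => rfl
  | [] => rfl

theorem flatten_pairUp_mergeL : ∀ l : List (List (ℝ × ℕ)),
    (pairUp mergeL l).flatten.Perm l.flatten
  | a :: b :: l => by
    simp only [pairUp, List.flatten_cons, ← List.append_assoc]
    exact (mergeL_perm a b).append (flatten_pairUp_mergeL l)
  | [a] => .refl _
  | [] => .refl _

theorem passL_eq {A : ℕ → ℝ × ℕ} {s : ℕ} (c : ℕ) : ∀ (o : ℕ) (l : List (List (ℝ × ℕ))),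
    l.length = 2 * c → (∀ a ∈ l, a.length = s) → seg A o (2 * s * c) = l.flatten →
    passL A s o c = (pairUp mergeL l).flatten := by
  induction c with
  | zero => intro o l hl; simp [List.length_eq_zero_iff.1 hl, pairUp, passL]
  | succ c ih =>
    intro o l hl hP hs
    match l, hl, hP, hs with
    | a :: b :: l, hl, hP, hs =>
      simp only [List.length_cons] at hl
      simp only [List.mem_cons, forall_eq_or_imp] at hP
      rw [show 2 * s * (c + 1) = s + (s + 2 * s * c) by ring, seg_append, seg_append,
        List.flatten_cons, List.flatten_cons] at hs
      obtain ⟨h1, h2⟩ := List.append_inj hs (by simp [hP.1])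
      obtain ⟨h2, h3⟩ := List.append_inj h2 (by simp [hP.2.1])
      rw [passL, h1, h2, ih _ l (by omega) hP.2.2 h3]
      rfl

theorem decimate_append {α : Type*} (c : ℕ) : ∀ (a b : List α), a.length = 2 * c →
    decimate (a ++ b) = decimate a ++ decimate b := by
  induction c with
  | zero => intro a b ha; simp [List.length_eq_zero_iff.1 ha, decimate]
  | succ c ih =>
    intro a b ha
    match a, ha with
    | x :: y :: a, ha =>
      simp only [List.length_cons] at ha
      simp [decimate, ih a b (by omega)]

theorem decimate_flatten {α : Type*} (c : ℕ) : ∀ l : List (List α), (∀ a ∈ l, a.length = 2 * c) →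
    decimate l.flatten = (l.map decimate).flatten
  | [], _ => rfl
  | a :: l, h => by
    simp only [List.mem_cons, forall_eq_or_imp] at h
    simp [decimate_append c a l.flatten h.1, decimate_flatten c l h.2]

theorem length_decimate {α : Type*} : ∀ l : List α, (decimate l).length = l.length / 2
  | [] => by simp [decimate]
  | [_] => by simp [decimate]
  | _ :: _ :: l => by
    simp only [decimate, List.length_cons, length_decimate l]
    omega

theorem decimate_sublist {α : Type*} : ∀ l : List α, (decimate l).Sublist l
  | [] => .slnil
  | [_] => List.nil_sublist _
  | _ :: b :: l => ((decimate_sublist l).cons_cons b).cons _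

/-- A predicate that is inherited by smaller keys holds exactly on an initial segment of a sorted
list, and an initial segment of length c contains ⌊c / 2⌋ odd positions, counted from 0. -/
theorem countP_decimate {p : ℝ × ℕ → Bool} : ∀ {l : List (ℝ × ℕ)}, SortedK l →
    (∀ a b : ℝ × ℕ, a.1 ≤ b.1 → p b → p a) →
    2 * (decimate l).countP p ≤ l.countP p ∧ l.countP p ≤ 2 * (decimate l).countP p + 1
  | [], _, _ => by simp [decimate]
  | [a], _, _ => by
    by_cases h : p a <;> simp [decimate, h]
  | a :: b :: l, hs, hp => by
    obtain ⟨h1, h2⟩ := List.pairwise_cons.1 hs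
    obtain ⟨h2, h3⟩ := List.pairwise_cons.1 h2
    obtain ⟨h4, h5⟩ := countP_decimate h3 hp
    by_cases hb : p b = true
    · have ha := hp a b (h1 b (by simp)) hb
      simp only [decimate, List.countP_cons, ha, hb, if_true]
      omega
    · have h0 : l.countP p = 0 := by
        rw [List.countP_eq_zero]
        exact fun x hx hpx => hb (hp b x (h2 x hx) hpx)
      by_cases ha : p a = true <;> simp only [decimate, List.countP_cons, ha, hb, if_true] <;>
        simp <;> omega

/-! ### Approximate medians -/

/-- The sorted list `S` represents the ranks in the list `X`, with weight `w`. -/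
structure Sketch (w len size e e' : ℕ) (x : List (ℝ × ℕ) × List (ℝ × ℕ)) : Prop where
  length : x.1.length = len
  sorted : SortedK x.1
  size : x.2.length = size
  lower : ∀ p : ℝ × ℕ → Bool, (∀ a b : ℝ × ℕ, a.1 ≤ b.1 → p b → p a) →
    w * x.1.countP p ≤ x.2.countP p
  upper : ∀ p : ℝ × ℕ → Bool, (∀ a b : ℝ × ℕ, a.1 ≤ b.1 → p b → p a) →
    2 * x.2.countP p + e ≤ 2 * (w * x.1.countP p) + e'

noncomputable def mergeSketch (x y : List (ℝ × ℕ) × List (ℝ × ℕ)) : List (ℝ × ℕ) × List (ℝ × ℕ) :=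
  (mergeL x.1 y.1, x.2 ++ y.2)

theorem Sketch.merge {w len size e e' : ℕ} {x y : List (ℝ × ℕ) × List (ℝ × ℕ)}
    (hx : Sketch w len size e e' x) (hy : Sketch w len size e e' y) :
    Sketch w (2 * len) (2 * size) (2 * e) (2 * e') (mergeSketch x y) := by
  have hc : ∀ p, (mergeL x.1 y.1).countP p = x.1.countP p + y.1.countP p := fun p => by
    rw [(mergeL_perm _ _).countP_eq, List.countP_append]
  refine ⟨?_, sortedK_mergeL hx.sorted hy.sorted, ?_, fun p hp => ?_, fun p hp => ?_⟩
  · simp [mergeSketch, length_mergeL, hx.length, hy.length]; ring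
  · simp [mergeSketch, hx.size, hy.size]; ring
  · simp only [mergeSketch, hc, List.countP_append, Nat.mul_add]
    exact Nat.add_le_add (hx.lower p hp) (hy.lower p hp)
  · simp only [mergeSketch, hc, List.countP_append, Nat.mul_add]
    have := hx.upper p hp
    have := hy.upper p hp
    omega

/-- Let S and X count the items with a given downward closed property in a sketch of length and
weight s and in the s² items behind it. The invariant is s S ≤ X ≤ s S + (s² - s) / 2. Merging four
sketches multiplies the error by four, and keeping every second item doubles the weight and loses at
most one item of weight s. The resulting error is exactly the one allowed for length and weight 2s.
-/
theorem Sketch.decimate {s : ℕ} {x : List (ℝ × ℕ) × List (ℝ × ℕ)}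
    (hx : Sketch s (2 * (2 * s)) (2 * (2 * (s * s))) (2 * (2 * s)) (2 * (2 * (s * s))) x) :
    Sketch (s + s) (s + s) ((s + s) * (s + s)) (s + s) ((s + s) * (s + s))
      (RealRAM.decimate x.1, x.2) := by
  refine ⟨?_, hx.sorted.sublist (decimate_sublist _), ?_, fun p hp => ?_, fun p hp => ?_⟩
  · simp [length_decimate, hx.length]; omega
  · simp [hx.size]; ring
  · have h1 := hx.lower p hp
    have h2 := Nat.mul_le_mul_left s (countP_decimate hx.sorted hp).1
    simp only at h1 h2 ⊢
    nlinarith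
  · have h1 := hx.upper p hp
    have h2 := Nat.mul_le_mul_left s (countP_decimate hx.sorted hp).2
    simp only at h1 h2 ⊢
    nlinarith

end RealRAM


/-! ### Approximate medians and sorting on the machine -/

namespace RealRAM

def decimateStep : Cmd :=
  .setReal 30 (nv 48) (.get 30 (nv 49)) ;; .setNat 40 (nv 48) (.get 40 (nv 49)) ;;
  setN 48 (nv 48 + 1) ;; setN 49 (nv 49 + 2)

/-- Keep the items in odd positions. -/
def decimateCmd : Cmd :=
  (setN 48 0 ;; setN 49 1) ;; .loop (.natLt (nv 49) (nv 42)) decimateStep ;; setN 42 (nv 48)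

theorem decimateCmd_run : ∃ C, ∀ (σ : State) (M c : ℕ), σ.nat 42 0 = M → M = 2 * c →
    Run decimateCmd σ (C * (M + 1))
      (fun τ => seg τ.item 0 c = decimate (seg σ.item 0 M) ∧ τ.nat 42 0 = c) := by
  apply Exists.intro
  intro σ M c hM hc
  apply Run.seqL (Run.simpleL rfl (Nat.succ_pos _) rfl)
  rintro τ rfl
  refine Run.seqL (K' := (setN 42 (nv 48)).bound) (Q := fun τ => seg τ.item 0 c = decimate (seg σ.item 0 M) ∧ τ.nat 48 0 = c)
    ((Run.loopMeasure (fun τ => ∃ i d, c = i + d ∧ τ.nat 48 0 = i ∧ τ.nat 49 0 = 2 * i + 1 ∧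
      τ.nat 42 0 = M ∧ (∀ j, i ≤ j → τ.item j = σ.item j) ∧
      seg τ.item 0 i ++ decimate (seg σ.item (2 * i) (2 * d)) = decimate (seg σ.item 0 M))
      (fun τ => c - τ.nat 48 0) decimateStep.bound ?_ ?_).mono (T' := (decimateStep.bound +
        (BExp.natLt (nv 49) (nv 42)).cost + 1) * (M + 1)) ?_ ?_) ?_
  · rintro τ ⟨i, d, h1, h2, h3, h4, h5, h6⟩ hb
    simp only [holds_natLt, eval_nv, h3, h4] at hb
    refine Run.simple rfl ⟨⟨i + 1, d - 1, by omega, by simp [decimateStep, h2],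
      by simp [decimateStep, h3]; ring, by simpa [decimateStep] using h4, fun j hj => ?_, ?_⟩, ?_⟩
    · rw [← h5 j (by omega)]
      simp [decimateStep, State.item, h2, show j ≠ i by omega]
    · rw [← h6, seg_snoc]
      have e : 2 * d = 2 * (d - 1) + 1 + 1 := by omega
      rw [e, seg_cons, seg_cons, decimate, List.append_assoc]
      congr 1
      · refine seg_congr fun j hj => ?_
        simp [decimateStep, State.item, h2, show j ≠ i by omega]
      · have := h5 (2 * i + 1) (by omega)
        -- The write head is behind the read head, so the item read here is still the original one.
        simp only [List.singleton_append, List.cons.injEq]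
        refine ⟨?_, by ring_nf⟩
        rw [← this]
        simp [decimateStep, State.item, h2, h3]
    · simp [decimateStep, h2]
      omega
  · exact ⟨0, c, by simp, by simp, by simp, by simpa using hM, fun j _ => rfl, by simp [hc]⟩
  · exact Nat.mul_le_mul_left _ (by omega)
  · rintro τ ⟨⟨i, d, h1, h2, h3, h4, h5, h6⟩, hb⟩
    simp only [holds_natLt, eval_nv, h3, h4] at hb
    obtain rfl : d = 0 := by omega
    obtain rfl : c = i := h1
    exact ⟨by simpa [decimate] using h6, h2⟩
  · rintro τ ⟨h1, h2⟩
    exact Run.simpleL rfl (Nat.succ_pos _) ⟨by rw [← h1]; rfl, by simp [h2]⟩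

/-- Four runs are merged into one and the result is decimated. -/
def sketchStep : Cmd :=
  (setN 51 (nv 50) ;; setN 50 (nv 43)) ;; pass ;; setN 43 (nv 43 + nv 43) ;; pass ;; decimateCmd

/-- The first `M` items of `A` are the concatenation of `r` sketches with run length `s` of the
list `X`. -/
def IsSketch (A : ℕ → ℝ × ℕ) (M s r : ℕ) (X : List (ℝ × ℕ)) : Prop :=
  M = s * r ∧ ∃ l : List (List (ℝ × ℕ) × List (ℝ × ℕ)), l.length = r ∧
    (∀ x ∈ l, Sketch s s (s * s) s (s * s) x) ∧ seg A 0 M = (l.map Prod.fst).flatten ∧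
    (l.map Prod.snd).flatten = X

theorem sketchStep_run : ∃ C, ∀ (σ : State) (M s r : ℕ) (X : List (ℝ × ℕ)), σ.nat 42 0 = M →
    σ.nat 43 0 = s → 0 < r → IsSketch σ.item M s (4 * r) X →
    Run sketchStep σ (C * (M + 1))
      (fun τ => IsSketch τ.item (2 * s * r) (s + s) r X ∧ τ.nat 42 0 = 2 * s * r ∧
        τ.nat 43 0 = s + s ∧ τ.nat 50 0 = s ∧ τ.nat 51 0 = σ.nat 50 0) := by
  obtain ⟨C, hpass⟩ := pass_run
  obtain ⟨C', hdec⟩ := decimateCmd_run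
  apply Exists.intro
  rintro σ M s r X hM hs hr ⟨hMs, l, hl, hS, hA, hX⟩
  apply Run.seqL (Run.simpleL rfl (Nat.succ_pos _) rfl)
  rintro τ rfl
  have hS1 := pairUp_forall (fun a b => Sketch.merge (x := a) (y := b)) (2 * r) l (by omega) hS
  have hS2 := pairUp_forall (fun a b => Sketch.merge (x := a) (y := b)) r _
    (length_pairUp mergeSketch (2 * r) l (by omega)) hS1
  apply Run.seqL (hpass _ M s (2 * r) (by simpa using hM) (by simpa using hs)
    (by rw [hMs]; ring) (by omega)).frame
  rintro τ ⟨⟨h1, h2, h3⟩, hf⟩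
  have e1 : seg τ.item 0 M = (((pairUp mergeSketch l)).map Prod.fst).flatten := by
    rw [h1, map_pairUp (g := mergeL) fun _ _ => rfl]
    refine passL_eq _ _ _ (by simp [hl]; ring) ?_ ?_
    · simpa using fun a x hx => (hS _ hx).length
    · rw [show 2 * s * (2 * r) = M by rw [hMs]; ring, ← hA]; rfl
  have h50 : τ.nat 50 0 = s := by rw [hf.1 50 (by decide)]; simp [hs]
  have h51 : τ.nat 51 0 = σ.nat 50 0 := by rw [hf.1 51 (by decide)]; simp
  apply Run.seqL (Run.simpleL rfl (Nat.succ_pos _) rfl)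
  rintro ρ rfl
  apply Run.seqL (hpass _ M (2 * s) r (by simpa using h2) (by simp [h3]; ring)
    (by rw [hMs]; ring) (by omega)).frame
  rintro ρ ⟨⟨h4, h5, h6⟩, hg⟩
  have e2 : seg ρ.item 0 M = ((pairUp mergeSketch (pairUp mergeSketch l)).map Prod.fst).flatten := by
    rw [h4, map_pairUp (g := mergeL) fun _ _ => rfl]
    refine passL_eq _ _ _ ?_ ?_ ?_
    · rw [List.length_map, length_pairUp _ (2 * r) l (by omega)]
    · simpa using fun a x hx => (hS1 _ hx).length
    · rw [show 2 * (2 * s) * r = M by rw [hMs]; ring, ← e1]; rfl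
  have g50 : ρ.nat 50 0 = s := by rw [hg.1 50 (by decide)]; simpa using h50
  have g51 : ρ.nat 51 0 = σ.nat 50 0 := by rw [hg.1 51 (by decide)]; simpa using h51
  refine (hdec _ M (2 * s * r) h5 (by rw [hMs]; ring)).frame.mono le_rfl ?_
  rintro π ⟨⟨h7, h8⟩, hh⟩
  refine ⟨⟨by ring, (pairUp mergeSketch (pairUp mergeSketch l)).map
    (fun x => (decimate x.1, x.2)), ?_, ?_, ?_, ?_⟩, h8, ?_, ?_, ?_⟩
  · rw [List.length_map, length_pairUp _ r _ (length_pairUp _ (2 * r) l (by omega))]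
  · intro x hx
    obtain ⟨y, hy, rfl⟩ := List.mem_map.1 hx
    exact (hS2 y hy).decimate
  · rw [h7, e2, decimate_flatten (2 * s)]
    · simp [Function.comp_def]
    · simpa using fun a x hx => (hS2 _ hx).length
  · rw [← hX, List.map_map, show (Prod.snd ∘ fun x : List (ℝ × ℕ) × List (ℝ × ℕ) =>
      (decimate x.1, x.2)) = Prod.snd from rfl, map_pairUp (g := (· ++ ·)) fun _ _ => rfl,
      map_pairUp (g := (· ++ ·)) fun _ _ => rfl, flatten_pairUp_append, flatten_pairUp_append]
  · rw [hh.1 43 (by decide), h6]; ring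
  · rw [hh.1 50 (by decide), g50]
  · rw [hh.1 51 (by decide), g51]

/-- The real variable `28` becomes an approximate median of the first `nv 52` keys. -/
def approxMedian : Cmd :=
  (setN 42 1 ;; setN 43 1 ;; setN 50 0 ;; setN 51 0) ;;
  .loop (.not (.natLt (nv 52) (nv 42 + nv 42 + nv 42 + nv 42)))
    (setN 42 (nv 42 + nv 42 + nv 42 + nv 42)) ;;
  .loop (.natLt (nv 43) (nv 42)) sketchStep ;;
  setR 28 (.get 30 (nv 51))

theorem flatten_map_singleton {α : Type*} : ∀ l : List α, (l.map fun x => [x]).flatten = l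
  | [] => rfl
  | a :: l => by simp [flatten_map_singleton l]

theorem isSketch_one (A : ℕ → ℝ × ℕ) (N : ℕ) : IsSketch A N 1 N (seg A 0 N) := by
  refine ⟨by simp, (seg A 0 N).map fun x => ([x], [x]), by simp, ?_, ?_, ?_⟩
  · intro x hx
    obtain ⟨y, -, rfl⟩ := List.mem_map.1 hx
    exact ⟨rfl, by simp, rfl, by simp, by simp⟩
  · rw [List.map_map]
    exact (flatten_map_singleton _).symm
  · rw [List.map_map]
    exact flatten_map_singleton _

theorem countP_fst_seg (A : ℕ → ℝ × ℕ) (p : ℝ → Bool) (r c : ℕ) :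
    (seg A r c).countP (fun x => p x.1) = (seg (fun i => (A i).1) r c).countP p := by
  have := seg_map (A := A) Prod.fst r c
  rw [← this, List.countP_map]
  rfl

theorem pow4_run (k : ℕ) (hk : 0 < k) {σ : State} (h52 : σ.nat 52 0 = k) (h42 : σ.nat 42 0 = 1) :
    Run (.loop (.not (.natLt (nv 52) (nv 42 + nv 42 + nv 42 + nv 42)))
      (setN 42 (nv 42 + nv 42 + nv 42 + nv 42))) σ
      (((setN 42 (nv 42 + nv 42 + nv 42 + nv 42)).bound +
        (BExp.not (.natLt (nv 52) (nv 42 + nv 42 + nv 42 + nv 42))).cost + 1) * (k + 1))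
      (fun τ => ∃ e, τ.nat 42 0 = 4 ^ e ∧ 4 ^ e ≤ k ∧ k < 4 * 4 ^ e) := by
  refine (Run.loopMeasure (fun τ => τ.nat 52 0 = k ∧ ∃ e, τ.nat 42 0 = 4 ^ e ∧ 4 ^ e ≤ k)
    (fun τ => k - τ.nat 42 0) (setN 42 (nv 42 + nv 42 + nv 42 + nv 42)).bound ?_
    ⟨h52, 0, by simpa using h42, by simpa using Nat.succ_le_of_lt hk⟩).mono ?_ ?_
  · rintro τ ⟨h1, e, h2, h3⟩ hb
    simp only [holds_not, holds_natLt, eval_nv, eval_natAdd, h1, h2] at hb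
    have := Nat.pow_pos (n := e) (show 0 < 4 by decide)
    refine Run.simple rfl ⟨⟨by simpa using h1, e + 1, ?_, by rw [pow_succ]; omega⟩, ?_⟩
    · simp [h2, pow_succ]; ring
    · simp [h2]; omega
  · exact Nat.mul_le_mul_left _ (by omega)
  · rintro τ ⟨⟨h1, e, h2, h3⟩, hb⟩
    simp only [holds_not, holds_natLt, eval_nv, eval_natAdd, h1, h2] at hb
    exact ⟨e, h2, h3, by omega⟩

/-- By `rank`, cells 50 and 51 hold the run lengths of one and of two rounds ago, or 0 if there were
none. At the end cell 51 is thus a quarter of the run length, up to rounding, which is the rank at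
which the median is read. -/
structure SketchInv (X : List (ℝ × ℕ)) (σ : State) : Prop where
  sketch : ∃ m, IsSketch σ.item (σ.nat 42 0) (σ.nat 43 0) (4 ^ m) X
  pos : 0 < σ.nat 43 0
  rank : (σ.nat 43 0 = 1 ∧ σ.nat 50 0 = 0 ∧ σ.nat 51 0 = 0) ∨
    (σ.nat 43 0 = 2 ∧ σ.nat 50 0 = 1 ∧ σ.nat 51 0 = 0) ∨
    (0 < σ.nat 51 0 ∧ σ.nat 50 0 = 2 * σ.nat 51 0 ∧ σ.nat 43 0 = 4 * σ.nat 51 0)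

/-- Each round halves the number of stored items, so the times of all rounds form a geometric sum.
-/
theorem sketchLoop_run : ∃ C, ∀ (σ : State) (X : List (ℝ × ℕ)), SketchInv X σ →
    Run (.loop (.natLt (nv 43) (nv 42)) sketchStep) σ (C * (X.length + 1))
      (fun τ => SketchInv X τ ∧ τ.nat 42 0 = τ.nat 43 0) := by
  obtain ⟨C, hstep⟩ := sketchStep_run
  obtain ⟨B, hB⟩ : ∃ B, (BExp.natLt (nv 43) (nv 42)).cost + 1 = B := ⟨_, rfl⟩
  refine ⟨2 * (2 * C + B), fun σ X h => ?_⟩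
  have hlen : ∀ σ, SketchInv X σ → σ.nat 42 0 ≤ X.length := by
    rintro σ ⟨⟨m, hM, l, hl, hS, -, hX⟩, hp, -⟩
    rw [← hX, hM, ← hl]
    clear hX hl hM
    induction l with
    | nil => simp
    | cons a l ih =>
      simp only [List.mem_cons, forall_eq_or_imp] at hS
      have := ih hS.2
      simp only [List.length_cons, List.map_cons, List.flatten_cons, List.length_append, hS.1.size]
      nlinarith
  have hsize : ∀ σ, SketchInv X σ → σ.nat 43 0 ≤ σ.nat 42 0 := by
    rintro σ ⟨⟨m, hM, -⟩, -, -⟩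
    rw [hM]
    exact Nat.le_mul_of_pos_right _ (by positivity)
  refine (Run.loop (SketchInv X) (fun τ => (2 * (2 * C + B)) * τ.nat 42 0)
    (fun τ => C * (τ.nat 42 0 + 1)) ?_ h).mono ?_ ?_
  · rintro τ hτ hb
    simp only [holds_natLt, eval_nv] at hb
    obtain ⟨m, hm⟩ := hτ.sketch
    obtain _ | m := m
    · have := hm.1
      simp at this
      omega
    · have hr : 4 ^ (m + 1) = 4 * 4 ^ m := by ring
      refine (hstep τ _ _ _ X rfl rfl (by positivity) (hr ▸ hm)).mono le_rfl ?_
      rintro ρ ⟨h1, h2, h3, h4, h5⟩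
      refine ⟨⟨⟨m, by rw [h2, h3]; exact h1⟩, ?_, ?_⟩, ?_⟩
      · have := hτ.pos; omega
      · have := hτ.rank; omega
      · have e : τ.nat 42 0 = 2 * ρ.nat 42 0 := by rw [h2, hm.1]; ring
        have : 0 < ρ.nat 42 0 := by omega
        rw [e, hB]
        nlinarith [Nat.zero_le (C * ρ.nat 42 0), Nat.mul_le_mul_left C this,
          Nat.mul_le_mul_left B this]
  · have := hlen σ h
    have := Nat.mul_le_mul_left (2 * (2 * C + B)) this
    rw [hB]
    have := Nat.zero_le C
    nlinarith
  · rintro τ ⟨h1, h2⟩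
    simp only [holds_natLt, eval_nv] at h2
    have := hsize τ h1
    exact ⟨h1, by omega⟩

/-- The first 4^e items, with 4^e the largest power of four not exceeding k, are compressed to a
single sorted sketch of length s = 2^e. Its entry v has rank about s / 4, so at least s² / 4 items
are ≤ v. At most s² / 4 plus the error, which is below s² / 2, are < v, so at least s² / 4 items are
≥ v as well. The factor 16 comes from k < 4 · 4^e. -/
theorem approxMedian_run : ∃ C, ∀ (σ : State) (k : ℕ), σ.nat 52 0 = k → 0 < k →
    Run approxMedian σ (C * (k + 1))
      (fun τ => k ≤ 16 * (seg (σ.real 30) 0 k).countP (fun x => decide (x ≤ τ.real 28 0)) ∧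
        k ≤ 16 * (seg (σ.real 30) 0 k).countP (fun x => decide (τ.real 28 0 ≤ x))) := by
  obtain ⟨C, hloop⟩ := sketchLoop_run
  apply Exists.intro
  intro σ k hk hk0
  apply Run.seqL (Run.simpleL rfl (Nat.succ_pos _) rfl)
  rintro τ rfl
  apply Run.seqL (pow4_run k hk0 (by simpa using hk) (by simp)).frame
  rintro τ ⟨⟨e, h1, h2, h3⟩, hf⟩
  have hitem : τ.item = σ.item := by
    funext i
    simp only [State.item]
    rw [hf.1 40 (by decide), hf.2 30 (by decide)]
    simp
  have h43 : τ.nat 43 0 = 1 := by rw [hf.1 43 (by decide)]; simp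
  have h50 : τ.nat 50 0 = 0 := by rw [hf.1 50 (by decide)]; simp
  have h51 : τ.nat 51 0 = 0 := by rw [hf.1 51 (by decide)]; simp
  apply Run.seqL ((hloop τ (seg σ.item 0 (4 ^ e)) ⟨⟨e, by
    rw [h1, h43, hitem]; exact isSketch_one _ _⟩, by omega, by omega⟩).mono
    (Nat.mul_le_mul_left _ (by simpa using h2)) fun _ => id)
  rintro ρ ⟨⟨⟨m, hM, l, hl, hS, hA, hX⟩, hp, hr⟩, h4⟩
  refine Run.simpleL rfl (Nat.succ_pos _) ?_
  have hm : 4 ^ m = 1 := by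
    rw [h4] at hM
    exact Nat.eq_of_mul_eq_mul_left hp (by omega)
  obtain ⟨⟨S, Y⟩, rfl⟩ := List.length_eq_one_iff.1 (hl.trans hm)
  simp only [List.map_cons, List.map_nil, List.flatten_cons, List.flatten_nil, List.append_nil,
    List.mem_singleton, forall_eq] at hA hX hS
  subst hX
  set s := ρ.nat 43 0
  set r := ρ.nat 51 0
  have hN : 4 ^ e = s * s := by simpa using hS.size
  have hrs : r < s := by omega
  set v := ρ.real 30 r
  have hv : ((setR 28 (.get 30 (nv 51))).den ρ).real 28 0 = v := by simp [v, r]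
  rw [hv]
  have hcount : ∀ p : ℝ → Bool, S.countP (fun x => p x.1) =
      (seg (ρ.real 30) 0 r).countP p + (seg (ρ.real 30) r (s - r)).countP p := by
    intro p
    rw [← hA, countP_fst_seg, h4, show s = r + (s - r) by omega, seg_append, List.countP_append,
      Nat.add_sub_cancel_left, Nat.zero_add]
    rfl
  have hsorted : ∀ i j, i ≤ j → j < s → ρ.real 30 i ≤ ρ.real 30 j := by
    intro i j hij hj
    rcases hij.eq_or_lt with rfl | hij
    · exact le_rfl
    · have := hS.sorted
      rw [← hA, h4, SortedK, List.pairwise_iff_getElem] at this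
      have := this i j (by simp; omega) (by simpa using hj) hij
      rw [getElem_seg, getElem_seg, Nat.zero_add, Nat.zero_add] at this
      exact this
  have hle : r + 1 ≤ S.countP fun x => decide (x.1 ≤ v) := by
    rw [hcount fun x => decide (x ≤ v)]
    refine Nat.add_le_add (le_of_eq ?_) ?_
    · conv_lhs => rw [← length_seg (ρ.real 30) 0 r]
      refine (List.countP_eq_length.2 fun x hx => ?_).symm
      obtain ⟨i, hi, rfl⟩ := (mem_seg _).1 hx
      simpa using hsorted i r hi.le hrs
    · refine List.countP_pos_iff.2 ⟨v, (mem_seg _).2 ⟨0, by omega, rfl⟩, by simp⟩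
  have hlt : S.countP (fun x => decide (x.1 < v)) ≤ r := by
    rw [hcount fun x => decide (x < v)]
    have h0 : (seg (ρ.real 30) r (s - r)).countP (fun x => decide (x < v)) = 0 := by
      refine List.countP_eq_zero.2 fun x hx => ?_
      obtain ⟨i, hi, rfl⟩ := (mem_seg _).1 hx
      simpa using hsorted r (r + i) (by omega) (by omega)
    rw [h0, Nat.add_zero]
    exact List.countP_le_length.trans (length_seg _ _ _).le
  have hmono : ∀ p : ℝ → Bool, (seg σ.item 0 (4 ^ e)).countP (fun x => p x.1) ≤
      (seg (σ.real 30) 0 k).countP p := by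
    intro p
    rw [countP_fst_seg]
    obtain ⟨d, rfl⟩ := Nat.exists_eq_add_of_le h2
    rw [seg_append, List.countP_append]
    exact Nat.le_add_right _ _
  refine ⟨?_, ?_⟩
  · have h5 := hS.lower (fun x => decide (x.1 ≤ v)) (by simpa using fun a b h h' => le_trans h h')
    have h6 := hmono fun x => decide (x ≤ v)
    simp only at h5 h6
    have h7 := Nat.mul_le_mul_left s hle
    have h8 : s * s ≤ s * (4 * (r + 1)) := Nat.mul_le_mul_left s (by omega)
    nlinarith
  · have h5 := hS.upper (fun x => decide (x.1 < v)) (by simpa using fun a b h h' => lt_of_le_of_lt h h')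
    have h6 := hmono fun x => decide (v ≤ x)
    have h9 := List.length_eq_countP_add_countP (fun x : ℝ × ℕ => decide (x.1 < v))
      (l := seg σ.item 0 (4 ^ e))
    simp only [decide_eq_true_eq, not_lt, length_seg] at h5 h6 h9
    have h7 := Nat.mul_le_mul_left s hlt
    have h8 : s * (4 * r) ≤ s * s := Nat.mul_le_mul_left s (by omega)
    nlinarith

/-! ### Sorting -/

/-- Sort the first `nv 42` items, where `nv 42` is a power of two. -/
def mergeSort : Cmd :=
  setN 43 1 ;; .loop (.natLt (nv 43) (nv 42)) (pass ;; setN 43 (nv 43 + nv 43))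

theorem mergeSort_run : ∃ C, ∀ (σ : State) (e : ℕ), σ.nat 42 0 = 2 ^ e →
    Run mergeSort σ (C * ((2 ^ e + 1) * (e + 1)))
      (fun τ => SortedK (seg τ.item 0 (2 ^ e)) ∧
        (seg τ.item 0 (2 ^ e)).Perm (seg σ.item 0 (2 ^ e))) := by
  obtain ⟨C, hpass⟩ := pass_run
  apply Exists.intro
  intro σ e he
  apply Run.seqL (Run.simpleL rfl (by positivity) rfl)
  rintro τ rfl
  refine (Run.loopMeasure (T := (C + (setN 43 (nv 43 + nv 43)).bound) * (2 ^ e + 1))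
    (fun τ => τ.nat 42 0 = 2 ^ e ∧ ∃ d m, e = d + m ∧ τ.nat 43 0 = 2 ^ d ∧
      ∃ l : List (List (ℝ × ℕ)), l.length = 2 ^ m ∧ (∀ x ∈ l, x.length = 2 ^ d ∧ SortedK x) ∧
        seg τ.item 0 (2 ^ e) = l.flatten ∧ l.flatten.Perm (seg σ.item 0 (2 ^ e)))
    (fun τ => e - Nat.log 2 (τ.nat 43 0)) ?_ ?_).mono (T' := (C +
      (setN 43 (nv 43 + nv 43)).bound + (BExp.natLt (nv 43) (nv 42)).cost + 1) *
        ((2 ^ e + 1) * (e + 1))) ?_ ?_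
  · rintro τ ⟨h1, d, m, hdm, h2, l, h3, h4, h5, h6⟩ hb
    simp only [holds_natLt, eval_nv, h1, h2] at hb
    have hde : d < e := (Nat.pow_lt_pow_iff_right (by decide)).1 hb
    obtain ⟨m, rfl⟩ : ∃ m', m = m' + 1 := ⟨m - 1, by omega⟩
    have hl : l.length = 2 * 2 ^ m := by rw [h3]; ring
    have hM : 2 ^ e = 2 * 2 ^ d * 2 ^ m := by rw [hdm]; ring
    refine Run.seqL (hpass τ _ _ (2 ^ m) h1 h2 hM (by positivity))
      fun ρ ⟨h7, h8, h9⟩ => Run.simpleL rfl (by positivity) ?_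
    refine ⟨⟨by simpa using h8, d + 1, m, by omega, by simp [h9, pow_succ]; ring,
      pairUp mergeL l, length_pairUp _ _ l hl, ?_, ?_, ?_⟩, ?_⟩
    · refine pairUp_forall (P := fun x => x.length = 2 ^ d ∧ SortedK x) ?_ (2 ^ m) l hl h4
      rintro a b ⟨ha, ha'⟩ ⟨hb, hb'⟩
      exact ⟨by rw [length_mergeL, ha, hb]; ring, sortedK_mergeL ha' hb'⟩
    · rw [← passL_eq (A := τ.item) (s := 2 ^ d) (2 ^ m) 0 l hl (fun x hx => (h4 x hx).1)
        (by rw [← hM]; exact h5), ← h7]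
      rfl
    · exact (flatten_pairUp_mergeL l).trans h6
    · simp only [den_setN, eval_natAdd, eval_nv, State.setNat_nat_same, Function.update_self, h9, h2]
      rw [← two_mul, ← pow_succ', Nat.log_pow (by decide), Nat.log_pow (by decide)]
      omega
  · refine ⟨by simpa using he, 0, e, by simp, by simp, (seg σ.item 0 (2 ^ e)).map fun x => [x],
      by simp, fun x hx => ?_, ?_, ?_⟩
    · obtain ⟨y, -, rfl⟩ := List.mem_map.1 hx
      simp
    · rw [flatten_map_singleton]; rfl
    · rw [flatten_map_singleton]
  · have h1 : (setN 43 1 |>.den σ).nat 43 0 = 1 := by simp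
    rw [h1]
    simp only [Nat.log_one_right, Nat.sub_zero]
    have : (BExp.natLt (nv 43) (nv 42)).cost + 1 ≤
      ((BExp.natLt (nv 43) (nv 42)).cost + 1) * (2 ^ e + 1) := Nat.le_mul_of_pos_right _ (by positivity)
    rw [← Nat.mul_assoc]
    refine Nat.mul_le_mul_right _ ?_
    rw [Nat.add_assoc, Nat.add_assoc (C + _), Nat.add_mul (C + _)]
    exact Nat.add_le_add_left this _
  · rintro τ ⟨⟨h1, d, m, hdm, h2, l, h3, h4, h5, h6⟩, hb⟩
    simp only [holds_natLt, eval_nv, h1, h2, not_lt] at hb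
    have hde : e ≤ d := (Nat.pow_le_pow_iff_right (by decide)).1 hb
    obtain rfl : m = 0 := by omega
    obtain ⟨x, rfl⟩ := List.length_eq_one_iff.1 h3
    rw [h5]
    refine ⟨?_, h6⟩
    simpa using (h4 x (by simp)).2

end RealRAM


namespace RealRAM

/-! ### Pruning of families of affine functions -/

section lists
variable (X Y : ℕ → ℝ)

/-- The value at `x` of the affine function number `j`. -/
def aff (x : ℝ) (j : ℕ) : ℝ := X j + Y j * x

/-- The points where consecutive pairs of functions cross between `lo` and `hi`. -/
noncomputable def crits (lo hi : ℝ) : List ℕ → List ℝ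
  | j :: k :: l =>
    if (aff X Y lo j - aff X Y lo k) * (aff X Y hi j - aff X Y hi k) < 0 then
      (X k - X j) / (Y j - Y k) :: crits lo hi l
    else crits lo hi l
  | _ => []

/-- Of each pair of consecutive functions that do not cross between `lo` and `hi`, keep the
smaller one. -/
noncomputable def pruneL (lo hi : ℝ) : List ℕ → List ℕ
  | j :: k :: l =>
    if (aff X Y lo j - aff X Y lo k) * (aff X Y hi j - aff X Y hi k) < 0 then
      j :: k :: pruneL lo hi l
    else if aff X Y lo j - aff X Y lo k + (aff X Y hi j - aff X Y hi k) ≤ 0 then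
      j :: pruneL lo hi l
    else k :: pruneL lo hi l
  | l => l

variable {X Y}

theorem aff_sub_mem {lo hi x : ℝ} (hx : lo ≤ x ∧ x ≤ hi) (j k : ℕ)
    (h1 : aff X Y lo j ≤ aff X Y lo k) (h2 : aff X Y hi j ≤ aff X Y hi k) :
    aff X Y x j ≤ aff X Y x k := by
  unfold aff at *
  by_cases h : 0 ≤ Y j - Y k
  · nlinarith [mul_nonneg h (sub_nonneg.2 hx.2)]
  · nlinarith [mul_nonneg (neg_nonneg.2 (not_le.1 h).le) (sub_nonneg.2 hx.1)]

theorem same_sign {a b : ℝ} (h : ¬ a * b < 0) : (a ≤ 0 ∧ b ≤ 0) ∨ (0 ≤ a ∧ 0 ≤ b) := by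
  rcases lt_trichotomy a 0 with ha | ha | ha <;> rcases lt_trichotomy b 0 with hb | hb | hb
  all_goals first
    | exact Or.inl ⟨by linarith, by linarith⟩
    | exact Or.inr ⟨by linarith, by linarith⟩
    | exact absurd (mul_neg_of_neg_of_pos ha hb) h
    | exact absurd (mul_neg_of_pos_of_neg ha hb) h

theorem pruneL_subset (lo hi : ℝ) : ∀ l, pruneL X Y lo hi l ⊆ l
  | [] => by simp [pruneL]
  | [_] => by simp [pruneL]
  | j :: k :: l => by
    have := pruneL_subset lo hi l
    have h2 : l ⊆ j :: k :: l := fun x hx => by simp [hx]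
    rw [pruneL]
    split_ifs <;> simp [List.Subset.trans this h2, List.cons_subset]

/-- Affine functions that do not cross strictly between `lo` and `hi` are ordered in the same way at
both ends, hence on the whole interval. The sum of the two end differences tells which one is
smaller. -/
theorem pruneL_dominates {lo hi : ℝ} : ∀ l, ∀ j ∈ l, ∃ k ∈ pruneL X Y lo hi l,
    ∀ x, lo ≤ x → x ≤ hi → aff X Y x k ≤ aff X Y x j
  | [] => by simp
  | [i] => by simp [pruneL]
  | i :: k :: l => by
    intro j hj
    have ih := pruneL_dominates (lo := lo) (hi := hi) l
    rw [List.mem_cons, List.mem_cons, ← or_assoc] at hj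
    rcases hj with hj | hj
    · have key : (∃ m ∈ [j], m ∈ pruneL X Y lo hi (i :: k :: l)) ∨
          (∃ m, m ∈ pruneL X Y lo hi (i :: k :: l) ∧
            aff X Y lo m ≤ aff X Y lo j ∧ aff X Y hi m ≤ aff X Y hi j) := by
        rw [pruneL]
        split_ifs with h h'
        · left; rcases hj with rfl | rfl <;> simp
        · right
          refine ⟨i, by simp, ?_⟩
          have h1 := same_sign h
          rcases hj with rfl | rfl
          · simp
          · rcases h1 with h1 | h1 <;> constructor <;> linarith
        · right
          refine ⟨k, by simp, ?_⟩
          have h1 := same_sign h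
          rcases hj with rfl | rfl
          · rcases h1 with h1 | h1 <;> constructor <;> linarith
          · simp
      rcases key with ⟨m, hm, h⟩ | ⟨m, hm, h1, h2⟩
      · obtain rfl := List.mem_singleton.1 hm
        exact ⟨m, h, fun _ _ _ => le_rfl⟩
      · exact ⟨m, hm, fun x h h' => aff_sub_mem ⟨h, h'⟩ _ _ h1 h2⟩
    · obtain ⟨m, hm, h⟩ := ih j hj
      refine ⟨m, ?_, h⟩
      rw [pruneL]
      split_ifs <;> simp [hm]

theorem not_cross_mono {lo hi lo' hi' : ℝ} (h1 : lo ≤ lo') (h2 : lo' ≤ hi') (h3 : hi' ≤ hi) {j k : ℕ}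
    (h : ¬ (aff X Y lo j - aff X Y lo k) * (aff X Y hi j - aff X Y hi k) < 0) :
    ¬ (aff X Y lo' j - aff X Y lo' k) * (aff X Y hi' j - aff X Y hi' k) < 0 := by
  rw [not_lt]
  rcases same_sign h with ⟨ha, hb⟩ | ⟨ha, hb⟩
  · have := aff_sub_mem ⟨h1, h2.trans h3⟩ j k (sub_nonpos.1 ha) (sub_nonpos.1 hb)
    have := aff_sub_mem ⟨h1.trans h2, h3⟩ j k (sub_nonpos.1 ha) (sub_nonpos.1 hb)
    apply mul_nonneg_of_nonpos_of_nonpos <;> linarith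
  · have := aff_sub_mem ⟨h1, h2.trans h3⟩ k j (sub_nonneg.1 ha) (sub_nonneg.1 hb)
    have := aff_sub_mem ⟨h1.trans h2, h3⟩ k j (sub_nonneg.1 ha) (sub_nonneg.1 hb)
    apply mul_nonneg <;> linarith

theorem slope_ne_of_cross {lo hi : ℝ} {j k : ℕ}
    (h : (aff X Y lo j - aff X Y lo k) * (aff X Y hi j - aff X Y hi k) < 0) : Y j - Y k ≠ 0 := by
  intro h0
  refine not_le.2 h ?_
  have : aff X Y lo j - aff X Y lo k = aff X Y hi j - aff X Y hi k := by
    unfold aff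
    linear_combination (lo - hi) * h0
  rw [this]
  exact mul_self_nonneg _

theorem aff_sub_eq {j k : ℕ} (h : Y j - Y k ≠ 0) (x : ℝ) :
    aff X Y x j - aff X Y x k = (Y j - Y k) * (x - (X k - X j) / (Y j - Y k)) := by
  unfold aff
  field_simp
  ring

theorem crits_mem {lo hi : ℝ} (hlh : lo < hi) : ∀ l, ∀ x ∈ crits X Y lo hi l, lo < x ∧ x < hi
  | [] => by simp [crits]
  | [_] => by simp [crits]
  | j :: k :: l => by
    have ih := crits_mem hlh l
    rw [crits]
    split_ifs with h
    · simp only [List.mem_cons, forall_eq_or_imp]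
      refine ⟨?_, ih⟩
      have h0 := slope_ne_of_cross h
      rw [aff_sub_eq h0, aff_sub_eq h0] at h
      set c := (X k - X j) / (Y j - Y k)
      have h1 : (Y j - Y k) ^ 2 * ((lo - c) * (hi - c)) < 0 := by nlinarith
      have h2 : (lo - c) * (hi - c) < 0 := by
        by_contra h3
        exact not_le.2 h1 (mul_nonneg (sq_nonneg _) (not_lt.1 h3))
      constructor <;> by_contra h4 <;> rw [not_lt] at h4 <;> nlinarith
    · exact ih

/-- There are `l.length / 2` pairs. A pair loses a member if it does not cross between the old
bounds, and also if it does but its crossing is marked by `p`, since that crossing is not strictly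
between the new bounds. So at least as many functions disappear as there are pairs, minus the
crossing pairs, plus the marked crossings. -/
theorem pruneL_progress {lo hi lo' hi' : ℝ} (h1 : lo ≤ lo') (h2 : lo' ≤ hi') (h3 : hi' ≤ hi)
    (p : ℝ → Bool) (hp : ∀ x, p x → x ≤ lo' ∨ hi' ≤ x) : ∀ l,
    l.length / 2 + (crits X Y lo hi l).countP p + (pruneL X Y lo' hi' l).length ≤
      l.length + (crits X Y lo hi l).length
  | [] => by simp [crits, pruneL]
  | [_] => by simp [crits, pruneL]
  | j :: k :: l => by
    have ih := pruneL_progress h1 h2 h3 p hp l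
    have hl : (j :: k :: l).length / 2 = l.length / 2 + 1 := by simp only [List.length_cons]; omega
    rw [hl, pruneL, crits]
    by_cases h : (aff X Y lo j - aff X Y lo k) * (aff X Y hi j - aff X Y hi k) < 0
    · rw [if_pos h]
      by_cases hc : p ((X k - X j) / (Y j - Y k)) = true
      · have h0 := slope_ne_of_cross h
        rw [if_neg]
        · split_ifs <;> simp only [List.length_cons, List.countP_cons, hc, if_true] <;> omega
        · rw [aff_sub_eq h0, aff_sub_eq h0, not_lt]
          set c := (X k - X j) / (Y j - Y k)
          have : 0 ≤ (Y j - Y k) ^ 2 * ((lo' - c) * (hi' - c)) := by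
            refine mul_nonneg (sq_nonneg _) ?_
            rcases hp _ hc with h4 | h4
            · exact mul_nonneg (by linarith) (by linarith)
            · exact mul_nonneg_of_nonpos_of_nonpos (by linarith) (by linarith)
          nlinarith
      · split_ifs <;> simp only [List.length_cons, List.countP_cons, hc] <;> simp <;> omega
    · rw [if_neg h, if_neg (not_cross_mono h1 h2 h3 h)]
      split_ifs <;> simp only [List.length_cons] <;> omega

end lists

end RealRAM


/-! ### Collecting crossings and pruning on the machine -/

namespace RealRAM

/-- The value at the point `x` of the affine function whose number is the value of `i`. -/
def affE (x : RExp) (i : NExp) : RExp := .get 20 i + .get 21 i * x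

/-- The difference at the point `x` of the current pair of functions of the list `lst`. -/
def gapE (lst : ℕ) (x : RExp) : RExp :=
  affE x (.get lst (nv 53)) - affE x (.get lst (nv 53 + 1))

def collectStep (lst : ℕ) : Cmd :=
  .cond (.realLt (gapE lst (rv 26) * gapE lst (rv 27)) 0)
    (.setReal 30 (nv 52) ((.get 20 (.get lst (nv 53 + 1)) - .get 20 (.get lst (nv 53))) /
      (.get 21 (.get lst (nv 53)) - .get 21 (.get lst (nv 53 + 1)))) ;; setN 52 (nv 52 + 1)) .skip ;;
  setN 53 (nv 53 + 2)

/-- Append the crossings of consecutive pairs of the list `lst` to the keys. -/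
def collect (lst cnt : ℕ) : Cmd :=
  setN 53 0 ;; .loop (.natLt (nv 53 + 1) (nv cnt)) (collectStep lst)

/-- The two lists of functions and their counters. -/
def IsList (lst cnt : ℕ) : Prop := (lst = 11 ∧ cnt = 12) ∨ (lst = 13 ∧ cnt = 14)

theorem collect_run {lst cnt : ℕ} (hlst : IsList lst cnt) : ∃ C, ∀ (σ : State) (X Y : ℕ → ℝ)
    (l : List ℕ) (lo hi : ℝ) (K : List ℝ), σ.real 20 = X → σ.real 21 = Y → σ.real 26 0 = lo →
    σ.real 27 0 = hi → seg (σ.nat lst) 0 (σ.nat cnt 0) = l →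
    seg (σ.real 30) 0 (σ.nat 52 0) = K → Run (collect lst cnt) σ (C * (l.length + 1))
      (fun τ => seg (τ.real 30) 0 (τ.nat 52 0) = K ++ crits X Y lo hi l) := by
  apply Exists.intro
  rintro σ X Y l lo hi K hX hY hlo hhi hl hK
  apply Run.seqL (Run.simpleL rfl (Nat.succ_pos _) rfl)
  rintro τ rfl
  have hl52 : lst ≠ 52 := by rcases hlst with h | h <;> omega
  have hl53 : lst ≠ 53 := by rcases hlst with h | h <;> omega
  have hc52 : cnt ≠ 52 := by rcases hlst with h | h <;> omega
  have hc53 : cnt ≠ 53 := by rcases hlst with h | h <;> omega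
  have hlen : l.length = σ.nat cnt 0 := by rw [← hl]; simp
  refine (Run.loopMeasure (T := (collectStep lst).bound) (fun τ => τ.real 20 = X ∧ τ.real 21 = Y ∧
    τ.real 26 0 = lo ∧ τ.real 27 0 = hi ∧ τ.nat lst = σ.nat lst ∧ τ.nat cnt = σ.nat cnt ∧
    ∃ r, τ.nat 53 0 = r ∧ seg (τ.real 30) 0 (τ.nat 52 0) ++
      crits X Y lo hi (seg (σ.nat lst) r (σ.nat cnt 0 - r)) = K ++ crits X Y lo hi l)
    (fun τ => σ.nat cnt 0 - τ.nat 53 0) ?_ ?_).mono (T' := ((collectStep lst).bound +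
      (BExp.natLt (nv 53 + 1) (nv cnt)).cost + 1) * (l.length + 1)) ?_ ?_
  · rintro τ ⟨h1, h2, h3, h4, h5, h6, r, h7, h8⟩ hb
    simp only [holds_natLt, eval_nv, eval_natAdd, eval_ofNat, h7, h6] at hb
    have e1 : σ.nat cnt 0 - r = (σ.nat cnt 0 - (r + 1 + 1)) + 1 + 1 := by omega
    rw [e1, seg_cons, seg_cons, crits] at h8
    refine Run.simple rfl ?_
    by_cases hcross : (aff X Y lo (σ.nat lst r) - aff X Y lo (σ.nat lst (r + 1))) *
      (aff X Y hi (σ.nat lst r) - aff X Y hi (σ.nat lst (r + 1))) < 0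
    · have e : (collectStep lst).den τ = ((τ.setReal 30 (τ.nat 52 0)
          ((X (σ.nat lst (r + 1)) - X (σ.nat lst r)) / (Y (σ.nat lst r) - Y (σ.nat lst (r + 1))))).setNat
          52 0 (τ.nat 52 0 + 1)).setNat 53 0 (r + 2) := by
        rw [collectStep, den_seq, den_cond_pos τ (by simpa [gapE, affE, h1, h2, h3, h4, h5, h7, aff]
          using hcross)]
        simp [h1, h2, h5, h7]
      rw [if_pos hcross] at h8
      rw [e]
      refine ⟨⟨by simpa using h1, by simpa using h2, by simpa using h3, by simpa using h4,
        by simpa [hl52, hl53] using h5, by simpa [hc52, hc53] using h6, r + 2, by simp, ?_⟩, ?_⟩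
      · rw [← h8]
        simp only [ne_eq, Nat.reduceEqDiff, not_false_eq_true, State.setNat_nat_ne, State.setReal_nat,
          State.setNat_nat_same, Function.update_self, State.setNat_real, State.setReal_real_same]
        rw [seg_snoc, List.append_assoc, Nat.zero_add, Function.update_self]
        congr 1
        refine seg_congr fun i hi => ?_
        rw [Function.update_of_ne (by omega)]
      · simp [h7]; omega
    · have e : (collectStep lst).den τ = τ.setNat 53 0 (r + 2) := by
        rw [collectStep, den_seq, den_cond_neg τ (by simpa [gapE, affE, h1, h2, h3, h4, h5, h7, aff]
          using hcross)]
        simp [h7]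
      rw [if_neg hcross] at h8
      rw [e]
      exact ⟨⟨h1, h2, h3, h4, by simpa [hl53] using h5, by simpa [hc53] using h6, r + 2, by simp,
        by simpa using h8⟩, by simp [h7]; omega⟩
  · exact ⟨by simpa using hX, by simpa using hY, by simpa using hlo, by simpa using hhi,
      by simp [hl53], by simp [hc53], 0, by simp, by simp [hl, hK]⟩
  · exact Nat.mul_le_mul_left _ (by omega)
  · rintro τ ⟨⟨h1, h2, h3, h4, h5, h6, r, h7, h8⟩, hb⟩
    simp only [holds_natLt, eval_nv, eval_natAdd, eval_ofNat, h7, h6] at hb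
    have : crits X Y lo hi (seg (σ.nat lst) r (σ.nat cnt 0 - r)) = [] := by
      obtain h | h : σ.nat cnt 0 - r = 0 ∨ σ.nat cnt 0 - r = 1 := by omega
      all_goals simp [h, seg_cons, crits]
    rw [← h8, this, List.append_nil]

def pruneStep (lst : ℕ) : Cmd :=
  .cond (.realLt (gapE lst (rv 26) * gapE lst (rv 27)) 0)
    (.setNat lst (nv 54) (.get lst (nv 53)) ;; .setNat lst (nv 54 + 1) (.get lst (nv 53 + 1)) ;;
      setN 54 (nv 54 + 2))
    (.cond (.le (gapE lst (rv 26) + gapE lst (rv 27)) 0)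
      (.setNat lst (nv 54) (.get lst (nv 53)) ;; setN 54 (nv 54 + 1))
      (.setNat lst (nv 54) (.get lst (nv 53 + 1)) ;; setN 54 (nv 54 + 1))) ;;
  setN 53 (nv 53 + 2)

def pruneEnd (lst cnt : ℕ) : Cmd :=
  .cond (.natLt (nv 53) (nv cnt)) (.setNat lst (nv 54) (.get lst (nv 53)) ;; setN 54 (nv 54 + 1))
    .skip ;;
  setN cnt (nv 54)

/-- Prune the list `lst` in place. -/
def prune (lst cnt : ℕ) : Cmd :=
  (setN 53 0 ;; setN 54 0) ;; .loop (.natLt (nv 53 + 1) (nv cnt)) (pruneStep lst) ;;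
  pruneEnd lst cnt

theorem seg_update {α : Type*} (A : ℕ → α) (w : ℕ) (x : α) :
    seg (Function.update A w x) 0 (w + 1) = seg A 0 w ++ [x] := by
  rw [seg_snoc, Nat.zero_add, Function.update_self]
  congr 1
  refine seg_congr fun i hi => ?_
  rw [Function.update_of_ne (by omega)]

/-- Pruning in place is safe because the write position never overtakes the read position: each pair
read produces at most two entries. -/
theorem prune_run {lst cnt : ℕ} (hlst : IsList lst cnt) : ∃ C, ∀ (σ : State) (X Y : ℕ → ℝ)
    (l : List ℕ) (lo hi : ℝ), σ.real 20 = X → σ.real 21 = Y → σ.real 26 0 = lo →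
    σ.real 27 0 = hi → seg (σ.nat lst) 0 (σ.nat cnt 0) = l →
    Run (prune lst cnt) σ (C * (l.length + 1))
      (fun τ => seg (τ.nat lst) 0 (τ.nat cnt 0) = pruneL X Y lo hi l) := by
  apply Exists.intro
  rintro σ X Y l lo hi hX hY hlo hhi hl
  apply Run.seqL (Run.simpleL rfl (Nat.succ_pos _) rfl)
  rintro τ rfl
  have hl53 : lst ≠ 53 := by rcases hlst with h | h <;> omega
  have hl54 : lst ≠ 54 := by rcases hlst with h | h <;> omega
  have hc53 : cnt ≠ 53 := by rcases hlst with h | h <;> omega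
  have hc54 : cnt ≠ 54 := by rcases hlst with h | h <;> omega
  have hcl : cnt ≠ lst := by rcases hlst with h | h <;> omega
  have hlen : l.length = σ.nat cnt 0 := by rw [← hl]; simp
  refine Run.seqL (K' := (pruneEnd lst cnt).bound) ((Run.loopMeasure (T := (pruneStep lst).bound)
    (fun τ => τ.real 20 = X ∧ τ.real 21 = Y ∧
    τ.real 26 0 = lo ∧ τ.real 27 0 = hi ∧ τ.nat cnt = σ.nat cnt ∧
    ∃ r w, τ.nat 53 0 = r ∧ τ.nat 54 0 = w ∧ w ≤ r ∧ (∀ i, r ≤ i → τ.nat lst i = σ.nat lst i) ∧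
      seg (τ.nat lst) 0 w ++
      pruneL X Y lo hi (seg (σ.nat lst) r (σ.nat cnt 0 - r)) = pruneL X Y lo hi l)
    (fun τ => σ.nat cnt 0 - τ.nat 53 0) ?_ ?_).mono (T' := ((pruneStep lst).bound +
      (BExp.natLt (nv 53 + 1) (nv cnt)).cost + 1) * (l.length + 1)) ?_ fun _ => id) ?_
  · rintro τ ⟨h1, h2, h3, h4, h6, r, w, h7, h9, hwr, h5, h8⟩ hb
    simp only [holds_natLt, eval_nv, eval_natAdd, eval_ofNat, h7, h6] at hb
    have e1 : σ.nat cnt 0 - r = (σ.nat cnt 0 - (r + 1 + 1)) + 1 + 1 := by omega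
    rw [e1, seg_cons, seg_cons, pruneL] at h8
    refine Run.simple rfl ?_
    have hr0 := h5 r le_rfl
    have hr1 := h5 (r + 1) (by omega)
    by_cases hcross : (aff X Y lo (σ.nat lst r) - aff X Y lo (σ.nat lst (r + 1))) *
      (aff X Y hi (σ.nat lst r) - aff X Y hi (σ.nat lst (r + 1))) < 0
    · have e : (pruneStep lst).den τ = (((τ.setNat lst w (σ.nat lst r)).setNat lst (w + 1)
          (σ.nat lst (r + 1))).setNat 54 0 (w + 2)).setNat 53 0 (r + 2) := by
        rw [pruneStep, den_seq, den_cond_pos τ (by simpa [gapE, affE, h1, h2, h3, h4, hr0, hr1, h7, aff]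
          using hcross)]
        simp [hr0, hr1, h7, h9, hl53.symm, hl54.symm, show r + 1 ≠ w by omega]
      rw [if_pos hcross] at h8
      rw [e]
      refine ⟨⟨h1, h2, h3, h4, by simpa [hc54, hc53, hcl] using h6, r + 2, w + 2, by simp, by simp,
        by omega, fun i hi => ?_, ?_⟩, ?_⟩
      · simp [hl54, hl53, show i ≠ w by omega, show i ≠ w + 1 by omega, h5 i (by omega)]
      · rw [← h8]
        rw [State.setNat_nat_ne _ _ _ hl53, State.setNat_nat_ne _ _ _ hl54, State.setNat_nat_same,
          State.setNat_nat_same, seg_update, seg_update]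
        simp
      · simp [h7]; omega
    · rw [if_neg hcross] at h8
      obtain ⟨x, hx, e⟩ : ∃ x, (if aff X Y lo (σ.nat lst r) - aff X Y lo (σ.nat lst (r + 1)) +
            (aff X Y hi (σ.nat lst r) - aff X Y hi (σ.nat lst (r + 1))) ≤ 0 then
            σ.nat lst r else σ.nat lst (r + 1)) = x ∧ (pruneStep lst).den τ =
            ((τ.setNat lst w x).setNat 54 0 (w + 1)).setNat 53 0 (r + 2) := by
        by_cases hle : aff X Y lo (σ.nat lst r) - aff X Y lo (σ.nat lst (r + 1)) +
          (aff X Y hi (σ.nat lst r) - aff X Y hi (σ.nat lst (r + 1))) ≤ 0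
        · refine ⟨σ.nat lst r, if_pos hle, ?_⟩
          rw [pruneStep, den_seq, den_cond_neg τ (by simpa [gapE, affE, h1, h2, h3, h4, hr0, hr1, h7, aff]
            using hcross), den_cond_pos τ (by simpa [gapE, affE, h1, h2, h3, h4, hr0, hr1, h7, aff]
            using hle)]
          simp [hr0, h7, h9, hl53.symm, hl54.symm]
        · refine ⟨σ.nat lst (r + 1), if_neg hle, ?_⟩
          rw [pruneStep, den_seq, den_cond_neg τ (by simpa [gapE, affE, h1, h2, h3, h4, hr0, hr1, h7, aff]
            using hcross), den_cond_neg τ (by simpa [gapE, affE, h1, h2, h3, h4, hr0, hr1, h7, aff]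
            using hle)]
          simp [hr1, h7, h9, hl53.symm, hl54.symm]
      rw [e]
      refine ⟨⟨h1, h2, h3, h4, by simpa [hc54, hc53, hcl] using h6, r + 2, w + 1, by simp, by simp,
        by omega, fun i hi => ?_, ?_⟩, ?_⟩
      · simp [hl54, hl53, show i ≠ w by omega, h5 i (by omega)]
      · rw [← h8]
        rw [State.setNat_nat_ne _ _ _ hl53, State.setNat_nat_ne _ _ _ hl54, State.setNat_nat_same,
          seg_update, List.append_assoc]
        congr 1
        rw [← hx]
        split_ifs <;> rfl
      · simp [h7]; omega
  · exact ⟨by simpa using hX, by simpa using hY, by simpa using hlo, by simpa using hhi,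
      by simp [hc53, hc54], 0, 0, by simp, by simp, le_rfl, by simp [hl53, hl54], by simp [hl]⟩
  · exact Nat.mul_le_mul_left _ (by omega)
  · rintro τ ⟨⟨h1, h2, h3, h4, h6, r, w, h7, h9, hwr, h5, h8⟩, hb⟩
    simp only [holds_natLt, eval_nv, eval_natAdd, eval_ofNat, h7, h6] at hb
    refine Run.simpleL rfl (Nat.succ_pos _) ?_
    by_cases hr : r < σ.nat cnt 0
    · rw [show σ.nat cnt 0 - r = 1 by omega, seg_cons, seg_zero, pruneL] at h8
      · have e : (pruneEnd lst cnt).den τ = ((τ.setNat lst w (σ.nat lst r)).setNat 54 0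
          (w + 1)).setNat cnt 0 (w + 1) := by
          rw [pruneEnd, den_seq, den_cond_pos τ (by simpa [h6, h7] using hr)]
          simp [h7, h9, h5 r le_rfl, hl54.symm]
        rw [e, ← h8]
        simp [hcl.symm, hl54, seg_update]
      · simp
    · rw [show σ.nat cnt 0 - r = 0 by omega, seg_zero, pruneL, List.append_nil] at h8
      · rw [pruneEnd, den_seq, den_cond_neg τ (by simpa [h6, h7] using hr), ← h8]
        simp [h9, hcl.symm]
      · simp

end RealRAM


namespace RealRAM

/-! ### Prune and search -/

/-- One round of prune and search: the command `upd` decides on which side of an approximate median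
of the crossings the search continues. -/
def searchStep (upd : Cmd) : Cmd :=
  setN 52 0 ;; (collect 11 12 ;; collect 13 14) ;;
  .cond (.natLt 0 (nv 52)) (approxMedian ;; upd) .skip ;; (prune 11 12 ;; prune 13 14)

def searchTest : BExp := .and (.natLt (nv 17) 1) (.natLt 2 (nv 12 + nv 14))

/-- Prune and search, until the variable `17` is set or at most two functions are left. -/
def search (upd : Cmd) : Cmd := .loop searchTest (searchStep upd)

/-- The current list of functions of the first or second kind. -/
def State.list (σ : State) (lst cnt : ℕ) : List ℕ := seg (σ.nat lst) 0 (σ.nat cnt 0)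

/-- Between `lo` and `hi`, the minimum over the list `l` is the minimum over the set `S`. -/
structure Represents (X Y : ℕ → ℝ) (S : Set ℕ) (lo hi : ℝ) (l : List ℕ) : Prop where
  sub : ∀ j ∈ l, j ∈ S
  dom : ∀ j ∈ S, ∃ k ∈ l, ∀ x, lo ≤ x → x ≤ hi → aff X Y x k ≤ aff X Y x j

theorem Represents.prune {X Y : ℕ → ℝ} {S : Set ℕ} {lo hi lo' hi' : ℝ} {l : List ℕ}
    (h : Represents X Y S lo hi l) (h1 : lo ≤ lo') (h2 : hi' ≤ hi) :
    Represents X Y S lo' hi' (pruneL X Y lo' hi' l) := by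
  refine ⟨fun j hj => h.sub j (pruneL_subset _ _ _ hj), fun j hj => ?_⟩
  obtain ⟨k, hk, h3⟩ := h.dom j hj
  obtain ⟨m, hm, h4⟩ := pruneL_dominates (X := X) (Y := Y) (lo := lo') (hi := hi') l k hk
  exact ⟨m, hm, fun x hx hx' => (h4 x hx hx').trans (h3 x (h1.trans hx) (hx'.trans h2))⟩

/-- Between the bounds in the real cells 26 and 27, the two working lists still have the same
pointwise minima as the whole families `L` and `U`. -/
structure Active (X Y : ℕ → ℝ) (L U : Set ℕ) (σ : State) : Prop where
  coeff : σ.real 20 = X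
  slope : σ.real 21 = Y
  lt : σ.real 26 0 < σ.real 27 0
  repL : Represents X Y L (σ.real 26 0) (σ.real 27 0) (σ.list 11 12)
  repU : Represents X Y U (σ.real 26 0) (σ.real 27 0) (σ.list 13 14)

/-- The arrays of naturals changed by a round of prune and search, except by `upd`. -/
abbrev searchN : List ℕ :=
  [11, 12, 13, 14, 40, 41, 42, 43, 44, 45, 46, 47, 48, 49, 50, 51, 52, 53, 54]
abbrev searchR : List ℕ := [28, 30, 31]

/-- The property does not depend on the arrays changed by a round of prune and search. -/
def Stable (E : State → Prop) : Prop := ∀ σ τ, Frame searchN searchR σ τ → E σ → E τ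

theorem Frame.weaken {N N' R R' : List ℕ} {σ τ : State} (h : Frame N R σ τ) (hN : N ⊆ N')
    (hR : R ⊆ R') : Frame N' R' σ τ :=
  ⟨fun b hb => h.1 b fun h' => hb (hN h'), fun b hb => h.2 b fun h' => hb (hR h')⟩

theorem Frame.trans {N R : List ℕ} {σ τ ρ : State} (h : Frame N R σ τ) (h' : Frame N R τ ρ) :
    Frame N R σ ρ :=
  ⟨fun b hb => (h'.1 b hb).trans (h.1 b hb), fun b hb => (h'.2 b hb).trans (h.2 b hb)⟩

/-- The command `upd` decides about the point `v`: it stops the search with the property `F`, or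
it replaces one of the bounds by `v` and keeps the property `E`. -/
structure Updates (upd : Cmd) (X Y : ℕ → ℝ) (L U : Set ℕ) (E F : State → Prop) (C : ℕ) : Prop where
  natW : ∀ b ∈ [11, 12, 13, 14], b ∉ upd.natW
  realW : ∀ b ∈ [20, 21, 28], b ∉ upd.realW
  stableE : Stable E
  stableF : Stable F
  run : ∀ σ, Active X Y L U σ → E σ → σ.nat 17 0 = 0 → σ.real 26 0 < σ.real 28 0 →
    σ.real 28 0 < σ.real 27 0 → Run upd σ (C * (σ.nat 12 0 + σ.nat 14 0 + 1))
      (fun τ => (τ.nat 17 0 = 1 ∧ F τ ∧ τ.real 26 0 = σ.real 26 0 ∧ τ.real 27 0 = σ.real 27 0) ∨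
        (τ.nat 17 0 = 0 ∧ E τ ∧
        ((τ.real 26 0 = σ.real 28 0 ∧ τ.real 27 0 = σ.real 27 0) ∨
          (τ.real 26 0 = σ.real 26 0 ∧ τ.real 27 0 = σ.real 28 0))))

theorem length_crits_le (X Y : ℕ → ℝ) (lo hi : ℝ) : ∀ l, (crits X Y lo hi l).length ≤ l.length / 2
  | [] => by simp [crits]
  | [_] => by simp [crits]
  | j :: k :: l => by
    have ih := length_crits_le X Y lo hi l
    rw [crits]
    split_ifs <;> simp only [List.length_cons] <;> omega

theorem prunes_run : ∃ C, ∀ (σ : State) (X Y : ℕ → ℝ) (lo hi : ℝ),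
    σ.real 20 = X → σ.real 21 = Y → σ.real 26 0 = lo → σ.real 27 0 = hi →
    Run (prune 11 12 ;; prune 13 14) σ (C * ((σ.list 11 12).length + (σ.list 13 14).length + 1))
      (fun τ => τ.list 11 12 = pruneL X Y lo hi (σ.list 11 12) ∧
        τ.list 13 14 = pruneL X Y lo hi (σ.list 13 14)) := by
  obtain ⟨C, hL⟩ := prune_run (lst := 11) (cnt := 12) (Or.inl ⟨rfl, rfl⟩)
  obtain ⟨C', hU⟩ := prune_run (lst := 13) (cnt := 14) (Or.inr ⟨rfl, rfl⟩)
  apply Exists.intro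
  intro σ X Y lo hi hX hY hlo hhi
  apply Run.seqL (((hL σ X Y _ lo hi hX hY hlo hhi rfl).mono
    (Nat.mul_le_mul_left _ (by simp only [State.list]; omega)) fun _ => id).frame)
  rintro τ ⟨h1, hf⟩
  have e1 : τ.list 13 14 = σ.list 13 14 := by
    simp only [State.list]; rw [hf.1 13 (by decide), hf.1 14 (by decide)]
  refine ((hU τ X Y _ lo hi ?_ ?_ ?_ ?_ rfl).mono (Nat.mul_le_mul_left _ ?_) fun _ => id).frame.mono
    le_rfl ?_
  · rw [hf.2 20 (by decide), hX]
  · rw [hf.2 21 (by decide), hY]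
  · rw [hf.2 26 (by decide), hlo]
  · rw [hf.2 27 (by decide), hhi]
  · show (τ.list 13 14).length + 1 ≤ _
    rw [e1]
    omega
  · rintro ρ ⟨h2, hg⟩
    refine ⟨?_, ?_⟩
    · refine Eq.trans ?_ h1
      simp only [State.list]
      rw [hg.1 11 (by decide), hg.1 12 (by decide)]
    · rw [← e1]
      exact h2

theorem collects_run : ∃ C, ∀ (σ : State) (X Y : ℕ → ℝ) (lo hi : ℝ),
    σ.real 20 = X → σ.real 21 = Y → σ.real 26 0 = lo → σ.real 27 0 = hi → σ.nat 52 0 = 0 →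
    Run (collect 11 12 ;; collect 13 14) σ
      (C * ((σ.list 11 12).length + (σ.list 13 14).length + 1))
      (fun τ => seg (τ.real 30) 0 (τ.nat 52 0) =
        crits X Y lo hi (σ.list 11 12) ++ crits X Y lo hi (σ.list 13 14)) := by
  obtain ⟨C, hL⟩ := collect_run (lst := 11) (cnt := 12) (Or.inl ⟨rfl, rfl⟩)
  obtain ⟨C', hU⟩ := collect_run (lst := 13) (cnt := 14) (Or.inr ⟨rfl, rfl⟩)
  apply Exists.intro
  intro σ X Y lo hi hX hY hlo hhi hK
  apply Run.seqL (((hL σ X Y _ lo hi [] hX hY hlo hhi rfl (by rw [hK]; rfl)).mono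
    (Nat.mul_le_mul_left _ (by simp only [State.list]; omega)) fun _ => id).frame)
  rintro τ ⟨h1, hf⟩
  have e1 : τ.list 13 14 = σ.list 13 14 := by
    simp only [State.list]; rw [hf.1 13 (by decide), hf.1 14 (by decide)]
  refine ((hU τ X Y _ lo hi _ ?_ ?_ ?_ ?_ rfl h1).mono (Nat.mul_le_mul_left _ ?_) fun _ => id).mono
    le_rfl ?_
  · rw [hf.2 20 (by decide), hX]
  · rw [hf.2 21 (by decide), hY]
  · rw [hf.2 26 (by decide), hlo]
  · rw [hf.2 27 (by decide), hhi]
  · show (τ.list 13 14).length + 1 ≤ _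
    rw [e1]
    omega
  · rintro ρ h2
    rw [h2, ← e1]
    rfl

/-- Every pair that does not cross between the bounds loses a member. Of the crossing pairs, at
least one sixteenth have their crossing on the discarded side of the approximate median and lose a
member too. So at least a sixteenth of all pairs shrink, whatever the number of crossings. -/
theorem searchStep_run {upd : Cmd} : ∃ D, ∀ (C : ℕ) (X Y : ℕ → ℝ) (L U : Set ℕ)
    (E F : State → Prop) (_ : Updates upd X Y L U E F C) (σ : State), Active X Y L U σ → E σ →
    σ.nat 17 0 = 0 → 2 < σ.nat 12 0 + σ.nat 14 0 →
    Run (searchStep upd) σ ((D + C) * (σ.nat 12 0 + σ.nat 14 0 + 1))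
      (fun τ => τ.nat 12 0 + τ.nat 14 0 ≤ σ.nat 12 0 + σ.nat 14 0 ∧ ((τ.nat 17 0 = 1 ∧ F τ) ∨
        (τ.nat 17 0 = 0 ∧ E τ ∧ Active X Y L U τ ∧ σ.nat 12 0 + σ.nat 14 0 +
          96 * (τ.nat 12 0 + τ.nat 14 0) ≤ 96 * (σ.nat 12 0 + σ.nat 14 0)))) := by
  obtain ⟨C1, hcollect⟩ := collects_run
  obtain ⟨C2, hmedian⟩ := approxMedian_run
  obtain ⟨C3, hprune⟩ := prunes_run
  refine ⟨(setN 52 0).bound + (C1 + (((BExp.natLt 0 (nv 52)).cost + 1 + (C2 + Cmd.bound .skip)) +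
    C3)), ?_⟩
  intro C X Y L U E F hupd σ hσ hE h17 hcard
  set a := σ.nat 12 0 + σ.nat 14 0 with ha
  have hlenL : (σ.list 11 12).length = σ.nat 12 0 := by simp [State.list]
  have hlenU : (σ.list 13 14).length = σ.nat 14 0 := by simp [State.list]
  rw [show (setN 52 0).bound + (C1 + (((BExp.natLt 0 (nv 52)).cost + 1 + (C2 + Cmd.bound .skip)) +
    C3)) + C = (setN 52 0).bound + (C1 + (((BExp.natLt 0 (nv 52)).cost + 1 +
      ((C2 + C) + Cmd.bound .skip)) + C3)) by ring]
  refine Run.seqL (Run.simpleL rfl (Nat.succ_pos _) rfl) ?_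
  rintro τ rfl
  set σ0 := (setN 52 0).den σ
  have hτ : ∀ b, b ∉ [52] → σ0.nat b = σ.nat b := fun b hb => by
    simp only [σ0, den_setN]
    exact State.setNat_nat_ne _ _ _ (by simpa using hb)
  have hτr : σ0.real = σ.real := rfl
  have hl0 : σ0.list 11 12 = σ.list 11 12 ∧ σ0.list 13 14 = σ.list 13 14 := by
    simp only [State.list]
    rw [hτ 11 (by decide), hτ 12 (by decide), hτ 13 (by decide), hτ 14 (by decide)]
    simp
  set K := crits X Y (σ.real 26 0) (σ.real 27 0) (σ.list 11 12) ++
    crits X Y (σ.real 26 0) (σ.real 27 0) (σ.list 13 14) with hK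
  have hKlen : K.length ≤ σ.nat 12 0 / 2 + σ.nat 14 0 / 2 := by
    rw [hK, List.length_append, ← hlenL, ← hlenU]
    exact Nat.add_le_add (length_crits_le ..) (length_crits_le ..)
  refine Run.seqL (hcollect σ0 X Y _ _ (by rw [hτr, hσ.coeff]) (by rw [hτr, hσ.slope]) rfl rfl
    (by simp [σ0]) |>.mono (by rw [hl0.1, hl0.2, hlenL, hlenU]) fun _ => id).frame ?_
  rintro σ1 ⟨hk1, hf1⟩
  rw [hl0.1, hl0.2, hτr, ← hK] at hk1
  have hn1 : ∀ b, b ∉ [52, 53] → σ1.nat b = σ.nat b := fun b hb => by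
    rw [hf1.1 b (by simp [collect, collectStep, Cmd.natW, setN] at hb ⊢; tauto), hτ b (by
      simp only [List.mem_cons] at hb ⊢; tauto)]
  have hr1 : ∀ b, b ∉ [30] → σ1.real b = σ.real b := fun b hb => by
    rw [hf1.2 b (by simp [collect, collectStep, Cmd.realW, setN] at hb ⊢; tauto), hτr]
  refine Run.seqL (Q := fun τ => τ.list 11 12 = σ.list 11 12 ∧ τ.list 13 14 = σ.list 13 14 ∧
    τ.real 20 = X ∧ τ.real 21 = Y ∧
    ((τ.nat 17 0 = 1 ∧ F τ ∧ τ.real 26 0 = σ.real 26 0 ∧ τ.real 27 0 = σ.real 27 0) ∨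
      (τ.nat 17 0 = 0 ∧ E τ ∧ σ.real 26 0 ≤ τ.real 26 0 ∧ τ.real 26 0 < τ.real 27 0 ∧
      τ.real 27 0 ≤ σ.real 27 0 ∧
      ∃ p : ℝ → Bool, (∀ x, p x → x ≤ τ.real 26 0 ∨ τ.real 27 0 ≤ x) ∧
        K.length ≤ 16 * K.countP p))) (Run.condL (Nat.succ_pos _) ?_ ?_) ?_
  · intro hpos
    simp only [holds_natLt, eval_nv, eval_ofNat] at hpos
    have hk : σ1.nat 52 0 = K.length := by rw [← hk1]; simp
    refine Run.seqL ((hmedian σ1 _ rfl hpos).mono (Nat.mul_le_mul_left _ (by omega))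
      fun _ => id).frame ?_
    rintro σ2 ⟨⟨hv1, hv2⟩, hf2⟩
    rw [hk1] at hv1 hv2
    have hn2 : ∀ b, b ∉ searchN → σ2.nat b = σ.nat b := fun b hb => by
      rw [hf2.1 b (fun h => hb ((by decide : approxMedian.natW ⊆ searchN) h)),
        hn1 b (fun h => hb ((by decide : [52, 53] ⊆ searchN) h))]
    have hn2' : ∀ b ∈ [11, 12, 13, 14], σ2.nat b = σ.nat b := fun b hb => by
      rw [hf2.1 b ((by decide : ∀ b ∈ [11, 12, 13, 14], b ∉ approxMedian.natW) b hb),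
        hn1 b ((by decide : ∀ b ∈ [11, 12, 13, 14], b ∉ [52, 53]) b hb)]
    have hr2 : ∀ b, b ∉ searchR → σ2.real b = σ.real b := fun b hb => by
      rw [hf2.2 b (fun h => hb ((by decide : approxMedian.realW ⊆ searchR) h)),
        hr1 b (fun h => hb ((by decide : [30] ⊆ searchR) h))]
    have hl2 : σ2.list 11 12 = σ.list 11 12 ∧ σ2.list 13 14 = σ.list 13 14 := by
      simp only [State.list]
      rw [hn2' 11 (by decide), hn2' 12 (by decide), hn2' 13 (by decide), hn2' 14 (by decide)]
      simp
    have h26 := congrFun (hr2 26 (by decide)) 0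
    have h27 := congrFun (hr2 27 (by decide)) 0
    have hKm : ∀ x ∈ K, σ.real 26 0 < x ∧ x < σ.real 27 0 := by
      intro x hx
      rcases List.mem_append.1 hx with hx | hx <;> exact crits_mem hσ.lt _ x hx
    have hlo : σ.real 26 0 < σ2.real 28 0 := by
      have : 0 < K.countP (fun x => decide (x ≤ σ2.real 28 0)) := by omega
      obtain ⟨x, hx, hx'⟩ := List.countP_pos_iff.1 this
      exact (hKm x hx).1.trans_le (by simpa using hx')
    have hhi : σ2.real 28 0 < σ.real 27 0 := by
      have : 0 < K.countP (fun x => decide (σ2.real 28 0 ≤ x)) := by omega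
      obtain ⟨x, hx, hx'⟩ := List.countP_pos_iff.1 this
      exact lt_of_le_of_lt (by simpa using hx') (hKm x hx).2
    refine ((hupd.run σ2 ⟨?_, ?_, ?_, ?_, ?_⟩ (hupd.stableE σ σ2 ⟨hn2, hr2⟩ hE) ?_ ?_ ?_).mono
      (Nat.mul_le_mul_left _ ?_) fun _ => id).frame.mono le_rfl ?_
    · rw [hr2 20 (by decide), hσ.coeff]
    · rw [hr2 21 (by decide), hσ.slope]
    · rw [h26, h27]; exact hσ.lt
    · rw [h26, h27, hl2.1]; exact hσ.repL
    · rw [h26, h27, hl2.2]; exact hσ.repU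
    · rw [hn2 17 (by decide), h17]
    · rw [h26]; exact hlo
    · rw [h27]; exact hhi
    · rw [hn2' 12 (by decide), hn2' 14 (by decide)]
    · rintro σ3 ⟨h3, hf3⟩
      rw [h26, h27] at h3
      refine ⟨?_, ?_, ?_, ?_, ?_⟩
      · rw [← hl2.1]
        simp only [State.list]
        rw [hf3.1 11 (hupd.natW 11 (by decide)), hf3.1 12 (hupd.natW 12 (by decide))]
      · rw [← hl2.2]
        simp only [State.list]
        rw [hf3.1 13 (hupd.natW 13 (by decide)), hf3.1 14 (hupd.natW 14 (by decide))]
      · rw [hf3.2 20 (hupd.realW 20 (by decide)), hr2 20 (by decide), hσ.coeff]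
      · rw [hf3.2 21 (hupd.realW 21 (by decide)), hr2 21 (by decide), hσ.slope]
      · rcases h3 with h3 | ⟨h3, h4, ⟨h5, h6⟩ | ⟨h5, h6⟩⟩
        · exact Or.inl h3
        · refine Or.inr ⟨h3, h4, ?_, ?_, ?_, fun x => decide (x ≤ σ2.real 28 0), ?_, ?_⟩
          · rw [h5]; exact hlo.le
          · rw [h5, h6]; exact hhi
          · rw [h6]
          · intro x hx
            rw [h5]
            exact Or.inl (by simpa using hx)
          · rw [← hk]; exact hv1
        · refine Or.inr ⟨h3, h4, ?_, ?_, ?_, fun x => decide (σ2.real 28 0 ≤ x), ?_, ?_⟩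
          · rw [h5]
          · rw [h5, h6]; exact hlo
          · rw [h6]; exact hhi.le
          · intro x hx
            rw [h6]
            exact Or.inr (by simpa using hx)
          · rw [← hk]; exact hv2
  · intro hpos
    simp only [holds_natLt, eval_nv, eval_ofNat] at hpos
    have hk : K = [] := by
      rw [← List.length_eq_zero_iff, ← hk1, length_seg]
      omega
    -- Without crossings the bounds stay as they are, and pruning alone removes a member of every
    -- pair.
    refine Run.simpleL rfl (Nat.succ_pos _) ⟨?_, ?_, ?_, ?_, Or.inr ⟨?_, ?_, ?_, ?_, ?_,
      fun _ => false, ?_, ?_⟩⟩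
    · simp only [den_skip, State.list]
      rw [hn1 11 (by decide), hn1 12 (by decide)]
    · simp only [den_skip, State.list]
      rw [hn1 13 (by decide), hn1 14 (by decide)]
    · rw [den_skip, hr1 20 (by decide), hσ.coeff]
    · rw [den_skip, hr1 21 (by decide), hσ.slope]
    · rw [den_skip, hn1 17 (by decide), h17]
    · exact hupd.stableE σ _ ⟨fun b hb => hn1 b fun h => hb ((by decide : [52, 53] ⊆ searchN) h),
        fun b hb => hr1 b fun h => hb ((by decide : [30] ⊆ searchR) h)⟩ hE
    · rw [den_skip, hr1 26 (by decide)]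
    · rw [den_skip, hr1 26 (by decide), hr1 27 (by decide)]; exact hσ.lt
    · rw [den_skip, hr1 27 (by decide)]
    · simp
    · simp [hk]
  · rintro σ2 ⟨hl1, hl2, hX, hY, h2⟩
    refine ((hprune σ2 X Y _ _ hX hY rfl rfl).mono (Nat.mul_le_mul_left _ ?_)
      fun _ => id).frame.mono le_rfl ?_
    · rw [hl1, hl2, hlenL, hlenU]
    rintro σ3 ⟨⟨hL3, hU3⟩, hf3⟩
    have hf3' : Frame searchN searchR σ2 σ3 := hf3.weaken (by decide) (by decide)
    rw [hl1] at hL3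
    rw [hl2] at hU3
    have hlenL3 : (σ3.list 11 12).length = σ3.nat 12 0 := by simp [State.list]
    have hlenU3 : (σ3.list 13 14).length = σ3.nat 14 0 := by simp [State.list]
    have h26 := congrFun (hf3'.2 26 (by decide)) 0
    have h27 := congrFun (hf3'.2 27 (by decide)) 0
    have hprog : ∀ p : ℝ → Bool, (∀ x, p x → x ≤ σ2.real 26 0 ∨ σ2.real 27 0 ≤ x) →
        σ.real 26 0 ≤ σ2.real 26 0 → σ2.real 26 0 < σ2.real 27 0 →
        σ2.real 27 0 ≤ σ.real 27 0 → σ.nat 12 0 / 2 + σ.nat 14 0 / 2 + K.countP p +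
          (σ3.nat 12 0 + σ3.nat 14 0) ≤ a + K.length := by
      intro p hp h3 h4 h5
      have h6 := pruneL_progress (X := X) (Y := Y) h3 h4.le h5 p hp (σ.list 11 12)
      have h7 := pruneL_progress (X := X) (Y := Y) h3 h4.le h5 p hp (σ.list 13 14)
      rw [← hL3, hlenL, hlenL3] at h6
      rw [← hU3, hlenU, hlenU3] at h7
      rw [hK, List.countP_append, List.length_append]
      omega
    -- Each list leaves at most one function unpaired, and `a` is at least 3. Together with the
    -- factor 16 of the median this gives the factor 96.
    have hP : a ≤ 6 * (σ.nat 12 0 / 2 + σ.nat 14 0 / 2) := by omega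
    rcases h2 with ⟨h3, h4, h5, h6⟩ | ⟨h3, h4, h5, h6, h7, p, hp, hp'⟩
    · refine ⟨?_, Or.inl ⟨by rw [hf3'.1 17 (by decide), h3], hupd.stableF _ _ hf3' h4⟩⟩
      have := hprog (fun _ => false) (by simp) h5.ge (by rw [h5, h6]; exact hσ.lt) h6.le
      omega
    · have := hprog p hp h5 h6 h7
      refine ⟨by omega, Or.inr ⟨by rw [hf3'.1 17 (by decide), h3], hupd.stableE _ _ hf3' h4,
        ⟨?_, ?_, ?_, ?_, ?_⟩, by omega⟩⟩
      · rw [hf3'.2 20 (by decide), hX]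
      · rw [hf3'.2 21 (by decide), hY]
      · rw [h26, h27]; exact h6
      · rw [h26, h27, hL3]; exact hσ.repL.prune h5 h7
      · rw [h26, h27, hU3]; exact hσ.repU.prune h5 h7

/-- Each undecided round removes at least the fraction 1 / 96 of the remaining functions, while its
time is linear in their number. A potential proportional to that number, with 96 times the cost per
function as the factor, pays for all rounds. -/
theorem search_run {upd : Cmd} : ∃ D, ∀ (C : ℕ) (X Y : ℕ → ℝ) (L U : Set ℕ)
    (E F : State → Prop) (_ : Updates upd X Y L U E F C) (σ : State), Active X Y L U σ → E σ →
    σ.nat 17 0 = 0 →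
    Run (search upd) σ ((D + D * C) * (σ.nat 12 0 + σ.nat 14 0 + 1))
      (fun τ => (τ.nat 17 0 = 1 ∧ F τ) ∨
        (τ.nat 17 0 = 0 ∧ E τ ∧ Active X Y L U τ ∧ τ.nat 12 0 + τ.nat 14 0 ≤ 2)) := by
  obtain ⟨D, hstep⟩ := searchStep_run (upd := upd)
  obtain ⟨B, hB⟩ : ∃ B, searchTest.cost + 1 = B := ⟨_, rfl⟩
  refine ⟨96 * (2 * D + B + 2), fun C X Y L U E F hupd σ hσ hE h17 => ?_⟩
  set W := 96 * (2 * (D + C) + B)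
  refine (Run.loop (fun τ => (τ.nat 17 0 = 1 ∧ F τ) ∨ (τ.nat 17 0 = 0 ∧ E τ ∧ Active X Y L U τ))
    (fun τ => if τ.nat 17 0 = 0 then W * (τ.nat 12 0 + τ.nat 14 0) else 0)
    (fun τ => (D + C) * (τ.nat 12 0 + τ.nat 14 0 + 1)) ?_ (Or.inr ⟨h17, hE, hσ⟩)).mono ?_ ?_
  · rintro τ h hb
    simp only [searchTest, holds_and, holds_natLt, eval_nv, eval_ofNat, eval_natAdd] at hb
    obtain ⟨h1, h2, h3⟩ := h.resolve_left (by omega)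
    refine (hstep C X Y L U E F hupd τ h3 h2 h1 hb.2).mono le_rfl ?_
    rintro ρ ⟨h4, h5⟩
    rw [hB, if_pos h1]
    set a := τ.nat 12 0 + τ.nat 14 0
    set b := ρ.nat 12 0 + ρ.nat 14 0
    have hbase : (D + C) * (a + 1) + B ≤ (2 * (D + C) + B) * a := by
      have h6 : 1 ≤ a := by omega
      have := Nat.mul_le_mul_left (D + C) h6
      have := Nat.mul_le_mul_left B h6
      nlinarith
    rcases h5 with ⟨h5, h6⟩ | ⟨h5, h6, h7, h8⟩
    · refine ⟨Or.inl ⟨h5, h6⟩, ?_⟩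
      rw [if_neg (by omega)]
      simp only [W]
      nlinarith [Nat.zero_le ((2 * (D + C) + B) * a)]
    · refine ⟨Or.inr ⟨h5, h6, h7⟩, ?_⟩
      rw [if_pos h5]
      have := Nat.mul_le_mul_left (2 * (D + C) + B) h8
      simp only [W]
      nlinarith
  · rw [if_pos h17, hB]
    simp only [W]
    have := Nat.zero_le (C * B)
    have := Nat.zero_le (C * D)
    nlinarith [Nat.zero_le ((σ.nat 12 0 + σ.nat 14 0) * (C * B)),
      Nat.zero_le ((σ.nat 12 0 + σ.nat 14 0) * (C * D)), Nat.zero_le (σ.nat 12 0 + σ.nat 14 0)]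
  · rintro τ ⟨h | ⟨h1, h2, h3⟩, hb⟩
    · exact Or.inl h
    · refine Or.inr ⟨h1, h2, h3, ?_⟩
      simp only [searchTest, holds_and, holds_natLt, eval_nv, eval_ofNat, eval_natAdd] at hb
      omega

end RealRAM


namespace RealRAM

/-! ### Coordinates with respect to a basis -/

/-- The inner product of the normal number `j` with the vector in the cells `0` of the real arrays
`b`, `b + 1`, `b + 2`. -/
noncomputable def State.dot (σ : State) (b j : ℕ) : ℝ :=
  σ.real 0 j * σ.real b 0 + σ.real 1 j * σ.real (b + 1) 0 + σ.real 2 j * σ.real (b + 2) 0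

def dotE (b : ℕ) (j : NExp) : RExp :=
  .get 0 j * rv b + .get 1 j * rv (b + 1) + .get 2 j * rv (b + 2)

@[simp] theorem eval_dotE (σ : State) (b : ℕ) (j : NExp) :
    (dotE b j).eval σ = σ.dot b (j.eval σ) := rfl

/-- Division by the absolute value of the product with the first basis vector, which is kept in
array 16, brings a constraint into the form ±y + X a + Y b ≥ 0. -/
def setupStep : Cmd :=
  .setReal 16 (nv 55) (dotE 7 (nv 55)) ;;
  .cond (.realLt 0 (.get 16 (nv 55))) .skip (.setReal 16 (nv 55) (0 - .get 16 (nv 55))) ;;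
  .setReal 20 (nv 55) (dotE 10 (nv 55) / .get 16 (nv 55)) ;;
  .setReal 21 (nv 55) (dotE 13 (nv 55) / .get 16 (nv 55))

/-- Constraints orthogonal to the first basis vector enter neither list. In `lp` a generic vector
rules them out; for the polygon of directions they are the constraints tight at the apex, which
`clip` treats. -/
def setupLists : Cmd :=
  .cond (.natNe (nv 55) (nv 10))
    (.cond (.realLt 0 (dotE 7 (nv 55)))
      (.setNat 11 (nv 12) (nv 55) ;; setN 12 (nv 12 + 1))
      (.cond (.realLt (dotE 7 (nv 55)) 0)
        (.setNat 13 (nv 14) (nv 55) ;; setN 14 (nv 14 + 1)) .skip)) .skip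

/-- Compute the coefficients of all constraints with respect to the basis in the arrays `7` to `15`
and the lists of the lower and of the upper constraints, without the constraint number `nv 10`. -/
def setup : Cmd := (setN 12 0 ;; setN 14 0) ;; forN 55 (nv 0) (setupStep ;; setupLists)

/-- The result of `setup` for the constraints with number less than `k`. -/
structure Coords (k : ℕ) (σ : State) : Prop where
  coeff : ∀ j < k, σ.real 20 j = σ.dot 10 j / |σ.dot 7 j|
  slope : ∀ j < k, σ.real 21 j = σ.dot 13 j / |σ.dot 7 j|
  listL : ∀ j, j ∈ σ.list 11 12 ↔ j < k ∧ j ≠ σ.nat 10 0 ∧ 0 < σ.dot 7 j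
  listU : ∀ j, j ∈ σ.list 13 14 ↔ j < k ∧ j ≠ σ.nat 10 0 ∧ σ.dot 7 j < 0
  card : σ.nat 12 0 + σ.nat 14 0 ≤ k

theorem Coords.congr {k : ℕ} {σ τ : State} (h : Coords k σ) (hX : ∀ j < k, τ.real 20 j = σ.real 20 j)
    (hY : ∀ j < k, τ.real 21 j = σ.real 21 j) (hd : ∀ b ∈ [7, 10, 13], ∀ j, τ.dot b j = σ.dot b j)
    (h10 : τ.nat 10 0 = σ.nat 10 0) (hL : τ.list 11 12 = σ.list 11 12)
    (hU : τ.list 13 14 = σ.list 13 14) : Coords k τ := by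
  have h7 := hd 7 (by simp)
  refine ⟨fun j hj => ?_, fun j hj => ?_, fun j => ?_, fun j => ?_, ?_⟩
  · rw [hX j hj, h7, hd 10 (by simp)]; exact h.coeff j hj
  · rw [hY j hj, h7, hd 13 (by simp)]; exact h.slope j hj
  · rw [hL, h7, h10]; exact h.listL j
  · rw [hU, h7, h10]; exact h.listU j
  · have h1 := congrArg List.length hL
    have h2 := congrArg List.length hU
    simp only [State.list, length_seg] at h1 h2
    rw [h1, h2]; exact h.card

theorem setupStep_den {σ : State} {k : ℕ} (hk : σ.nat 55 0 = k) : ∃ x : State, setupStep.den σ =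
    ((x.setReal 20 k (σ.dot 10 k / |σ.dot 7 k|)).setReal 21 k (σ.dot 13 k / |σ.dot 7 k|)) ∧
      x.nat = σ.nat ∧ ∀ b, b ≠ 16 → x.real b = σ.real b := by
  by_cases h : 0 < σ.dot 7 k
  · refine ⟨σ.setReal 16 k (σ.dot 7 k), ?_, rfl, fun b hb => State.setReal_real_ne _ _ _ hb⟩
    rw [setupStep, den_seq, den_seq, den_cond_pos _ (by simpa [hk] using h)]
    simp only [den_skip, den_seq, den_setReal, eval_nv, hk, eval_dotE, eval_realDiv, eval_realGet,
      abs_of_pos h]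
    simp [State.dot, hk]
  · refine ⟨(σ.setReal 16 k (σ.dot 7 k)).setReal 16 k (0 - σ.dot 7 k), ?_, rfl, fun b hb => ?_⟩
    · rw [setupStep, den_seq, den_seq, den_cond_neg _ (by simpa [hk] using h)]
      simp only [den_seq, den_setReal, eval_nv, hk, eval_dotE, eval_realDiv, eval_realGet,
        abs_of_nonpos (not_lt.1 h)]
      simp [State.dot, hk]
    · rw [State.setReal_real_ne _ _ _ hb, State.setReal_real_ne _ _ _ hb]

theorem list_push {σ τ : State} {lst cnt x : ℕ} (hc : τ.nat cnt 0 = σ.nat cnt 0 + 1)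
    (hl : τ.nat lst = Function.update (σ.nat lst) (σ.nat cnt 0) x) :
    τ.list lst cnt = σ.list lst cnt ++ [x] := by
  rw [State.list, hc, hl, seg_update]
  rfl

theorem setupLists_coords {σ : State} {k : ℕ} (hk : σ.nat 55 0 = k)
    (hX : σ.real 20 k = σ.dot 10 k / |σ.dot 7 k|)
    (hY : σ.real 21 k = σ.dot 13 k / |σ.dot 7 k|) (h : Coords k σ) :
    Coords (k + 1) (setupLists.den σ) := by
  have hmem : ∀ {P : ℕ → Prop} {l : List ℕ}, (∀ j, j ∈ l ↔ j < k ∧ P j) →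
      (¬ P k → ∀ j, j ∈ l ↔ j < k + 1 ∧ P j) ∧ (P k → ∀ j, j ∈ l ++ [k] ↔ j < k + 1 ∧ P j) := by
    intro P l hl
    refine ⟨fun hP j => ?_, fun hP j => ?_⟩
    · rw [hl, Nat.lt_succ_iff_lt_or_eq]
      constructor
      · exact fun h => ⟨Or.inl h.1, h.2⟩
      · rintro ⟨h | rfl, h'⟩
        · exact ⟨h, h'⟩
        · exact absurd h' hP
    · rw [List.mem_append, hl, Nat.lt_succ_iff_lt_or_eq, List.mem_singleton]
      constructor
      · rintro (h | rfl)
        · exact ⟨Or.inl h.1, h.2⟩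
        · exact ⟨Or.inr rfl, hP⟩
      · rintro ⟨h | rfl, h'⟩
        · exact Or.inl ⟨h, h'⟩
        · exact Or.inr rfl
  have hcoeff : ∀ j < k + 1, σ.real 20 j = σ.dot 10 j / |σ.dot 7 j| := fun j hj => by
    rcases Nat.lt_succ_iff_lt_or_eq.1 hj with hj | rfl
    exacts [h.coeff j hj, hX]
  have hslope : ∀ j < k + 1, σ.real 21 j = σ.dot 13 j / |σ.dot 7 j| := fun j hj => by
    rcases Nat.lt_succ_iff_lt_or_eq.1 hj with hj | rfl
    exacts [h.slope j hj, hY]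
  have hcard := h.card
  by_cases hs : k ≠ σ.nat 10 0
  · rcases lt_trichotomy (σ.dot 7 k) 0 with hw | hw | hw
    · have e : setupLists.den σ = (σ.setNat 13 (σ.nat 14 0) k).setNat 14 0 (σ.nat 14 0 + 1) := by
        rw [setupLists, den_cond_pos _ (by simpa [hk] using hs),
          den_cond_neg _ (by simpa [hk] using hw.le), den_cond_pos _ (by simpa [hk] using hw)]
        simp [hk]
      rw [e]
      have hU := list_push (σ := σ) (τ := (σ.setNat 13 (σ.nat 14 0) k).setNat 14 0 (σ.nat 14 0 + 1))
        (lst := 13) (cnt := 14) (x := k) (by simp) (by simp)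
      refine ⟨hcoeff, hslope, fun j => ?_, fun j => ?_, by simp; omega⟩
      · exact (hmem h.listL).1 (by simp [hw.le]) j
      · rw [hU]
        exact (hmem h.listU).2 ⟨hs, hw⟩ j
    · have e : setupLists.den σ = σ := by
        rw [setupLists, den_cond_pos _ (by simpa [hk] using hs),
          den_cond_neg _ (by simp [hk, hw]), den_cond_neg _ (by simp [hk, hw])]
        rfl
      rw [e]
      exact ⟨hcoeff, hslope, (hmem h.listL).1 (by simp [hw]), (hmem h.listU).1 (by simp [hw]),
        by omega⟩
    · have e : setupLists.den σ = (σ.setNat 11 (σ.nat 12 0) k).setNat 12 0 (σ.nat 12 0 + 1) := by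
        rw [setupLists, den_cond_pos _ (by simpa [hk] using hs),
          den_cond_pos _ (by simpa [hk] using hw)]
        simp [hk]
      rw [e]
      have hL := list_push (σ := σ) (τ := (σ.setNat 11 (σ.nat 12 0) k).setNat 12 0 (σ.nat 12 0 + 1))
        (lst := 11) (cnt := 12) (x := k) (by simp) (by simp)
      refine ⟨hcoeff, hslope, fun j => ?_, fun j => ?_, by simp; omega⟩
      · rw [hL]
        exact (hmem h.listL).2 ⟨hs, hw⟩ j
      · exact (hmem h.listU).1 (by simp [hw.le]) j
  · have e : setupLists.den σ = σ := by
      rw [setupLists, den_cond_neg _ (by simpa [hk] using hs)]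
      rfl
    rw [e]
    exact ⟨hcoeff, hslope, (hmem h.listL).1 (by simp [hs]), (hmem h.listU).1 (by simp [hs]),
      by omega⟩

theorem setup_run : ∃ C, ∀ (σ : State) (n : ℕ), σ.nat 0 0 = n →
    Run setup σ (C * (n + 1)) (Coords n) := by
  apply Exists.intro
  intro σ n hn
  apply Run.seqL (Run.simpleL rfl (Nat.succ_pos _) rfl)
  rintro τ rfl
  refine (Run.forN_simple rfl (fun k τ => τ.nat 55 0 = k ∧ τ.nat 0 0 = n ∧ Coords k τ) n ?_ ?_
    ?_).mono le_rfl fun τ h => h.2.2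
  · exact ⟨by simp, by simpa using hn, ⟨by simp, by simp, by simp [State.list],
      by simp [State.list], by simp⟩⟩
  · exact fun i τ h => ⟨h.1, h.2.1⟩
  · rintro k τ hk ⟨h1, h2, h3⟩
    obtain ⟨x, e, hx, hx'⟩ := setupStep_den h1
    set ρ := setupStep.den τ with hρ
    have hρn : ρ.nat = τ.nat := by rw [e]; exact hx
    have hρr : ∀ b, b ∉ [16, 20, 21] → ρ.real b = τ.real b := fun b hb => by
      simp only [List.mem_cons, List.not_mem_nil, or_false, not_or] at hb
      rw [e, State.setReal_real_ne _ _ _ hb.2.2, State.setReal_real_ne _ _ _ hb.2.1, hx' b hb.1]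
    have hdot : ∀ b ∈ [7, 10, 13], ∀ j, ρ.dot b j = τ.dot b j := by
      intro b hb j
      simp only [List.mem_cons, List.not_mem_nil, or_false] at hb
      rcases hb with rfl | rfl | rfl <;> simp only [State.dot] <;> repeat rw [hρr _ (by decide)]
    have hX : ρ.real 20 = Function.update (τ.real 20) k (τ.dot 10 k / |τ.dot 7 k|) := by
      rw [e, State.setReal_real_ne _ _ _ (by decide), State.setReal_real_same, hx' _ (by decide)]
    have hY : ρ.real 21 = Function.update (τ.real 21) k (τ.dot 13 k / |τ.dot 7 k|) := by
      rw [e, State.setReal_real_same, State.setReal_real_ne _ _ _ (by decide), hx' _ (by decide)]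
    have h4 : Coords k ρ := by
      refine h3.congr ?_ ?_ hdot (by rw [hρn]) (by simp only [State.list, hρn])
        (by simp only [State.list, hρn])
      · intro j hj; rw [hX, Function.update_of_ne (by omega)]
      · intro j hj; rw [hY, Function.update_of_ne (by omega)]
    have h5 := setupLists_coords (σ := ρ) (k := k) (by rw [hρn, h1])
      (by rw [hX, hdot 10 (by simp), hdot 7 (by simp)]; simp)
      (by rw [hY, hdot 13 (by simp), hdot 7 (by simp)]; simp) h4
    have hf : ∀ b, b ∉ [11, 12, 13, 14] → (setupLists.den ρ).nat b = τ.nat b := by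
      intro b hb
      obtain ⟨t, -, he⟩ := Exec.of_simple [] (c := setupLists) rfl ρ
      rw [he.frame.1 b (fun h => hb ((by decide : setupLists.natW ⊆ [11, 12, 13, 14]) h)), hρn]
    simp only [den_seq, ← hρ]
    rw [hf 55 (by decide), h1]
    refine ⟨by simp, by simp [hf 0 (by decide), h2], ?_⟩
    exact h5.congr (by simp) (by simp) (by simp [State.dot]) (by simp) (by simp [State.list])
      (by simp [State.list])

end RealRAM


namespace RealRAM

/-! ### Minima of linear functions -/

/-- The linear function number `j` at the point `(nv 22, nv 23)`. -/
noncomputable def State.comb (σ : State) (j : ℕ) : ℝ :=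
  σ.real 20 j * σ.real 22 0 + σ.real 21 j * σ.real 23 0

def combE (i : NExp) : RExp := .get 20 i * rv 22 + .get 21 i * rv 23

@[simp] theorem eval_combE (σ : State) (i : NExp) : (combE i).eval σ = σ.comb (i.eval σ) := rfl

def argminStep (lst out val : ℕ) : Cmd :=
  .cond (.realLt (combE (.get lst (nv 56))) (rv val))
    (setN out (.get lst (nv 56)) ;; setR val (combE (.get lst (nv 56)))) .skip

/-- The minimum `val` of the linear functions in a list, and the number `out` of a function where
it is attained. -/
def argmin (lst cnt out val : ℕ) : Cmd :=
  (setN out (.get lst 0) ;; setR val (combE (.get lst 0))) ;;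
  forN 56 (nv cnt) (argminStep lst out val)

theorem argmin_run {lst cnt out val : ℕ} (hlst : (lst = 11 ∧ cnt = 12 ∧ out = 15 ∧ val = 24) ∨
    (lst = 13 ∧ cnt = 14 ∧ out = 16 ∧ val = 25)) : ∃ C, ∀ (σ : State), 0 < σ.nat cnt 0 →
    Run (argmin lst cnt out val) σ (C * (σ.nat cnt 0 + 1)) (fun τ =>
      τ.nat out 0 ∈ σ.list lst cnt ∧ τ.real val 0 = σ.comb (τ.nat out 0) ∧
        ∀ j ∈ σ.list lst cnt, τ.real val 0 ≤ σ.comb j) := by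
  have h1 : lst ≠ 56 ∧ cnt ≠ 56 ∧ lst ≠ out ∧ cnt ≠ out ∧ 56 ≠ out ∧ out ≠ 56 := by
    rcases hlst with h | h <;> omega
  have h2 : 20 ≠ val ∧ 21 ≠ val ∧ 22 ≠ val ∧ 23 ≠ val := by rcases hlst with h | h <;> omega
  apply Exists.intro
  intro σ hpos
  apply Run.seqL (Run.simpleL rfl (Nat.succ_pos _) rfl)
  rintro τ rfl
  refine (Run.forN_simple rfl (fun k τ => τ.nat 56 0 = k ∧ τ.nat cnt = σ.nat cnt ∧
    τ.nat lst = σ.nat lst ∧ τ.comb = σ.comb ∧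
    τ.nat out 0 ∈ σ.list lst cnt ∧ τ.real val 0 = σ.comb (τ.nat out 0) ∧
      ∀ i < k, τ.real val 0 ≤ σ.comb (σ.nat lst i)) (σ.nat cnt 0) ?_ ?_ ?_).mono le_rfl ?_
  · refine ⟨by simp, by simp [h1], by simp [h1], ?_, ?_, ?_, by simp⟩
    · funext j; simp [State.comb, h1, h2]
    · simp only [den_seq, den_setN, den_setR, State.list]
      rw [State.setNat_nat_ne _ _ _ h1.2.2.2.2.2]
      exact (mem_seg _).2 ⟨0, hpos, by simp⟩
    · simp [State.comb, h1]
  · exact fun i τ h => ⟨h.1, by simp [h.2.1]⟩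
  · rintro k τ hk ⟨h3, h4, h5, h6, h7, h8, h9⟩
    by_cases hlt : σ.comb (σ.nat lst k) < τ.real val 0
    · rw [argminStep, den_cond_pos _ (by simpa [h3, h5, h6] using hlt)]
      simp only [den_seq, den_setN, den_setR, eval_natGet, eval_nv, h3, h5, eval_combE]
      have e : (τ.setNat out 0 (σ.nat lst k)).comb = σ.comb := by rw [← h6]; rfl
      have e' : (τ.setNat out 0 (σ.nat lst k)).nat lst = σ.nat lst := by simp [h1, h5]
      have e'' : (τ.setNat out 0 (σ.nat lst k)).nat 56 0 = k := by simp [h1, h3]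
      rw [e, e', e'']
      refine ⟨by simp [h1, h3], by simp [h1, h4], by simp [h1, h5], ?_, ?_, by simp [h1], ?_⟩
      · rw [← h6]; funext j; simp [State.comb, h2]
      · simp only [State.setNat_nat_ne _ _ _ h1.2.2.2.2.2, State.setReal_nat,
          State.setNat_nat_same, Function.update_self]
        exact (mem_seg _).2 ⟨k, hk, by simp⟩
      · intro i hi
        simp only [State.setNat_real, State.setReal_real_same, Function.update_self]
        rcases Nat.lt_succ_iff_lt_or_eq.1 hi with hi | rfl
        · exact hlt.le.trans (h9 i hi)
        · exact le_rfl
    · rw [argminStep, den_cond_neg _ (by simpa [h3, h5, h6] using hlt), den_skip]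
      refine ⟨by simp [h3], by simp [h1, h4], by simp [h1, h5], h6, ?_, ?_, ?_⟩
      · rw [State.setNat_nat_ne _ _ _ h1.2.2.2.2.2]; exact h7
      · rw [State.setNat_nat_ne _ _ _ h1.2.2.2.2.2]; exact h8
      · intro i hi
        rcases Nat.lt_succ_iff_lt_or_eq.1 hi with hi | rfl
        · exact h9 i hi
        · exact not_lt.1 hlt
  · rintro τ ⟨-, -, -, -, h7, h8, h9⟩
    refine ⟨h7, h8, fun j hj => ?_⟩
    obtain ⟨i, hi, rfl⟩ := (mem_seg _).1 hj
    simpa using h9 i hi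

def oracle : Cmd := argmin 11 12 15 24 ;; argmin 13 14 16 25

theorem oracle_run : ∃ C, ∀ (σ : State), 0 < σ.nat 12 0 → 0 < σ.nat 14 0 →
    Run oracle σ (C * (σ.nat 12 0 + σ.nat 14 0 + 1)) (fun τ => Frame [15, 16, 56] [24, 25] σ τ ∧
      τ.nat 15 0 ∈ σ.list 11 12 ∧ τ.real 24 0 = σ.comb (τ.nat 15 0) ∧
        (∀ j ∈ σ.list 11 12, τ.real 24 0 ≤ σ.comb j) ∧
      τ.nat 16 0 ∈ σ.list 13 14 ∧ τ.real 25 0 = σ.comb (τ.nat 16 0) ∧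
        ∀ j ∈ σ.list 13 14, τ.real 25 0 ≤ σ.comb j) := by
  obtain ⟨C, hL⟩ := argmin_run (lst := 11) (cnt := 12) (out := 15) (val := 24) (by simp)
  obtain ⟨C', hU⟩ := argmin_run (lst := 13) (cnt := 14) (out := 16) (val := 25) (by simp)
  apply Exists.intro
  intro σ h12 h14
  apply Run.seqL ((hL σ h12).mono (Nat.mul_le_mul_left _ (by omega)) fun _ => id).frame
  rintro τ ⟨⟨h1, h2, h3⟩, hf⟩
  have e14 : τ.nat 14 = σ.nat 14 := hf.1 14 (by decide)
  have ec : τ.comb = σ.comb := by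
    funext j
    simp only [State.comb]
    rw [hf.2 20 (by decide), hf.2 21 (by decide), hf.2 22 (by decide), hf.2 23 (by decide)]
  have el : τ.list 13 14 = σ.list 13 14 := by
    simp only [State.list]
    rw [e14, hf.1 13 (by decide)]
  refine ((hU τ (by rw [e14]; exact h14)).mono (Nat.mul_le_mul_left _ (by rw [e14]; omega))
    fun _ => id).frame.mono le_rfl ?_
  rintro ρ ⟨⟨h4, h5, h6⟩, hg⟩
  rw [ec, el] at *
  rw [hg.1 15 (by decide), hg.2 24 (by decide)]
  exact ⟨(hf.weaken (by decide) (by decide)).trans (hg.weaken (by decide) (by decide)),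
    h1, h2, h3, h4, h5, h6⟩

/-- `(y, a, b)` is a nontrivial solution of all constraints. -/
structure Sol (X Y : ℕ → ℝ) (L U : Set ℕ) (y a b : ℝ) : Prop where
  ne : y ≠ 0 ∨ a ≠ 0 ∨ b ≠ 0
  lower : ∀ j ∈ L, 0 ≤ y + (X j * a + Y j * b)
  upper : ∀ j ∈ U, 0 ≤ -y + (X j * a + Y j * b)

/-- Is there a solution `(y, a, b)` for the point `(a, b) = (nv 22, nv 23)`? -/
def testPoint : Cmd :=
  oracle ;;
  .cond (.le 0 (rv 24 + rv 25))
    (setN 17 1 ;; setR 32 (0 - rv 24) ;; setR 33 (rv 22) ;; setR 34 (rv 23)) .skip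

/-- The lists attain the minima over the sets `L` and `U` at the point `(a, b)`. -/
structure Attains (X Y : ℕ → ℝ) (L U : Set ℕ) (a b : ℝ) (σ : State) : Prop where
  subL : ∀ j ∈ σ.list 11 12, j ∈ L
  subU : ∀ j ∈ σ.list 13 14, j ∈ U
  domL : ∀ j ∈ L, ∃ k ∈ σ.list 11 12, X k * a + Y k * b ≤ X j * a + Y j * b
  domU : ∀ j ∈ U, ∃ k ∈ σ.list 13 14, X k * a + Y k * b ≤ X j * a + Y j * b
  posL : 0 < σ.nat 12 0
  posU : 0 < σ.nat 14 0

/-- For fixed (a, b) the constraints on y say that y lies between minus the minimum of the lower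
family and the minimum of the upper family. If this range is nonempty its left end is a solution.
Otherwise the two minimizers are a pair whose sum is negative at (a, b). -/
theorem testPoint_run : ∃ C, ∀ (σ : State) (X Y : ℕ → ℝ) (L U : Set ℕ) (a b : ℝ),
    σ.real 20 = X → σ.real 21 = Y → σ.real 22 0 = a → σ.real 23 0 = b → (a ≠ 0 ∨ b ≠ 0) →
    σ.nat 17 0 = 0 → Attains X Y L U a b σ →
    Run testPoint σ (C * (σ.nat 12 0 + σ.nat 14 0 + 1)) (fun τ =>
      Frame [15, 16, 17, 56] [24, 25, 32, 33, 34] σ τ ∧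
      ((τ.nat 17 0 = 1 ∧ Sol X Y L U (τ.real 32 0) (τ.real 33 0) (τ.real 34 0)) ∨
      (τ.nat 17 0 = 0 ∧ τ.nat 15 0 ∈ σ.list 11 12 ∧ τ.nat 16 0 ∈ σ.list 13 14 ∧
        τ.nat 15 0 ∈ L ∧ τ.nat 16 0 ∈ U ∧
        (X (τ.nat 15 0) + X (τ.nat 16 0)) * a + (Y (τ.nat 15 0) + Y (τ.nat 16 0)) * b < 0))) := by
  obtain ⟨C, hC⟩ := oracle_run
  apply Exists.intro
  intro σ X Y L U a b hX hY ha hb hab h17 h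
  apply Run.seqL (hC σ h.posL h.posU)
  rintro τ ⟨hf, h1, h2, h3, h4, h5, h6⟩
  have hcomb : ∀ j, σ.comb j = X j * a + Y j * b := fun j => by
    rw [State.comb, hX, hY, ha, hb]
  simp only [hcomb] at *
  refine (Run.simpleL rfl (Nat.succ_pos _) rfl).frame.mono le_rfl ?_
  rintro ρ ⟨rfl, hg⟩
  refine ⟨(hf.weaken (by decide) (by decide)).trans (hg.weaken (by decide) (by decide)), ?_⟩
  by_cases hle : 0 ≤ τ.real 24 0 + τ.real 25 0
  · left
    rw [den_cond_pos _ (by simpa using hle)]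
    refine ⟨by simp, ?_⟩
    have h22 : τ.real 22 0 = a := by rw [hf.2 22 (by decide), ha]
    have h23 : τ.real 23 0 = b := by rw [hf.2 23 (by decide), hb]
    simp [h22, h23]
    refine ⟨Or.inr hab, fun j hj => ?_, fun j hj => ?_⟩
    · obtain ⟨k, hk, hkj⟩ := h.domL j hj
      have := h3 k hk
      linarith
    · obtain ⟨k, hk, hkj⟩ := h.domU j hj
      have := h6 k hk
      linarith
  · right
    rw [den_cond_neg _ (by simpa using hle), den_skip]
    refine ⟨by rw [hf.1 17 (by decide), h17], h1, h4, h.subL _ h1, h.subU _ h4, ?_⟩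
    rw [h2, h5] at hle
    linarith

end RealRAM


namespace RealRAM

/-! ### Linear programming -/

theorem Active.attains {X Y : ℕ → ℝ} {L U : Set ℕ} {σ τ : State} (h : Active X Y L U σ)
    (hL : L.Nonempty) (hU : U.Nonempty) {v : ℝ} (h1 : σ.real 26 0 ≤ v) (h2 : v ≤ σ.real 27 0)
    (hτ : τ.nat = σ.nat) : Attains X Y L U 1 v τ := by
  have e1 : τ.list 11 12 = σ.list 11 12 := by simp only [State.list, hτ]
  have e2 : τ.list 13 14 = σ.list 13 14 := by simp only [State.list, hτ]
  have hpos : ∀ {lst cnt : ℕ} {S : Set ℕ}, S.Nonempty →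
      Represents X Y S (σ.real 26 0) (σ.real 27 0) (σ.list lst cnt) → 0 < τ.nat cnt 0 := by
    rintro lst cnt S ⟨j, hj⟩ hS
    obtain ⟨k, hk, -⟩ := hS.dom j hj
    obtain ⟨i, hi, -⟩ := (mem_seg _).1 hk
    rw [hτ]
    omega
  refine ⟨?_, ?_, ?_, ?_, hpos hL h.repL, hpos hU h.repU⟩
  · rw [e1]; exact h.repL.sub
  · rw [e2]; exact h.repU.sub
  · rw [e1]
    intro j hj
    obtain ⟨k, hk, hkj⟩ := h.repL.dom j hj
    exact ⟨k, hk, by simpa [aff] using hkj v h1 h2⟩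
  · rw [e2]
    intro j hj
    obtain ⟨k, hk, hkj⟩ := h.repU.dom j hj
    exact ⟨k, hk, by simpa [aff] using hkj v h1 h2⟩

/-- The pairs of constraints with the numbers `e 0, e 1`, …, `e 8, e 9` confine the solutions to the
points `(a, b)` with `a > 0` and `lo < b / a < hi`. -/
structure Evidence (X Y : ℕ → ℝ) (L U : Set ℕ) (e : ℕ → ℕ) (lo hi : ℝ) : Prop where
  memL : ∀ k < 5, e (2 * k) ∈ L
  memU : ∀ k < 5, e (2 * k + 1) ∈ U
  right : 0 < X (e 0) + X (e 1) ∧ Y (e 0) + Y (e 1) = 0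
  up : Y (e 2) + Y (e 3) < 0
  down : 0 < Y (e 4) + Y (e 5)
  lo : ∀ x, 0 ≤ X (e 6) + X (e 7) + (Y (e 6) + Y (e 7)) * x → lo < x
  hi : ∀ x, 0 ≤ X (e 8) + X (e 9) + (Y (e 8) + Y (e 9)) * x → x < hi

def lpUpdate : Cmd :=
  (setR 22 1 ;; setR 23 (rv 28)) ;; testPoint ;;
  .cond (.natLt (nv 17) 1)
    (.cond (.le 0 (.get 21 (nv 15) + .get 21 (nv 16)))
      (setR 26 (rv 28) ;; .setNat 19 6 (nv 15) ;; .setNat 19 7 (nv 16))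
      (setR 27 (rv 28) ;; .setNat 19 8 (nv 15) ;; .setNat 19 9 (nv 16))) .skip

/-- Let α + β x be the sum of the pair that is violated at the ratio v. For β ≥ 0 it is negative for
all x ≤ v, otherwise for all x ≥ v. The pair thus decides which bound moves to v, and it is stored
as the evidence for that bound. -/
theorem lpUpdate_updates : ∃ C, ∀ (X Y : ℕ → ℝ) (L U : Set ℕ), L.Nonempty → U.Nonempty →
    Updates lpUpdate X Y L U (fun σ => Evidence X Y L U (σ.nat 19) (σ.real 26 0) (σ.real 27 0))
      (fun σ => Sol X Y L U (σ.real 32 0) (σ.real 33 0) (σ.real 34 0)) C := by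
  obtain ⟨C, hC⟩ := testPoint_run
  apply Exists.intro
  intro X Y L U hL hU
  apply Updates.mk (by decide) (by decide)
    (fun σ τ hf h => by
      rw [hf.1 19 (by decide), hf.2 26 (by decide), hf.2 27 (by decide)]; exact h)
    (fun σ τ hf h => by
      rw [hf.2 32 (by decide), hf.2 33 (by decide), hf.2 34 (by decide)]; exact h)
  intro σ hσ hE h17 hlo hhi
  apply Run.seqL (Run.simpleL rfl (Nat.succ_pos _) rfl)
  rintro τ rfl
  apply Run.seqL (hC ((setR 22 1 ;; setR 23 (rv 28)).den σ) X Y L U 1 (σ.real 28 0)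
    (by simp [hσ.coeff]) (by simp [hσ.slope])
    (by simp) (by simp) (by simp) (by simpa using h17) (hσ.attains hL hU hlo.le hhi.le rfl))
  rintro τ ⟨hf, h⟩
  refine Run.simpleL rfl (Nat.succ_pos _) ?_
  have h26 : τ.real 26 = σ.real 26 := by rw [hf.2 26 (by decide)]; simp
  have h27 : τ.real 27 = σ.real 27 := by rw [hf.2 27 (by decide)]; simp
  have h28 : τ.real 28 = σ.real 28 := by rw [hf.2 28 (by decide)]; simp
  have h19 : τ.nat 19 = σ.nat 19 := by rw [hf.1 19 (by decide)]; simp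
  have h21 : τ.real 21 = Y := by rw [hf.2 21 (by decide)]; simp [hσ.slope]
  rcases h with ⟨h1, h2⟩ | ⟨h1, -, -, h2, h3, h4⟩
  · rw [den_cond_neg _ (by simp [h1]), den_skip]
    exact Or.inl ⟨h1, h2, by rw [h26], by rw [h27]⟩
  · right
    rw [den_cond_pos _ (by simp [h1])]
    set l := τ.nat 15 0 with hl
    set u := τ.nat 16 0 with hu
    by_cases hβ : 0 ≤ Y l + Y u
    · rw [den_cond_pos _ (by simpa [h21] using hβ)]
      simp only [den_seq, den_setR, den_setNat, eval_nv, eval_rv, eval_ofNat, State.setReal_nat]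
      rw [← hl]
      have e1 : (((τ.setReal 26 0 (τ.real 28 0)).setNat 19 6 l).nat 16 0) = u := by simp [hu]
      rw [e1]
      refine ⟨by simp [h1], ?_, Or.inl ⟨by simp [h28], by simp [h27]⟩⟩
      simp [h19, h28, h27]
      obtain ⟨g1, g2, g3, g4, g5, g6, g7⟩ := hE
      refine ⟨?_, ?_, by simpa using g3, by simpa using g4, by simpa using g5, ?_, by simpa using g7⟩
      · intro k hk
        have := g1 k hk
        interval_cases k <;> simp_all
      · intro k hk
        have := g2 k hk
        interval_cases k <;> simp_all
      · intro x hx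
        simp at hx
        by_contra hx'
        nlinarith [mul_le_mul_of_nonneg_left (not_lt.1 hx') hβ]
    · rw [den_cond_neg _ (by simpa [h21] using hβ)]
      simp only [den_seq, den_setR, den_setNat, eval_nv, eval_rv, eval_ofNat, State.setReal_nat]
      rw [← hl]
      have e1 : (((τ.setReal 27 0 (τ.real 28 0)).setNat 19 8 l).nat 16 0) = u := by simp [hu]
      rw [e1]
      refine ⟨by simp [h1], ?_, Or.inr ⟨by simp [h26], by simp [h28]⟩⟩
      simp [h19, h28, h26]
      obtain ⟨g1, g2, g3, g4, g5, g6, g7⟩ := hE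
      refine ⟨?_, ?_, by simpa using g3, by simpa using g4, by simpa using g5, by simpa using g6, ?_⟩
      · intro k hk
        have := g1 k hk
        interval_cases k <;> simp_all
      · intro k hk
        have := g2 k hk
        interval_cases k <;> simp_all
      · intro x hx
        simp at hx
        by_contra hx'
        nlinarith [mul_le_mul_of_nonpos_left (not_lt.1 hx') (not_le.1 hβ).le]

/-- There are twelve constraints that have no common nontrivial solution. -/
structure Infeasible (X Y : ℕ → ℝ) (L U : Set ℕ) (e : ℕ → ℕ) : Prop where
  memL : ∀ k < 6, e (2 * k) ∈ L
  memU : ∀ k < 6, e (2 * k + 1) ∈ U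
  trivial : ∀ y a b, (∀ k < 6, 0 ≤ y + (X (e (2 * k)) * a + Y (e (2 * k)) * b)) →
    (∀ k < 6, 0 ≤ -y + (X (e (2 * k + 1)) * a + Y (e (2 * k + 1)) * b)) → y = 0 ∧ a = 0 ∧ b = 0

theorem Evidence.congr {X Y : ℕ → ℝ} {L U : Set ℕ} {e e' : ℕ → ℕ} {lo hi : ℝ}
    (h : Evidence X Y L U e lo hi) (he : ∀ k < 10, e' k = e k) : Evidence X Y L U e' lo hi := by
  refine ⟨fun k hk => ?_, fun k hk => ?_, ?_, ?_, ?_, ?_, ?_⟩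
  · rw [he _ (by omega)]; exact h.memL k hk
  · rw [he _ (by omega)]; exact h.memU k hk
  · rw [he 0 (by decide), he 1 (by decide)]; exact h.right
  · rw [he 2 (by decide), he 3 (by decide)]; exact h.up
  · rw [he 4 (by decide), he 5 (by decide)]; exact h.down
  · rw [he 6 (by decide), he 7 (by decide)]; exact h.lo
  · rw [he 8 (by decide), he 9 (by decide)]; exact h.hi

/-- Adding the two constraints of a pair eliminates y. The first pair forces a ≥ 0. For a = 0 the
second and the third pair force b = 0, and then any pair gives y = 0. For a > 0, division by a shows
that the ratio b / a lies between `lo` and `hi`, where the sixth pair is violated. -/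
theorem Evidence.infeasible {X Y : ℕ → ℝ} {L U : Set ℕ} {e : ℕ → ℕ} {lo hi : ℝ}
    (h : Evidence X Y L U e lo hi) (hL : e 10 ∈ L) (hU : e 11 ∈ U)
    (hneg : ∀ x, lo < x → x < hi → X (e 10) + X (e 11) + (Y (e 10) + Y (e 11)) * x < 0) :
    Infeasible X Y L U e := by
  refine ⟨fun k hk => ?_, fun k hk => ?_, fun y a b h1 h2 => ?_⟩
  · rcases Nat.lt_succ_iff_lt_or_eq.1 hk with hk | rfl
    exacts [h.memL k hk, hL]
  · rcases Nat.lt_succ_iff_lt_or_eq.1 hk with hk | rfl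
    exacts [h.memU k hk, hU]
  · have key : ∀ k < 6, 0 ≤ (X (e (2 * k)) + X (e (2 * k + 1))) * a +
        (Y (e (2 * k)) + Y (e (2 * k + 1))) * b := fun k hk => by
      have := h1 k hk
      have := h2 k hk
      linarith
    have k0 := key 0 (by decide)
    have k1 := key 1 (by decide)
    have k2 := key 2 (by decide)
    have k3 := key 3 (by decide)
    have k4 := key 4 (by decide)
    have k5 := key 5 (by decide)
    simp only [Nat.mul_zero, Nat.zero_add, Nat.mul_one, Nat.reduceMul, Nat.reduceAdd] at k0 k1 k2 k3 k4 k5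
    have ha : 0 ≤ a := by
      rw [h.right.2, zero_mul, add_zero] at k0
      exact nonneg_of_mul_nonneg_right k0 h.right.1
    rcases ha.eq_or_lt with rfl | ha
    · have hb1 : b ≤ 0 := by
        by_contra hb
        nlinarith [mul_neg_of_neg_of_pos h.up (not_le.1 hb)]
      have hb2 : 0 ≤ b := by
        by_contra hb
        nlinarith [mul_neg_of_pos_of_neg h.down (not_le.1 hb)]
      obtain rfl := le_antisymm hb1 hb2
      have := h1 0 (by decide)
      have := h2 0 (by decide)
      exact ⟨by linarith, rfl, rfl⟩
    · exfalso
      have hdiv : ∀ α β : ℝ, 0 ≤ α * a + β * b → 0 ≤ α + β * (b / a) := fun α β hαβ => by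
        have : α + β * (b / a) = (α * a + β * b) / a := by field_simp
        rw [this]
        positivity
      exact absurd (hdiv _ _ k5) (not_le.2 (hneg _ (h.lo _ (hdiv _ _ k3)) (h.hi _ (hdiv _ _ k4))))

/-- Only one function is left in each family, so their sum alone decides; its coefficients are put
into cells 35 and 36. -/
def lpLast : Cmd :=
  (.setNat 19 10 (.get 11 0) ;; .setNat 19 11 (.get 13 0)) ;;
  (setR 35 (.get 20 (.get 11 0) + .get 20 (.get 13 0)) ;;
   setR 36 (.get 21 (.get 11 0) + .get 21 (.get 13 0))) ;;
  .cond (.realLt ((rv 35 + rv 36 * rv 26) * (rv 35 + rv 36 * rv 27)) 0)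
    (setR 23 ((0 - rv 35) / rv 36)) (setR 23 ((rv 26 + rv 27) / 2)) ;;
  setR 22 1

/-- If the affine function changes sign between the ends, v is its zero and the premise of the last
claim fails. Otherwise the function is ≥ 0 at both ends or ≤ 0 at both ends, and a negative value at
the midpoint makes it negative at all interior points. -/
theorem last_point {α β lo hi v : ℝ} (hlt : lo < hi)
    (hv : v = if (α + β * lo) * (α + β * hi) < 0 then -α / β else (lo + hi) / 2) :
    lo ≤ v ∧ v ≤ hi ∧ (α + β * v < 0 → ∀ x, lo < x → x < hi → α + β * x < 0) := by
  split_ifs at hv with h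
  · have hβ : β ≠ 0 := by
      rintro rfl
      simp only [zero_mul, add_zero] at h
      nlinarith [mul_self_nonneg α]
    have e : ∀ x, α + β * x = β * (x - v) := fun x => by rw [hv]; field_simp; ring
    rw [e, e] at h
    have h1 : (lo - v) * (hi - v) < 0 := by
      by_contra h3
      nlinarith [mul_nonneg (mul_self_nonneg β) (not_lt.1 h3)]
    refine ⟨?_, ?_, fun h2 => ?_⟩
    · by_contra h4; nlinarith
    · by_contra h4; nlinarith
    · rw [e] at h2; simp at h2
  · refine ⟨by linarith, by linarith, fun h2 x hx hx' => ?_⟩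
    rw [hv] at h2
    rcases same_sign h with ⟨h3, h4⟩ | ⟨h3, h4⟩
    · by_cases hβ : 0 ≤ β
      · rcases hβ.eq_or_lt with rfl | hβ
        · linarith
        · nlinarith [mul_lt_mul_of_pos_left hx' hβ]
      · nlinarith [mul_lt_mul_of_neg_left hx (not_le.1 hβ)]
    · nlinarith

end RealRAM


/-! ### The final test of the linear program -/

namespace RealRAM

/-- The lists consist of all constraints. -/
structure Full (X Y : ℕ → ℝ) (L U : Set ℕ) (σ : State) : Prop where
  coeff : σ.real 20 = X
  slope : σ.real 21 = Y
  memL : ∀ j, j ∈ σ.list 11 12 ↔ j ∈ L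
  memU : ∀ j, j ∈ σ.list 13 14 ↔ j ∈ U
  nonemptyL : L.Nonempty
  nonemptyU : U.Nonempty

theorem Full.congr {X Y : ℕ → ℝ} {L U : Set ℕ} {σ τ : State} (h : Full X Y L U σ)
    (hn : ∀ b ∈ [11, 12, 13, 14], τ.nat b = σ.nat b) (hr : ∀ b ∈ [20, 21], τ.real b = σ.real b) :
    Full X Y L U τ := by
  have e1 : τ.list 11 12 = σ.list 11 12 := by
    simp only [State.list]; rw [hn 11 (by simp), hn 12 (by simp)]
  have e2 : τ.list 13 14 = σ.list 13 14 := by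
    simp only [State.list]; rw [hn 13 (by simp), hn 14 (by simp)]
  refine ⟨?_, ?_, ?_, ?_, h.nonemptyL, h.nonemptyU⟩
  · rw [hr 20 (by simp), h.coeff]
  · rw [hr 21 (by simp), h.slope]
  · rw [e1]; exact h.memL
  · rw [e2]; exact h.memU

theorem Full.attains {X Y : ℕ → ℝ} {L U : Set ℕ} {σ : State} (h : Full X Y L U σ) (a b : ℝ) :
    Attains X Y L U a b σ := by
  have hpos : ∀ {lst cnt : ℕ} {S : Set ℕ}, S.Nonempty → (∀ j, j ∈ σ.list lst cnt ↔ j ∈ S) →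
      0 < σ.nat cnt 0 := by
    rintro lst cnt S ⟨j, hj⟩ hS
    obtain ⟨i, hi, -⟩ := (mem_seg _).1 ((hS j).2 hj)
    omega
  exact ⟨fun j => (h.memL j).1, fun j => (h.memU j).1, fun j hj => ⟨j, (h.memL j).2 hj, le_rfl⟩,
    fun j hj => ⟨j, (h.memU j).2 hj, le_rfl⟩, hpos h.nonemptyL h.memL, hpos h.nonemptyU h.memU⟩

theorem Full.active {X Y : ℕ → ℝ} {L U : Set ℕ} {σ : State} (h : Full X Y L U σ)
    (hlt : σ.real 26 0 < σ.real 27 0) : Active X Y L U σ :=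
  ⟨h.coeff, h.slope, hlt, ⟨fun j => (h.memL j).1, fun j hj => ⟨j, (h.memL j).2 hj, fun _ _ _ => le_rfl⟩⟩,
    ⟨fun j => (h.memU j).1, fun j hj => ⟨j, (h.memU j).2 hj, fun _ _ _ => le_rfl⟩⟩⟩

/-- The result of linear programming. -/
def Outcome (X Y : ℕ → ℝ) (L U : Set ℕ) (σ : State) : Prop :=
  (σ.nat 17 0 = 1 ∧ Sol X Y L U (σ.real 32 0) (σ.real 33 0) (σ.real 34 0)) ∨
    (σ.nat 17 0 = 0 ∧ Infeasible X Y L U (σ.nat 19))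

def lpFinish : Cmd := lpLast ;; testPoint

theorem lpFinish_run : ∃ C, ∀ (σ : State) (X Y : ℕ → ℝ) (L U : Set ℕ) (n : ℕ), Active X Y L U σ →
    Evidence X Y L U (σ.nat 19) (σ.real 26 0) (σ.real 27 0) → σ.nat 17 0 = 0 →
    σ.nat 12 0 + σ.nat 14 0 ≤ 2 → 2 ≤ n → Run lpFinish σ (C * (n + 1)) (Outcome X Y L U) := by
  obtain ⟨C, hC⟩ := testPoint_run
  apply Exists.intro
  intro σ X Y L U n h hE h17 h2 hn
  have hL : L.Nonempty := ⟨_, hE.memL 0 (by decide)⟩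
  have hU : U.Nonempty := ⟨_, hE.memU 0 (by decide)⟩
  have hA := h.attains hL hU le_rfl h.lt.le (τ := σ) rfl
  have h12 : σ.nat 12 0 = 1 := by have := hA.posL; have := hA.posU; omega
  have h14 : σ.nat 14 0 = 1 := by have := hA.posL; have := hA.posU; omega
  set l := σ.nat 11 0 with hl
  set u := σ.nat 13 0 with hu
  have hlistL : σ.list 11 12 = [l] := by simp [State.list, h12, seg_cons, hl]
  have hlistU : σ.list 13 14 = [u] := by simp [State.list, h14, seg_cons, hu]
  apply Run.seqL (Run.simpleL rfl (Nat.succ_pos _) rfl)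
  rintro τ rfl
  obtain ⟨v, hv⟩ : ∃ v, v = if ((X l + X u) + (Y l + Y u) * σ.real 26 0) *
    ((X l + X u) + (Y l + Y u) * σ.real 27 0) < 0 then -(X l + X u) / (Y l + Y u) else
      (σ.real 26 0 + σ.real 27 0) / 2 := ⟨_, rfl⟩
  obtain ⟨hv1, hv2, hv3⟩ := last_point h.lt hv
  have key : (lpLast.den σ).nat = (((σ.setNat 19 10 l).setNat 19 11 u)).nat ∧
      (lpLast.den σ).real 20 = X ∧ (lpLast.den σ).real 21 = Y ∧ (lpLast.den σ).real 22 0 = 1 ∧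
      (lpLast.den σ).real 23 0 = v := by
    rw [hv]
    by_cases hc : ((X l + X u) + (Y l + Y u) * σ.real 26 0) *
      ((X l + X u) + (Y l + Y u) * σ.real 27 0) < 0
    · rw [if_pos hc, lpLast, den_seq, den_seq, den_seq,
        den_cond_pos _ (by simpa [h.coeff, h.slope, ← hl, ← hu] using hc)]
      simp [h.coeff, h.slope, ← hl, ← hu]
    · rw [if_neg hc, lpLast, den_seq, den_seq, den_seq,
        den_cond_neg _ (by simpa [h.coeff, h.slope, ← hl, ← hu] using hc)]
      simp [h.coeff, h.slope, ← hl, ← hu]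
  obtain ⟨k1, k2, k3, k4, k5⟩ := key
  have e1 : (lpLast.den σ).list 11 12 = [l] := by rw [← hlistL]; simp [State.list, k1]
  have e2 : (lpLast.den σ).list 13 14 = [u] := by rw [← hlistU]; simp [State.list, k1]
  refine ((hC (lpLast.den σ) X Y L U 1 v k2 k3 k4 k5 (by simp) (by simp [k1, h17]) ?_).mono
    (Nat.mul_le_mul_left _ (by simp [k1]; omega)) ?_)
  · have := h.attains hL hU hv1 hv2 (τ := σ) rfl
    refine ⟨?_, ?_, ?_, ?_, by simp [k1, h12], by simp [k1, h14]⟩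
    · rw [e1, ← hlistL]; exact this.subL
    · rw [e2, ← hlistU]; exact this.subU
    · rw [e1, ← hlistL]; exact this.domL
    · rw [e2, ← hlistU]; exact this.domU
  · rintro τ ⟨hf, hτ | ⟨h3, hl', hu', h4, h5, h6⟩⟩
    · exact Or.inl hτ
    · refine Or.inr ⟨h3, ?_⟩
      rw [e1, List.mem_singleton] at hl'
      rw [e2, List.mem_singleton] at hu'
      rw [hl', hu', mul_one] at h6
      rw [hl'] at h4
      rw [hu'] at h5
      have e19 : τ.nat 19 = Function.update (Function.update (σ.nat 19) 10 l) 11 u := by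
        rw [hf.1 19 (by decide), k1]; simp
      refine (hE.congr (e' := τ.nat 19) fun k hk => ?_).infeasible ?_ ?_ ?_
      · rw [e19, Function.update_of_ne (by omega), Function.update_of_ne (by omega)]
      · simpa [e19] using h4
      · simpa [e19] using h5
      · simpa [e19] using hv3 h6

end RealRAM


/-! ### Bracketing the ratio b / a -/

namespace RealRAM

/-- Record the two constraints found by `testPoint` in the cells `i` and `i + 1`. -/
def record (i : ℕ) : Cmd := .setNat 19 (.const i) (nv 15) ;; .setNat 19 (.const (i + 1)) (nv 16)

/-- The pair that refutes (0, 1) bounds the ratio from above by p in cell 38, and the one that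
refutes (0, -1) bounds it from below by q in cell 39. Since 1 + p² + q² exceeds both |p| and |q|, it
gives strict bounds on both sides without absolute values. The same two pairs serve as the initial
evidence for the two ends. -/
def lpBracket : Cmd :=
  record 4 ;; record 6 ;; .setNat 19 8 (.get 19 2) ;; .setNat 19 9 (.get 19 3) ;;
  setR 39 (0 - (.get 20 (nv 15) + .get 20 (nv 16)) / (.get 21 (nv 15) + .get 21 (nv 16))) ;;
  setR 27 (1 + rv 38 * rv 38 + rv 39 * rv 39) ;; setR 26 (0 - rv 27)

def lpRight : Cmd :=
  lpBracket ;; search lpUpdate ;; .cond (.natLt (nv 17) 1) lpFinish .skip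

theorem lpRight_run : ∃ C, ∀ (σ : State) (X Y : ℕ → ℝ) (L U : Set ℕ) (n : ℕ), Full X Y L U σ →
    σ.nat 12 0 + σ.nat 14 0 ≤ n → σ.nat 17 0 = 0 → σ.nat 19 0 ∈ L → σ.nat 19 1 ∈ U →
    0 < X (σ.nat 19 0) + X (σ.nat 19 1) → Y (σ.nat 19 0) + Y (σ.nat 19 1) = 0 →
    σ.nat 19 2 ∈ L → σ.nat 19 3 ∈ U → Y (σ.nat 19 2) + Y (σ.nat 19 3) < 0 →
    (∀ x, 0 ≤ X (σ.nat 19 2) + X (σ.nat 19 3) + (Y (σ.nat 19 2) + Y (σ.nat 19 3)) * x →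
      x ≤ σ.real 38 0) → σ.nat 15 0 ∈ L → σ.nat 16 0 ∈ U →
    0 < Y (σ.nat 15 0) + Y (σ.nat 16 0) →
    Run lpRight σ (C * (n + 1)) (Outcome X Y L U) := by
  obtain ⟨C, hC⟩ := lpUpdate_updates
  obtain ⟨D, hD⟩ := search_run (upd := lpUpdate)
  obtain ⟨F, hF⟩ := lpFinish_run
  apply Exists.intro
  intro σ X Y L U n h hn h17 e0 e1 hX0 hY0 e2 e3 hY2 hub e4 e5 hY4
  have hn2 : 2 ≤ n := by
    have hA := h.attains 0 0
    have := hA.posL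
    have := hA.posU
    omega
  apply Run.seqL (Run.simpleL rfl (Nat.succ_pos _) rfl).frame
  rintro τ ⟨rfl, hf⟩
  have h' : Full X Y L U (lpBracket.den σ) :=
    h.congr (fun b hb => hf.1 b (by revert b; decide)) (fun b hb => hf.2 b (by revert b; decide))
  have hhi : (lpBracket.den σ).real 27 0 = 1 + σ.real 38 0 * σ.real 38 0 +
      (0 - (X (σ.nat 15 0) + X (σ.nat 16 0)) / (Y (σ.nat 15 0) + Y (σ.nat 16 0))) *
      (0 - (X (σ.nat 15 0) + X (σ.nat 16 0)) / (Y (σ.nat 15 0) + Y (σ.nat 16 0))) := by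
    simp [lpBracket, record, h.coeff, h.slope]
  have hlo : (lpBracket.den σ).real 26 0 = - (lpBracket.den σ).real 27 0 := by
    simp [lpBracket, record]
  have hE : Evidence X Y L U ((lpBracket.den σ).nat 19) ((lpBracket.den σ).real 26 0)
      ((lpBracket.den σ).real 27 0) := by
    rw [hlo, hhi]
    obtain ⟨h0, h1, h2, h3, h4, h5, h6, h7, h8, h9⟩ :
        (lpBracket.den σ).nat 19 0 = σ.nat 19 0 ∧ (lpBracket.den σ).nat 19 1 = σ.nat 19 1 ∧
        (lpBracket.den σ).nat 19 2 = σ.nat 19 2 ∧ (lpBracket.den σ).nat 19 3 = σ.nat 19 3 ∧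
        (lpBracket.den σ).nat 19 4 = σ.nat 15 0 ∧ (lpBracket.den σ).nat 19 5 = σ.nat 16 0 ∧
        (lpBracket.den σ).nat 19 6 = σ.nat 15 0 ∧ (lpBracket.den σ).nat 19 7 = σ.nat 16 0 ∧
        (lpBracket.den σ).nat 19 8 = σ.nat 19 2 ∧ (lpBracket.den σ).nat 19 9 = σ.nat 19 3 := by
      simp [lpBracket, record, NExp.eval]
    refine ⟨fun k hk => ?_, fun k hk => ?_, by rw [h0, h1]; exact ⟨hX0, hY0⟩,
      by rw [h2, h3]; exact hY2, by rw [h4, h5]; exact hY4, fun x hx => ?_, fun x hx => ?_⟩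
    · interval_cases k <;> simp only [Nat.mul_zero, Nat.mul_one, Nat.reduceMul, *]
    · interval_cases k <;> simp only [Nat.mul_zero, Nat.mul_one, Nat.reduceMul, Nat.reduceAdd, *]
    · rw [h6, h7] at hx
      have : -((X (σ.nat 15 0) + X (σ.nat 16 0)) / (Y (σ.nat 15 0) + Y (σ.nat 16 0))) ≤ x := by
        rw [← neg_div, div_le_iff₀ hY4]
        linarith
      nlinarith [sq_nonneg ((X (σ.nat 15 0) + X (σ.nat 16 0)) /
        (Y (σ.nat 15 0) + Y (σ.nat 16 0)) - 1 / 2), mul_self_nonneg (σ.real 38 0)]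
    · rw [h8, h9] at hx
      have := hub x hx
      nlinarith [sq_nonneg (σ.real 38 0 - 1 / 2), mul_self_nonneg (0 - (X (σ.nat 15 0) + X (σ.nat 16 0)) / (Y (σ.nat 15 0) + Y (σ.nat 16 0)))]
  have hpos : 0 < (lpBracket.den σ).real 27 0 := by
    rw [hhi]
    nlinarith [mul_self_nonneg (σ.real 38 0), mul_self_nonneg
      (0 - (X (σ.nat 15 0) + X (σ.nat 16 0)) / (Y (σ.nat 15 0) + Y (σ.nat 16 0)))]
  apply Run.seqL ((hD C X Y L U _ _ (hC X Y L U h.nonemptyL h.nonemptyU) (lpBracket.den σ)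
    (h'.active (by rw [hlo]; linarith)) hE (by rw [hf.1 17 (by decide), h17])).mono
      (Nat.mul_le_mul_left _ (Nat.succ_le_succ
        (by rw [hf.1 12 (by decide), hf.1 14 (by decide)]; exact hn))) fun _ => id)
  rintro τ hτ
  apply Run.condL (Nat.succ_pos _)
  · intro hb
    simp only [holds_natLt, eval_nv, eval_ofNat] at hb
    rcases hτ with hτ | ⟨g1, g2, g3, g4⟩
    · omega
    · exact hF τ X Y L U n g3 g2 g1 g4 hn2
  · intro hb
    simp only [holds_natLt, eval_nv, eval_ofNat] at hb
    refine Run.simpleL rfl (Nat.succ_pos _) (Or.inl ?_)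
    rcases hτ with hτ | hτ
    · exact hτ
    · omega

def lpDown : Cmd :=
  record 2 ;;
  setR 38 ((.get 20 (nv 15) + .get 20 (nv 16)) / (0 - (.get 21 (nv 15) + .get 21 (nv 16)))) ;;
  setR 22 0 ;; setR 23 (0 - 1)

/-- Tests the two points (0, 1) and (0, -1), that is, the infinite ratios, so that afterwards only a
bounded interval of ratios is left. -/
def lpVertical : Cmd :=
  (setR 22 0 ;; setR 23 1) ;; testPoint ;;
  .cond (.natLt (nv 17) 1) (lpDown ;; testPoint ;; .cond (.natLt (nv 17) 1) lpRight .skip) .skip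

theorem lpVertical_run : ∃ C, ∀ (σ : State) (X Y : ℕ → ℝ) (L U : Set ℕ) (n : ℕ), Full X Y L U σ →
    σ.nat 12 0 + σ.nat 14 0 ≤ n → σ.nat 17 0 = 0 → σ.nat 19 0 ∈ L → σ.nat 19 1 ∈ U →
    0 < X (σ.nat 19 0) + X (σ.nat 19 1) → Y (σ.nat 19 0) + Y (σ.nat 19 1) = 0 →
    Run lpVertical σ (C * (n + 1)) (Outcome X Y L U) := by
  obtain ⟨C, hC⟩ := testPoint_run
  obtain ⟨D, hD⟩ := lpRight_run
  apply Exists.intro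
  intro σ X Y L U n h hn h17 e0 e1 hX0 hY0
  apply Run.seqL (Run.simpleL rfl (Nat.succ_pos _) rfl).frame
  rintro τ ⟨rfl, hf⟩
  set τ := (setR 22 0 ;; setR 23 1).den σ with hτ
  have h' : Full X Y L U τ :=
    h.congr (fun b hb => hf.1 b (by revert b; decide)) (fun b hb => hf.2 b (by revert b; decide))
  apply Run.seqL ((hC τ X Y L U 0 1 h'.coeff h'.slope (by simp [hτ]) (by simp [hτ]) (by simp)
    (by rw [hf.1 17 (by decide), h17]) (h'.attains 0 1)).mono (Nat.mul_le_mul_left _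
      (Nat.succ_le_succ (by rw [hf.1 12 (by decide), hf.1 14 (by decide)]; exact hn))) fun _ => id)
  rintro ρ ⟨hg, hρ⟩
  apply Run.condL (Nat.succ_pos _)
  · intro hb
    simp only [holds_natLt, eval_nv, eval_ofNat] at hb
    rcases hρ with hρ | ⟨g1, -, -, g2, g3, g4⟩
    · omega
    have hρF : Full X Y L U ρ :=
      h'.congr (fun b hb => hg.1 b (by revert b; decide)) (fun b hb => hg.2 b (by revert b; decide))
    have hr19 : ρ.nat 19 = σ.nat 19 := by rw [hg.1 19 (by decide), hf.1 19 (by decide)]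
    apply Run.seqL (Run.simpleL rfl (Nat.succ_pos _) rfl).frame
    rintro κ ⟨rfl, hk⟩
    have hκF : Full X Y L U (lpDown.den ρ) :=
      hρF.congr (fun b hb => hk.1 b (by revert b; decide))
        (fun b hb => hk.2 b (by revert b; decide))
    have hκn : (lpDown.den ρ).nat 12 0 + (lpDown.den ρ).nat 14 0 ≤ n := by
      rw [hk.1 12 (by decide), hk.1 14 (by decide), hg.1 12 (by decide), hg.1 14 (by decide),
        hf.1 12 (by decide), hf.1 14 (by decide)]; exact hn
    obtain ⟨k0, k1, k2, k3, k4⟩ :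
        (lpDown.den ρ).nat 19 0 = σ.nat 19 0 ∧ (lpDown.den ρ).nat 19 1 = σ.nat 19 1 ∧
        (lpDown.den ρ).nat 19 2 = ρ.nat 15 0 ∧ (lpDown.den ρ).nat 19 3 = ρ.nat 16 0 ∧
        (lpDown.den ρ).real 38 0 = (X (ρ.nat 15 0) + X (ρ.nat 16 0)) /
          (0 - (Y (ρ.nat 15 0) + Y (ρ.nat 16 0))) := by
      simp [lpDown, record, NExp.eval, hρF.coeff, hρF.slope, hr19]
    apply Run.seqL ((hC (lpDown.den ρ) X Y L U 0 (-1) hκF.coeff hκF.slope (by simp [lpDown])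
      (by simp [lpDown]) (by simp) (by rw [hk.1 17 (by decide), g1]) (hκF.attains 0 (-1))).mono
      (Nat.mul_le_mul_left _ (Nat.succ_le_succ hκn)) fun _ => id)
    rintro ω ⟨hω, hωr⟩
    apply Run.condL (Nat.succ_pos _)
    · intro hb
      simp only [holds_natLt, eval_nv, eval_ofNat] at hb
      rcases hωr with hωr | ⟨w1, -, -, w2, w3, w4⟩
      · omega
      have h19 := hω.1 19 (by decide)
      refine hD ω X Y L U n (hκF.congr (fun b hb => hω.1 b (by revert b; decide))
        (fun b hb => hω.2 b (by revert b; decide))) ?_ w1 ?_ ?_ ?_ ?_ ?_ ?_ ?_ ?_ w2 w3 ?_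
      · rw [hω.1 12 (by decide), hω.1 14 (by decide)]; exact hκn
      · rw [h19, k0]; exact e0
      · rw [h19, k1]; exact e1
      · rw [h19, k0, k1]; exact hX0
      · rw [h19, k0, k1]; exact hY0
      · rw [h19, k2]; exact g2
      · rw [h19, k3]; exact g3
      · rw [h19, k2, k3]; linarith
      · rw [h19, k2, k3, hω.2 38 (by decide), k4]
        intro x hx
        rw [le_div_iff₀ (by linarith)]
        linarith
      · linarith
    · intro hb
      simp only [holds_natLt, eval_nv, eval_ofNat] at hb
      refine Run.simpleL rfl (Nat.succ_pos _) (Or.inl ?_)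
      rcases hωr with hωr | hωr
      · exact hωr
      · omega
  · intro hb
    simp only [holds_natLt, eval_nv, eval_ofNat] at hb
    refine Run.simpleL rfl (Nat.succ_pos _) (Or.inl ?_)
    rcases hρ with hρ | hρ
    · exact hρ
    · omega

end RealRAM


/-! ### Rotating the basis -/

namespace RealRAM

/-- The basis `(1, T, T²)`, `(0, s, t)`, `(0, -t, s)`. -/
structure Basis (σ : State) : Prop where
  p0 : σ.real 7 0 = 1
  p1 : σ.real 8 0 = σ.real 6 0
  p2 : σ.real 9 0 = σ.real 6 0 * σ.real 6 0
  q0 : σ.real 10 0 = 0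
  r0 : σ.real 13 0 = 0
  r1 : σ.real 14 0 = -σ.real 12 0
  r2 : σ.real 15 0 = σ.real 11 0
  ne : σ.real 11 0 ≠ 0 ∨ σ.real 12 0 ≠ 0

theorem Basis.congr {σ τ : State} (h : Basis σ)
    (hr : ∀ b ∈ [6, 7, 8, 9, 10, 11, 12, 13, 14, 15], τ.real b = σ.real b) : Basis τ := by
  constructor
  · rw [hr 7 (by simp)]; exact h.p0
  · rw [hr 8 (by simp), hr 6 (by simp)]; exact h.p1
  · rw [hr 9 (by simp), hr 6 (by simp)]; exact h.p2
  · rw [hr 10 (by simp)]; exact h.q0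
  · rw [hr 13 (by simp)]; exact h.r0
  · rw [hr 14 (by simp), hr 12 (by simp)]; exact h.r1
  · rw [hr 15 (by simp), hr 11 (by simp)]; exact h.r2
  · rw [hr 11 (by simp), hr 12 (by simp)]; exact h.ne

/-- The normal number `j` has a positive inner product with `(1, T, T²)`, and it is not skipped. -/
def State.lower (σ : State) (n : ℕ) : Set ℕ := {j | j < n ∧ j ≠ σ.nat 10 0 ∧ 0 < σ.dot 7 j}
def State.upper (σ : State) (n : ℕ) : Set ℕ := {j | j < n ∧ j ≠ σ.nat 10 0 ∧ σ.dot 7 j < 0}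

/-- The result of linear programming in the coordinates of a basis. -/
structure Solved (n : ℕ) (σ : State) : Prop where
  basis : Basis σ
  coeff : ∀ j < n, σ.real 20 j = σ.dot 10 j / |σ.dot 7 j|
  slope : ∀ j < n, σ.real 21 j = σ.dot 13 j / |σ.dot 7 j|
  outcome : Outcome (σ.real 20) (σ.real 21) (σ.lower n) (σ.upper n) σ

theorem Coords.full {n : ℕ} {σ : State} (h : Coords n σ) (hL : (σ.lower n).Nonempty)
    (hU : (σ.upper n).Nonempty) :
    Full (σ.real 20) (σ.real 21) (σ.lower n) (σ.upper n) σ :=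
  ⟨rfl, rfl, h.listL, h.listU, hL, hU⟩

theorem State.dot_congr {σ τ : State} (hr : ∀ b ∈ [0, 1, 2, 7, 8, 9, 10, 11, 12, 13, 14, 15],
    τ.real b = σ.real b) : τ.dot 7 = σ.dot 7 ∧ τ.dot 10 = σ.dot 10 ∧ τ.dot 13 = σ.dot 13 := by
  refine ⟨?_, ?_, ?_⟩ <;> funext j <;> simp only [State.dot] <;>
    rw [hr 0 (by simp), hr 1 (by simp), hr 2 (by simp)]
  · rw [hr 7 (by simp), hr 8 (by simp), hr 9 (by simp)]
  · rw [hr 10 (by simp), hr 11 (by simp), hr 12 (by simp)]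
  · rw [hr 13 (by simp), hr 14 (by simp), hr 15 (by simp)]

theorem Solved.mk' {n : ℕ} {σ τ : State} (hb : Basis σ) (hc : Coords n σ)
    (hr : ∀ b ∈ [0, 1, 2, 6, 7, 8, 9, 10, 11, 12, 13, 14, 15, 20, 21], τ.real b = σ.real b)
    (hn : τ.nat 10 = σ.nat 10)
    (h : Outcome (σ.real 20) (σ.real 21) (σ.lower n) (σ.upper n) τ) : Solved n τ := by
  obtain ⟨e7, e10, e13⟩ := State.dot_congr (σ := σ) (τ := τ) fun b hb => hr b (by
    revert b; decide)
  have e20 := hr 20 (by simp)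
  have e21 := hr 21 (by simp)
  refine ⟨hb.congr fun b hb => hr b (by revert b; decide), ?_, ?_, ?_⟩
  · rw [e20, e7, e10]; exact hc.coeff
  · rw [e21, e7, e13]; exact hc.slope
  · have h1 : τ.lower n = σ.lower n := by simp only [State.lower, e7, hn]
    have h2 : τ.upper n = σ.upper n := by simp only [State.upper, e7, hn]
    rw [e20, e21, h1, h2]; exact h

/-- Let (s, t) be the summed coefficients of the pair that refutes (1, 0). In the rotated
coordinates the pair has the sum (s² + t²) a, with s < 0, so it forces a ≥ 0. This is the first
entry of the evidence. -/
def lpRotate : Cmd :=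
  record 0 ;;
  setR 35 (.get 20 (nv 15) + .get 20 (nv 16)) ;; setR 36 (.get 21 (nv 15) + .get 21 (nv 16)) ;;
  setR 11 (rv 35) ;; setR 12 (rv 36) ;; setR 14 (0 - rv 36) ;; setR 15 (rv 35)

/-- Solve the linear program when there are both lower and upper constraints. -/
def lpMixed : Cmd :=
  (setR 22 1 ;; setR 23 0) ;; testPoint ;;
  .cond (.natLt (nv 17) 1) (lpRotate ;; setup ;; lpVertical) .skip

theorem lpMixed_run : ∃ C, ∀ (σ : State) (n : ℕ), σ.nat 0 0 = n → Basis σ →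
    σ.real 11 0 = 1 → σ.real 12 0 = 0 →
    Coords n σ → (σ.lower n).Nonempty → (σ.upper n).Nonempty → σ.nat 17 0 = 0 →
    Run lpMixed σ (C * (n + 1)) (Solved n) := by
  obtain ⟨C, hC⟩ := testPoint_run
  obtain ⟨D, hD⟩ := setup_run
  obtain ⟨F, hF⟩ := lpVertical_run
  apply Exists.intro
  intro σ n h0 hb h11 h12 hc hL hU h17
  have h := hc.full hL hU
  apply Run.seqL (Run.simpleL rfl (Nat.succ_pos _) rfl).frame
  rintro τ ⟨rfl, hf⟩
  set τ := (setR 22 1 ;; setR 23 0).den σ with hτ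
  have h' : Full (σ.real 20) (σ.real 21) (σ.lower n) (σ.upper n) τ :=
    h.congr (fun b hb => hf.1 b (by revert b; decide)) (fun b hb => hf.2 b (by revert b; decide))
  apply Run.seqL ((hC τ _ _ _ _ 1 0 h'.coeff h'.slope (by simp [hτ]) (by simp [hτ]) (by simp)
    (by rw [hf.1 17 (by decide), h17]) (h'.attains 1 0)).mono (Nat.mul_le_mul_left _
      (Nat.succ_le_succ (by rw [hf.1 12 (by decide), hf.1 14 (by decide)]; exact hc.card)))
      fun _ => id)
  rintro ρ ⟨hg, hρ⟩
  have hrr : ∀ b ∈ [0, 1, 2, 6, 7, 8, 9, 10, 11, 12, 13, 14, 15, 20, 21], ρ.real b = σ.real b :=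
    fun b hb => by rw [hg.2 b (by revert b; decide), hf.2 b (by revert b; decide)]
  apply Run.condL (Nat.succ_pos _)
  · intro hb'
    simp only [holds_natLt, eval_nv, eval_ofNat] at hb'
    rcases hρ with hρ | ⟨g1, -, -, g2, g3, g4⟩
    · omega
    apply Run.seqL (Run.simpleL rfl (Nat.succ_pos _) rfl).frame
    rintro κ ⟨rfl, hk⟩
    set κ := lpRotate.den ρ with hκ
    set l := ρ.nat 15 0 with hl
    set u := ρ.nat 16 0 with hu
    apply Run.seqL (hD κ n (by rw [hk.1 0 (by decide), hg.1 0 (by decide), hf.1 0 (by decide)]; exact h0)).frame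
    rintro ω ⟨hωc, hω⟩
    obtain ⟨k0, k1, k11, k12, k14, k15⟩ : κ.nat 19 0 = l ∧ κ.nat 19 1 = u ∧
        κ.real 11 0 = σ.real 20 l + σ.real 20 u ∧ κ.real 12 0 = σ.real 21 l + σ.real 21 u ∧
        κ.real 14 0 = -(σ.real 21 l + σ.real 21 u) ∧ κ.real 15 0 = σ.real 20 l + σ.real 20 u := by
      simp [hκ, lpRotate, record, NExp.eval, hrr, ← hl, ← hu]
    have hωr : ∀ b ∈ [0, 1, 2, 6, 7, 8, 9, 10, 13], ω.real b = σ.real b := fun b hb => by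
      rw [hω.2 b (by revert b; decide), hk.2 b (by revert b; decide), hrr b (by revert b; decide)]
    have hωb : Basis ω := by
      constructor
      · rw [hωr 7 (by simp)]; exact hb.p0
      · rw [hωr 8 (by simp), hωr 6 (by simp)]; exact hb.p1
      · rw [hωr 9 (by simp), hωr 6 (by simp)]; exact hb.p2
      · rw [hωr 10 (by simp)]; exact hb.q0
      · rw [hωr 13 (by simp)]; exact hb.r0
      · rw [hω.2 14 (by decide), hω.2 12 (by decide), k14, k12]
      · rw [hω.2 15 (by decide), hω.2 11 (by decide), k15, k11]
      · rw [hω.2 11 (by decide), k11]; left; linarith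
    have e7 : ω.dot 7 = σ.dot 7 := by
      funext j; simp only [State.dot]
      rw [hωr 0 (by simp), hωr 1 (by simp), hωr 2 (by simp), hωr 7 (by simp), hωr 8 (by simp),
        hωr 9 (by simp)]
    have e10 : ω.nat 10 = σ.nat 10 := by
      rw [hω.1 10 (by decide), hk.1 10 (by decide), hg.1 10 (by decide), hf.1 10 (by decide)]
    have e1 : ω.lower n = σ.lower n := by simp only [State.lower, e7, e10]
    have e2 : ω.upper n = σ.upper n := by simp only [State.upper, e7, e10]
    have key : ∀ j < n, ω.real 20 j = (σ.real 20 l + σ.real 20 u) * σ.real 20 j +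
        (σ.real 21 l + σ.real 21 u) * σ.real 21 j ∧
        ω.real 21 j = -(σ.real 21 l + σ.real 21 u) * σ.real 20 j +
        (σ.real 20 l + σ.real 20 u) * σ.real 21 j := by
      intro j hj
      have d10 : σ.dot 10 j = σ.real 1 j := by
        simp [State.dot, hb.q0, h11, h12]
      have d13 : σ.dot 13 j = σ.real 2 j := by
        simp [State.dot, hb.r0, hb.r1, hb.r2, h11, h12]
      have f10 : ω.dot 10 j = (σ.real 20 l + σ.real 20 u) * σ.real 1 j +
        (σ.real 21 l + σ.real 21 u) * σ.real 2 j := by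
        simp only [State.dot, hωr 0 (by simp), hωr 1 (by simp), hωr 2 (by simp), hωr 10 (by simp),
          hb.q0, hω.2 11 (by decide), hω.2 12 (by decide), k11, k12]
        ring
      have f13 : ω.dot 13 j = -(σ.real 21 l + σ.real 21 u) * σ.real 1 j +
        (σ.real 20 l + σ.real 20 u) * σ.real 2 j := by
        simp only [State.dot, hωr 0 (by simp), hωr 1 (by simp), hωr 2 (by simp), hωr 13 (by simp),
          hb.r0, hω.2 14 (by decide), hω.2 15 (by decide), k14, k15]
        ring
      rw [hωc.coeff j hj, hωc.slope j hj, e7, f10, f13, hc.coeff j hj, hc.slope j hj, d10, d13]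
      constructor <;> ring
    obtain ⟨x1, y1⟩ := key l g2.1
    obtain ⟨x2, y2⟩ := key u g3.1
    have n0 : ω.nat 19 0 = l := by rw [hω.1 19 (by decide), k0]
    have n1 : ω.nat 19 1 = u := by rw [hω.1 19 (by decide), k1]
    refine (hF ω _ _ _ _ n (hωc.full (by rwa [e1]) (by rwa [e2])) hωc.card ?_ ?_ ?_ ?_ ?_).frame.mono
      le_rfl fun χ hχ => ?_
    · rw [hω.1 17 (by decide), hk.1 17 (by decide)]; exact g1
    · rw [n0, e1]; exact g2
    · rw [n1, e2]; exact g3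
    · rw [n0, n1, x1, x2]
      nlinarith [mul_self_nonneg (σ.real 21 l + σ.real 21 u)]
    · rw [n0, n1, y1, y2]
      ring
    · exact Solved.mk' hωb hωc (fun b hb => hχ.2.2 b (by revert b; decide))
        (hχ.2.1 10 (by decide)) hχ.1
  · intro hb'
    simp only [holds_natLt, eval_nv, eval_ofNat] at hb'
    refine Run.simpleL rfl (Nat.succ_pos _) ?_
    refine Solved.mk' hb hc hrr (by rw [den_skip, hg.1 10 (by decide), hf.1 10 (by decide)]) (Or.inl ?_)
    rcases hρ with hρ | hρ
    · exact hρ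
    · omega

end RealRAM


/-! ### The linear program in three-space -/

namespace RealRAM

def lpBasis : Cmd :=
  setN 17 0 ;; setR 7 1 ;; setR 8 (rv 6) ;; setR 9 (rv 6 * rv 6) ;; setR 10 0 ;; setR 11 1 ;;
  setR 12 0 ;; setR 13 0 ;; setR 14 0 ;; setR 15 1

/-- If there are no upper constraints the first basis vector itself is a solution, and if there are
no lower ones its negative is. -/
def lpSolve : Cmd :=
  lpBasis ;; setup ;;
  .cond (.natLt (nv 14) 1) (setN 17 1 ;; setR 32 1 ;; setR 33 0 ;; setR 34 0)
    (.cond (.natLt (nv 12) 1) (setN 17 1 ;; setR 32 (0 - 1) ;; setR 33 0 ;; setR 34 0) lpMixed)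

theorem lpSolve_run : ∃ C, ∀ (σ : State) (n : ℕ), σ.nat 0 0 = n →
    Run lpSolve σ (C * (n + 1)) (Solved n) := by
  obtain ⟨C, hC⟩ := setup_run
  obtain ⟨D, hD⟩ := lpMixed_run
  apply Exists.intro
  intro σ n h0
  apply Run.seqL (Run.simpleL rfl (Nat.succ_pos _) rfl).frame
  rintro τ ⟨rfl, hf⟩
  set τ := lpBasis.den σ with hτ
  apply Run.seqL (hC τ n (by rw [hf.1 0 (by decide)]; exact h0)).frame
  rintro ρ ⟨hc, hg⟩
  have hb : Basis ρ := by
    constructor <;> simp only [hg.2 6 (by decide), hg.2 7 (by decide), hg.2 8 (by decide),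
      hg.2 9 (by decide), hg.2 10 (by decide), hg.2 11 (by decide), hg.2 12 (by decide),
      hg.2 13 (by decide), hg.2 14 (by decide), hg.2 15 (by decide)] <;> simp [hτ, lpBasis]
  have hne : ∀ {lst cnt : ℕ} {S : Set ℕ}, (∀ j, j ∈ ρ.list lst cnt ↔ j ∈ S) →
      (0 < ρ.nat cnt 0 ↔ S.Nonempty) := by
    intro lst cnt S hS
    constructor
    · exact fun h => ⟨_, (hS _).1 ((mem_seg _).2 ⟨0, h, rfl⟩)⟩
    · rintro ⟨j, hj⟩
      obtain ⟨i, hi, -⟩ := (mem_seg _).1 ((hS j).2 hj)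
      omega
  have hL := hne (S := ρ.lower n) hc.listL
  have hU := hne (S := ρ.upper n) hc.listU
  apply Run.condL (Nat.succ_pos _)
  · intro h
    simp only [holds_natLt, eval_nv, eval_ofNat] at h
    refine (Run.simpleL rfl (Nat.succ_pos _) rfl).frame.mono le_rfl ?_
    rintro κ ⟨rfl, hk⟩
    refine Solved.mk' hb hc (fun b hb => hk.2 b (by revert b; decide)) (hk.1 10 (by decide))
      (Or.inl ⟨by simp, ?_⟩)
    have : ρ.upper n = ∅ := by
      rw [← Set.not_nonempty_iff_eq_empty, ← hU]; omega
    rw [this]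
    exact ⟨by simp, by simp, by simp⟩
  · intro h
    simp only [holds_natLt, eval_nv, eval_ofNat] at h
    apply Run.condL (Nat.succ_pos _)
    · intro h'
      simp only [holds_natLt, eval_nv, eval_ofNat] at h'
      refine (Run.simpleL rfl (Nat.succ_pos _) rfl).frame.mono le_rfl ?_
      rintro κ ⟨rfl, hk⟩
      refine Solved.mk' hb hc (fun b hb => hk.2 b (by revert b; decide)) (hk.1 10 (by decide))
        (Or.inl ⟨by simp, ?_⟩)
      have : ρ.lower n = ∅ := by
        rw [← Set.not_nonempty_iff_eq_empty, ← hL]; omega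
      rw [this]
      exact ⟨by simp, by simp, by simp⟩
    · intro h'
      simp only [holds_natLt, eval_nv, eval_ofNat] at h'
      refine hD ρ n ?_ hb ?_ ?_ hc (hL.1 (by omega)) (hU.1 (by omega)) ?_
      · rw [hg.1 0 (by decide), hf.1 0 (by decide)]; exact h0
      · rw [hg.2 11 (by decide)]; simp [hτ, lpBasis]
      · rw [hg.2 12 (by decide)]; simp [hτ, lpBasis]
      · rw [hg.1 17 (by decide)]; simp [hτ, lpBasis]

/-- Find a nonzero vector whose inner products with all normals but the number `nv 10` are
nonnegative, or twelve normals that prove that there is none. -/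
def lp : Cmd :=
  lpSolve ;;
  (setR 57 (rv 32 * rv 7 + rv 33 * rv 10 + rv 34 * rv 13) ;;
   setR 58 (rv 32 * rv 8 + rv 33 * rv 11 + rv 34 * rv 14) ;;
   setR 59 (rv 32 * rv 9 + rv 33 * rv 12 + rv 34 * rv 15))

/-- The inner product of the normal number `j` with `(d0, d1, d2)`. -/
noncomputable def State.inp (σ : State) (j : ℕ) (d0 d1 d2 : ℝ) : ℝ :=
  σ.real 0 j * d0 + σ.real 1 j * d1 + σ.real 2 j * d2

/-- The result of `lp`. -/
def Decided (n : ℕ) (σ : State) : Prop :=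
  (σ.nat 17 0 = 1 ∧ (σ.real 57 0 ≠ 0 ∨ σ.real 58 0 ≠ 0 ∨ σ.real 59 0 ≠ 0) ∧
    ∀ j < n, j ≠ σ.nat 10 0 → 0 ≤ σ.inp j (σ.real 57 0) (σ.real 58 0) (σ.real 59 0)) ∨
  (σ.nat 17 0 = 0 ∧ (∀ k < 12, σ.nat 19 k < n ∧ σ.nat 19 k ≠ σ.nat 10 0) ∧
    ∀ d0 d1 d2, (∀ k < 12, 0 ≤ σ.inp (σ.nat 19 k) d0 d1 d2) → d0 = 0 ∧ d1 = 0 ∧ d2 = 0)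

/-- By genericity every constraint that is not skipped is a lower or an upper one, so none is lost
in the coordinates. The value of a constraint is |dot 7| times its normalized form, and the change
of basis is invertible because s² + t² ≠ 0; hence both outcomes translate back. -/
theorem Solved.decided {n : ℕ} {σ τ : State} (h : Solved n σ)
    (hT : ∀ j < n, σ.inp j 1 (σ.real 6 0) (σ.real 6 0 * σ.real 6 0) ≠ 0)
    (hn : τ.nat = σ.nat) (hr : ∀ j, τ.inp j = σ.inp j)
    (h57 : τ.real 57 0 = σ.real 32 0 * σ.real 7 0 + σ.real 33 0 * σ.real 10 0 +
      σ.real 34 0 * σ.real 13 0)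
    (h58 : τ.real 58 0 = σ.real 32 0 * σ.real 8 0 + σ.real 33 0 * σ.real 11 0 +
      σ.real 34 0 * σ.real 14 0)
    (h59 : τ.real 59 0 = σ.real 32 0 * σ.real 9 0 + σ.real 33 0 * σ.real 12 0 +
      σ.real 34 0 * σ.real 15 0) : Decided n τ := by
  obtain ⟨⟨p0, p1, p2, q0, r0, r1, r2, hne⟩, hX, hY, hout⟩ := h
  have hw : ∀ j < n, σ.dot 7 j ≠ 0 := fun j hj => by
    have := hT j hj
    simpa only [State.dot, State.inp, p0, p1, p2] using this
  have hst : 0 < σ.real 11 0 * σ.real 11 0 + σ.real 12 0 * σ.real 12 0 := by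
    rcases hne with h | h
    · nlinarith [mul_self_pos.2 h, mul_self_nonneg (σ.real 12 0)]
    · nlinarith [mul_self_pos.2 h, mul_self_nonneg (σ.real 11 0)]
  have hlin : ∀ j < n, ∀ y a b, σ.inp j (y * σ.real 7 0 + a * σ.real 10 0 + b * σ.real 13 0)
      (y * σ.real 8 0 + a * σ.real 11 0 + b * σ.real 14 0)
      (y * σ.real 9 0 + a * σ.real 12 0 + b * σ.real 15 0) =
      y * σ.dot 7 j + |σ.dot 7 j| * (σ.real 20 j * a + σ.real 21 j * b) := by
    intro j hj y a b
    have := abs_ne_zero.2 (hw j hj)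
    rw [hX j hj, hY j hj]
    field_simp
    simp only [State.inp, State.dot]
    ring
  rw [Decided, hn]
  simp only [hr]
  rcases hout with ⟨h1, hs⟩ | ⟨h1, hs⟩
  · refine Or.inl ⟨h1, ?_, fun j hj hj' => ?_⟩
    · by_contra hz
      push Not at hz
      obtain ⟨z0, z1, z2⟩ := hz
      rw [h57, p0, q0, r0] at z0
      have y0 : σ.real 32 0 = 0 := by linarith
      rw [h58, y0, r1] at z1
      rw [h59, y0, r2] at z2
      have a0 : (σ.real 11 0 * σ.real 11 0 + σ.real 12 0 * σ.real 12 0) * σ.real 33 0 = 0 := by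
        linear_combination σ.real 11 0 * z1 + σ.real 12 0 * z2
      have b0 : (σ.real 11 0 * σ.real 11 0 + σ.real 12 0 * σ.real 12 0) * σ.real 34 0 = 0 := by
        linear_combination σ.real 11 0 * z2 - σ.real 12 0 * z1
      rcases hs.ne with h | h | h
      · exact h y0
      · exact h ((mul_eq_zero.1 a0).resolve_left hst.ne')
      · exact h ((mul_eq_zero.1 b0).resolve_left hst.ne')
    · rw [h57, h58, h59, hlin j hj]
      rcases lt_or_gt_of_ne (hw j hj) with hneg | hpos
      · have := hs.upper j ⟨hj, hj', hneg⟩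
        rw [abs_of_neg hneg]
        nlinarith
      · have := hs.lower j ⟨hj, hj', hpos⟩
        rw [abs_of_pos hpos]
        nlinarith
  · refine Or.inr ⟨h1, fun k hk => ?_, fun d0 d1 d2 hd => ?_⟩
    · rcases Nat.even_or_odd' k with ⟨i, rfl | rfl⟩
      · have := hs.memL i (by omega)
        exact ⟨this.1, this.2.1⟩
      · have := hs.memU i (by omega)
        exact ⟨this.1, this.2.1⟩
    · obtain ⟨a, ha⟩ : ∃ a, a = ((d1 - d0 * σ.real 6 0) * σ.real 11 0 +
        (d2 - d0 * (σ.real 6 0 * σ.real 6 0)) * σ.real 12 0) /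
        (σ.real 11 0 * σ.real 11 0 + σ.real 12 0 * σ.real 12 0) := ⟨_, rfl⟩
      obtain ⟨b, hb⟩ : ∃ b, b = ((d2 - d0 * (σ.real 6 0 * σ.real 6 0)) * σ.real 11 0 -
        (d1 - d0 * σ.real 6 0) * σ.real 12 0) /
        (σ.real 11 0 * σ.real 11 0 + σ.real 12 0 * σ.real 12 0) := ⟨_, rfl⟩
      rw [eq_div_iff hst.ne'] at ha hb
      have e0 : d0 = d0 * σ.real 7 0 + a * σ.real 10 0 + b * σ.real 13 0 := by
        rw [p0, q0, r0]; ring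
      have e1 : d1 = d0 * σ.real 8 0 + a * σ.real 11 0 + b * σ.real 14 0 := by
        rw [p1, r1]
        refine mul_right_cancel₀ hst.ne' ?_
        linear_combination -σ.real 11 0 * ha + σ.real 12 0 * hb
      have e2 : d2 = d0 * σ.real 9 0 + a * σ.real 12 0 + b * σ.real 15 0 := by
        rw [p2, r2]
        refine mul_right_cancel₀ hst.ne' ?_
        linear_combination -σ.real 12 0 * ha - σ.real 11 0 * hb
      have key : ∀ j < n, σ.inp j d0 d1 d2 =
          d0 * σ.dot 7 j + |σ.dot 7 j| * (σ.real 20 j * a + σ.real 21 j * b) := fun j hj => by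
        rw [← hlin j hj d0 a b, ← e0, ← e1, ← e2]
      have hl : ∀ i < 6, 0 ≤ d0 + (σ.real 20 (σ.nat 19 (2 * i)) * a +
          σ.real 21 (σ.nat 19 (2 * i)) * b) := fun i hi => by
        obtain ⟨m1, -, m2⟩ := hs.memL i hi
        have := hd (2 * i) (by omega)
        rw [key _ m1, abs_of_pos m2] at this
        exact nonneg_of_mul_nonneg_right (this.trans_eq (by ring)) m2
      have hu : ∀ i < 6, 0 ≤ -d0 + (σ.real 20 (σ.nat 19 (2 * i + 1)) * a +
          σ.real 21 (σ.nat 19 (2 * i + 1)) * b) := fun i hi => by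
        obtain ⟨m1, -, m2⟩ := hs.memU i hi
        have := hd (2 * i + 1) (by omega)
        rw [key _ m1, abs_of_neg m2] at this
        exact nonneg_of_mul_nonneg_right (this.trans_eq (by ring)) (neg_pos.2 m2)
      obtain ⟨y0, a0, b0⟩ := hs.trivial d0 a b hl hu
      rw [y0, a0, b0] at e0 e1 e2
      exact ⟨y0, by simpa using e1, by simpa using e2⟩

theorem lp_run : ∃ C, ∀ (σ : State) (n : ℕ), σ.nat 0 0 = n →
    (∀ j < n, σ.inp j 1 (σ.real 6 0) (σ.real 6 0 * σ.real 6 0) ≠ 0) →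
    Run lp σ (C * (n + 1)) (Decided n) := by
  obtain ⟨C, hC⟩ := lpSolve_run
  apply Exists.intro
  intro σ n h0 hT
  apply Run.seqL (hC σ n h0).frame
  rintro τ ⟨h, hf⟩
  refine Run.simpleL rfl (Nat.succ_pos _) ?_
  refine h.decided (fun j hj => ?_) (by simp) (fun j => ?_) (by simp) (by simp) (by simp)
  · rw [hf.2 6 (by decide), State.inp, hf.2 0 (by decide), hf.2 1 (by decide), hf.2 2 (by decide)]
    exact hT j hj
  · funext d0 d1 d2
    simp [State.inp]

/-! ### A vector that is orthogonal to no normal -/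

def generic : Cmd :=
  setR 6 2 ;; forN 55 (nv 0) (setR 6 (rv 6 +
    (.get 0 (nv 55) * .get 0 (nv 55)) / (.get 2 (nv 55) * .get 2 (nv 55)) +
    (.get 1 (nv 55) * .get 1 (nv 55)) / (.get 2 (nv 55) * .get 2 (nv 55)) +
    (.get 0 (nv 55) * .get 0 (nv 55)) / (.get 1 (nv 55) * .get 1 (nv 55))))

/-- `T` is larger than all real roots of a + b x + c x². Squares replace the absolute values of the
coefficient ratios, as |x| ≤ x² + 1. A quotient by 0 is 0 and only drops a summand that is not
needed. -/
theorem generic_ne {a b c T : ℝ} (h : a ≠ 0 ∨ b ≠ 0 ∨ c ≠ 0)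
    (hT : 2 + a * a / (c * c) + b * b / (c * c) + a * a / (b * b) ≤ T) :
    a * 1 + b * T + c * (T * T) ≠ 0 := by
  have hbb := mul_self_nonneg (a / b)
  have hac := mul_self_nonneg (a / c)
  have hbc := mul_self_nonneg (b / c)
  rw [← div_mul_div_comm, ← div_mul_div_comm, ← div_mul_div_comm] at hT
  by_cases hc : c = 0
  · subst hc
    by_cases hb : b = 0
    · subst hb
      simpa using h
    · have : a * 1 + b * T + 0 * (T * T) = b * (a / b + T) := by field_simp; ring
      rw [this]
      exact mul_ne_zero hb (by nlinarith [mul_self_nonneg (a / b + 1)])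
  · have : a * 1 + b * T + c * (T * T) = c * (a / c + b / c * T + T * T) := by field_simp
    rw [this]
    refine mul_ne_zero hc (ne_of_gt ?_)
    nlinarith [mul_self_nonneg (a / c + 1), mul_nonneg (mul_self_nonneg (b / c + 1))
      (show 0 ≤ T by linarith), mul_nonneg hbc (show 0 ≤ T by linarith)]

theorem generic_run : ∃ C, ∀ (σ : State) (n : ℕ), σ.nat 0 0 = n →
    (∀ j < n, σ.real 0 j ≠ 0 ∨ σ.real 1 j ≠ 0 ∨ σ.real 2 j ≠ 0) →
    Run generic σ (C * (n + 1)) (fun τ =>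
      ∀ j < n, τ.inp j 1 (τ.real 6 0) (τ.real 6 0 * τ.real 6 0) ≠ 0) := by
  apply Exists.intro
  intro σ n h0 hne
  apply Run.seqL (Run.simpleL rfl (Nat.succ_pos _) rfl)
  rintro τ rfl
  refine (Run.forN_simple rfl (fun k τ => τ.nat 55 0 = k ∧ τ.nat 0 0 = n ∧
    (∀ b < 3, τ.real b = σ.real b) ∧ 2 ≤ τ.real 6 0 ∧
    ∀ j < k, 2 + σ.real 0 j * σ.real 0 j / (σ.real 2 j * σ.real 2 j) +
      σ.real 1 j * σ.real 1 j / (σ.real 2 j * σ.real 2 j) +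
      σ.real 0 j * σ.real 0 j / (σ.real 1 j * σ.real 1 j) ≤ τ.real 6 0) n ?_ ?_ ?_).mono le_rfl ?_
  · refine ⟨by simp, by simpa using h0, fun b hb => ?_, by simp, by simp⟩
    simp [State.setReal_real_ne _ _ _ (show b ≠ 6 by omega)]
  · exact fun i τ h => ⟨h.1, h.2.1⟩
  · rintro k τ hk ⟨h1, h2, h3, h4, h5⟩
    have t0 := h3 0 (by decide)
    have t1 := h3 1 (by decide)
    have t2 := h3 2 (by decide)
    have n1 : 0 ≤ σ.real 0 k * σ.real 0 k / (σ.real 2 k * σ.real 2 k) :=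
      div_nonneg (mul_self_nonneg _) (mul_self_nonneg _)
    have n2 : 0 ≤ σ.real 1 k * σ.real 1 k / (σ.real 2 k * σ.real 2 k) :=
      div_nonneg (mul_self_nonneg _) (mul_self_nonneg _)
    have n3 : 0 ≤ σ.real 0 k * σ.real 0 k / (σ.real 1 k * σ.real 1 k) :=
      div_nonneg (mul_self_nonneg _) (mul_self_nonneg _)
    refine ⟨by simp [h1], by simpa using h2, fun b hb => ?_, ?_, fun j hj => ?_⟩
    · simp [State.setReal_real_ne _ _ _ (show b ≠ 6 by omega), h3 b hb]
    · simp [h1, t0, t1, t2]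
      linarith
    · simp [h1, t0, t1, t2]
      rcases Nat.lt_succ_iff_lt_or_eq.1 hj with hj | rfl
      · have := h5 j hj
        linarith
      · linarith
  · rintro τ ⟨-, -, h3, -, h5⟩ j hj
    rw [State.inp, h3 0 (by decide), h3 1 (by decide), h3 2 (by decide)]
    exact generic_ne (hne j hj) (h5 j hj)

end RealRAM


/-! ### Every direction leaves a polyhedron through a facet -/

open Topology in
-- Finitely many hyperplanes do not cover a nonempty open set: a point on one of them is moved
-- slightly along its normal, and the remaining open set is used in the induction. A pair with zero
-- normal describes the empty set, which is what `hS` ensures.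
theorem exists_forall_inner_ne {E : Type*} [NormedAddCommGroup E] [InnerProductSpace ℝ E]
    (S : Finset (E × ℝ)) (hS : ∀ s ∈ S, s.1 = 0 → s.2 ≠ 0) {U : Set E} (hU : IsOpen U)
    (hne : U.Nonempty) : ∃ x ∈ U, ∀ s ∈ S, inner ℝ s.1 x ≠ s.2 := by
  classical
  induction S using Finset.induction_on generalizing U with
  | empty => exact ⟨_, hne.some_mem, by simp⟩
  | insert s S _ ih =>
    have hop : IsOpen (U ∩ {x | inner ℝ s.1 x ≠ s.2}) :=
      hU.inter (isOpen_ne_fun (by fun_prop) continuous_const)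
    have hne' : (U ∩ {x | inner ℝ s.1 x ≠ s.2}).Nonempty := by
      obtain ⟨x, hx⟩ := hne
      by_cases h : inner ℝ s.1 x = s.2
      · have hs : s.1 ≠ 0 := fun h0 =>
          hS s (Finset.mem_insert_self _ _) h0 (by rw [← h, h0, inner_zero_left])
        have hc : ContinuousAt (fun t : ℝ => x + t • s.1) 0 := by fun_prop
        have h1 : ∀ᶠ t : ℝ in 𝓝 0, x + t • s.1 ∈ U :=
          hc (by simpa using hU.mem_nhds hx)
        obtain ⟨t, ht, ht0⟩ := ((h1.filter_mono nhdsWithin_le_nhds).and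
          (self_mem_nhdsWithin : {0}ᶜ ∈ 𝓝[≠] (0 : ℝ))).exists
        refine ⟨_, ht, ?_⟩
        simp only [Set.mem_ofPred_eq, inner_add_right, inner_smul_right, h]
        simpa using ⟨ht0, hs⟩
      · exact ⟨x, hx, h⟩
    obtain ⟨x, hx, hx'⟩ := ih (fun s hs => hS s (Finset.mem_insert_of_mem hs)) hop hne'
    refine ⟨x, hx.1, fun r hr => ?_⟩
    rcases Finset.mem_insert.1 hr with rfl | hr
    exacts [hx.2, hx' r hr]

/-- A line in the direction `d` through a generic point of an open set meets the given planes
transversally, and at different points. -/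
theorem exists_transversal {E : Type*} [NormedAddCommGroup E] [InnerProductSpace ℝ E]
    (H : Finset (E × ℝ)) (hH : ∀ h ∈ H, h.1 ≠ 0) (d : E) {U : Set E} (hU : IsOpen U)
    (hne : U.Nonempty) : ∃ x ∈ U, ∀ t : ℝ, ∀ h ∈ H, inner ℝ h.1 (x + t • d) = h.2 →
      inner ℝ h.1 d ≠ 0 ∧ ∀ k ∈ H, inner ℝ k.1 (x + t • d) = k.2 →
        ∀ z, inner ℝ k.1 z = k.2 ↔ inner ℝ h.1 z = h.2 := by
  classical
  -- Points to be avoided: the given planes, which matter only if parallel to `d`, and for any two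
  -- given planes the points from which a line in direction `d` meets both at the same parameter.
  -- For coinciding planes the latter equation is 0 = 0, and the filter removes it.
  let S : Finset (E × ℝ) := (H ∪ (H ×ˢ H).image (fun p =>
    ((inner ℝ p.2.1 d : ℝ) • p.1.1 - (inner ℝ p.1.1 d : ℝ) • p.2.1,
      inner ℝ p.2.1 d * p.1.2 - inner ℝ p.1.1 d * p.2.2))).filter (fun s => s ≠ 0)
  obtain ⟨x, hx, hS⟩ := exists_forall_inner_ne S (fun s hs h1 h2 => by
    rw [Finset.mem_filter] at hs
    exact hs.2 (Prod.ext h1 h2)) hU hne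
  have htr : ∀ t : ℝ, ∀ h ∈ H, inner ℝ h.1 (x + t • d) = h.2 → inner ℝ h.1 d ≠ 0 := by
    intro t h hh hht h0
    refine hS h (Finset.mem_filter.2 ⟨Finset.mem_union_left _ hh, fun h' => hH h hh ?_⟩) ?_
    · rw [h']; rfl
    · rwa [inner_add_right, inner_smul_right, h0, mul_zero, add_zero] at hht
  refine ⟨x, hx, fun t h hh hht => ⟨htr t h hh hht, fun k hk hkt => ?_⟩⟩
  have h0 := htr t h hh hht
  have k0 := htr t k hk hkt
  rw [inner_add_right, inner_smul_right] at hht hkt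
  have hzero : ((inner ℝ k.1 d : ℝ) • h.1 - (inner ℝ h.1 d : ℝ) • k.1,
      inner ℝ k.1 d * h.2 - inner ℝ h.1 d * k.2) = (0 : E × ℝ) := by
    by_contra hc
    refine hS _ (Finset.mem_filter.2 ⟨Finset.mem_union_right _
      (Finset.mem_image.2 ⟨(h, k), Finset.mem_product.2 ⟨hh, hk⟩, rfl⟩), hc⟩) ?_
    simp only [inner_sub_left, inner_smul_left, conj_trivial]
    rw [← hht, ← hkt]
    ring
  obtain ⟨z1, z2⟩ := Prod.mk.inj hzero
  intro z
  have z3 : inner ℝ k.1 d * inner ℝ h.1 z = inner ℝ h.1 d * inner ℝ k.1 z := by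
    have := congrArg (fun v : E => (inner ℝ v z : ℝ)) z1
    simp only [inner_sub_left, inner_smul_left, conj_trivial, inner_zero_left] at this
    linarith
  constructor
  · intro hz
    apply mul_left_cancel₀ k0
    rw [z3, hz]
    linarith
  · intro hz
    apply mul_left_cancel₀ h0
    rw [← z3, hz]
    linarith

theorem subset_interior_or_compl {X : Type*} [TopologicalSpace X] {K S : Set X} (hK : IsClosed K)
    (hS : IsPreconnected S) (h : Disjoint S (frontier K)) : S ⊆ interior K ∨ S ⊆ Kᶜ := by
  have hsub : S ⊆ interior K ∪ Kᶜ := fun x hx => by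
    by_cases hxK : x ∈ K
    · left
      by_contra hi
      exact Set.disjoint_left.1 h hx ⟨subset_closure hxK, hi⟩
    · exact Or.inr hxK
  exact hS.subset_or_subset isOpen_interior hK.isOpen_compl
    (Set.disjoint_left.2 fun x hx hx' => hx' (interior_subset hx)) hsub

open Topology in
/-- A point of a regular closed set where the boundary lies on one plane and that is left in a
direction transversal to this plane. -/
theorem isInwardNormalAt_of_planar {P : Set E3} (hP : IsClosed P) (hreg : closure (interior P) = P)
    {y d ν : E3} (hy : y ∈ P) (hν : inner ℝ ν d < 0)
    (hfr : ∀ᶠ z in 𝓝 y, z ∈ frontier P → inner ℝ ν (z - y) = 0)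
    (hout : ∀ t : ℝ, 0 < t → y + t • d ∉ P) : IsInwardNormalAt P y ν := by
  refine ⟨fun h => by simp [h] at hν, ?_⟩
  obtain ⟨ε, hε, hball⟩ := Metric.eventually_nhds_iff_ball.1 hfr
  have hlin : IsLinearMap ℝ (fun z : E3 => (inner ℝ ν z : ℝ)) :=
    ⟨fun a b => inner_add_right _ _ _, fun a b => inner_smul_right _ _ _⟩
  have hconv : ∀ s : Set ℝ, Convex ℝ s → Convex ℝ (Metric.ball y ε ∩ {z | inner ℝ ν (z - y) ∈ s}) := by
    intro s hs
    refine (convex_ball y ε).inter ?_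
    have : {z : E3 | inner ℝ ν (z - y) ∈ s} = (fun z => z + -y) ⁻¹' ((fun z : E3 => (inner ℝ ν z : ℝ)) ⁻¹' s) := by
      ext z; simp [sub_eq_add_neg]
    rw [this]
    exact (hs.is_linear_preimage hlin).translate_preimage_left _
  -- The two open half-balls are convex and miss the boundary of `P`, so each lies in the interior
  -- or in the complement.
  have hside : ∀ s : Set ℝ, Convex ℝ s → 0 ∉ s →
      Metric.ball y ε ∩ {z | inner ℝ ν (z - y) ∈ s} ⊆ interior P ∨
      Metric.ball y ε ∩ {z | inner ℝ ν (z - y) ∈ s} ⊆ Pᶜ := by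
    intro s hs h0
    refine subset_interior_or_compl hP (hconv s hs).isPreconnected (Set.disjoint_left.2 ?_)
    rintro z ⟨hz, hz'⟩ hzf
    rw [Set.mem_ofPred_eq, hball z hz hzf] at hz'
    exact h0 hz'
  -- The ray from `y` in direction `d` runs on this side and is outside `P`.
  have hneg : Metric.ball y ε ∩ {z | inner ℝ ν (z - y) ∈ Set.Iio 0} ⊆ Pᶜ := by
    refine (hside (Set.Iio 0) (convex_Iio 0) (by simp)).resolve_left fun h => ?_
    have hc : ContinuousAt (fun t : ℝ => y + t • d) 0 := by fun_prop
    have h1 : ∀ᶠ t : ℝ in 𝓝 0, y + t • d ∈ Metric.ball y ε :=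
      hc (by simpa using Metric.ball_mem_nhds y hε)
    obtain ⟨t, ht, ht0⟩ := ((h1.filter_mono nhdsWithin_le_nhds).and
      (self_mem_nhdsWithin : Set.Ioi 0 ∈ 𝓝[>] (0 : ℝ))).exists
    refine hout t ht0 (interior_subset (h ⟨ht, ?_⟩))
    simp only [Set.mem_ofPred_eq, add_sub_cancel_left, inner_smul_right, Set.mem_Iio]
    exact mul_neg_of_pos_of_neg ht0 hν
  -- By regularity there are interior points arbitrarily close to `y`; one of them off the plane
  -- must lie on this side.
  have hpos : Metric.ball y ε ∩ {z | inner ℝ ν (z - y) ∈ Set.Ioi 0} ⊆ interior P := by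
    refine (hside (Set.Ioi 0) (convex_Ioi 0) (by simp)).resolve_right fun h => ?_
    have hyc : y ∈ closure (interior P) := by rw [hreg]; exact hy
    obtain ⟨z, hzb, hzi⟩ := mem_closure_iff.1 hyc _ Metric.isOpen_ball (Metric.mem_ball_self hε)
    obtain ⟨x, ⟨hx1, hx2⟩, hx3⟩ := exists_forall_inner_ne {(ν, inner ℝ ν y)}
      (by
        intro s hs h0
        simp only [Finset.mem_singleton] at hs
        subst hs
        simp only at h0
        simp [h0] at hν) (Metric.isOpen_ball.inter isOpen_interior) ⟨z, hzb, hzi⟩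
    have hx4 : inner ℝ ν (x - y) ≠ 0 := by
      rw [inner_sub_right, sub_ne_zero]
      exact hx3 _ (Finset.mem_singleton_self _)
    rcases lt_or_gt_of_ne hx4 with h' | h'
    · exact hneg ⟨hx1, h'⟩ (interior_subset hx2)
    · exact h ⟨hx1, h'⟩ (interior_subset hx2)
  filter_upwards [Metric.ball_mem_nhds y hε] with z hz
  constructor
  · intro hzP
    by_contra hlt
    exact hneg ⟨hz, not_le.1 hlt⟩ hzP
  · intro h0
    rcases h0.eq_or_lt with h0 | h0
    · rw [← hP.closure_eq]
      have hc : Filter.Tendsto (fun t : ℝ => z + t • (-d)) (𝓝[>] 0) (𝓝 z) := by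
        have : ContinuousAt (fun t : ℝ => z + t • (-d)) 0 := by fun_prop
        have h2 : Filter.Tendsto (fun t : ℝ => z + t • (-d)) (𝓝 0) (𝓝 z) := by simpa using this.tendsto
        exact h2.mono_left nhdsWithin_le_nhds
      refine mem_closure_of_tendsto hc ?_
      filter_upwards [hc (Metric.isOpen_ball.mem_nhds hz), self_mem_nhdsWithin] with t ht ht0
      refine interior_subset (hpos ⟨ht, ?_⟩)
      have : z + t • (-d) - y = (z - y) + t • (-d) := by abel
      simp only [Set.mem_ofPred_eq, this, inner_add_right, ← h0, inner_smul_right, inner_neg_right,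
        Set.mem_Ioi]
      have ht0' : (0 : ℝ) < t := ht0
      nlinarith
    · exact interior_subset (hpos ⟨hz, h0⟩)

open Topology in
-- On a line in direction `d` through a generic interior point, the last point that belongs to `P`
-- exists by compactness. Genericity makes all the planes through it coincide and be transversal to
-- `d`, so the boundary near it is flat.
theorem IsPolyhedron.exists_inward_normal {P : Set E3} (hP : IsPolyhedron P) {d : E3} (hd : d ≠ 0) :
    ∃ y ν, IsInwardNormalAt P y ν ∧ inner ℝ ν d < 0 := by
  obtain ⟨H, hH, hfr⟩ := hP.planar
  have hcl : IsClosed P := hP.isCompact.isClosed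
  have hne : (interior P).Nonempty := by
    rw [← closure_nonempty_iff, hP.regular]; exact hP.nonempty
  obtain ⟨x, hx, htr⟩ := exists_transversal H hH d isOpen_interior hne
  let T : Set ℝ := {t | x + t • d ∈ P}
  have hTc : IsClosed T := hcl.preimage (by fun_prop)
  have hTb : BddAbove T := by
    obtain ⟨R, hR⟩ := hP.isCompact.isBounded.exists_norm_le
    refine ⟨(R + ‖x‖) / ‖d‖, fun t ht => ?_⟩
    rw [le_div_iff₀ (norm_pos_iff.2 hd)]
    calc t * ‖d‖ ≤ ‖t • d‖ := by rw [norm_smul]; gcongr; exact le_abs_self t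
      _ = ‖(x + t • d) - x‖ := by rw [add_sub_cancel_left]
      _ ≤ ‖x + t • d‖ + ‖x‖ := norm_sub_le _ _
      _ ≤ R + ‖x‖ := by gcongr; exact hR _ ht
  have hTn : T.Nonempty := ⟨0, by simpa [T] using interior_subset hx⟩
  have hs : sSup T ∈ T := hTc.csSup_mem hTn hTb
  set s := sSup T with hsdef
  have hout : ∀ t : ℝ, 0 < t → (x + s • d) + t • d ∉ P := by
    intro t ht hm
    have : s + t ∈ T := by
      simp only [T, Set.mem_ofPred_eq, add_smul, ← add_assoc]; exact hm
    have := le_csSup hTb this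
    linarith
  have hyf : x + s • d ∈ frontier P := by
    refine ⟨subset_closure hs, fun hi => ?_⟩
    have hc : ContinuousAt (fun t : ℝ => (x + s • d) + t • d) 0 := by fun_prop
    have h1 : ∀ᶠ t : ℝ in 𝓝 0, (x + s • d) + t • d ∈ interior P :=
      hc (by simpa using isOpen_interior.mem_nhds hi)
    obtain ⟨t, ht, ht0⟩ := ((h1.filter_mono nhdsWithin_le_nhds).and
      (self_mem_nhdsWithin : Set.Ioi 0 ∈ 𝓝[>] (0 : ℝ))).exists
    exact hout t ht0 (interior_subset ht)
  obtain ⟨h, hh, hyh⟩ : ∃ h ∈ H, inner ℝ h.1 (x + s • d) = h.2 := by simpa using hfr hyf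
  obtain ⟨h0, hsame⟩ := htr s h hh hyh
  -- The factor orients the normal of the plane against `d`.
  have hν : inner ℝ (-(inner ℝ h.1 d : ℝ) • h.1) d < 0 := by
    rw [inner_smul_left, conj_trivial]
    nlinarith [mul_self_pos.2 h0]
  refine ⟨x + s • d, _, isInwardNormalAt_of_planar hcl hP.regular hs hν ?_ hout, hν⟩
  have hev : ∀ᶠ z in 𝓝 (x + s • d), ∀ k ∈ H, inner ℝ k.1 z = k.2 →
      inner ℝ k.1 (x + s • d) = k.2 := by
    refine (Finset.eventually_all H).2 fun k _ => ?_
    by_cases hk : inner ℝ k.1 (x + s • d) = k.2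
    · exact Filter.Eventually.of_forall fun _ _ => hk
    · have hc : ContinuousAt (fun z : E3 => (inner ℝ k.1 z : ℝ)) (x + s • d) := by fun_prop
      filter_upwards [hc.eventually_ne hk] with z hz hz'
      exact absurd hz' hz
  filter_upwards [hev] with z hz hzf
  obtain ⟨k, hk, hzk⟩ : ∃ k ∈ H, inner ℝ k.1 z = k.2 := by simpa using hfr hzf
  have := (hsame k hk (hz k hk hzk) z).1 hzk
  rw [inner_smul_left, inner_sub_right, this, hyh]
  simp

/-! ### Valid pairs as solutions of linear inequalities -/

namespace Polyhedron

variable {n : ℕ} (P : Polyhedron n)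

theorem exists_mem_facet (i : Fin n) : ∃ x, x ∈ P.facet i := by
  obtain ⟨x, hx, h⟩ : P.facet i ∈ facets P.carrier := P.range_facet ▸ Set.mem_range_self i
  exact ⟨x, h ▸ mem_connectedComponentIn hx⟩

theorem normal_ne_zero (i : Fin n) : P.normal i ≠ 0 := by
  obtain ⟨x, hx⟩ := P.exists_mem_facet i
  exact (P.normal_spec i x hx).1

open Topology in
-- The normal at the exit point and the prescribed normal of the facet containing it describe the
-- same half-space near that point. Comparing the two descriptions along `d` transfers the sign.
theorem exists_inner_neg {d : E3} (hd : d ≠ 0) : ∃ i, inner ℝ d (P.normal i) < 0 := by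
  obtain ⟨y, ν, hν, hneg⟩ := P.isPolyhedron.exists_inward_normal hd
  have hy : y ∈ flatBoundary P.carrier := ⟨ν, hν⟩
  obtain ⟨i, hi⟩ : connectedComponentIn (flatBoundary P.carrier) y ∈ Set.range P.facet := by
    rw [P.range_facet]; exact ⟨y, hy, rfl⟩
  have hyi := P.normal_spec i y (hi ▸ mem_connectedComponentIn hy)
  refine ⟨i, ?_⟩
  have hc : ContinuousAt (fun t : ℝ => y + t • d) 0 := by fun_prop
  have hc' : Filter.Tendsto (fun t : ℝ => y + t • d) (𝓝[>] 0) (𝓝 y) := by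
    have : Filter.Tendsto (fun t : ℝ => y + t • d) (𝓝 0) (𝓝 y) := by simpa using hc.tendsto
    exact this.mono_left nhdsWithin_le_nhds
  obtain ⟨t, ⟨h1, h2⟩, ht⟩ := (((hc'.eventually hν.2).and (hc'.eventually hyi.2)).and
    (self_mem_nhdsWithin : Set.Ioi 0 ∈ 𝓝[>] (0 : ℝ))).exists
  have ht' : (0 : ℝ) < t := ht
  rw [add_sub_cancel_left, inner_smul_right] at h1 h2
  by_contra hge
  rw [real_inner_comm] at hge
  have := h1.1 (h2.2 (mul_nonneg ht'.le (not_lt.1 hge)))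
  nlinarith

/-- Allows bounds in n + 1 to be replaced by bounds in n, and keeps log n away from 0. -/
theorem two_le (P : Polyhedron n) : 2 ≤ n := by
  have hd : (EuclideanSpace.single 0 1 : E3) ≠ 0 := by simp
  obtain ⟨i, hi⟩ := P.exists_inner_neg hd
  obtain ⟨j, hj⟩ := P.exists_inner_neg (neg_ne_zero.2 hd)
  rw [inner_neg_left] at hj
  have hij : i ≠ j := by rintro rfl; linarith
  have := Fintype.one_lt_card_iff.2 ⟨i, j, hij⟩
  rwa [Fintype.card_fin] at this

/-- Some normal has a negative product with a nonzero `d`, and the inequalities leave only the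
normal number `i` for this role. -/
theorem isValidPair_iff {i : Fin n} {d : E3} :
    P.IsValidPair i d ↔ d ≠ 0 ∧ ∀ j, j ≠ i → 0 ≤ inner ℝ d (P.normal j) := by
  constructor
  · rintro ⟨h1, h2⟩
    exact ⟨fun h => by simp [h] at h1, h2⟩
  · rintro ⟨h1, h2⟩
    obtain ⟨j, hj⟩ := P.exists_inner_neg h1
    obtain rfl : j = i := by
      by_contra hji
      exact absurd (h2 j hji) (not_le.2 hj)
    exact ⟨hj, h2⟩

theorem isCoveringSet_of_trivial {S : Set (Fin n)}
    (h : ∀ d : E3, (∀ i ∈ S, 0 ≤ inner ℝ d (P.normal i)) → d = 0) : P.IsCoveringSet S := by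
  refine Set.Subset.antisymm (Set.iUnion₂_subset fun i _ d hd => hd.1) fun d hd => ?_
  by_contra hc
  simp only [Set.mem_iUnion, openHemisphere, Set.mem_ofPred_eq, not_exists, not_and, not_lt] at hc
  have := h d fun i hi => hc i hi hd
  simp [this] at hd

/-- If `i` were outside `S`, a valid direction for `i` would be a nonzero solution of all
constraints of `S`. -/
theorem IsValidTopFacet.mem_of_trivial {P : Polyhedron n} {S : Set (Fin n)}
    (h : ∀ d : E3, (∀ i ∈ S, 0 ≤ inner ℝ d (P.normal i)) → d = 0) {i : Fin n}
    (hi : P.IsValidTopFacet i) : i ∈ S := by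
  obtain ⟨d, h1, h2⟩ := hi
  by_contra hc
  have := h d fun j hj => h2 j (fun hji => hc (hji ▸ hj))
  simp [this] at h1

end Polyhedron


namespace RealRAM

/-! ### The driver: a covering set and the valid top facets -/

def copyCover : Cmd := forN 62 12 (.setNat 2 (nv 62) (.get 19 (nv 62))) ;; setN 1 12

/-- The twelve entries of the covering list may repeat. The marks in array 63 prevent a valid facet
from being listed twice. -/
def visit (emit : Cmd) : Cmd :=
  setN 10 (.get 2 (nv 60)) ;;
  .cond (.natLt (.get 63 (nv 10)) 1)
    (lp ;; .cond (.natLt 0 (nv 17)) (.setNat 63 (nv 10) 1 ;; emit) .skip) .skip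

/-- Compute a covering set and run `emit` for each valid top facet. -/
def driver (emit : Cmd) : Cmd :=
  (generic ;; setN 10 (nv 0) ;; lp) ;; copyCover ;; forN 60 12 (visit emit)

end RealRAM

/-! ### Correctness of the driver -/

namespace Polyhedron

open RealRAM

variable {n : ℕ} (P : Polyhedron n)

/-- The memory contains the input polyhedron and a vector that is orthogonal to no normal. -/
structure Loaded (σ : State) : Prop where
  size : σ.nat 0 0 = n
  normals : ∀ i : Fin n, σ.vec 0 i = P.normal i
  generic : ∀ j < n, σ.inp j 1 (σ.real 6 0) (σ.real 6 0 * σ.real 6 0) ≠ 0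

variable {P} in
theorem Loaded.congr {σ τ : State} (h : P.Loaded σ) (hn : τ.nat 0 = σ.nat 0)
    (hr : ∀ b ∈ [0, 1, 2, 6], τ.real b = σ.real b) : P.Loaded τ := by
  refine ⟨by rw [hn]; exact h.size, fun i => ?_, fun j hj => ?_⟩
  · rw [← h.normals i, State.vec, State.vec, hr 0 (by simp), hr (0 + 1) (by simp),
      hr (0 + 2) (by simp)]
  · have := h.generic j hj
    rwa [State.inp, hr 0 (by simp), hr 1 (by simp), hr 2 (by simp), hr 6 (by simp)]

variable {P} in
theorem inner_eq_inp {σ : State} (h : ∀ i : Fin n, σ.vec 0 i = P.normal i) (d : E3) (i : Fin n) :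
    inner ℝ d (P.normal i) = σ.inp i (d 0) (d 1) (d 2) := by
  rw [← h i, State.vec, State.inp, PiLp.inner_apply, Fin.sum_univ_three]
  simp

/-- The vector `(d0, d1, d2)` found by `lp`. -/
theorem isValidPair_of_decided {σ : State} (h : P.Loaded σ) {i : Fin n} (hi : σ.nat 10 0 = i)
    (hd : Decided n σ) (h17 : σ.nat 17 0 ≠ 0) : P.IsValidPair i (σ.vec 57 0) := by
  rcases hd with ⟨-, hne, hd⟩ | hd
  · rw [isValidPair_iff]
    refine ⟨fun h0 => ?_, fun j hj => ?_⟩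
    · have e : ∀ k : Fin 3, σ.vec 57 0 k = 0 := fun k => by rw [h0]; rfl
      have e0 := e 0
      have e1 := e 1
      have e2 := e 2
      simp [State.vec] at e0 e1 e2
      simp [e0, e1, e2] at hne
    · rw [inner_eq_inp h.normals]
      simpa [State.vec] using hd j j.2 (by rw [hi]; exact fun h => hj (Fin.ext h))
  · exact absurd hd.1 h17

theorem trivial_of_decided {σ : State} (h : P.Loaded σ) (hd : Decided n σ) (h17 : σ.nat 17 0 = 0)
    (d : E3) (hd' : ∀ i ∈ {i : Fin n | ∃ k < 12, σ.nat 19 k = i}, 0 ≤ inner ℝ d (P.normal i)) :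
    d = 0 := by
  rcases hd with hd | ⟨-, h1, h2⟩
  · omega
  · obtain ⟨e0, e1, e2⟩ := h2 (d 0) (d 1) (d 2) fun k hk => by
      have := hd' ⟨_, (h1 k hk).1⟩ ⟨k, hk, rfl⟩
      rwa [inner_eq_inp h.normals] at this
    ext k
    fin_cases k <;> assumption

/-- The command `emit` appends the facet number `nv 10` to the list of valid top facets. -/
structure Emits (emit : Cmd) (Good : State → Prop) (T : ℕ) : Prop where
  natW : ∀ b ∈ [0, 1, 2, 10, 60, 63], b ∉ emit.natW
  realW : ∀ b ∈ [0, 1, 2, 6], b ∉ emit.realW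
  stable : ∀ σ τ : State, (∀ b ∈ [3, 4, 5, 6, 64], τ.nat b = σ.nat b) →
    (∀ b ∈ [3, 4, 5], τ.real b = σ.real b) → Good σ → Good τ
  init : ∀ σ, σ.nat 3 0 = 0 → Good σ
  run : ∀ σ, P.Loaded σ → Good σ → ∀ i : Fin n, σ.nat 10 0 = i → P.IsValidPair i (σ.vec 57 0) →
    Run emit σ T (fun τ => Good τ ∧ τ.nat 3 0 = σ.nat 3 0 + 1 ∧
      τ.nat 4 = Function.update (σ.nat 4) (σ.nat 3 0) i)

/-- The state of the driver after the visit of `c` elements of the covering set `e`. -/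
structure Visited (Good : State → Prop) (e : ℕ → ℕ) (c : ℕ) (σ : State) : Prop where
  loaded : P.Loaded σ
  counter : σ.nat 60 0 = c
  cover : (∀ k < 12, σ.nat 2 k = e k) ∧ σ.nat 1 0 = 12
  good : Good σ
  marked : ∀ j, σ.nat 63 j = 0 ↔ ¬ ∃ k < σ.nat 3 0, σ.nat 4 k = j
  lt : ∀ k < σ.nat 3 0, σ.nat 4 k < n
  inj : ∀ k < σ.nat 3 0, ∀ l < σ.nat 3 0, σ.nat 4 k = σ.nat 4 l → k = l
  valid : ∀ i : Fin n, (∃ k < σ.nat 3 0, σ.nat 4 k = i) ↔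
    P.IsValidTopFacet i ∧ ∃ k < c, e k = i

theorem visit_run : ∃ C : ℕ, ∀ (n : ℕ) (P : Polyhedron n) (emit : Cmd) (Good : State → Prop)
    (A m : ℕ), n + 1 ≤ m → P.Emits emit Good (A * m) → ∀ (e : ℕ → ℕ), (∀ k < 12, e k < n) →
    ∀ c < 12, ∀ σ : State, P.Visited Good e c σ → Run (visit emit) σ ((C + A) * m)
      (fun τ => P.Visited Good e (c + 1) (τ.setNat 60 0 (τ.nat 60 0 + 1))) := by
  obtain ⟨C, hC⟩ := lp_run
  obtain ⟨B, hB⟩ : ∃ B, B = (setN 10 (.get 2 (nv 60))).bound +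
    (BExp.natLt (.get 63 (nv 10)) 1).cost + (BExp.natLt 0 (nv 17)).cost +
    (Cmd.setNat 63 (nv 10) 1).bound + 10 := ⟨_, rfl⟩
  refine ⟨C + B, fun n P emit Good A m hm hemit e he c hc σ h => ?_⟩
  have hm0 : 0 < m := by omega
  obtain ⟨i, hi⟩ : ∃ i : Fin n, e c = i := ⟨⟨e c, he c hc⟩, rfl⟩
  -- This covers all cases in which the visit emits nothing.
  have hkeep : ∀ τ : State, P.Loaded τ → (∀ b ∈ [1, 2, 3, 4, 5, 6, 60, 63, 64], τ.nat b = σ.nat b) →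
      (∀ b ∈ [3, 4, 5], τ.real b = σ.real b) →
      (P.IsValidTopFacet i ↔ ∃ k < σ.nat 3 0, σ.nat 4 k = i) →
      P.Visited Good e (c + 1) (τ.setNat 60 0 (τ.nat 60 0 + 1)) := by
    intro τ hl hn hr hv
    have e3 : ((τ.setNat 60 0 (τ.nat 60 0 + 1)).nat 3) = σ.nat 3 := by simp [hn]
    have e4 : ((τ.setNat 60 0 (τ.nat 60 0 + 1)).nat 4) = σ.nat 4 := by simp [hn]
    have e63 : ((τ.setNat 60 0 (τ.nat 60 0 + 1)).nat 63) = σ.nat 63 := by simp [hn]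
    refine ⟨hl.congr (by simp) (fun b _ => rfl), by simp [hn, h.counter], ?_, ?_, ?_, ?_, ?_, ?_⟩
    · simpa [hn] using h.cover
    · refine hemit.stable σ _ (fun b hb => ?_) (fun b hb => hr b hb) h.good
      rw [State.setNat_nat_ne _ _ _ (by rintro rfl; simp at hb)]
      exact hn b (by simp only [List.mem_cons, List.not_mem_nil, or_false] at hb ⊢; omega)
    · rw [e3, e4, e63]; exact h.marked
    · rw [e3, e4]; exact h.lt
    · rw [e3, e4]; exact h.inj
    · intro j
      rw [e3, e4, h.valid j]
      refine and_congr_right fun hj => ⟨fun ⟨k, hk, hkj⟩ => ⟨k, by omega, hkj⟩, ?_⟩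
      rintro ⟨k, hk, hkj⟩
      rcases Nat.lt_succ_iff_lt_or_eq.1 hk with hk | rfl
      · exact ⟨k, hk, hkj⟩
      · obtain rfl : i = j := Fin.ext (hi.symm.trans hkj)
        exact ((h.valid i).1 (hv.1 hj)).2
  have hcost : ((setN 10 (.get 2 (nv 60))).bound + ((BExp.natLt (.get 63 (nv 10)) 1).cost + 1 +
      (C + ((BExp.natLt 0 (nv 17)).cost + 1 + ((Cmd.setNat 63 (nv 10) 1).bound + A +
        Cmd.skip.bound)) + Cmd.skip.bound))) * m ≤ (C + B + A) * m := by
    refine Nat.mul_le_mul_right _ ?_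
    simp only [hB, Cmd.bound]
    omega
  refine (Run.seqL (Run.simpleL rfl hm0 rfl) ?_).mono hcost fun _ => id
  rintro τ rfl
  set τ := (setN 10 (.get 2 (nv 60))).den σ with hτ
  have hτn : ∀ b, b ≠ 10 → τ.nat b = σ.nat b := fun b hb => State.setNat_nat_ne _ _ _ hb
  have hτr : τ.real = σ.real := rfl
  have hτi : τ.nat 10 0 = i := by simp [hτ, h.counter, h.cover.1 c hc, hi]
  have hτl : P.Loaded τ := h.loaded.congr (hτn _ (by decide)) fun _ _ => by rw [hτr]
  apply Run.condL hm0
  · intro hb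
    simp only [holds_natLt, eval_natGet, eval_nv, hτi, eval_ofNat] at hb
    have hnew := (h.marked i).1 (by rw [← hτn 63 (by decide)]; omega)
    refine Run.seqL ((hC τ n hτl.size hτl.generic).mono (Nat.mul_le_mul_left _ hm)
      fun _ => id).frame ?_
    rintro ρ ⟨hd, hf⟩
    have hρn : ∀ b ∈ [0, 1, 2, 3, 4, 5, 6, 60, 63, 64], ρ.nat b = σ.nat b := fun b hb => by
      rw [hf.1 b (by revert b; decide), hτn b (by rintro rfl; simp at hb)]
    have hρr : ∀ b ∈ [0, 1, 2, 3, 4, 5, 6], ρ.real b = σ.real b := fun b hb => by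
      rw [hf.2 b (by revert b; decide), hτr]
    have hρi : ρ.nat 10 0 = i := by rw [hf.1 10 (by decide), hτi]
    have hρl : P.Loaded ρ := h.loaded.congr (hρn 0 (by simp)) fun b hb =>
      hρr b (by revert b; decide)
    apply Run.condL hm0
    · intro hb
      simp only [holds_natLt, eval_nv, eval_ofNat] at hb
      have hvalid := P.isValidPair_of_decided hρl hρi hd (by omega)
      refine Run.seqL (Run.simpleL rfl hm0 rfl) ?_
      rintro κ rfl
      set κ := (Cmd.setNat 63 (nv 10) 1).den ρ with hκ
      have hκn : ∀ b, b ≠ 63 → κ.nat b = ρ.nat b := fun b hb => State.setNat_nat_ne _ _ _ hb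
      have hκl : P.Loaded κ := hρl.congr (hκn 0 (by decide)) fun b _ => rfl
      have hκg : Good κ := hemit.stable σ κ
        (fun b hb => by rw [hκn b (by rintro rfl; simp at hb),
          hρn b (by revert b; decide)]) (fun b hb => hρr b (by revert b; decide)) h.good
      refine (hemit.run κ hκl hκg i (by rw [hκn 10 (by decide), hρi]) hvalid).frame.mono le_rfl ?_
      rintro ω ⟨⟨hg, h3, h4⟩, hω⟩
      have hωn : ∀ b ∈ [0, 1, 2, 10, 60, 63], ω.nat b = κ.nat b := fun b hb =>
        hω.1 b (hemit.natW b hb)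
      rw [hκn 3 (by decide), hρn 3 (by simp)] at h3 h4
      rw [hκn 4 (by decide), hρn 4 (by simp)] at h4
      have e3 : (ω.setNat 60 0 (ω.nat 60 0 + 1)).nat 3 0 = σ.nat 3 0 + 1 := by simp [h3]
      have e4 : (ω.setNat 60 0 (ω.nat 60 0 + 1)).nat 4 =
        Function.update (σ.nat 4) (σ.nat 3 0) i := by simp [h4]
      have e63 : (ω.setNat 60 0 (ω.nat 60 0 + 1)).nat 63 = Function.update (σ.nat 63) i 1 := by
        rw [State.setNat_nat_ne _ _ _ (by decide), hωn 63 (by simp), hκ, ← hρn 63 (by simp)]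
        simp [hρi]
      have hmem : ∀ j, (∃ k < σ.nat 3 0 + 1, Function.update (σ.nat 4) (σ.nat 3 0) i k = j) ↔
          (∃ k < σ.nat 3 0, σ.nat 4 k = j) ∨ j = i := by
        intro j
        constructor
        · rintro ⟨k, hk, rfl⟩
          rcases Nat.lt_succ_iff_lt_or_eq.1 hk with hk | rfl
          · exact Or.inl ⟨k, hk, by rw [Function.update_of_ne (by omega)]⟩
          · right; simp
        · rintro (⟨k, hk, rfl⟩ | rfl)
          · exact ⟨k, by omega, by rw [Function.update_of_ne (by omega)]⟩
          · exact ⟨σ.nat 3 0, by omega, by simp⟩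
      refine ⟨?_, ?_, ?_, ?_, ?_, ?_, ?_, ?_⟩
      · refine hκl.congr ?_ fun b hb => hω.2 b (hemit.realW b hb)
        rw [State.setNat_nat_ne _ _ _ (by decide), hωn 0 (by simp)]
      · simp [hωn, hκn, hρn, h.counter]
      · simpa [hωn, hκn, hρn] using h.cover
      · refine hemit.stable ω _ (fun b hb => ?_) (fun b hb => rfl) hg
        rw [State.setNat_nat_ne _ _ _ (by rintro rfl; simp at hb)]
      · intro j
        rw [e3, e4, e63, hmem]
        by_cases hj : j = i
        · simp [hj]
        · rw [Function.update_of_ne hj, h.marked j]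
          simp [hj]
      · rw [e3, e4]
        intro k hk
        rcases Nat.lt_succ_iff_lt_or_eq.1 hk with hk | rfl
        · rw [Function.update_of_ne (by omega)]; exact h.lt k hk
        · simp
      · rw [e3, e4]
        intro k hk l hl hkl
        have hno : ∀ k < σ.nat 3 0, σ.nat 4 k ≠ i := fun k hk hki => hnew ⟨k, hk, hki⟩
        rcases Nat.lt_succ_iff_lt_or_eq.1 hk with hk | rfl <;>
          rcases Nat.lt_succ_iff_lt_or_eq.1 hl with hl | rfl
        · rw [Function.update_of_ne (by omega), Function.update_of_ne (by omega)] at hkl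
          exact h.inj k hk l hl hkl
        · rw [Function.update_of_ne (by omega), Function.update_self] at hkl
          exact absurd hkl (hno k hk)
        · rw [Function.update_self, Function.update_of_ne (by omega)] at hkl
          exact absurd hkl.symm (hno l hl)
        · rfl
      · intro j
        rw [e3, e4, hmem, h.valid j]
        constructor
        · rintro (⟨hj, k, hk, hkj⟩ | hj)
          · exact ⟨hj, k, by omega, hkj⟩
          · obtain rfl := Fin.ext hj
            exact ⟨⟨_, hvalid⟩, c, by omega, hi⟩
        · rintro ⟨hj, k, hk, hkj⟩
          rcases Nat.lt_succ_iff_lt_or_eq.1 hk with hk | rfl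
          · exact Or.inl ⟨hj, k, hk, hkj⟩
          · right; rw [← hkj, hi]
    · intro hb
      simp only [holds_natLt, eval_nv, eval_ofNat] at hb
      refine Run.simpleL rfl hm0 (hkeep ρ hρl (fun b hb => hρn b (by revert b; decide))
        (fun b hb => hρr b (by revert b; decide)) ⟨fun hv => ?_, fun hv => absurd hv hnew⟩)
      have h17 : ρ.nat 17 0 = 0 := by omega
      -- A valid top facet must belong to every set of constraints with only the trivial solution,
      -- but the skipped index is not among the twelve returned.
      obtain ⟨k, hk, hki⟩ := hv.mem_of_trivial (P.trivial_of_decided hρl hd h17)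
      rcases hd with hd | hd
      · omega
      · exact absurd (hki.trans hρi.symm) (hd.2.1 k hk).2
  · intro hb
    simp only [holds_natLt, eval_natGet, eval_nv, hτi, eval_ofNat] at hb
    have hold := (not_iff_not.2 (h.marked i)).1 (by rw [← hτn 63 (by decide)]; omega)
    rw [not_not] at hold
    refine Run.simpleL rfl hm0 (hkeep τ hτl (fun b hb => hτn b (by rintro rfl; simp at hb))
      (fun b hb => by rw [hτr]) ⟨fun _ => hold, fun hv => ((h.valid i).1 hv).1⟩)

end Polyhedron


/-! ### The covering set and the list of valid top facets -/

namespace Polyhedron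

open RealRAM

variable {n : ℕ} (P : Polyhedron n)

theorem vec_input (i : Fin n) : P.input.vec 0 i = P.normal i := by
  ext k
  fin_cases k <;> simp [State.vec, input]

/-- Skipping the index `n` skips nothing, and the full system has no nonzero solution by
`exists_inner_neg`, so the first call of `lp` must return twelve constraints. The factor 13 is the
twelve visits plus the extra iteration charged by the rule for loops. -/
theorem driver_run : ∃ C : ℕ, ∀ (n : ℕ) (P : Polyhedron n) (emit : Cmd) (Good : State → Prop)
    (A m : ℕ), n + 1 ≤ m → P.Emits emit Good (A * m) →
    Run (driver emit) P.input ((C + 13 * A) * m)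
      (fun τ => P.OutputsCoveringSet τ ∧ P.OutputsValidTopFacets τ ∧ Good τ) := by
  obtain ⟨G, hG⟩ := generic_run
  obtain ⟨L, hL⟩ := lp_run
  obtain ⟨V, hV⟩ := visit_run
  obtain ⟨B, hB⟩ : ∃ B, B = (setN 10 (nv 0)).bound := ⟨_, rfl⟩
  obtain ⟨F, hF⟩ : ∃ F, F = forCost 62 12 (Cmd.setNat 2 (nv 62) (.get 19 (nv 62))).bound * 13 :=
    ⟨_, rfl⟩
  obtain ⟨D, hD⟩ : ∃ D, D = (setN 60 0).bound + ((setN 60 (nv 60 + 1)).bound +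
    (BExp.natLt (nv 60) 12).cost + 1) * 13 := ⟨_, rfl⟩
  refine ⟨G + (B + L) + (F + (setN 1 12).bound + (D + V * 13)), ?_⟩
  intro n P emit Good A m hm hemit
  have hm0 : 0 < m := by omega
  have hin0 : P.input.nat 0 0 = n := by simp [input]
  have hcost : ((G + (B + L)) + ((F + (setN 1 12).bound) + (D + (V + A) * 13))) * m ≤
      (G + (B + L) + (F + (setN 1 12).bound + (D + V * 13)) + 13 * A) * m :=
    Nat.mul_le_mul_right _ (by ring_nf; rfl)
  refine (Run.seqL (Run.seqL ((hG P.input n hin0 ?_).mono (Nat.mul_le_mul_left _ hm)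
    fun _ => id).frame ?_ (K' := B + L) (Q' := fun τ => P.Loaded τ ∧ Decided n τ ∧
      τ.nat 17 0 = 0 ∧ τ.nat 3 0 = 0 ∧ τ.nat 63 = 0)) ?_).mono hcost fun _ => id
  · intro j hj
    have := P.normal_ne_zero ⟨j, hj⟩
    by_contra hc
    push Not at hc
    simp only [input, hj] at hc
    apply this
    ext k
    fin_cases k
    exacts [by simpa using hc.1, by simpa using hc.2.1, by simpa using hc.2.2]
  · rintro τ ⟨hg, hf⟩
    rw [hB]
    refine Run.seqL (Run.simpleL rfl hm0 rfl) ?_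
    rintro ρ rfl
    set ρ := (setN 10 (nv 0)).den τ with hρ
    have hρn : ∀ b, b ≠ 10 → ρ.nat b = τ.nat b := fun b hb => State.setNat_nat_ne _ _ _ hb
    have h0 : ρ.nat 0 0 = n := by
      rw [hρn 0 (by decide), hf.1 0 (by decide)]; exact hin0
    have hl : P.Loaded ρ := by
      refine ⟨h0, fun i => ?_, hg⟩
      rw [← P.vec_input i, State.vec, State.vec]
      show !₂[τ.real 0 i, τ.real 1 i, τ.real 2 i] = _
      rw [hf.2 0 (by decide), hf.2 1 (by decide), hf.2 2 (by decide)]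
    refine ((hL ρ n h0 hg).mono (Nat.mul_le_mul_left _ hm) fun _ => id).frame.mono le_rfl ?_
    rintro κ ⟨hd, hk⟩
    have hκl : P.Loaded κ := hl.congr (hk.1 0 (by decide)) fun b hb => hk.2 b (by
      revert b; decide)
    have h10 : κ.nat 10 0 = n := by
      rw [hk.1 10 (by decide)]
      simpa [hρ] using (hf.1 0 (by decide) ▸ hin0 : τ.nat 0 0 = n)
    refine ⟨hκl, hd, ?_, ?_, ?_⟩
    · rcases hd with ⟨-, hne, hd⟩ | hd
      · exfalso
        have h1 : κ.vec 57 0 ≠ 0 := by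
          intro h0
          have e : ∀ k : Fin 3, κ.vec 57 0 k = 0 := fun k => by rw [h0]; rfl
          have e0 := e 0
          have e1 := e 1
          have e2 := e 2
          simp [State.vec] at e0 e1 e2
          simp [e0, e1, e2] at hne
        obtain ⟨i, hi⟩ := P.exists_inner_neg h1
        rw [inner_eq_inp hκl.normals] at hi
        have := hd i i.2 (by rw [h10]; exact i.2.ne)
        simp [State.vec] at hi
        linarith
      · exact hd.1
    · rw [hk.1 3 (by decide), hρn 3 (by decide), hf.1 3 (by decide)]
      simp [input]
    · rw [hk.1 63 (by decide), hρn 63 (by decide), hf.1 63 (by decide)]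
      funext i
      simp [input]
  · rintro τ ⟨hl, hd, h17, h3, h63⟩
    have he : ∀ k < 12, τ.nat 19 k < n := fun k hk => by
      rcases hd with hd | hd
      · omega
      · exact (hd.2.1 k hk).1
    have htriv := P.trivial_of_decided hl hd h17
    refine Run.seqL (Q := fun ρ => (∀ k < 12, ρ.nat 2 k = τ.nat 19 k) ∧ ρ.nat 1 0 = 12 ∧
      ∀ b ∈ [0, 3, 63], ρ.nat b = τ.nat b ∧ ρ.real = τ.real) (Run.seqL (K := F) (Q := fun ρ =>
      (∀ k < 12, ρ.nat 2 k = τ.nat 19 k) ∧ ∀ b ∈ [0, 3, 63], ρ.nat b = τ.nat b ∧ ρ.real = τ.real)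
        ?_ ?_) ?_
    · refine (Run.forN_simple rfl (fun c ρ => ρ.nat 62 0 = c ∧ ρ.nat 19 = τ.nat 19 ∧
        (∀ k < c, ρ.nat 2 k = τ.nat 19 k) ∧ ∀ b ∈ [0, 3, 63], ρ.nat b = τ.nat b ∧
          ρ.real = τ.real) 12 ?_ ?_ ?_).mono ?_ ?_
      · simp
      · exact fun i ρ h => ⟨h.1, rfl⟩
      · rintro c ρ hc ⟨g1, g2, g3, g4⟩
        refine ⟨by simp [g1], by simp [g2], fun k hk => ?_, fun b hb => ?_⟩
        · simp only [den_setNat, eval_nv, g1, eval_natGet, g2]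
          rw [State.setNat_nat_ne _ _ _ (by decide), State.setNat_nat_same]
          rcases Nat.lt_succ_iff_lt_or_eq.1 hk with hk | rfl
          · rw [Function.update_of_ne (by omega), g3 k hk]
          · simp
        · refine ⟨?_, (g4 b hb).2⟩
          rw [den_setNat, State.setNat_nat_ne _ _ _ (by rintro rfl; simp at hb),
            State.setNat_nat_ne _ _ _ (by rintro rfl; simp at hb), (g4 b hb).1]
      · rw [hF]; exact Nat.le_mul_of_pos_right _ hm0
      · exact fun ρ h => h.2.2
    · rintro ρ ⟨g1, g2⟩
      refine Run.simpleL rfl hm0 ⟨by simpa using g1, by simp, fun b hb => ⟨?_, (g2 b hb).2⟩⟩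
      rw [den_setN, State.setNat_nat_ne _ _ _ (by rintro rfl; simp at hb), (g2 b hb).1]
    · rintro ρ ⟨g1, g2, g3⟩
      have e3 : ρ.nat 3 0 = 0 := by rw [(g3 3 (by simp)).1, h3]
      refine (Run.forN (I := fun c ρ => P.Visited Good (τ.nat 19) c ρ) 12 ((V + A) * m)
        ?_ ?_ ?_).mono ?_ ?_
      · refine ⟨hl.congr ?_ fun b _ => ?_, by simp, by simpa using ⟨g1, g2⟩, ?_, ?_, ?_, ?_, ?_⟩
        · rw [State.setNat_nat_ne _ _ _ (by decide), (g3 0 (by simp)).1]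
        · rw [State.setNat_real, (g3 0 (by simp)).2]
        · exact hemit.init _ (by simp [e3])
        · intro j
          simp [(g3 63 (by simp)).1, h63, e3]
        · simp [e3]
        · simp [e3]
        · intro i
          simp [e3]
      · exact fun c κ h => ⟨h.counter, rfl⟩
      · exact fun c κ hc h => hV n P emit Good A m hm hemit _ he c hc κ h
      · have h1 := Nat.le_mul_of_pos_right D hm0
        calc _ = D + (V + A) * m * 13 := by rw [hD]; ring
          _ ≤ D * m + (V + A) * m * 13 := by omega
          _ = _ := by ring
      · intro κ hκ
        have hS : {i : Fin n | ∃ k < κ.nat 1 0, κ.nat 2 k = (i : ℕ)} =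
            {i : Fin n | ∃ k < 12, τ.nat 19 k = (i : ℕ)} := by
          ext i
          rw [Set.mem_ofPred_eq, Set.mem_ofPred_eq, hκ.cover.2]
          refine exists_congr fun k => and_congr_right fun hk => ?_
          rw [hκ.cover.1 k hk]
        refine ⟨⟨hκ.cover.2.le, fun k hk => ?_, ?_⟩, ⟨hκ.inj, hκ.lt, fun i => ?_⟩, hκ.good⟩
        · rw [hκ.cover.2] at hk
          rw [hκ.cover.1 k hk]; exact he k hk
        · rw [hS]; exact P.isCoveringSet_of_trivial htriv
        · rw [hκ.valid i]
          exact ⟨fun h => ⟨h, h.mem_of_trivial htriv⟩, fun h => h.1⟩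

end Polyhedron

/-! ### All facets, single direction -/

namespace RealRAM

def emitDirection : Cmd :=
  .setReal 3 (nv 3) (rv 57) ;; .setReal 4 (nv 3) (rv 58) ;; .setReal 5 (nv 3) (rv 59) ;;
  .setNat 4 (nv 3) (nv 10) ;; setN 3 (nv 3 + 1)

end RealRAM

namespace Polyhedron

open RealRAM

theorem emits_direction {n : ℕ} (P : Polyhedron n) {m : ℕ} (hm : 0 < m) :
    P.Emits emitDirection (fun σ => ∀ k < σ.nat 3 0, ∀ i : Fin n, σ.nat 4 k = (i : ℕ) →
      P.IsValidPair i (σ.vec 3 k)) (emitDirection.bound * m) := by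
  refine ⟨by decide, by decide, fun σ τ hn hr h => ?_, fun σ h3 k hk => by omega, ?_⟩
  · simp only [State.vec, hn 3 (by simp), hn 4 (by simp), hr 3 (by simp), hr (3 + 1) (by simp),
      hr (3 + 2) (by simp)]
    exact h
  · intro σ hl hg i hi hd
    refine Run.simpleL rfl hm ⟨?_, by simp [emitDirection], by simp [emitDirection, hi]⟩
    intro k hk j hj
    simp only [emitDirection, den_seq, den_setReal, den_setNat, den_setN, eval_nv,
      eval_rv, State.setReal_nat, eval_natAdd, eval_ofNat] at hk hj ⊢
    simp [hi] at hk hj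
    rcases hk.lt_or_eq with hk | rfl
    · rw [Function.update_of_ne (by omega)] at hj
      have := hg k hk j hj
      simpa [State.vec, Function.update_of_ne (show k ≠ σ.nat 3 0 by omega)] using this
    · rw [Function.update_self] at hj
      obtain rfl := Fin.ext hj
      simpa [State.vec] using hd

theorem exists_program_allFSD : ∃ (p : Program) (C : ℕ), ∀ (n : ℕ) (P : Polyhedron n),
    ∃ (t : ℕ) (σ : State), p.Runs P.input t σ ∧ t ≤ C * n ∧
      P.OutputsCoveringSet σ ∧ P.OutputsAllFSD σ := by
  obtain ⟨C, hC⟩ := driver_run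
  refine ⟨⟨[], driver emitDirection⟩, (C + 13 * emitDirection.bound) * 2, fun n P => ?_⟩
  obtain ⟨t, ht, σ, h, h1, h2, h3⟩ := hC n P emitDirection _ _ (n + 1) le_rfl
    (P.emits_direction (Nat.succ_pos n))
  refine ⟨t, σ, h, ht.trans ?_, h1, h2, h3⟩
  have := P.two_le
  rw [Nat.mul_assoc]
  exact Nat.mul_le_mul_left _ (by omega)

end Polyhedron


/-! ### Boundary descriptions of cones -/

/-- The determinant of three vectors. -/
noncomputable def det3 (u v w : E3) : ℝ := Matrix.det (Matrix.of ![⇑u, ⇑v, ⇑w])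

theorem det3_eq (u v w : E3) : det3 u v w = u 0 * v 1 * w 2 - u 0 * v 2 * w 1 - u 1 * v 0 * w 2 +
    u 1 * v 2 * w 0 + u 2 * v 0 * w 1 - u 2 * v 1 * w 0 := by
  simp [det3, Matrix.det_fin_three]

/-- The determinant as a linear function of the third vector. -/
noncomputable def det3Lin (u v : E3) : E3 →ₗ[ℝ] ℝ where
  toFun := det3 u v
  map_add' x y := by simp only [det3_eq, PiLp.add_apply]; ring
  map_smul' c x := by simp only [det3_eq, PiLp.smul_apply, smul_eq_mul, RingHom.id_apply]; ring

/-- The linear function det(v_{k-1}, v_k, ·) + det(v_k, v_{k+1}, ·) vanishes at v_k and is positive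
at all the other vectors. If v_k were a nonnegative combination of the others, all coefficients
would vanish and v_k would be 0, which the determinants exclude. At least three vectors are needed
for the two neighbours of v_k to differ. -/
theorem irredundant_of_cyclic {c : ℕ} (hc : 3 ≤ c) {v : Fin c → E3}
    (h : ∀ k k' l : Fin c, (k' : ℕ) = ((k : ℕ) + 1) % c → l ≠ k → l ≠ k' →
      0 < det3 (v k) (v k') (v l)) (k : Fin c) :
    ¬ ∃ a : Fin c → ℝ, (∀ l, 0 ≤ a l) ∧ a k = 0 ∧ v k = ∑ l, a l • v l := by
  rintro ⟨a, ha, hak, hv⟩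
  obtain ⟨p, hp, hpk⟩ : ∃ p : Fin c, (k : ℕ) = ((p : ℕ) + 1) % c ∧
      ((k : ℕ) = p + 1 ∨ ((k : ℕ) = 0 ∧ (p : ℕ) + 1 = c)) := by
    by_cases hk : (k : ℕ) = 0
    · refine ⟨⟨c - 1, by omega⟩, ?_, Or.inr ⟨hk, by simp; omega⟩⟩
      simp only [Nat.sub_add_cancel (show 1 ≤ c by omega), Nat.mod_self]
      exact hk
    · refine ⟨⟨k - 1, by omega⟩, ?_, Or.inl (by simp; omega)⟩
      simp only [Nat.sub_add_cancel (show 1 ≤ (k : ℕ) by omega), Nat.mod_eq_of_lt k.2]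
  obtain ⟨s, hs, hsk⟩ : ∃ s : Fin c, (s : ℕ) = ((k : ℕ) + 1) % c ∧
      ((s : ℕ) = k + 1 ∨ ((s : ℕ) = 0 ∧ (k : ℕ) + 1 = c)) := by
    by_cases hk : (k : ℕ) + 1 = c
    · exact ⟨⟨0, by omega⟩, by simp [hk], Or.inr ⟨rfl, hk⟩⟩
    · exact ⟨⟨k + 1, by omega⟩, (Nat.mod_eq_of_lt (by omega)).symm, Or.inl rfl⟩
  have hps : p ≠ s := fun h => by
    have := congrArg Fin.val h
    omega
  have hpk' : p ≠ k := fun h => by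
    have := congrArg Fin.val h
    omega
  have hsk' : s ≠ k := fun h => by
    have := congrArg Fin.val h
    omega
  let F : E3 →ₗ[ℝ] ℝ := det3Lin (v p) (v k) + det3Lin (v k) (v s)
  have hF : ∀ w, F w = det3 (v p) (v k) w + det3 (v k) (v s) w := fun w => rfl
  have hFk : F (v k) = 0 := by rw [hF]; simp only [det3_eq]; ring
  have hpos : ∀ l, l ≠ k → 0 < F (v l) := by
    intro l hl
    rw [hF]
    by_cases h1 : l = p
    · subst h1
      have := h k s l hs hl hps
      have h0 : det3 (v l) (v k) (v l) = 0 := by simp only [det3_eq]; ring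
      linarith
    · by_cases h2 : l = s
      · subst h2
        have := h p k l hp h1 hl
        have h0 : det3 (v k) (v l) (v l) = 0 := by simp only [det3_eq]; ring
        linarith
      · exact add_pos (h p k l hp h1 hl) (h k s l hs hl h2)
  have hsum : ∑ l, a l * F (v l) = 0 := by
    rw [← hFk]
    conv_rhs => rw [hv, map_sum]
    simp
  have hnn : ∀ l, 0 ≤ a l * F (v l) := fun l => by
    by_cases hl : l = k
    · simp [hl, hFk]
    · exact mul_nonneg (ha l) (hpos l hl).le
  have hzero : ∀ l, a l = 0 := fun l => by
    by_cases hl : l = k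
    · rw [hl, hak]
    · have := (Finset.sum_eq_zero_iff_of_nonneg fun l _ => hnn l).1 hsum l (Finset.mem_univ l)
      exact (mul_eq_zero.1 this).resolve_right (hpos l hl).ne'
  have hvk : v k = 0 := by rw [hv]; simp [hzero]
  have := hpos p hpk'
  rw [hF, hvk] at this
  simp [det3_eq] at this

theorem exists_between_consecutive {z : ℕ → ℝ} {h : ℕ} {x : ℝ} (h0 : z 0 ≤ x) (hx : x ≤ z h) (hpos : 0 < h) :
    ∃ r < h, z r ≤ x ∧ x ≤ z (r + 1) := by
  induction h with
  | zero => omega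
  | succ h ih =>
    by_cases hh : z h ≤ x
    · exact ⟨h, by omega, hh, hx⟩
    · rcases Nat.eq_zero_or_pos h with rfl | hp
      · exact absurd h0 hh
      · obtain ⟨r, hr, h1⟩ := ih (not_le.1 hh).le hp
        exact ⟨r, by omega, h1⟩

/-- The linear functions `α r + β r * x` form a strictly concave chain with the breakpoints
`z 1, …, z (h - 1)` over the interval from `z 0` to `z h`. -/
structure Chain (α β z : ℕ → ℝ) (h : ℕ) : Prop where
  lt : ∀ r < h, z r < z (r + 1)
  cont : ∀ r < h, α r + β r * z (r + 1) = α (r + 1) + β (r + 1) * z (r + 1)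
  anti : ∀ r, r + 1 < h → β (r + 1) < β r

namespace Chain

variable {α β z : ℕ → ℝ} {h : ℕ} (H : Chain α β z h)
include H

theorem strictMono {r s : ℕ} (hrs : r < s) (hs : s ≤ h) : z r < z s := by
  induction s, hrs using Nat.le_induction with
  | base => exact H.lt r (by omega)
  | succ s hrs ih => exact (ih (by omega)).trans (H.lt s (by omega))

theorem mono {r s : ℕ} (hrs : r ≤ s) (hs : s ≤ h) : z r ≤ z s := by
  rcases hrs.eq_or_lt with rfl | hrs
  exacts [le_rfl, (H.strictMono hrs hs).le]

/-- A line of a strictly concave chain lies above the chain outside its own interval. The induction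
passes from line s to line s + 1, which agrees with it at a point further to the right and has a
smaller slope. `lt_of_succ_lt` is the same on the other side. -/
theorem lt_of_lt {r s : ℕ} (hrs : r < s) (hs : s < h) : α r + β r * z r < α s + β s * z r := by
  induction s, hrs using Nat.le_induction with
  | base => nlinarith [H.cont r (by omega), H.lt r (by omega), H.anti r hs]
  | succ s hrs ih =>
    have h1 := ih (by omega)
    have h2 := H.cont s (by omega)
    have h3 := H.anti s hs
    have h4 : z r < z (s + 1) := H.strictMono (by omega) (by omega)
    nlinarith

theorem lt_of_succ_lt {r s : ℕ} (hrs : s + 1 < r) (hr : r ≤ h) :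
    α r + β r * z r < α s + β s * z r := by
  obtain ⟨k, rfl⟩ : ∃ k, r = s + 2 + k := ⟨r - (s + 2), by omega⟩
  induction k generalizing s with
  | zero =>
    nlinarith [H.cont (s + 1) (by omega), H.cont s (by omega), H.lt (s + 1) (by omega),
      H.anti s (by omega)]
  | succ k ih =>
    have h1 := ih (s := s + 1) (by omega) (by omega)
    rw [show s + 1 + 2 + k = s + 2 + (k + 1) by ring] at h1
    have h2 := H.cont s (by omega)
    have h3 := H.anti s (by omega)
    have h4 : z (s + 1) < z (s + 2 + (k + 1)) := H.strictMono (by omega) hr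
    nlinarith

theorem le_of_le {r s : ℕ} (hr : r ≤ h) (hs : s < h) : α r + β r * z r ≤ α s + β s * z r := by
  rcases lt_trichotomy r s with h1 | rfl | h1
  · exact (H.lt_of_lt h1 hs).le
  · exact le_rfl
  · rcases Nat.lt_or_ge (s + 1) r with h2 | h2
    · exact (H.lt_of_succ_lt h2 hr).le
    · obtain rfl : r = s + 1 := by omega
      exact (H.cont s hs).ge

end Chain

section cone

variable (v q₁ q₂ : E3)

/-- The vector with given coordinates. -/
noncomputable def comb3 (y a b : ℝ) : E3 := y • v + a • q₁ + b • q₂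

theorem det3_comb3 (y a b y' a' b' y'' a'' b'' : ℝ) :
    det3 (comb3 v q₁ q₂ y a b) (comb3 v q₁ q₂ y' a' b') (comb3 v q₁ q₂ y'' a'' b'') =
      (y * a' * b'' - y * b' * a'' - a * y' * b'' + a * b' * y'' + b * y' * a'' - b * a' * y'') *
        det3 v q₁ q₂ := by
  simp only [det3_eq, comb3, PiLp.add_apply, PiLp.smul_apply, smul_eq_mul]
  ring

variable {v q₁ q₂}

/-- Cramer's rule. -/
theorem exists_comb3 (hdet : det3 v q₁ q₂ ≠ 0) (d : E3) : ∃ y a b, d = comb3 v q₁ q₂ y a b := by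
  refine ⟨det3 d q₁ q₂ / det3 v q₁ q₂, det3 v d q₂ / det3 v q₁ q₂, det3 v q₁ d / det3 v q₁ q₂, ?_⟩
  ext k
  simp only [comb3, PiLp.add_apply, PiLp.smul_apply, smul_eq_mul, div_mul_eq_mul_div, ← add_div]
  rw [eq_div_iff hdet]
  simp only [det3_eq]
  fin_cases k <;> simp <;> ring

theorem comb3_injective (hdet : det3 v q₁ q₂ ≠ 0) {y a b y' a' b' : ℝ}
    (h : comb3 v q₁ q₂ y a b = comb3 v q₁ q₂ y' a' b') : y = y' ∧ a = a' ∧ b = b' := by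
  have e : ∀ k, comb3 v q₁ q₂ y a b k = comb3 v q₁ q₂ y' a' b' k := fun k => by rw [h]
  have e0 := e 0
  have e1 := e 1
  have e2 := e 2
  simp only [comb3, PiLp.add_apply, PiLp.smul_apply, smul_eq_mul] at e0 e1 e2
  refine ⟨mul_right_cancel₀ hdet ?_, mul_right_cancel₀ hdet ?_, mul_right_cancel₀ hdet ?_⟩ <;>
    simp only [det3_eq]
  · linear_combination (q₁ 1 * q₂ 2 - q₁ 2 * q₂ 1) * e0 + (q₁ 2 * q₂ 0 - q₁ 0 * q₂ 2) * e1 +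
      (q₁ 0 * q₂ 1 - q₁ 1 * q₂ 0) * e2
  · linear_combination (q₂ 1 * v 2 - q₂ 2 * v 1) * e0 + (q₂ 2 * v 0 - q₂ 0 * v 2) * e1 +
      (q₂ 0 * v 1 - q₂ 1 * v 0) * e2
  · linear_combination (v 1 * q₁ 2 - v 2 * q₁ 1) * e0 + (v 2 * q₁ 0 - v 0 * q₁ 2) * e1 +
      (v 0 * q₁ 1 - v 1 * q₁ 0) * e2

theorem comb3_add (y a b y' a' b' : ℝ) : comb3 v q₁ q₂ y a b + comb3 v q₁ q₂ y' a' b' =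
    comb3 v q₁ q₂ (y + y') (a + a') (b + b') := by
  simp only [comb3]; module

theorem comb3_smul (c y a b : ℝ) : c • comb3 v q₁ q₂ y a b =
    comb3 v q₁ q₂ (c * y) (c * a) (c * b) := by
  simp only [comb3]; module

theorem comb3_zero : comb3 v q₁ q₂ 0 0 0 = 0 := by simp [comb3]

variable (v q₁ q₂) in
/-- The cone of all vectors above the concave chain over the interval from `lo` to `hi`. -/
def chainCone (α β : ℕ → ℝ) (h : ℕ) (lo hi : ℝ) : Set E3 :=
  {d | ∃ y a b, d = comb3 v q₁ q₂ y a b ∧ 0 ≤ a ∧ lo * a ≤ b ∧ b ≤ hi * a ∧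
    ∀ r < h, 0 ≤ y + (α r * a + β r * b)}

variable (v q₁ q₂) in
/-- The corners of the cone: the vector `v`, and the breakpoints of the chain. -/
noncomputable def corner (α β z : ℕ → ℝ) : ℕ → E3
  | 0 => comb3 v q₁ q₂ 1 0 0
  | r + 1 => comb3 v q₁ q₂ (-(α r + β r * z r)) 1 (z r)

variable {α β z : ℕ → ℝ} {h : ℕ} {lo hi : ℝ}

theorem sum_corner_mem {m : ℕ} (hz : ∀ r < m, lo ≤ z r ∧ z r ≤ hi)
    (hmin : ∀ r < m, ∀ s < h, α r + β r * z r ≤ α s + β s * z r)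
    {c : Fin (m + 1) → ℝ} (hc : ∀ k, 0 ≤ c k) :
    ∑ k, c k • corner v q₁ q₂ α β z k ∈ chainCone v q₁ q₂ α β h lo hi := by
  refine Finset.sum_induction _ (· ∈ chainCone v q₁ q₂ α β h lo hi) ?_ ?_ ?_
  · rintro _ _ ⟨y, a, b, rfl, h1, h2, h3, h4⟩ ⟨y', a', b', rfl, h1', h2', h3', h4'⟩
    refine ⟨_, _, _, comb3_add _ _ _ _ _ _, by linarith, by linarith, by linarith, fun r hr => ?_⟩
    have := h4 r hr
    have := h4' r hr
    linarith
  · exact ⟨0, 0, 0, comb3_zero.symm, by simp⟩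
  · rintro ⟨k, hk⟩ -
    have hck := hc ⟨k, hk⟩
    rcases k with _ | r
    · refine ⟨_, _, _, comb3_smul _ _ _ _, ?_⟩
      simpa using fun _ _ => hck
    · refine ⟨_, _, _, comb3_smul _ _ _ _, by simpa using hck, ?_, ?_, fun s hs => ?_⟩
      · nlinarith [(hz r (by omega)).1]
      · nlinarith [(hz r (by omega)).2]
      · nlinarith [hmin r (by omega) s hs]

theorem corner_smul_sum {m : ℕ} (k : Fin (m + 1)) (x : ℝ) :
    x • corner v q₁ q₂ α β z k =
      ∑ l, (Pi.single k x : Fin (m + 1) → ℝ) l • corner v q₁ q₂ α β z l := by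
  rw [Finset.sum_eq_single k]
  · simp
  · intro l _ hl
    simp [hl]
  · simp

/-- In coordinates, a determinant that involves the corner v is a difference of breakpoints. For the
side between the breakpoints r and r + 1 it is z (r + 1) - z r times the height of line r above the
chain at the third breakpoint. Both are positive, and so is the determinant of the basis. -/
theorem cyclic_corner (hdet : 0 < det3 v q₁ q₂) (H : Chain α β z h) (k k' l : Fin (h + 2))
    (hk' : (k' : ℕ) = ((k : ℕ) + 1) % (h + 2)) (hlk : l ≠ k) (hlk' : l ≠ k') :
    0 < det3 (corner v q₁ q₂ α β z k) (corner v q₁ q₂ α β z k') (corner v q₁ q₂ α β z l) := by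
  have hlk : (l : ℕ) ≠ k := fun h => hlk (Fin.ext h)
  have hlk' : (l : ℕ) ≠ k' := fun h => hlk' (Fin.ext h)
  obtain ⟨k, hk⟩ := k
  obtain ⟨k', hk''⟩ := k'
  obtain ⟨l, hl⟩ := l
  simp only at hk' hlk hlk' ⊢
  rcases Nat.lt_or_ge (k + 1) (h + 2) with hlt | hge
  · rw [Nat.mod_eq_of_lt hlt] at hk'
    subst hk'
    rcases k with _ | r
    · obtain ⟨s, rfl⟩ : ∃ s, l = s + 2 := ⟨l - 2, by omega⟩
      have := H.strictMono (r := 0) (s := s + 1) (by omega) (by omega)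
      simp only [corner]
      rw [det3_comb3]
      refine mul_pos ?_ hdet
      linarith
    · rcases l with _ | s
      · have := H.lt r (by omega)
        simp only [corner]
        rw [det3_comb3]
        refine mul_pos ?_ hdet
        linarith
      · have h1 := H.lt r (by omega)
        have h2 := H.cont r (by omega)
        have h3 : α s + β s * z s < α r + β r * z s := by
          rcases Nat.lt_or_ge s r with h3 | h3
          · exact H.lt_of_lt h3 (by omega)
          · exact H.lt_of_succ_lt (by omega) (by omega)
        simp only [corner]
        rw [det3_comb3]
        refine mul_pos ?_ hdet
        rw [← h2]
        nlinarith [mul_pos (sub_pos.2 h1) (sub_pos.2 h3)]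
  · obtain rfl : k = h + 1 := by omega
    rw [Nat.mod_self] at hk'
    subst hk'
    obtain ⟨s, rfl⟩ : ∃ s, l = s + 1 := ⟨l - 1, by omega⟩
    have := H.strictMono (r := s) (s := h) (by omega) le_rfl
    simp only [corner]
    rw [det3_comb3]
    refine mul_pos ?_ hdet
    linarith

/-- A cone over a nondegenerate chain. -/
theorem isBoundaryDescription_chain (hdet : 0 < det3 v q₁ q₂) (H : Chain α β z h) (hpos : 0 < h)
    {D : Set E3} (hD : ∀ d, d ∈ D ↔ d ≠ 0 ∧ d ∈ chainCone v q₁ q₂ α β h (z 0) (z h)) :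
    IsBoundaryDescription D (fun k : Fin (h + 2) => corner v q₁ q₂ α β z k) := by
  refine ⟨fun d => ?_, irredundant_of_cyclic (by omega) (cyclic_corner hdet H),
    cyclic_corner hdet H⟩
  rw [hD]
  refine and_congr_right fun hd => ⟨?_, ?_⟩
  · rintro ⟨y, a, b, rfl, ha, h1, h2, h3⟩
    -- If b / a lies between the breakpoints r and r + 1, the vector is a combination of `v` and
    -- these two corners. The coefficient of `v` is the left-hand side of constraint r.
    obtain ⟨r, hr, w, p, q, hw, hp, hq, e⟩ : ∃ r < h, ∃ w p q : ℝ, 0 ≤ w ∧ 0 ≤ p ∧ 0 ≤ q ∧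
        comb3 v q₁ q₂ y a b = w • corner v q₁ q₂ α β z 0 + p • corner v q₁ q₂ α β z (r + 1) +
          q • corner v q₁ q₂ α β z (r + 1 + 1) := by
      rcases ha.eq_or_lt with rfl | ha
      · obtain rfl : b = 0 := by linarith
        have := h3 0 hpos
        refine ⟨0, hpos, y, 0, 0, by linarith, le_rfl, le_rfl, ?_⟩
        simp [corner, comb3]
      · obtain ⟨r, hr, g1, g2⟩ := exists_between_consecutive (x := b / a)
          (by rwa [le_div_iff₀ ha]) (by rwa [div_le_iff₀ ha]) hpos
        rw [le_div_iff₀ ha] at g1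
        rw [div_le_iff₀ ha] at g2
        have hlt := sub_pos.2 (H.lt r hr)
        obtain ⟨q, hq⟩ : ∃ q, q * (z (r + 1) - z r) = b - z r * a :=
          ⟨(b - z r * a) / (z (r + 1) - z r), by field_simp⟩
        have hq0 : 0 ≤ q := by
          by_contra hc
          nlinarith
        have hqa : 0 ≤ a - q := by
          by_contra hc
          nlinarith
        refine ⟨r, hr, y + (α r * a + β r * b), a - q, q, h3 r hr, hqa, hq0, ?_⟩
        simp only [corner]
        rw [comb3_smul, comb3_smul, comb3_smul, comb3_add, comb3_add]
        have hc := H.cont r hr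
        congr 1
        · rw [← hc]
          linear_combination (β r) * hq
        · ring
        · linear_combination -hq
    refine ⟨Pi.single ⟨0, by omega⟩ w + Pi.single ⟨r + 1, by omega⟩ p +
      Pi.single ⟨r + 1 + 1, by omega⟩ q, fun k => ?_, ?_⟩
    · simp only [Pi.add_apply, Pi.single_apply]
      split_ifs <;> linarith
    · simp only [Pi.add_apply, add_smul, Finset.sum_add_distrib]
      rw [← corner_smul_sum, ← corner_smul_sum, ← corner_smul_sum, e]
  · rintro ⟨c, hc, rfl⟩
    exact sum_corner_mem (m := h + 1) (fun r hr => ⟨H.mono (Nat.zero_le _) (by omega),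
      H.mono (by omega) le_rfl⟩) (fun r hr s hs => H.le_of_le (by omega) hs) hc

/-- A cone over a single point of a line. -/
theorem isBoundaryDescription_pair (hdet : 0 < det3 v q₁ q₂) {D : Set E3}
    (hD : ∀ d, d ∈ D ↔ d ≠ 0 ∧ d ∈ chainCone v q₁ q₂ α β 1 (z 0) (z 0)) :
    IsBoundaryDescription D (fun k : Fin (1 + 1) => corner v q₁ q₂ α β z k) := by
  refine ⟨fun d => ?_, fun k => ?_, fun k k' l => ?_⟩
  · rw [hD]
    refine and_congr_right fun hd => ⟨?_, ?_⟩
    · rintro ⟨y, a, b, rfl, ha, h1, h2, h3⟩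
      obtain rfl := le_antisymm h2 h1
      have := h3 0 (by omega)
      refine ⟨![y + (α 0 * a + β 0 * (z 0 * a)), a], fun k => ?_, ?_⟩
      · fin_cases k
        exacts [this, ha]
      · rw [Fin.sum_univ_two]
        simp only [corner, Matrix.cons_val_zero, Matrix.cons_val_one]
        rw [comb3_smul, comb3_smul, comb3_add]
        congr 1 <;> ring
    · rintro ⟨c, hc, rfl⟩
      refine sum_corner_mem (m := 1) (fun r hr => ?_) (fun r hr s hs => ?_) hc
      · obtain rfl : r = 0 := by omega
        exact ⟨le_rfl, le_rfl⟩
      · obtain rfl : r = 0 := by omega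
        obtain rfl : s = 0 := by omega
        exact le_rfl
  · rintro ⟨a, -, ha, h⟩
    rw [Fin.sum_univ_two] at h
    fin_cases k
    · simp only [Fin.zero_eta] at ha h
      rw [ha] at h
      simp only [corner, zero_smul, zero_add, comb3_smul] at h
      obtain ⟨g1, g2, g3⟩ := comb3_injective hdet.ne' h
      simp only [mul_one] at g2
      rw [← g2] at g1
      simp at g1
    · simp only [Fin.mk_one] at ha h
      rw [ha] at h
      simp only [corner, zero_smul, add_zero] at h
      rw [comb3_smul] at h
      obtain ⟨g1, g2, g3⟩ := comb3_injective hdet.ne' h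
      simp at g2
  · intro h1 h2 h3
    -- With two vectors there is no third index, so the condition is vacuous.
    exfalso
    revert k k' l
    decide

/-- A ray. -/
theorem isBoundaryDescription_ray (hv : v ≠ 0) {D : Set E3}
    (hD : ∀ d, d ∈ D ↔ d ≠ 0 ∧ ∃ y : ℝ, 0 ≤ y ∧ d = y • v) :
    IsBoundaryDescription D (fun k : Fin (0 + 1) => corner v q₁ q₂ α β z k) := by
  refine ⟨fun d => ?_, fun k => ?_, fun k k' l _ h => ?_⟩
  · rw [hD]
    refine and_congr_right fun hd => ⟨?_, ?_⟩
    · rintro ⟨y, hy, rfl⟩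
      exact ⟨fun _ => y, fun _ => hy, by simp [corner, comb3]⟩
    · rintro ⟨a, ha, h⟩
      exact ⟨a 0, ha 0, by simpa [corner, comb3] using h⟩
  · rintro ⟨a, -, ha, h⟩
    obtain rfl : k = 0 := Fin.ext (by omega)
    rw [Fin.sum_univ_one] at h
    rw [ha] at h
    exact hv (by simpa [corner, comb3] using h)
  · exact absurd (Fin.ext (by omega)) h

end cone


namespace RealRAM

/-! ### Moving to the boundary of the cone of valid directions -/

/-- A ratio test: cell 67 tells whether some constraint decreases along the ray, and cell 63 is the
least parameter found so far at which one becomes tight. -/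
def shootStep : Cmd :=
  .cond (.and (.natNe (nv 55) (nv 10)) (.and (.realLt (dotE 60 (nv 55)) 0)
      (.or (.natLt (nv 67) 1) (.realLt (dotE 57 (nv 55) / (0 - dotE 60 (nv 55))) (rv 63)))))
    (setN 67 1 ;; setN 66 (nv 55) ;; setR 63 (dotE 57 (nv 55) / (0 - dotE 60 (nv 55)))) .skip

/-- Move the vector in the arrays `57`, `58`, `59` in the direction of the vector in the arrays
`60`, `61`, `62` until a constraint, whose number is stored in `nv 66`, becomes tight. -/
def shoot : Cmd :=
  setN 67 0 ;; forN 55 (nv 0) shootStep ;;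
  (setR 57 (rv 57 + rv 63 * rv 60) ;; setR 58 (rv 58 + rv 63 * rv 61) ;;
    setR 59 (rv 59 + rv 63 * rv 62))

/-- The result of `shoot`. -/
structure Shot (n : ℕ) (σ τ : State) : Prop where
  eq : ∃ t : ℝ, τ.real 57 0 = σ.real 57 0 + t * σ.real 60 0 ∧
    τ.real 58 0 = σ.real 58 0 + t * σ.real 61 0 ∧ τ.real 59 0 = σ.real 59 0 + t * σ.real 62 0
  nonneg : ∀ j < n, j ≠ σ.nat 10 0 → 0 ≤ τ.dot 57 j
  lt : τ.nat 66 0 < n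
  ne : τ.nat 66 0 ≠ σ.nat 10 0
  neg : σ.dot 60 (τ.nat 66 0) < 0
  tight : τ.dot 57 (τ.nat 66 0) = 0

theorem shoot_run : ∃ C, ∀ (σ : State) (n : ℕ), σ.nat 0 0 = n →
    (∀ j < n, j ≠ σ.nat 10 0 → 0 ≤ σ.dot 57 j) → (∃ j < n, j ≠ σ.nat 10 0 ∧ σ.dot 60 j < 0) →
    Run shoot σ (C * (n + 1)) (Shot n σ) := by
  apply Exists.intro
  intro σ n h0 hnn hex
  apply Run.seqL (Run.simpleL rfl (Nat.succ_pos _) rfl)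
  rintro τ rfl
  apply Run.seqL (Run.forN_simple rfl (fun k τ => τ.nat 55 0 = k ∧ τ.nat 0 0 = n ∧
    τ.nat 10 0 = σ.nat 10 0 ∧ (∀ b, b ≠ 63 → τ.real b = σ.real b) ∧
    ((τ.nat 67 0 = 0 ∧ ∀ j < k, j ≠ σ.nat 10 0 → 0 ≤ σ.dot 60 j) ∨
      (τ.nat 67 0 = 1 ∧ τ.nat 66 0 < k ∧ τ.nat 66 0 ≠ σ.nat 10 0 ∧ σ.dot 60 (τ.nat 66 0) < 0 ∧
        τ.real 63 0 = σ.dot 57 (τ.nat 66 0) / (0 - σ.dot 60 (τ.nat 66 0)) ∧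
        ∀ j < k, j ≠ σ.nat 10 0 → σ.dot 60 j < 0 →
          τ.real 63 0 ≤ σ.dot 57 j / (0 - σ.dot 60 j)))) n ?_ ?_ ?_)
  · rintro τ ⟨-, h2, h3, h4, h5⟩
    refine Run.simpleL rfl (Nat.succ_pos _) ?_
    rcases h5 with ⟨-, h5⟩ | ⟨-, g1, g2, g3, g4, g5⟩
    · obtain ⟨j, hj, hj', hneg⟩ := hex
      exact absurd (h5 j hj hj') (not_le.2 hneg)
    · set ρ := (setR 57 (rv 57 + rv 63 * rv 60) ;; setR 58 (rv 58 + rv 63 * rv 61) ;;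
        setR 59 (rv 59 + rv 63 * rv 62)).den τ with hρ
      have e57 : ρ.real 57 0 = σ.real 57 0 + τ.real 63 0 * σ.real 60 0 := by simp [hρ, h4]
      have e58 : ρ.real 58 0 = σ.real 58 0 + τ.real 63 0 * σ.real 61 0 := by simp [hρ, h4]
      have e59 : ρ.real 59 0 = σ.real 59 0 + τ.real 63 0 * σ.real 62 0 := by simp [hρ, h4]
      have hdot : ∀ j, ρ.dot 57 j = σ.dot 57 j + τ.real 63 0 * σ.dot 60 j := by
        intro j
        have e0 : ∀ b < 3, ρ.real b = σ.real b := fun b hb => by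
          rw [← h4 b (by omega), hρ]
          simp [State.setReal_real_ne _ _ _ (show b ≠ 57 by omega),
            State.setReal_real_ne _ _ _ (show b ≠ 58 by omega),
            State.setReal_real_ne _ _ _ (show b ≠ 59 by omega)]
        simp only [State.dot, Nat.reduceAdd, e57, e58, e59, e0 0 (by decide), e0 1 (by decide),
          e0 2 (by decide)]
        ring
      have ht : 0 ≤ τ.real 63 0 := by
        rw [g4]
        exact div_nonneg (hnn _ g1 g2) (by linarith)
      refine ⟨⟨_, e57, e58, e59⟩, fun j hj hj' => ?_, g1, g2, g3, ?_⟩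
      · rw [hdot]
        by_cases hneg : σ.dot 60 j < 0
        · have := g5 j hj hj' hneg
          rw [le_div_iff₀ (by linarith)] at this
          linarith
        · have := hnn j hj hj'
          nlinarith
      · show ρ.dot 57 (τ.nat 66 0) = 0
        rw [hdot, g4]
        have : σ.dot 60 (τ.nat 66 0) ≠ 0 := g3.ne
        field_simp
        ring
  · refine ⟨by simp, by simpa using h0, by simp, fun b _ => rfl, Or.inl ⟨by simp, by simp⟩⟩
  · exact fun i τ h => ⟨h.1, h.2.1⟩
  · rintro k τ hk ⟨h1, h2, h3, h4, h5⟩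
    have d57 : τ.dot 57 = σ.dot 57 := by
      funext j
      simp only [State.dot, Nat.reduceAdd, h4 0 (by decide), h4 1 (by decide), h4 2 (by decide),
        h4 57 (by decide), h4 58 (by decide), h4 59 (by decide)]
    have d60 : τ.dot 60 = σ.dot 60 := by
      funext j
      simp only [State.dot, Nat.reduceAdd, h4 0 (by decide), h4 1 (by decide), h4 2 (by decide),
        h4 60 (by decide), h4 61 (by decide), h4 62 (by decide)]
    by_cases hc : k ≠ σ.nat 10 0 ∧ σ.dot 60 k < 0 ∧
        (τ.nat 67 0 < 1 ∨ σ.dot 57 k / (0 - σ.dot 60 k) < τ.real 63 0)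
    · rw [shootStep, den_cond_pos _ (by simpa [h1, h3, d57, d60] using hc)]
      refine ⟨by simp [h1], by simpa using h2, by simp [h3], fun b hb => ?_, Or.inr ?_⟩
      · simp [State.setReal_real_ne _ _ _ hb, h4 b hb]
      · have d57' : ((τ.setNat 67 0 1).setNat 66 0 k).dot 57 = σ.dot 57 := d57
        have d60' : ((τ.setNat 67 0 1).setNat 66 0 k).dot 60 = σ.dot 60 := d60
        simp [h1, d57', d60']
        refine ⟨hc.1, hc.2.1, fun j hj hj' hneg => ?_⟩
        rcases hj.lt_or_eq with hj | rfl
        · rcases h5 with ⟨-, h5⟩ | ⟨h6, -, -, -, -, g5⟩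
          · exact absurd (h5 j hj hj') (not_le.2 hneg)
          · rcases hc.2.2 with h7 | h7
            · omega
            · have := g5 j hj hj' hneg
              simp only [zero_sub] at this h7
              linarith
        · exact le_rfl
    · rw [shootStep, den_cond_neg _ (by simpa [h1, h3, d57, d60] using hc), den_skip]
      refine ⟨by simp [h1], by simpa using h2, by simp [h3], h4, ?_⟩
      simp only [not_and, not_or, not_lt] at hc
      have e67 : (τ.setNat 55 0 (τ.nat 55 0 + 1)).nat 67 = τ.nat 67 := by simp
      have e66 : (τ.setNat 55 0 (τ.nat 55 0 + 1)).nat 66 = τ.nat 66 := by simp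
      rw [e67, e66, State.setNat_real]
      rcases h5 with ⟨h6, h5⟩ | ⟨h6, g1, g2, g3, g4, g5⟩
      · refine Or.inl ⟨h6, fun j hj hj' => ?_⟩
        rcases Nat.lt_succ_iff_lt_or_eq.1 hj with hj | rfl
        · exact h5 j hj hj'
        · by_contra hneg
          have := (hc hj' (not_le.1 hneg)).1
          omega
      · refine Or.inr ⟨h6, by omega, g2, g3, g4, fun j hj hj' hneg => ?_⟩
        rcases Nat.lt_succ_iff_lt_or_eq.1 hj with hj | rfl
        · exact g5 j hj hj' hneg
        · exact (hc hj' hneg).2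

/-- Store the cross product of two vectors in the arrays `out`, `out + 1`, `out + 2`. -/
def cross (out : ℕ) (a₀ a₁ a₂ b₀ b₁ b₂ : RExp) : Cmd :=
  setR out (a₁ * b₂ - a₂ * b₁) ;; setR (out + 1) (a₂ * b₀ - a₀ * b₂) ;;
    setR (out + 2) (a₀ * b₁ - a₁ * b₀)

/-- A nonzero vector orthogonal to the normal number `nv 10`: its horizontal part turned by a right
angle, or (1, 0, 0) if the normal is vertical. -/
def tangent : Cmd :=
  .cond (.realLt 0 (.get 0 (nv 10) * .get 0 (nv 10) + .get 1 (nv 10) * .get 1 (nv 10)))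
    (setR 60 (0 - .get 1 (nv 10)) ;; setR 61 (.get 0 (nv 10)) ;; setR 62 0)
    (setR 60 1 ;; setR 61 0 ;; setR 62 0)

/-- With v the vector found and j, k the two tight constraints, q₁ = ν_k × v and q₂ = v × ν_j - q₁.
Up to the positive factor v · (ν_j × ν_k), the two constraints then read b ≤ a and 0 ≤ b. -/
def apexBasis : Cmd :=
  setR 7 (rv 57) ;; setR 8 (rv 58) ;; setR 9 (rv 59) ;;
  cross 10 (.get 0 (nv 66)) (.get 1 (nv 66)) (.get 2 (nv 66)) (rv 7) (rv 8) (rv 9) ;;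
  cross 13 (rv 7) (rv 8) (rv 9) (.get 0 (nv 68)) (.get 1 (nv 68)) (.get 2 (nv 68)) ;;
  setR 13 (rv 13 - rv 10) ;; setR 14 (rv 14 - rv 11) ;; setR 15 (rv 15 - rv 12)

/-- Find an extreme ray of the cone of valid directions, and a basis adapted to it. -/
def apex : Cmd :=
  tangent ;; shoot ;;
  (setN 68 (nv 66) ;; cross 60 (.get 0 (nv 10)) (.get 1 (nv 10)) (.get 2 (nv 10))
    (.get 0 (nv 68)) (.get 1 (nv 68)) (.get 2 (nv 68))) ;; shoot ;; apexBasis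

/-- The result of `apex`. -/
structure Apex (n : ℕ) (σ : State) : Prop where
  nonneg : ∀ j < n, j ≠ σ.nat 10 0 → 0 ≤ σ.dot 7 j
  neg : σ.dot 7 (σ.nat 10 0) < 0
  det : 0 < det3 (σ.vec 7 0) (σ.vec 10 0) (σ.vec 13 0)
  sides : ∃ δ > 0, ∃ j < n, ∃ k < n, j ≠ σ.nat 10 0 ∧ k ≠ σ.nat 10 0 ∧ σ.dot 7 j = 0 ∧
    σ.dot 7 k = 0 ∧ σ.dot 10 j = δ ∧ σ.dot 13 j = -δ ∧ σ.dot 10 k = 0 ∧ σ.dot 13 k = δ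

/-- If the cross product vanished, b would be a multiple of a ≠ 0 and would be orthogonal to e as
well. -/
theorem cross_ne_zero {a₀ a₁ a₂ b₀ b₁ b₂ e₀ e₁ e₂ : ℝ} (ha : a₀ ≠ 0 ∨ a₁ ≠ 0 ∨ a₂ ≠ 0)
    (hae : a₀ * e₀ + a₁ * e₁ + a₂ * e₂ = 0) (hbe : b₀ * e₀ + b₁ * e₁ + b₂ * e₂ < 0) :
    a₁ * b₂ - a₂ * b₁ ≠ 0 ∨ a₂ * b₀ - a₀ * b₂ ≠ 0 ∨ a₀ * b₁ - a₁ * b₀ ≠ 0 := by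
  by_contra hc
  push Not at hc
  obtain ⟨h0, h1, h2⟩ := hc
  have hpos : 0 < a₀ * a₀ + a₁ * a₁ + a₂ * a₂ := by
    rcases ha with h | h | h <;> have := mul_self_pos.2 h <;>
      nlinarith [mul_self_nonneg a₀, mul_self_nonneg a₁, mul_self_nonneg a₂]
  have : (a₀ * a₀ + a₁ * a₁ + a₂ * a₂) * (b₀ * e₀ + b₁ * e₁ + b₂ * e₂) = 0 := by
    linear_combination (a₀ * b₀ + a₁ * b₁ + a₂ * b₂) * hae + (e₂ * a₁ - e₁ * a₂) * h0 +
      (e₀ * a₂ - e₂ * a₀) * h1 + (e₁ * a₀ - e₀ * a₁) * h2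
  rcases mul_eq_zero.1 this with h | h <;> linarith

/-- The triple product of two vectors and a vector that is orthogonal to both of them is positive
if the products of the two vectors and of this vector with some vector have the same sign. -/
theorem triple_pos {a₀ a₁ a₂ b₀ b₁ b₂ c₀ c₁ c₂ v₀ v₁ v₂ : ℝ}
    (hb : b₀ * v₀ + b₁ * v₁ + b₂ * v₂ = 0) (hc : c₀ * v₀ + c₁ * v₁ + c₂ * v₂ = 0)
    (hv : a₀ * v₀ + a₁ * v₁ + a₂ * v₂ < 0)
    (h : a₀ * (b₁ * c₂ - b₂ * c₁) + a₁ * (b₂ * c₀ - b₀ * c₂) + a₂ * (b₀ * c₁ - b₁ * c₀) < 0) :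
    0 < v₀ * (b₁ * c₂ - b₂ * c₁) + v₁ * (b₂ * c₀ - b₀ * c₂) + v₂ * (b₀ * c₁ - b₁ * c₀) := by
  have hpos : 0 < v₀ * v₀ + v₁ * v₁ + v₂ * v₂ := by
    by_contra hn
    have h0 : v₀ = 0 := by nlinarith [mul_self_nonneg v₀, mul_self_nonneg v₁, mul_self_nonneg v₂]
    have h1 : v₁ = 0 := by nlinarith [mul_self_nonneg v₀, mul_self_nonneg v₁, mul_self_nonneg v₂]
    have h2 : v₂ = 0 := by nlinarith [mul_self_nonneg v₀, mul_self_nonneg v₁, mul_self_nonneg v₂]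
    simp [h0, h1, h2] at hv
  have key : (v₀ * v₀ + v₁ * v₁ + v₂ * v₂) *
      (a₀ * (b₁ * c₂ - b₂ * c₁) + a₁ * (b₂ * c₀ - b₀ * c₂) + a₂ * (b₀ * c₁ - b₁ * c₀)) =
      (v₀ * (b₁ * c₂ - b₂ * c₁) + v₁ * (b₂ * c₀ - b₀ * c₂) + v₂ * (b₀ * c₁ - b₁ * c₀)) *
      (a₀ * v₀ + a₁ * v₁ + a₂ * v₂) := by
    linear_combination
      (a₀ * (v₁ * c₂ - v₂ * c₁) + a₁ * (v₂ * c₀ - v₀ * c₂) + a₂ * (v₀ * c₁ - v₁ * c₀)) * hb -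
      (a₀ * (v₁ * b₂ - v₂ * b₁) + a₁ * (v₂ * b₀ - v₀ * b₂) + a₂ * (v₀ * b₁ - v₁ * b₀)) * hc
  by_contra hn
  nlinarith [mul_neg_of_pos_of_neg hpos h, mul_nonneg_of_nonpos_of_nonpos (not_lt.1 hn) hv.le]

end RealRAM


/-! ### Correctness of the apex -/

namespace Polyhedron

open RealRAM

variable {n : ℕ} {P : Polyhedron n}

theorem inner_eq_dot {σ : State} (h : P.Loaded σ) (b : ℕ) (i : Fin n) :
    inner ℝ (σ.vec b 0) (P.normal i) = σ.dot b i := by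
  rw [inner_eq_inp h.normals]
  simp [State.vec, State.inp, State.dot]

/-- There is a facet to hit in a nonzero direction parallel to the facet `nv 10`. -/
theorem Loaded.exists_dot_neg {σ : State} (h : P.Loaded σ) {b : ℕ}
    (hne : σ.real b 0 ≠ 0 ∨ σ.real (b + 1) 0 ≠ 0 ∨ σ.real (b + 2) 0 ≠ 0)
    (h0 : σ.dot b (σ.nat 10 0) = 0) : ∃ j < n, j ≠ σ.nat 10 0 ∧ σ.dot b j < 0 := by
  have hv : σ.vec b 0 ≠ 0 := by
    intro hz
    have e : ∀ k : Fin 3, σ.vec b 0 k = 0 := fun k => by rw [hz]; rfl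
    have e0 := e 0
    have e1 := e 1
    have e2 := e 2
    simp [State.vec] at e0 e1 e2
    simp [e0, e1, e2] at hne
  obtain ⟨i, hi⟩ := P.exists_inner_neg hv
  rw [inner_eq_dot h] at hi
  exact ⟨i, i.2, fun hc => by rw [hc, h0] at hi; exact lt_irrefl _ hi, hi⟩

theorem Loaded.normal_ne {σ : State} (h : P.Loaded σ) (i : Fin n) :
    σ.real 0 i ≠ 0 ∨ σ.real 1 i ≠ 0 ∨ σ.real 2 i ≠ 0 := by
  by_contra hc
  push Not at hc
  apply P.normal_ne_zero i
  rw [← h.normals i]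
  ext k
  fin_cases k
  exacts [by simpa [State.vec] using hc.1, by simpa [State.vec] using hc.2.1,
    by simpa [State.vec] using hc.2.2]

theorem tangent_spec {σ : State} :
    (tangent.den σ).dot 60 (σ.nat 10 0) = 0 ∧ ((tangent.den σ).real 60 0 ≠ 0 ∨
      (tangent.den σ).real 61 0 ≠ 0 ∨ (tangent.den σ).real 62 0 ≠ 0) := by
  set x := σ.real 0 (σ.nat 10 0) with hx
  set y := σ.real 1 (σ.nat 10 0) with hy
  by_cases h : 0 < x * x + y * y
  · rw [tangent, den_cond_pos _ (by simpa [← hx, ← hy] using h)]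
    simp [State.dot, ← hx, ← hy]
    refine ⟨by ring, ?_⟩
    by_contra hc
    push Not at hc
    simp [hc.1, hc.2] at h
  · rw [tangent, den_cond_neg _ (by simpa [← hx, ← hy] using h)]
    simp [State.dot, ← hx, ← hy]
    nlinarith [mul_self_nonneg x, mul_self_nonneg y]

/-- Both motions are parallel to the facet i, so the product with ν_i stays negative, and some other
constraint decreases along each direction by `exists_dot_neg`. The second direction ν_i × ν_j also
keeps constraint j tight. The constraint k that stops it satisfies ν_i · (ν_j × ν_k) < 0, and
`triple_pos` turns this into the orientation of the basis. -/
theorem apex_run : ∃ C, ∀ (n : ℕ) (P : Polyhedron n) (σ : State), P.Loaded σ → ∀ i : Fin n,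
    σ.nat 10 0 = i → P.IsValidPair i (σ.vec 57 0) → Run apex σ (C * (n + 1)) (Apex n) := by
  obtain ⟨C, hC⟩ := shoot_run
  apply Exists.intro
  intro n P σ hl i hi hd
  apply Run.seqL (Run.simpleL rfl (Nat.succ_pos _) rfl).frame
  rintro τ₁ ⟨rfl, hf₁⟩
  obtain ⟨t1, t2⟩ := tangent_spec (σ := σ)
  set τ := tangent.den σ with hτ
  have hl₁ : P.Loaded τ := hl.congr (hf₁.1 0 (by decide)) fun b hb => hf₁.2 b (by
    revert b; decide)
  have hi₁ : τ.nat 10 0 = i := by rw [hf₁.1 10 (by decide), hi]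
  rw [hi] at t1
  have d57 : τ.vec 57 0 = σ.vec 57 0 := by
    simp only [State.vec, hf₁.2 57 (by decide), hf₁.2 (57 + 1) (by decide),
      hf₁.2 (57 + 2) (by decide)]
  rw [← d57] at hd
  have hnn : ∀ j < n, j ≠ τ.nat 10 0 → 0 ≤ τ.dot 57 j := fun j hj hj' => by
    have := hd.2 ⟨j, hj⟩ (fun h => hj' (by rw [hi₁, ← h]))
    rwa [inner_eq_dot hl₁] at this
  have hneg : τ.dot 57 i < 0 := by
    have := hd.1
    rwa [inner_eq_dot hl₁] at this
  apply Run.seqL (hC τ n hl₁.size hnn (hl₁.exists_dot_neg t2 (by rw [hi₁]; exact t1))).frame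
  rintro ρ ⟨⟨⟨t, r0, r1, r2⟩, r3, r4, r5, r6, r7⟩, hf₂⟩
  have hl₂ : P.Loaded ρ := hl₁.congr (hf₂.1 0 (by decide)) fun b hb => hf₂.2 b (by
    revert b; decide)
  have hi₂ : ρ.nat 10 0 = i := by rw [hf₂.1 10 (by decide), hi₁]
  apply Run.seqL (Run.simpleL rfl (Nat.succ_pos _) rfl).frame
  rintro κ' ⟨hκ, hf₃⟩
  set j := ρ.nat 66 0 with hj
  obtain ⟨k60, k61, k62, k68⟩ : κ'.real 60 0 = ρ.real 1 i * ρ.real 2 j - ρ.real 2 i * ρ.real 1 j ∧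
      κ'.real 61 0 = ρ.real 2 i * ρ.real 0 j - ρ.real 0 i * ρ.real 2 j ∧
      κ'.real 62 0 = ρ.real 0 i * ρ.real 1 j - ρ.real 1 i * ρ.real 0 j ∧ κ'.nat 68 0 = j := by
    rw [← hκ]
    simp [cross, hi₂, ← hj]
  have hl₃ : P.Loaded κ' := hl₂.congr (hf₃.1 0 (by decide)) fun b hb => hf₃.2 b (by
    revert b; decide)
  have hi₃ : κ'.nat 10 0 = i := by rw [hf₃.1 10 (by decide), hi₂]
  have n0 := hf₃.2 0 (by decide)
  have n1 := hf₃.2 1 (by decide)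
  have n2 := hf₃.2 2 (by decide)
  have m0 := hf₂.2 0 (by decide)
  have m1 := hf₂.2 1 (by decide)
  have m2 := hf₂.2 2 (by decide)
  have d57₃ : κ'.dot 57 = ρ.dot 57 := by
    funext l
    simp only [State.dot, n0, n1, n2, hf₃.2 57 (by decide), hf₃.2 (57 + 1) (by decide),
      hf₃.2 (57 + 2) (by decide)]
  have hdi : ρ.dot 57 i = τ.dot 57 i := by
    simp only [State.dot, Nat.reduceAdd] at t1 ⊢
    rw [m0, m1, m2, r0, r1, r2]
    linear_combination t * t1
  have g0 : κ'.dot 60 (κ'.nat 10 0) = 0 := by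
    simp only [State.dot, Nat.reduceAdd, hi₃, k60, k61, k62, n0, n1, n2]
    ring
  have g1 := cross_ne_zero (hl₂.normal_ne i) (b₀ := ρ.real 0 j) (b₁ := ρ.real 1 j)
    (b₂ := ρ.real 2 j) (e₀ := τ.real 60 0) (e₁ := τ.real 61 0) (e₂ := τ.real 62 0)
    (by simpa only [State.dot, m0, m1, m2] using t1)
    (by simpa only [State.dot, m0, m1, m2] using r6)
  rw [← k60, ← k61, ← k62] at g1
  have hnn₃ : ∀ j < n, j ≠ κ'.nat 10 0 → 0 ≤ κ'.dot 57 j := by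
    rw [d57₃, hi₃, ← hi₁]; exact r3
  apply Run.seqL (hC κ' n hl₃.size hnn₃ (hl₃.exists_dot_neg g1 g0)).frame
  rintro ω ⟨⟨⟨s, s0, s1, s2⟩, s3, s4, s5, s6, s7⟩, hf₄⟩
  refine (Run.simpleL rfl (Nat.succ_pos _) rfl).frame.mono le_rfl ?_
  rintro χ ⟨hχ, hf₅⟩
  set k := ω.nat 66 0 with hk
  have p0 := hf₄.2 0 (by decide)
  have p1 := hf₄.2 1 (by decide)
  have p2 := hf₄.2 2 (by decide)
  have w0 : χ.real 0 = ω.real 0 := hf₅.2 0 (by decide)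
  have w1 : χ.real 1 = ω.real 1 := hf₅.2 1 (by decide)
  have w2 : χ.real 2 = ω.real 2 := hf₅.2 2 (by decide)
  have hχi : χ.nat 10 0 = i := by rw [hf₅.1 10 (by decide), hf₄.1 10 (by decide), hi₃]
  have hωj : ω.nat 68 0 = j := by rw [hf₄.1 68 (by decide), k68]
  obtain ⟨x7, x8, x9⟩ : χ.real 7 0 = ω.real 57 0 ∧ χ.real 8 0 = ω.real 58 0 ∧
      χ.real 9 0 = ω.real 59 0 := by
    rw [← hχ]
    simp [apexBasis, cross]
  obtain ⟨x10, x11, x12⟩ : χ.real 10 0 = ω.real 1 k * χ.real 9 0 - ω.real 2 k * χ.real 8 0 ∧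
      χ.real 11 0 = ω.real 2 k * χ.real 7 0 - ω.real 0 k * χ.real 9 0 ∧
      χ.real 12 0 = ω.real 0 k * χ.real 8 0 - ω.real 1 k * χ.real 7 0 := by
    rw [← hχ]
    simp [apexBasis, cross, ← hk]
  obtain ⟨x13, x14, x15⟩ :
      χ.real 13 0 = χ.real 8 0 * ω.real 2 j - χ.real 9 0 * ω.real 1 j - χ.real 10 0 ∧
      χ.real 14 0 = χ.real 9 0 * ω.real 0 j - χ.real 7 0 * ω.real 2 j - χ.real 11 0 ∧
      χ.real 15 0 = χ.real 7 0 * ω.real 1 j - χ.real 8 0 * ω.real 0 j - χ.real 12 0 := by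
    rw [← hχ]
    simp [apexBasis, cross, hωj]
  have hdot7 : ∀ l, χ.dot 7 l = ω.dot 57 l := fun l => by
    simp only [State.dot, Nat.reduceAdd, w0, w1, w2, x7, x8, x9]
  have hωdot : ∀ l, ω.dot 57 l = ρ.dot 57 l + s * κ'.dot 60 l := fun l => by
    rw [← d57₃]
    simp only [State.dot, Nat.reduceAdd, p0, p1, p2, s0, s1, s2]
    ring
  have hvi : χ.dot 7 i < 0 := by
    rw [hdot7, hωdot, hdi, ← hi₃, g0, hi₃]
    linarith
  have hvk : χ.dot 7 k = 0 := by rw [hdot7]; exact s7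
  have hvj : χ.dot 7 j = 0 := by
    rw [hdot7, hωdot, r7]
    simp only [State.dot, Nat.reduceAdd, k60, k61, k62, n0, n1, n2]
    ring
  obtain ⟨q0, q1, q2⟩ : χ.real 0 = ρ.real 0 ∧ χ.real 1 = ρ.real 1 ∧ χ.real 2 = ρ.real 2 :=
    ⟨by rw [w0, p0, n0], by rw [w1, p1, n1], by rw [w2, p2, n2]⟩
  have htr : χ.real 0 i * (χ.real 1 j * χ.real 2 k - χ.real 2 j * χ.real 1 k) +
      χ.real 1 i * (χ.real 2 j * χ.real 0 k - χ.real 0 j * χ.real 2 k) +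
      χ.real 2 i * (χ.real 0 j * χ.real 1 k - χ.real 1 j * χ.real 0 k) < 0 := by
    refine lt_of_eq_of_lt ?_ s6
    simp only [State.dot, Nat.reduceAdd, k60, k61, k62, q0, q1, q2, n0, n1, n2]
    ring
  have hpos := triple_pos (v₀ := χ.real 7 0) (v₁ := χ.real 8 0) (v₂ := χ.real 9 0)
    hvj hvk hvi htr
  set δ := χ.real 7 0 * (χ.real 1 j * χ.real 2 k - χ.real 2 j * χ.real 1 k) +
      χ.real 8 0 * (χ.real 2 j * χ.real 0 k - χ.real 0 j * χ.real 2 k) +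
      χ.real 9 0 * (χ.real 0 j * χ.real 1 k - χ.real 1 j * χ.real 0 k) with hδ
  simp only [← w0, ← w1, ← w2] at x10 x11 x12 x13 x14 x15
  refine ⟨?_, by rw [hχi]; exact hvi, ?_, δ, hpos, j, r4, k, s4, ?_, ?_, hvj, hvk, ?_, ?_, ?_, ?_⟩
  · intro l hl hl'
    rw [hdot7]
    exact s3 l hl (by rw [hi₃, ← hχi]; exact hl')
  · have e : det3 (χ.vec 7 0) (χ.vec 10 0) (χ.vec 13 0) = δ * (χ.real 7 0 * χ.real 7 0 +
        χ.real 8 0 * χ.real 8 0 + χ.real 9 0 * χ.real 9 0) := by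
      rw [det3_eq]
      simp only [State.vec, Nat.reduceAdd, PiLp.toLp_apply, Matrix.cons_val]
      rw [x13, x14, x15, x10, x11, x12, hδ]
      ring
    rw [e]
    refine mul_pos hpos ?_
    by_contra hn
    have n7 := mul_self_nonneg (χ.real 7 0)
    have n8 := mul_self_nonneg (χ.real 8 0)
    have n9 := mul_self_nonneg (χ.real 9 0)
    have h0 : χ.real 7 0 = 0 := mul_self_eq_zero.1 (by linarith)
    have h1 : χ.real 8 0 = 0 := mul_self_eq_zero.1 (by linarith)
    have h2 : χ.real 9 0 = 0 := mul_self_eq_zero.1 (by linarith)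
    simp [State.dot, h0, h1, h2] at hvi
  · rw [hχi, ← hi₁]; exact r5
  · rw [hχi, ← hi₃]; exact s5
  · simp only [State.dot, Nat.reduceAdd, x10, x11, x12, hδ]
    ring
  · simp only [State.dot, Nat.reduceAdd, x13, x14, x15, x10, x11, x12, hδ]
    ring
  · simp only [State.dot, Nat.reduceAdd, x10, x11, x12]
    ring
  · simp only [State.dot, Nat.reduceAdd, x13, x14, x15, x10, x11, x12, hδ]
    ring

end Polyhedron


namespace RealRAM

/-! ### The constraints through the apex -/

/-- At the apex no constraint but the skipped one is negative, so the test selects the tight ones.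
Such a constraint does not involve y and bounds x = b / a on one side. If it is a negative constant,
no ratio is admissible, and the interval is made empty by a right end below the left one. -/
def clipStep : Cmd :=
  .cond (.and (.natNe (nv 55) (nv 10)) (.not (.realLt 0 (dotE 7 (nv 55)))))
    (.cond (.realLt 0 (dotE 13 (nv 55)))
      (.cond (.realLt (rv 26) (0 - dotE 10 (nv 55) / dotE 13 (nv 55)))
        (setR 26 (0 - dotE 10 (nv 55) / dotE 13 (nv 55))) .skip)
      (.cond (.realLt (dotE 13 (nv 55)) 0)
        (.cond (.realLt (0 - dotE 10 (nv 55) / dotE 13 (nv 55)) (rv 27))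
          (setR 27 (0 - dotE 10 (nv 55) / dotE 13 (nv 55))) .skip)
        (.cond (.realLt (dotE 10 (nv 55)) 0) (setR 27 (rv 26 - 1)) .skip))) .skip

/-- Compute the interval from `rv 26` to `rv 27` in which all constraints that are tight at the
apex hold. -/
def clip : Cmd := (setR 26 0 ;; setR 27 1) ;; forN 55 (nv 0) clipStep

theorem clipStep_spec {σ : State} {j : ℕ} (hj : σ.nat 55 0 = j) :
    (clipStep.den σ).nat = σ.nat ∧
    (∀ b, b ≠ 26 → b ≠ 27 → (clipStep.den σ).real b = σ.real b) ∧
    ∀ x, ((clipStep.den σ).real 26 0 ≤ x ∧ x ≤ (clipStep.den σ).real 27 0) ↔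
      (σ.real 26 0 ≤ x ∧ x ≤ σ.real 27 0) ∧
        (j ≠ σ.nat 10 0 → ¬ 0 < σ.dot 7 j → 0 ≤ σ.dot 10 j + σ.dot 13 j * x) := by
  by_cases h : j ≠ σ.nat 10 0 ∧ ¬ 0 < σ.dot 7 j
  · rw [clipStep, den_cond_pos _ (by simpa [hj] using h)]
    have hcond : ∀ p : Prop, (j ≠ σ.nat 10 0 → ¬ 0 < σ.dot 7 j → p) ↔ p :=
      fun p => ⟨fun f => f h.1 h.2, fun hp _ _ => hp⟩
    simp only [hcond]
    rcases lt_trichotomy (σ.dot 13 j) 0 with hb | hb | hb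
    · have key : ∀ x, 0 ≤ σ.dot 10 j + σ.dot 13 j * x ↔ x ≤ 0 - σ.dot 10 j / σ.dot 13 j := by
        intro x
        rw [zero_sub, ← neg_div, le_div_iff_of_neg hb]
        constructor <;> intro h <;> linarith
      rw [den_cond_neg _ (by simpa [hj] using hb.le), den_cond_pos _ (by simpa [hj] using hb)]
      simp only [key]
      by_cases hl : 0 - σ.dot 10 j / σ.dot 13 j < σ.real 27 0
      · rw [den_cond_pos _ (by simpa [hj] using hl)]
        refine ⟨rfl, fun b _ h27 => State.setReal_real_ne _ _ _ h27, fun x => ?_⟩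
        simp only [den_setR, eval_realSub, eval_realDiv, eval_dotE, eval_nv, hj, eval_realOfNat,
          State.setReal_real_same, Function.update_self, Nat.cast_zero]
        rw [State.setReal_real_ne _ _ _ (by decide)]
        exact ⟨fun h => ⟨⟨h.1, h.2.trans hl.le⟩, h.2⟩, fun h => ⟨h.1.1, h.2⟩⟩
      · rw [den_cond_neg _ (by simpa [hj] using hl), den_skip]
        exact ⟨rfl, fun b _ _ => rfl, fun x => ⟨fun h => ⟨h, h.2.trans (not_lt.1 hl)⟩, And.left⟩⟩
    · rw [den_cond_neg _ (by simp [hj, hb]), den_cond_neg _ (by simp [hj, hb])]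
      by_cases hl : σ.dot 10 j < 0
      · rw [den_cond_pos _ (by simpa [hj] using hl)]
        refine ⟨rfl, fun b _ h27 => State.setReal_real_ne _ _ _ h27, fun x => ?_⟩
        simp only [den_setR, eval_realSub, eval_rv, eval_realOfNat, State.setReal_real_same,
          Function.update_self, Nat.cast_one, hb]
        rw [State.setReal_real_ne _ _ _ (by decide)]
        constructor
        · intro h; linarith
        · intro h; linarith
      · rw [den_cond_neg _ (by simpa [hj] using hl), den_skip]
        refine ⟨rfl, fun b _ _ => rfl, fun x => ⟨fun h => ⟨h, ?_⟩, And.left⟩⟩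
        rw [hb]
        linarith
    · have key : ∀ x, 0 ≤ σ.dot 10 j + σ.dot 13 j * x ↔ 0 - σ.dot 10 j / σ.dot 13 j ≤ x := by
        intro x
        rw [zero_sub, ← neg_div, div_le_iff₀ hb]
        constructor <;> intro h <;> linarith
      rw [den_cond_pos _ (by simpa [hj] using hb)]
      simp only [key]
      by_cases hl : σ.real 26 0 < 0 - σ.dot 10 j / σ.dot 13 j
      · rw [den_cond_pos _ (by simpa [hj] using hl)]
        refine ⟨rfl, fun b h26 _ => State.setReal_real_ne _ _ _ h26, fun x => ?_⟩
        simp only [den_setR, eval_realSub, eval_realDiv, eval_dotE, eval_nv, hj, eval_realOfNat,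
          State.setReal_real_same, Function.update_self, Nat.cast_zero]
        rw [State.setReal_real_ne _ _ _ (by decide)]
        exact ⟨fun h => ⟨⟨hl.le.trans h.1, h.2⟩, h.1⟩, fun h => ⟨h.2, h.1.2⟩⟩
      · rw [den_cond_neg _ (by simpa [hj] using hl), den_skip]
        exact ⟨rfl, fun b _ _ => rfl, fun x => ⟨fun h => ⟨h, (not_lt.1 hl).trans h.1⟩, And.left⟩⟩
  · rw [clipStep, den_cond_neg _ (by simpa [hj] using h), den_skip]
    refine ⟨rfl, fun b _ _ => rfl, fun x => ⟨fun h' => ⟨h', fun h1 h2 => absurd ⟨h1, h2⟩ h⟩,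
      And.left⟩⟩

theorem clip_run : ∃ C, ∀ (σ : State) (n : ℕ), σ.nat 0 0 = n → Run clip σ (C * (n + 1)) (fun τ =>
    ∀ x, (τ.real 26 0 ≤ x ∧ x ≤ τ.real 27 0) ↔ (0 ≤ x ∧ x ≤ 1) ∧
      ∀ j < n, j ≠ σ.nat 10 0 → ¬ 0 < σ.dot 7 j → 0 ≤ σ.dot 10 j + σ.dot 13 j * x) := by
  apply Exists.intro
  intro σ n h0
  apply Run.seqL (Run.simpleL rfl (Nat.succ_pos _) rfl)
  rintro τ rfl
  refine (Run.forN_simple rfl (fun k τ => τ.nat 55 0 = k ∧ τ.nat 0 0 = n ∧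
    τ.nat 10 0 = σ.nat 10 0 ∧ (∀ b, b ≠ 26 → b ≠ 27 → τ.real b = σ.real b) ∧
    ∀ x, (τ.real 26 0 ≤ x ∧ x ≤ τ.real 27 0) ↔ (0 ≤ x ∧ x ≤ 1) ∧
      ∀ j < k, j ≠ σ.nat 10 0 → ¬ 0 < σ.dot 7 j → 0 ≤ σ.dot 10 j + σ.dot 13 j * x) n
    ?_ ?_ ?_).mono le_rfl fun τ h => h.2.2.2.2
  · refine ⟨by simp, by simpa using h0, by simp, fun b h1 h2 => ?_, by simp⟩
    simp [State.setReal_real_ne _ _ _ h1, State.setReal_real_ne _ _ _ h2]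
  · exact fun i τ h => ⟨h.1, h.2.1⟩
  · rintro k τ hk ⟨h1, h2, h3, h4, h5⟩
    obtain ⟨e1, e2, e3⟩ := clipStep_spec h1
    have hdot : ∀ b ∈ [7, 10, 13], τ.dot b k = σ.dot b k := by
      intro b hb
      simp only [List.mem_cons, List.not_mem_nil, or_false] at hb
      rw [State.dot, State.dot, h4 0 (by decide) (by decide), h4 1 (by decide) (by decide),
        h4 2 (by decide) (by decide), h4 b (by omega) (by omega), h4 (b + 1) (by omega) (by omega),
        h4 (b + 2) (by omega) (by omega)]
    rw [e1]
    refine ⟨by simp [h1], by simp [e1, h2], by simp [e1, h3],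
      fun b hb hb' => (e2 b hb hb').trans (h4 b hb hb'), fun x => ?_⟩
    rw [State.setNat_real, e3 x, h5 x, h3, hdot 7 (by simp), hdot 10 (by simp),
      hdot 13 (by simp), and_assoc]
    refine and_congr_right fun _ => ⟨fun h j hj => ?_, fun h => ⟨fun j hj => h j (by omega),
      h k (by omega)⟩⟩
    rcases Nat.lt_succ_iff_lt_or_eq.1 hj with hj | rfl
    exacts [h.1 j hj, h.2]

/-! ### Sorting by slope -/

def padSize : Cmd :=
  setN 42 1 ;; .loop (.natLt (nv 42) (nv 12)) (setN 42 (nv 42 + nv 42))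

theorem padSize_run : ∃ C, ∀ (σ : State) (n : ℕ), 0 < σ.nat 12 0 → σ.nat 12 0 ≤ n →
    Run padSize σ (C * (n + 1)) (fun τ => ∃ e, τ.nat 42 0 = 2 ^ e ∧ e ≤ Nat.log 2 n + 1 ∧
      σ.nat 12 0 ≤ 2 ^ e ∧ 2 ^ e ≤ 2 * n) := by
  apply Exists.intro
  intro σ n hpos hn
  apply Run.seqL (Run.simpleL rfl (Nat.succ_pos _) rfl)
  rintro τ rfl
  refine (Run.loopMeasure (fun τ => τ.nat 12 0 = σ.nat 12 0 ∧ ∃ e, τ.nat 42 0 = 2 ^ e ∧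
    e ≤ Nat.log 2 n + 1 ∧ 2 ^ e ≤ 2 * n) (fun τ => σ.nat 12 0 - τ.nat 42 0)
    (setN 42 (nv 42 + nv 42)).bound ?_ ⟨by simp, 0, by simp, by simp, by omega⟩).mono
    (Nat.mul_le_mul_left _ (by omega)) ?_
  · rintro τ ⟨h1, e, h2, h3, h4⟩ hb
    simp only [holds_natLt, eval_nv, h1, h2] at hb
    refine Run.simple rfl ⟨⟨by simp [h1], e + 1, by simp [h2]; ring, ?_, ?_⟩, ?_⟩
    · have := Nat.le_log_of_pow_le (b := 2) (by decide) (show 2 ^ e ≤ n by omega)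
      omega
    · rw [pow_succ]; omega
    · have := Nat.two_pow_pos e
      simp [h2]
      omega
  · rintro τ ⟨⟨h1, e, h2, h3, h4⟩, hb⟩
    simp only [holds_natLt, eval_nv, h1, h2] at hb
    exact ⟨e, h2, h3, by omega, h4⟩

/-- The list is padded to a power of two by copies of its first line, which does not change the set
of lines. The keys are the negated slopes, so increasing keys mean decreasing slopes. -/
def fillStep : Cmd :=
  .cond (.natLt (nv 55) (nv 12)) (.setNat 40 (nv 55) (.get 11 (nv 55)))
    (.setNat 40 (nv 55) (.get 11 0)) ;;
  .setReal 30 (nv 55) (0 - .get 21 (.get 40 (nv 55)))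

def sortLines : Cmd := padSize ;; forN 55 (nv 42) fillStep ;; mergeSort

/-- The first `M` cells of the array `40` contain the elements of `l`, in the order of decreasing
slopes. -/
structure SortedLines (Y : ℕ → ℝ) (l : List ℕ) (M : ℕ) (ln : ℕ → ℕ) : Prop where
  pos : 0 < M
  mem : ∀ j, j ∈ l ↔ ∃ i < M, ln i = j
  anti : ∀ i j, i ≤ j → j < M → Y (ln j) ≤ Y (ln i)

theorem fill_run : ∃ C, ∀ (σ : State) (M : ℕ), σ.nat 42 0 = M →
    Run (forN 55 (nv 42) fillStep) σ (C * (M + 1)) (fun τ => τ.nat 42 0 = M ∧ ∀ i < M,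
      τ.item i = (-σ.real 21 (τ.nat 40 i), τ.nat 40 i) ∧
      τ.nat 40 i = if i < σ.nat 12 0 then σ.nat 11 i else σ.nat 11 0) := by
  apply Exists.intro
  intro σ M hM
  refine (Run.forN_simple rfl (fun k τ => τ.nat 55 0 = k ∧ τ.nat 42 0 = M ∧
    τ.nat 12 = σ.nat 12 ∧ τ.nat 11 = σ.nat 11 ∧ τ.real 21 = σ.real 21 ∧ ∀ i < k,
    τ.real 30 i = -σ.real 21 (τ.nat 40 i) ∧
      τ.nat 40 i = if i < σ.nat 12 0 then σ.nat 11 i else σ.nat 11 0) M ?_ ?_ ?_).mono le_rfl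
    fun τ h => ⟨h.2.1, fun i hi => ⟨?_, (h.2.2.2.2.2 i hi).2⟩⟩
  · simp [hM]
  · exact fun i τ h => ⟨h.1, h.2.1⟩
  · rintro k τ hk ⟨h1, h2, h3, h4, h5, h6⟩
    have e : fillStep.den τ = (τ.setNat 40 k (if k < σ.nat 12 0 then σ.nat 11 k else
        σ.nat 11 0)).setReal 30 k (-σ.real 21 (if k < σ.nat 12 0 then σ.nat 11 k else
        σ.nat 11 0)) := by
      by_cases hc : k < σ.nat 12 0
      · rw [fillStep, den_seq, den_cond_pos _ (by simpa [h1, h3] using hc), if_pos hc]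
        simp [h1, h4, h5]
      · rw [fillStep, den_seq, den_cond_neg _ (by simpa [h1, h3] using hc), if_neg hc]
        simp [h1, h4, h5]
    rw [e]
    refine ⟨by simp [h1], by simp [h2], by simp [h3], by simp [h4], by simp [h5], fun i hi => ?_⟩
    rcases Nat.lt_succ_iff_lt_or_eq.1 hi with hi | rfl
    · simpa [Function.update_of_ne (show i ≠ k by omega)] using h6 i hi
    · simp
  · simp only [State.item]
    rw [(h.2.2.2.2.2 i hi).1]

theorem sortLines_run : ∃ C, ∀ (σ : State) (n : ℕ), 0 < σ.nat 12 0 → σ.nat 12 0 ≤ n →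
    Run sortLines σ (C * ((n + 1) * (Nat.log 2 n + 2))) (fun τ => τ.nat 42 0 ≤ 2 * n ∧
      SortedLines (σ.real 21) (σ.list 11 12) (τ.nat 42 0) (τ.nat 40)) := by
  obtain ⟨C, hC⟩ := padSize_run
  obtain ⟨D, hD⟩ := fill_run
  obtain ⟨F, hF⟩ := mergeSort_run
  refine ⟨C + (2 * D + 2 * F), ?_⟩
  intro σ n hpos hn
  have hm : n + 1 ≤ (n + 1) * (Nat.log 2 n + 2) := Nat.le_mul_of_pos_right _ (by omega)
  refine Run.seqL ((hC σ n hpos hn).mono (Nat.mul_le_mul_left _ hm) fun _ => id).frame ?_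
  rintro τ ⟨⟨e, h1, h2, h3, h4⟩, hf⟩
  have hcost : D * (2 ^ e + 1) ≤ 2 * D * ((n + 1) * (Nat.log 2 n + 2)) := by
    calc D * (2 ^ e + 1) ≤ D * (2 * ((n + 1) * (Nat.log 2 n + 2))) :=
          Nat.mul_le_mul_left _ (by omega)
      _ = _ := by ring
  refine Run.seqL ((hD τ (2 ^ e) h1).mono hcost fun _ => id) ?_
  rintro ρ ⟨h5, h6⟩
  have hcost' : F * ((2 ^ e + 1) * (e + 1)) ≤ 2 * F * ((n + 1) * (Nat.log 2 n + 2)) := by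
    calc F * ((2 ^ e + 1) * (e + 1)) ≤ F * ((2 * (n + 1)) * (Nat.log 2 n + 2)) :=
          Nat.mul_le_mul_left _ (Nat.mul_le_mul (by omega) (by omega))
      _ = _ := by ring
  refine ((hF ρ e h5).mono hcost' fun _ => id).frame.mono le_rfl ?_
  rintro κ ⟨⟨h7, h8⟩, hk⟩
  have e42 : κ.nat 42 0 = 2 ^ e := by rw [hk.1 42 (by decide), h5]
  have e12 : τ.nat 12 = σ.nat 12 := hf.1 12 (by decide)
  have e11 : τ.nat 11 = σ.nat 11 := hf.1 11 (by decide)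
  have e21 : τ.real 21 = σ.real 21 := hf.2 21 (by decide)
  rw [e12, e11, e21] at h6
  rw [e42]
  have hmem : ∀ j, j ∈ σ.list 11 12 ↔ (-σ.real 21 j, j) ∈ seg ρ.item 0 (2 ^ e) := by
    intro j
    simp only [State.list, mem_seg, zero_add]
    constructor
    · rintro ⟨i, hi, rfl⟩
      obtain ⟨g1, g2⟩ := h6 i (by omega)
      rw [if_pos hi] at g2
      exact ⟨i, by omega, by rw [g1, g2]⟩
    · rintro ⟨i, hi, hij⟩
      obtain ⟨g1, g2⟩ := h6 i hi
      rw [g1, Prod.mk.injEq] at hij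
      rw [← hij.2, g2]
      split_ifs with hc
      exacts [⟨i, hc, rfl⟩, ⟨0, hpos, rfl⟩]
  have hitem : ∀ i < 2 ^ e, κ.item i = (-σ.real 21 (κ.nat 40 i), κ.nat 40 i) := by
    intro i hi
    have : κ.item i ∈ seg ρ.item 0 (2 ^ e) :=
      h8.mem_iff.1 ((mem_seg _).2 ⟨i, hi, by rw [zero_add]⟩)
    obtain ⟨i', hi', h9⟩ := (mem_seg _).1 this
    rw [zero_add, (h6 i' hi').1] at h9
    have h10 : ρ.nat 40 i' = κ.nat 40 i := congrArg Prod.snd h9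
    rw [← h9, h10]
  refine ⟨h4, by positivity, fun j => ?_, fun i j hij hj => ?_⟩
  · rw [hmem, ← h8.mem_iff, mem_seg]
    constructor
    · rintro ⟨i, hi, hij⟩
      exact ⟨i, hi, by rw [zero_add] at hij; exact congrArg Prod.snd hij⟩
    · rintro ⟨i, hi, rfl⟩
      exact ⟨i, hi, by rw [zero_add, hitem i hi]⟩
  · rcases hij.eq_or_lt with rfl | hij
    · exact le_rfl
    have hs := List.pairwise_iff_getElem.1 h7 i j (by simpa using hij.trans hj) (by simpa using hj) hij
    rw [getElem_seg, getElem_seg, zero_add, zero_add, hitem i (hij.trans hj), hitem j hj] at hs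
    exact neg_le_neg_iff.1 hs

end RealRAM


namespace RealRAM

/-! ### The lower envelope of the lines -/

/-- The value at `x` of the affine function number `j`. -/
def lineAt (X Y : ℕ → ℝ) (x : ℝ) (j : ℕ) : ℝ := X j + Y j * x

/-- The first `pos` of the `M` lines `ln 0, ln 1, …` have been processed: the stack of height `h`
contains the lines `ℓ r` of their lower envelope and the left ends `b r` of the intervals in which
these are minimal, except that the next line may be needed too. -/
structure Scan (X Y : ℕ → ℝ) (ln : ℕ → ℕ) (M : ℕ) (lo hi : ℝ) (pos h : ℕ) (b : ℕ → ℝ)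
    (ℓ : ℕ → ℕ) : Prop where
  pos_le : pos ≤ M
  height_le : h ≤ pos
  start : 0 < h → b 0 = lo
  mem : ∀ r < h, ∃ i < pos, ℓ r = ln i
  lt : ∀ r, r + 1 < h → b r < b (r + 1)
  lt_hi : ∀ r, r + 1 < h → b (r + 1) < hi
  cont : ∀ r, r + 1 < h → lineAt X Y (b (r + 1)) (ℓ r) = lineAt X Y (b (r + 1)) (ℓ (r + 1))
  anti : ∀ r, r + 1 < h → Y (ℓ (r + 1)) < Y (ℓ r)
  dom : ∀ i < pos, ∀ x, lo ≤ x → x ≤ hi → (∃ r < h, lineAt X Y x (ℓ r) ≤ lineAt X Y x (ln i)) ∨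
    (pos < M ∧ lineAt X Y x (ln pos) ≤ lineAt X Y x (ln i))

namespace Scan

variable {X Y : ℕ → ℝ} {ln : ℕ → ℕ} {M : ℕ} {lo hi : ℝ} {pos h : ℕ} {b : ℕ → ℝ} {ℓ : ℕ → ℕ}
  (H : Scan X Y ln M lo hi pos h b ℓ)
include H

/-- The next line is not steeper than the top line and not below it at the right end of the
interval, hence nowhere below it in the interval. -/
theorem skip (hM : pos < M) (hh : 0 < h) (hanti : Y (ln pos) ≤ Y (ℓ (h - 1)))
    (hhi : lineAt X Y hi (ℓ (h - 1)) ≤ lineAt X Y hi (ln pos)) :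
    Scan X Y ln M lo hi (pos + 1) h b ℓ := by
  refine ⟨hM, H.height_le.trans (Nat.le_succ _), H.start, fun r hr => ?_, H.lt, H.lt_hi, H.cont,
    H.anti, fun i hi' x h1 h2 => Or.inl ?_⟩
  · obtain ⟨i, hi, e⟩ := H.mem r hr
    exact ⟨i, by omega, e⟩
  · have key : lineAt X Y x (ℓ (h - 1)) ≤ lineAt X Y x (ln pos) := by
      simp only [lineAt] at hhi ⊢
      nlinarith
    rcases Nat.lt_succ_iff_lt_or_eq.1 hi' with hi' | rfl
    · rcases H.dom i hi' x h1 h2 with h3 | ⟨-, h3⟩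
      · exact h3
      · exact ⟨h - 1, by omega, key.trans h3⟩
    · exact ⟨h - 1, by omega, key⟩

/-- From the left end of its interval on, the top line is nowhere below the new line; to the left of
that end the previous line of the stack is not above it. So the top line is not needed. -/
theorem pop (hM : pos < M) (hh : 0 < h) (hanti : Y (ln pos) ≤ Y (ℓ (h - 1)))
    (hb : lineAt X Y (b (h - 1)) (ln pos) ≤ lineAt X Y (b (h - 1)) (ℓ (h - 1))) :
    Scan X Y ln M lo hi pos (h - 1) b ℓ := by
  refine ⟨H.pos_le, (Nat.sub_le _ _).trans H.height_le, fun _ => H.start hh,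
    fun r hr => H.mem r (by omega), fun r hr => H.lt r (by omega), fun r hr => H.lt_hi r (by omega),
    fun r hr => H.cont r (by omega), fun r hr => H.anti r (by omega), fun i hi' x h1 h2 => ?_⟩
  rcases H.dom i hi' x h1 h2 with ⟨r, hr, h3⟩ | h3
  · by_cases hr' : r < h - 1
    · exact Or.inl ⟨r, hr', h3⟩
    obtain rfl : r = h - 1 := by omega
    rcases le_total (b (h - 1)) x with hx | hx
    · refine Or.inr ⟨hM, le_trans ?_ h3⟩
      simp only [lineAt] at hb ⊢
      nlinarith
    · obtain rfl | ⟨k, rfl⟩ : h = 1 ∨ ∃ k, h = k + 2 := by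
        rcases Nat.lt_or_ge 1 h with h' | h'
        · exact Or.inr ⟨h - 2, by omega⟩
        · exact Or.inl (by omega)
      · obtain rfl : x = b 0 := le_antisymm hx (by rw [H.start hh]; exact h1)
        exact Or.inr ⟨hM, hb.trans h3⟩
      · refine Or.inl ⟨k, by omega, le_trans ?_ h3⟩
        have h4 := H.cont k (by omega)
        have h5 := H.anti k (by omega)
        simp only [show k + 2 - 1 = k + 1 by omega, lineAt] at hx h4 ⊢
        nlinarith
  · exact Or.inr h3

/-- Here the new line crosses the top line strictly between the left end of the top interval and the
right end `hi`, and the crossing becomes the next breakpoint. -/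
theorem push (hM : pos < M) {c : ℝ} (hc0 : h = 0 → c = lo)
    (hc : 0 < h → b (h - 1) < c ∧ c < hi ∧ lineAt X Y c (ℓ (h - 1)) = lineAt X Y c (ln pos) ∧
      Y (ln pos) < Y (ℓ (h - 1))) :
    Scan X Y ln M lo hi (pos + 1) (h + 1) (Function.update b h c)
      (Function.update ℓ h (ln pos)) := by
  have hu : ∀ r < h, Function.update b h c r = b r := fun r hr => Function.update_of_ne hr.ne _ _
  have hv : ∀ r < h, Function.update ℓ h (ln pos) r = ℓ r :=
    fun r hr => Function.update_of_ne hr.ne _ _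
  refine ⟨hM, Nat.succ_le_succ H.height_le, fun _ => ?_, fun r hr => ?_, fun r hr => ?_,
    fun r hr => ?_, fun r hr => ?_, fun r hr => ?_, fun i hi' x h1 h2 => Or.inl ?_⟩
  · rcases Nat.eq_zero_or_pos h with rfl | hh
    · simpa using hc0 rfl
    · rw [hu 0 hh, H.start hh]
  · rcases Nat.lt_succ_iff_lt_or_eq.1 hr with hr | rfl
    · obtain ⟨i, hi, e⟩ := H.mem r hr
      exact ⟨i, by omega, by rw [hv r hr, e]⟩
    · exact ⟨pos, by omega, by simp⟩
  · rw [hu r (by omega)]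
    rcases Nat.lt_succ_iff_lt_or_eq.1 hr with hr | rfl
    · rw [hu _ hr]; exact H.lt r hr
    · simpa using (hc (by omega)).1
  · rcases Nat.lt_succ_iff_lt_or_eq.1 hr with hr | rfl
    · rw [hu _ hr]; exact H.lt_hi r hr
    · simpa using (hc (by omega)).2.1
  · rw [hv r (by omega)]
    rcases Nat.lt_succ_iff_lt_or_eq.1 hr with hr | rfl
    · rw [hu _ hr, hv _ hr]; exact H.cont r hr
    · simpa using (hc (by omega)).2.2.1
  · rw [hv r (by omega)]
    rcases Nat.lt_succ_iff_lt_or_eq.1 hr with hr | rfl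
    · rw [hv _ hr]; exact H.anti r hr
    · simpa using (hc (by omega)).2.2.2
  · have key : lineAt X Y x (ln pos) ≤ lineAt X Y x (ln i) →
        ∃ r < h + 1, lineAt X Y x (Function.update ℓ h (ln pos) r) ≤ lineAt X Y x (ln i) :=
      fun h => ⟨_, Nat.lt_succ_self _, by simpa using h⟩
    rcases Nat.lt_succ_iff_lt_or_eq.1 hi' with hi' | rfl
    · rcases H.dom i hi' x h1 h2 with ⟨r, hr, h3⟩ | ⟨-, h3⟩
      · exact ⟨r, by omega, by rwa [hv r hr]⟩
      · exact key h3
    · exact key le_rfl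

end Scan

theorem scan_zero (X Y : ℕ → ℝ) (ln : ℕ → ℕ) (M : ℕ) (lo hi : ℝ) (b : ℕ → ℝ) (ℓ : ℕ → ℕ) :
    Scan X Y ln M lo hi 0 0 b ℓ :=
  ⟨by simp, by simp, by simp, by simp, by simp, by simp, by simp, by simp, by simp⟩

/-- The value at `x` of the line `j`. -/
def lineE (j : NExp) (x : RExp) : RExp := .get 20 j + .get 21 j * x

@[simp] theorem eval_lineE (σ : State) (j : NExp) (x : RExp) :
    (lineE j x).eval σ = lineAt (σ.real 20) (σ.real 21) (x.eval σ) (j.eval σ) := rfl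

def pushLine (c : RExp) : Cmd :=
  .setReal 70 (nv 73) c ;; .setNat 71 (nv 73) (.get 40 (nv 72)) ;; setN 73 (nv 73 + 1) ;;
    setN 72 (nv 72 + 1)

def topLine : NExp := .get 71 (nv 73 - 1)

def nextLine : NExp := .get 40 (nv 72)

def scanStep : Cmd :=
  .cond (.natLt (nv 73) 1) (pushLine (rv 26))
    (.cond (.le (lineE topLine (rv 27)) (lineE nextLine (rv 27))) (setN 72 (nv 72 + 1))
      (.cond (.le (lineE nextLine (.get 70 (nv 73 - 1))) (lineE topLine (.get 70 (nv 73 - 1))))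
        (setN 73 (nv 73 - 1))
        (pushLine ((.get 20 nextLine - .get 20 topLine) / (.get 21 topLine - .get 21 nextLine)))))

def scan : Cmd := (setN 72 0 ;; setN 73 0) ;; .loop (.natLt (nv 72) (nv 42)) scanStep

@[simp] theorem eval_topLine (σ : State) : topLine.eval σ = σ.nat 71 (σ.nat 73 0 - 1) := rfl

@[simp] theorem eval_nextLine (σ : State) : nextLine.eval σ = σ.nat 40 (σ.nat 72 0) := rfl

/-- Reading a line adds at most one entry to the stack, so twice the number of unread lines plus the
height of the stack decreases in every step, also when a line is popped. -/
theorem scanStep_spec {σ : State} {M : ℕ}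
    (hanti : ∀ i j, i ≤ j → j < M → σ.real 21 (σ.nat 40 j) ≤ σ.real 21 (σ.nat 40 i))
    (H : Scan (σ.real 20) (σ.real 21) (σ.nat 40) M (σ.real 26 0) (σ.real 27 0) (σ.nat 72 0)
      (σ.nat 73 0) (σ.real 70) (σ.nat 71)) (hM : σ.nat 72 0 < M) :
    ((scanStep.den σ).real 20 = σ.real 20 ∧ (scanStep.den σ).real 21 = σ.real 21 ∧
      (scanStep.den σ).real 26 = σ.real 26 ∧ (scanStep.den σ).real 27 = σ.real 27 ∧
      (scanStep.den σ).nat 40 = σ.nat 40 ∧ (scanStep.den σ).nat 42 = σ.nat 42) ∧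
    Scan (σ.real 20) (σ.real 21) (σ.nat 40) M (σ.real 26 0) (σ.real 27 0)
      ((scanStep.den σ).nat 72 0) ((scanStep.den σ).nat 73 0) ((scanStep.den σ).real 70)
      ((scanStep.den σ).nat 71) ∧
    2 * (M - (scanStep.den σ).nat 72 0) + (scanStep.den σ).nat 73 0 <
      2 * (M - σ.nat 72 0) + σ.nat 73 0 := by
  by_cases h0 : σ.nat 73 0 < 1
  · rw [scanStep, den_cond_pos _ (by simpa using h0)]
    refine ⟨by simp [pushLine], ?_, by simp [pushLine]; omega⟩
    simpa [pushLine] using H.push hM (c := σ.real 26 0) (fun _ => rfl) (by omega)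
  rw [scanStep, den_cond_neg _ (by simpa using h0)]
  have hh : 0 < σ.nat 73 0 := by omega
  have hY : σ.real 21 (σ.nat 40 (σ.nat 72 0)) ≤ σ.real 21 (σ.nat 71 (σ.nat 73 0 - 1)) := by
    obtain ⟨i, hi, e⟩ := H.mem (σ.nat 73 0 - 1) (by omega)
    rw [e]
    exact hanti i _ hi.le hM
  by_cases h1 : lineAt (σ.real 20) (σ.real 21) (σ.real 27 0) (σ.nat 71 (σ.nat 73 0 - 1)) ≤
      lineAt (σ.real 20) (σ.real 21) (σ.real 27 0) (σ.nat 40 (σ.nat 72 0))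
  · rw [den_cond_pos _ (by simpa using h1)]
    refine ⟨by simp, ?_, by simp; omega⟩
    simpa using H.skip hM hh hY h1
  rw [den_cond_neg _ (by simpa using h1)]
  by_cases h2 : lineAt (σ.real 20) (σ.real 21) (σ.real 70 (σ.nat 73 0 - 1)) (σ.nat 40 (σ.nat 72 0)) ≤
      lineAt (σ.real 20) (σ.real 21) (σ.real 70 (σ.nat 73 0 - 1)) (σ.nat 71 (σ.nat 73 0 - 1))
  · rw [den_cond_pos _ (by simpa using h2)]
    refine ⟨by simp, ?_, by simp; omega⟩
    simpa using H.pop hM hh hY h2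
  rw [den_cond_neg _ (by simpa using h2)]
  refine ⟨by simp [pushLine], ?_, by simp [pushLine]; omega⟩
  have := H.push hM (c := (σ.real 20 (σ.nat 40 (σ.nat 72 0)) -
    σ.real 20 (σ.nat 71 (σ.nat 73 0 - 1))) / (σ.real 21 (σ.nat 71 (σ.nat 73 0 - 1)) -
      σ.real 21 (σ.nat 40 (σ.nat 72 0)))) (by omega) fun _ => ?_
  · simpa [pushLine] using this
  · simp only [lineAt, not_le] at h1 h2 ⊢
    have hb : σ.real 70 (σ.nat 73 0 - 1) ≤ σ.real 27 0 := by
      by_contra hb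
      nlinarith
    have hlt : σ.real 21 (σ.nat 40 (σ.nat 72 0)) < σ.real 21 (σ.nat 71 (σ.nat 73 0 - 1)) := by
      refine hY.lt_of_ne fun e => ?_
      rw [e] at h1 h2
      linarith
    have hd : 0 < σ.real 21 (σ.nat 71 (σ.nat 73 0 - 1)) - σ.real 21 (σ.nat 40 (σ.nat 72 0)) := by
      linarith
    refine ⟨?_, ?_, ?_, hlt⟩
    · rw [lt_div_iff₀ hd]; linarith
    · rw [div_lt_iff₀ hd]; linarith
    · field_simp
      ring

theorem scan_run : ∃ C, ∀ (σ : State) (l : List ℕ) (M : ℕ), σ.nat 42 0 = M →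
    SortedLines (σ.real 21) l M (σ.nat 40) →
    Run scan σ (C * (M + 1)) (fun τ => Scan (σ.real 20) (σ.real 21) (σ.nat 40) M (σ.real 26 0)
      (σ.real 27 0) M (τ.nat 73 0) (τ.real 70) (τ.nat 71)) := by
  apply Exists.intro
  intro σ l M hM hs
  apply Run.seqL (Run.simpleL rfl (Nat.succ_pos _) rfl)
  rintro τ rfl
  refine (Run.loopMeasure (fun τ => (τ.real 20 = σ.real 20 ∧ τ.real 21 = σ.real 21 ∧
    τ.real 26 = σ.real 26 ∧ τ.real 27 = σ.real 27 ∧ τ.nat 40 = σ.nat 40 ∧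
    τ.nat 42 = σ.nat 42) ∧ Scan (σ.real 20) (σ.real 21) (σ.nat 40) M (σ.real 26 0)
      (σ.real 27 0) (τ.nat 72 0) (τ.nat 73 0) (τ.real 70) (τ.nat 71))
    (fun τ => 2 * (M - τ.nat 72 0) + τ.nat 73 0) scanStep.bound ?_ ?_).mono
    ((Nat.mul_le_mul_left _ (show _ ≤ 2 * (M + 1) by simp)).trans
      (Nat.mul_assoc _ _ _).ge) ?_
  · rintro τ ⟨⟨h1, h2, h3, h4, h5, h6⟩, H⟩ hb
    simp only [holds_natLt, eval_nv, h6, hM] at hb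
    rw [← h1, ← h2, ← h3, ← h4, ← h5] at H
    obtain ⟨⟨g1, g2, g3, g4, g5, g6⟩, G, hlt⟩ := scanStep_spec
      (by rw [h2, h5]; exact hs.anti) H hb
    refine Run.simple rfl ⟨⟨⟨g1.trans h1, g2.trans h2, g3.trans h3, g4.trans h4, g5.trans h5,
      g6.trans h6⟩, ?_⟩, hlt⟩
    rwa [h1, h2, h3, h4, h5] at G
  · exact ⟨by simp, scan_zero _ _ _ _ _ _ _ _⟩
  · rintro τ ⟨⟨⟨h1, h2, h3, h4, h5, h6⟩, H⟩, hb⟩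
    simp only [holds_natLt, eval_nv, h6, hM] at hb
    have := H.pos_le
    rwa [show τ.nat 72 0 = M by omega] at H

end RealRAM


/-! ### The corners of the polygon of valid directions -/

/-- The cone of the vectors `y v + a q₁ + b q₂` that satisfy the constraints number `j ∈ l`, with
`b / a` in the interval from `lo` to `hi`. -/
def polygonCone (v q₁ q₂ : E3) (X Y : ℕ → ℝ) (l : List ℕ) (lo hi : ℝ) : Set E3 :=
  {d | ∃ y a b, d = comb3 v q₁ q₂ y a b ∧ (a = 0 ∧ b = 0 ∨ 0 < a ∧ lo ≤ b / a ∧ b / a ≤ hi) ∧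
    ∀ j ∈ l, 0 ≤ y + (X j * a + Y j * b)}

/-- The vectors given by the `m` breakpoints `z` and the lines `ℓ` are, together with `v`, a
boundary description of the cone. -/
def IsOutline (X Y : ℕ → ℝ) (l : List ℕ) (lo hi : ℝ) (m : ℕ) (z : ℕ → ℝ) (ℓ : ℕ → ℕ) : Prop :=
  ∀ (v q₁ q₂ : E3) (D : Set E3), 0 < det3 v q₁ q₂ →
    (∀ d, d ∈ D ↔ d ≠ 0 ∧ d ∈ polygonCone v q₁ q₂ X Y l lo hi) →
    IsBoundaryDescription D (fun k : Fin (m + 1) =>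
      corner v q₁ q₂ (fun r => X (ℓ r)) (fun r => Y (ℓ r)) z k)

/-- If no ratio is admissible, only a = b = 0 remains. Any constraint of the nonempty list then says
y ≥ 0. -/
theorem isOutline_ray {X Y : ℕ → ℝ} {l : List ℕ} {lo hi : ℝ} (hl : l ≠ []) (hlt : hi < lo)
    (z : ℕ → ℝ) (ℓ : ℕ → ℕ) : IsOutline X Y l lo hi 0 z ℓ := by
  intro v q₁ q₂ D hdet hD
  refine isBoundaryDescription_ray ?_ fun d => ?_
  · rintro rfl
    simp [det3_eq] at hdet
  · rw [hD]
    refine and_congr_right fun _ => ⟨?_, ?_⟩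
    · rintro ⟨y, a, b, rfl, ⟨rfl, rfl⟩ | ⟨-, h1, h2⟩, h3⟩
      · obtain ⟨j, hj⟩ := List.exists_mem_of_ne_nil _ hl
        exact ⟨y, by simpa using h3 j hj, by simp [comb3]⟩
      · exact absurd (h1.trans h2) (not_le.2 hlt)
    · rintro ⟨y, hy, rfl⟩
      exact ⟨y, 0, 0, by simp [comb3], Or.inl ⟨rfl, rfl⟩, fun j _ => by simpa using hy⟩

/-! ### From the lower envelope to the corners -/

namespace RealRAM

namespace Scan

variable {X Y : ℕ → ℝ} {ln : ℕ → ℕ} {M : ℕ} {lo hi : ℝ} {h : ℕ} {b : ℕ → ℝ} {ℓ : ℕ → ℕ}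
  (H : Scan X Y ln M lo hi M h b ℓ)
include H

theorem exists_le {l : List ℕ} (hs : SortedLines Y l M ln) {j : ℕ} (hj : j ∈ l) {x : ℝ}
    (h1 : lo ≤ x) (h2 : x ≤ hi) : ∃ r < h, lineAt X Y x (ℓ r) ≤ lineAt X Y x j := by
  obtain ⟨i, hi, rfl⟩ := (hs.mem j).1 hj
  rcases H.dom i hi x h1 h2 with h3 | h3
  · exact h3
  · omega

theorem height_pos {l : List ℕ} (hs : SortedLines Y l M ln) (hle : lo ≤ hi) : 0 < h := by
  obtain ⟨r, hr, -⟩ := H.exists_le hs ((hs.mem _).2 ⟨0, hs.pos, rfl⟩) le_rfl hle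
  omega

/-- Over the interval every line is bounded below by a line of the stack. Multiplication by a > 0
carries this over to the constraints. -/
theorem mem_polygonCone_iff {l : List ℕ} (hs : SortedLines Y l M ln) (hle : lo ≤ hi)
    {v q₁ q₂ d : E3} : d ∈ polygonCone v q₁ q₂ X Y l lo hi ↔
      d ∈ chainCone v q₁ q₂ (fun r => X (ℓ r)) (fun r => Y (ℓ r)) h lo hi := by
  constructor
  · rintro ⟨y, a, b, rfl, h1, h3⟩
    have h4 : ∀ r < h, 0 ≤ y + (X (ℓ r) * a + Y (ℓ r) * b) := fun r hr =>
      h3 _ ((hs.mem _).2 (by obtain ⟨i, hi, e⟩ := H.mem r hr; exact ⟨i, hi, e.symm⟩))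
    rcases h1 with ⟨rfl, rfl⟩ | ⟨h1, h2, h5⟩
    · exact ⟨y, 0, 0, rfl, le_rfl, by simp, by simp, h4⟩
    · exact ⟨y, a, b, rfl, h1.le, (le_div_iff₀ h1).1 h2, (div_le_iff₀ h1).1 h5, h4⟩
  · rintro ⟨y, a, b, rfl, ha, h1, h2, h3⟩
    rcases ha.eq_or_lt with rfl | ha
    · obtain rfl : b = 0 := by linarith
      refine ⟨y, 0, 0, rfl, Or.inl ⟨rfl, rfl⟩, fun j _ => ?_⟩
      simpa using h3 0 (H.height_pos hs hle)
    · have h1' := (le_div_iff₀ ha).2 h1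
      have h2' := (div_le_iff₀ ha).2 h2
      refine ⟨y, a, b, rfl, Or.inr ⟨ha, h1', h2'⟩, fun j hj => ?_⟩
      obtain ⟨r, hr, h4⟩ := H.exists_le hs hj h1' h2'
      have h5 := mul_le_mul_of_nonneg_right h4 ha.le
      have e : ∀ i, lineAt X Y (b / a) i * a = X i * a + Y i * b := fun i => by
        simp only [lineAt]
        field_simp
      rw [e, e] at h5
      exact (h3 r hr).trans (by linarith)

/-- The right end `hi` is the last breakpoint. The top line is repeated because each corner takes
its height from the line with the number of its breakpoint. -/
theorem isOutline_of_lt {l : List ℕ} (hs : SortedLines Y l M ln) (hlt : lo < hi) :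
    IsOutline X Y l lo hi (h + 1) (Function.update b h hi)
      (Function.update ℓ h (ℓ (h - 1))) := by
  intro v q₁ q₂ D hdet hD
  have hpos := H.height_pos hs hlt.le
  have hb : ∀ r < h, Function.update b h hi r = b r := fun r hr => Function.update_of_ne hr.ne _ _
  have hℓ : ∀ r < h, Function.update ℓ h (ℓ (h - 1)) r = ℓ r :=
    fun r hr => Function.update_of_ne hr.ne _ _
  have hb0 : b 0 = lo := H.start hpos
  refine isBoundaryDescription_chain hdet ⟨fun r hr => ?_, fun r hr => ?_, fun r hr => ?_⟩ hpos
    fun d => ?_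
  · rw [hb r hr]
    rcases Nat.lt_or_ge (r + 1) h with hr' | hr'
    · rw [hb _ hr']; exact H.lt r hr'
    · obtain rfl : h = r + 1 := by omega
      rw [Function.update_self]
      rcases Nat.eq_zero_or_pos r with rfl | h0
      · rwa [hb0]
      · obtain ⟨s, rfl⟩ : ∃ s, r = s + 1 := ⟨r - 1, by omega⟩
        exact H.lt_hi s (by omega)
  · simp only [hℓ r hr]
    rcases Nat.lt_or_ge (r + 1) h with hr' | hr'
    · rw [hb _ hr', hℓ _ hr']; exact H.cont r hr'
    · obtain rfl : h = r + 1 := by omega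
      simp
  · simp only [hℓ r (by omega), hℓ _ hr]
    exact H.anti r hr
  · rw [hD, hb 0 hpos, hb0, Function.update_self, H.mem_polygonCone_iff hs hlt.le]
    refine and_congr_right fun _ => ?_
    simp only [chainCone]
    refine exists_congr fun y => exists_congr fun a => exists_congr fun c => ?_
    refine and_congr_right fun _ => and_congr_right fun _ => and_congr_right fun _ =>
      and_congr_right fun _ => forall₂_congr fun r hr => ?_
    rw [hℓ r hr]

/-- Strictly increasing breakpoints that start at `lo` and stay below `hi` leave room for only one
line. -/
theorem isOutline_of_eq {l : List ℕ} (hs : SortedLines Y l M ln) (heq : lo = hi) :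
    IsOutline X Y l lo hi h b ℓ := by
  intro v q₁ q₂ D hdet hD
  have hpos := H.height_pos hs heq.le
  have hb0 : b 0 = lo := H.start hpos
  obtain rfl : h = 1 := by
    by_contra hne
    have h1 := H.lt 0 (by omega)
    have h2 := H.lt_hi 0 (by omega)
    linarith
  refine isBoundaryDescription_pair hdet fun d => ?_
  rw [hD, H.mem_polygonCone_iff hs heq.le, hb0, ← heq]

end Scan

def closeOutline : Cmd :=
  .cond (.realLt (rv 26) (rv 27))
    (.setReal 70 (nv 73) (rv 27) ;; .setNat 71 (nv 73) (.get 71 (nv 73 - 1)) ;;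
      setN 74 (nv 73 + 1)) (setN 74 (nv 73))

/-- The cases of an interval of positive length, a single ratio and an empty interval give a
polygon, an arc and a point. -/
def outline : Cmd :=
  .cond (.le (rv 26) (rv 27)) (sortLines ;; scan ;; closeOutline) (setN 74 0)

theorem outline_run : ∃ C, ∀ (σ : State) (n : ℕ), 0 < σ.nat 12 0 → σ.nat 12 0 ≤ n →
    Run outline σ (C * ((n + 1) * (Nat.log 2 n + 2))) (fun τ => τ.nat 74 0 ≤ 2 * n + 1 ∧
      IsOutline (σ.real 20) (σ.real 21) (σ.list 11 12) (σ.real 26 0) (σ.real 27 0) (τ.nat 74 0)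
        (τ.real 70) (τ.nat 71)) := by
  obtain ⟨C, hC⟩ := sortLines_run
  obtain ⟨D, hD⟩ := scan_run
  apply Exists.intro
  intro σ n hpos hn
  have hm0 : 0 < (n + 1) * (Nat.log 2 n + 2) := by positivity
  have hm : n + 1 ≤ (n + 1) * (Nat.log 2 n + 2) := Nat.le_mul_of_pos_right _ (by omega)
  refine Run.condL (K := C + (2 * D + closeOutline.bound)) (K' := (setN 74 0).bound) hm0
    (fun hle => ?_) (fun hle => Run.simpleL rfl hm0 ⟨by simp, ?_⟩)
  · simp only [holds_le, eval_rv] at hle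
    refine Run.seqL (hC σ n hpos hn).frame ?_
    rintro τ ⟨⟨h1, h2⟩, hf⟩
    have e20 : τ.real 20 = σ.real 20 := hf.2 20 (by decide)
    have e21 : τ.real 21 = σ.real 21 := hf.2 21 (by decide)
    have e26 : τ.real 26 = σ.real 26 := hf.2 26 (by decide)
    have e27 : τ.real 27 = σ.real 27 := hf.2 27 (by decide)
    have hcost : D * (τ.nat 42 0 + 1) ≤ 2 * D * ((n + 1) * (Nat.log 2 n + 2)) := by
      calc D * (τ.nat 42 0 + 1) ≤ D * (2 * ((n + 1) * (Nat.log 2 n + 2))) :=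
            Nat.mul_le_mul_left _ (by omega)
        _ = _ := by ring
    refine Run.seqL ((hD τ _ _ rfl (by rw [e21]; exact h2)).mono hcost fun _ => id).frame ?_
    rintro ρ ⟨H, hf'⟩
    rw [e20, e21, e26, e27] at H
    have r26 : ρ.real 26 = σ.real 26 := by rw [hf'.2 26 (by decide), e26]
    have r27 : ρ.real 27 = σ.real 27 := by rw [hf'.2 27 (by decide), e27]
    have hh := H.height_le
    refine Run.simpleL rfl hm0 ?_
    rcases hle.lt_or_eq with hlt | heq
    · rw [closeOutline, den_cond_pos _ (by simpa [r26, r27] using hlt)]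
      refine ⟨by simp; omega, ?_⟩
      simpa [r27] using H.isOutline_of_lt h2 hlt
    · rw [closeOutline, den_cond_neg _ (by simp [r26, r27, heq])]
      refine ⟨by simp; omega, ?_⟩
      simpa using H.isOutline_of_eq h2 heq
  · simp only [holds_le, eval_rv, not_le] at hle
    have hl : σ.list 11 12 ≠ [] := by
      rw [← List.length_pos_iff_ne_nil, State.list, length_seg]
      exact hpos
    simpa using isOutline_ray hl hle _ _

/-! ### Writing the corners -/

def cornerStep : Cmd :=
  setR 28 (0 - lineE (.get 71 (nv 55)) (.get 70 (nv 55))) ;; setR 29 (.get 70 (nv 55)) ;;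
  .setReal 3 (nv 64 + 1 + nv 55) (rv 28 * rv 7 + rv 10 + rv 29 * rv 13) ;;
  .setReal 4 (nv 64 + 1 + nv 55) (rv 28 * rv 8 + rv 11 + rv 29 * rv 14) ;;
  .setReal 5 (nv 64 + 1 + nv 55) (rv 28 * rv 9 + rv 12 + rv 29 * rv 15)

def writeCorners : Cmd :=
  (.setReal 3 (nv 64) (rv 7) ;; .setReal 4 (nv 64) (rv 8) ;; .setReal 5 (nv 64) (rv 9)) ;;
  forN 55 (nv 74) cornerStep

theorem vec_write (σ : State) (p q : ℕ) (x y z : ℝ) :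
    (((σ.setReal 3 p x).setReal 4 p y).setReal 5 p z).vec 3 q =
      if q = p then !₂[x, y, z] else σ.vec 3 q := by
  split_ifs with h
  · subst h
    simp [State.vec]
  · simp [State.vec, Function.update_of_ne h]

/-- The corner number `k` of the outline in the memory `σ`. -/
noncomputable def State.corner (σ : State) (k : ℕ) : E3 :=
  _root_.corner (σ.vec 7 0) (σ.vec 10 0) (σ.vec 13 0) (fun r => σ.real 20 (σ.nat 71 r))
    (fun r => σ.real 21 (σ.nat 71 r)) (σ.real 70) k

theorem State.corner_congr {σ τ : State} (h71 : τ.nat 71 = σ.nat 71)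
    (h : ∀ b ∈ [7, 8, 9, 10, 11, 12, 13, 14, 15, 20, 21, 70], τ.real b = σ.real b) (k : ℕ) :
    τ.corner k = σ.corner k := by
  simp only [State.corner, State.vec, Nat.reduceAdd, h71]
  repeat rw [h _ (by decide)]

theorem cornerStep_spec {σ : State} {k : ℕ} (hk : σ.nat 55 0 = k) :
    (cornerStep.den σ).nat = σ.nat ∧
    (∀ b ∉ [3, 4, 5, 28, 29], (cornerStep.den σ).real b = σ.real b) ∧
    ∀ q, (cornerStep.den σ).vec 3 q =
      if q = σ.nat 64 0 + 1 + k then σ.corner (k + 1) else σ.vec 3 q := by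
  have hf : (∀ b ∉ cornerStep.natW, (cornerStep.den σ).nat b = σ.nat b) ∧
      ∀ b ∉ cornerStep.realW, (cornerStep.den σ).real b = σ.real b := by
    obtain ⟨t, -, he⟩ := Exec.of_simple [] (c := cornerStep) rfl σ
    exact he.frame
  refine ⟨funext fun b => hf.1 b (by simp [cornerStep, Cmd.natW, setR]),
    fun b hb => hf.2 b ?_, fun q => ?_⟩
  · simp only [List.mem_cons, List.not_mem_nil, or_false, not_or] at hb
    simp [cornerStep, Cmd.realW, setR]
    omega
  refine (vec_write _ (σ.nat 64 0 + 1 + σ.nat 55 0) _ _ _ _).trans ?_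
  split_ifs with h1 h2 h2
  · simp only [State.corner, _root_.corner, comb3, State.vec]
    ext c
    fin_cases c <;> simp [hk, lineAt]
  · simp [hk] at h1; omega
  · simp [hk] at h1; omega
  · simp [State.vec]

theorem writeCorners_run : ∃ C, ∀ (σ : State) (m : ℕ), σ.nat 74 0 = m →
    Run writeCorners σ (C * (m + 1)) (fun τ => (∀ q < σ.nat 64 0, τ.vec 3 q = σ.vec 3 q) ∧
      ∀ k < m + 1, τ.vec 3 (σ.nat 64 0 + k) = σ.corner k) := by
  apply Exists.intro
  intro σ m hm
  apply Run.seqL (Run.simpleL rfl (Nat.succ_pos _) rfl).frame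
  rintro τ ⟨hτ, hf⟩
  have hn : τ.nat = σ.nat := by rw [← hτ]; rfl
  have hvec : ∀ q, τ.vec 3 q = if q = σ.nat 64 0 then σ.vec 7 0 else σ.vec 3 q := by
    intro q
    rw [← hτ]
    refine (vec_write _ (σ.nat 64 0) _ _ _ _).trans ?_
    simp [State.vec]
  refine (Run.forN_simple rfl (fun c ρ => ρ.nat 55 0 = c ∧ (∀ b, b ≠ 55 → ρ.nat b = σ.nat b) ∧
    (∀ b ∉ [3, 4, 5, 28, 29], ρ.real b = σ.real b) ∧
    (∀ q < σ.nat 64 0, ρ.vec 3 q = σ.vec 3 q) ∧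
    ∀ k < c + 1, ρ.vec 3 (σ.nat 64 0 + k) = σ.corner k) m ?_ ?_ ?_).mono le_rfl
    fun ρ h => h.2.2.2
  · refine ⟨by simp, fun b hb => by simp [hb, hn], fun b hb => ?_, fun q hq => ?_, fun k hk => ?_⟩
    · refine hf.2 b ?_
      simp only [List.mem_cons, List.not_mem_nil, or_false, not_or] at hb
      simp [Cmd.realW]
      omega
    · show τ.vec 3 q = _
      rw [hvec, if_neg (by omega)]
    · obtain rfl : k = 0 := by omega
      show τ.vec 3 _ = _
      rw [hvec, Nat.add_zero, if_pos rfl]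
      simp [State.corner, _root_.corner, comb3]
  · exact fun i ρ h => ⟨h.1, by rw [eval_nv, h.2.1 74 (by decide), hm]⟩
  · rintro c ρ hc ⟨h1, h2, h3, h4, h5⟩
    obtain ⟨e1, e2, e3⟩ := cornerStep_spec h1
    have h64 : ρ.nat 64 0 = σ.nat 64 0 := by rw [h2 64 (by decide)]
    have hcor : ρ.corner (c + 1) = σ.corner (c + 1) :=
      State.corner_congr (h2 71 (by decide)) (fun b hb => h3 b (by
        simp only [List.mem_cons, List.not_mem_nil, or_false] at hb ⊢; omega)) _
    rw [e1]
    refine ⟨by simp [h1], fun b hb => by simp [hb, e1, h2 b hb],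
      fun b hb => (e2 b hb).trans (h3 b hb), fun q hq => ?_, fun k hk => ?_⟩
    · show (cornerStep.den ρ).vec 3 q = _
      rw [e3, if_neg (by omega), h4 q hq]
    · show (cornerStep.den ρ).vec 3 _ = _
      rw [e3, h64]
      split_ifs with hkc
      · obtain rfl : k = c + 1 := by omega
        exact hcor
      · exact h5 k (by omega)

end RealRAM


theorem IsBoundaryDescription.congr {D : Set E3} {c c' : ℕ} {v : Fin c → E3} {v' : Fin c' → E3}
    (h : IsBoundaryDescription D v) (hc : c' = c) (hv : ∀ j, v' j = v (Fin.cast hc j)) :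
    IsBoundaryDescription D v' := by
  subst hc
  obtain rfl : v' = v := funext hv
  exact h

/-! ### The cone of valid directions in the coordinates of the apex -/

namespace Polyhedron

open RealRAM

variable {n : ℕ} {P : Polyhedron n}

theorem inner_comb3 {σ : State} (h : P.Loaded σ) (y a b : ℝ) (j : Fin n) :
    inner ℝ (comb3 (σ.vec 7 0) (σ.vec 10 0) (σ.vec 13 0) y a b) (P.normal j) =
      σ.dot 7 j * y + (σ.dot 10 j * a + σ.dot 13 j * b) := by
  simp only [comb3, inner_add_left, real_inner_smul_left, inner_eq_dot h]
  ring

/-- At the apex, some constraint is not tight. -/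
theorem exists_dot_pos {σ : State} (h : P.Loaded σ) (ha : Apex n σ) {i : Fin n}
    (hi : σ.nat 10 0 = i) : ∃ j < n, j ≠ σ.nat 10 0 ∧ 0 < σ.dot 7 j := by
  by_contra hcon
  have hneg := ha.neg
  rw [hi, ← inner_eq_dot h] at hneg
  have hv : σ.vec 7 0 ≠ 0 := fun hv => by simp [hv] at hneg
  -- Otherwise -v would be a valid direction for i, although v · ν_i < 0.
  have hvalid : P.IsValidPair i (-σ.vec 7 0) := by
    refine P.isValidPair_iff.2 ⟨neg_ne_zero.2 hv, fun j hj => ?_⟩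
    rw [inner_neg_left, inner_eq_dot h, neg_nonneg]
    exact not_lt.1 fun hlt => hcon ⟨j, j.2, by rw [hi]; exact fun e => hj (Fin.ext e), hlt⟩
  have := hvalid.1
  rw [inner_neg_left] at this
  linarith

/-- A constraint that is positive at the apex can be divided by its value there and becomes a lower
bound for y; a tight one does not involve y. The two tight constraints of `Apex.sides` give 0 ≤ b ≤
a, so either a = b = 0, or the ratio b / a is defined and lies in [0, 1]. -/
theorem isValidPair_iff_mem_polygonCone {σ : State} (h : P.Loaded σ) (ha : Apex n σ)
    (hc : Coords n σ) {i : Fin n} (hi : σ.nat 10 0 = i) {lo hi' : ℝ}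
    (hx : ∀ x, (lo ≤ x ∧ x ≤ hi') ↔ (0 ≤ x ∧ x ≤ 1) ∧
      ∀ j < n, j ≠ σ.nat 10 0 → ¬ 0 < σ.dot 7 j → 0 ≤ σ.dot 10 j + σ.dot 13 j * x) (d : E3) :
    P.IsValidPair i d ↔ d ≠ 0 ∧ d ∈ polygonCone (σ.vec 7 0) (σ.vec 10 0) (σ.vec 13 0)
      (σ.real 20) (σ.real 21) (σ.list 11 12) lo hi' := by
  rw [P.isValidPair_iff]
  refine and_congr_right fun _ => ⟨fun hd => ?_, ?_⟩
  · obtain ⟨y, a, b, rfl⟩ := exists_comb3 ha.det.ne' d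
    have hd' : ∀ j < n, j ≠ σ.nat 10 0 →
        0 ≤ σ.dot 7 j * y + (σ.dot 10 j * a + σ.dot 13 j * b) := fun j hj hji => by
      have := hd ⟨j, hj⟩ (fun e => hji (by rw [hi, ← e]))
      rwa [inner_comb3 h] at this
    obtain ⟨δ, hδ, j, hj, k, hk, hji, hki, h7j, h7k, h1, h2, h3, h4⟩ := ha.sides
    have hab := hd' j hj hji
    have hb := hd' k hk hki
    rw [h7j, h1, h2] at hab
    rw [h7k, h3, h4] at hb
    replace hb : 0 ≤ b := by nlinarith
    replace hab : b ≤ a := by nlinarith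
    refine ⟨y, a, b, rfl, ?_, fun j hj => ?_⟩
    · rcases (hb.trans hab).eq_or_lt with rfl | hpos
      · exact Or.inl ⟨rfl, le_antisymm hab hb⟩
      · refine Or.inr ⟨hpos, (hx _).2 ⟨⟨div_nonneg hb hpos.le, (div_le_one hpos).2 hab⟩,
          fun j hj hji h7 => ?_⟩⟩
        have := hd' j hj hji
        rw [le_antisymm (not_lt.1 h7) (ha.nonneg j hj hji)] at this
        have e : σ.dot 10 j + σ.dot 13 j * (b / a) = (σ.dot 10 j * a + σ.dot 13 j * b) / a := by
          field_simp
        rw [e]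
        exact div_nonneg (by linarith) hpos.le
    · obtain ⟨hj, hji, hw⟩ := (hc.listL j).1 hj
      rw [hc.coeff j hj, hc.slope j hj, abs_of_pos hw]
      have e : y + (σ.dot 10 j / σ.dot 7 j * a + σ.dot 13 j / σ.dot 7 j * b) =
          (σ.dot 7 j * y + (σ.dot 10 j * a + σ.dot 13 j * b)) / σ.dot 7 j := by
        field_simp
      rw [e]
      exact div_nonneg (hd' j hj hji) hw.le
  · rintro ⟨y, a, b, rfl, h1, h2⟩ j hj
    have hji : (j : ℕ) ≠ σ.nat 10 0 := by rw [hi]; exact fun e => hj (Fin.ext e)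
    rw [inner_comb3 h]
    by_cases hw : 0 < σ.dot 7 j
    · have := h2 j ((hc.listL j).2 ⟨j.2, hji, hw⟩)
      rw [hc.coeff j j.2, hc.slope j j.2, abs_of_pos hw] at this
      have e : σ.dot 7 j * y + (σ.dot 10 j * a + σ.dot 13 j * b) = σ.dot 7 j *
          (y + (σ.dot 10 j / σ.dot 7 j * a + σ.dot 13 j / σ.dot 7 j * b)) := by
        field_simp
      rw [e]
      exact mul_nonneg hw.le this
    · rw [le_antisymm (not_lt.1 hw) (ha.nonneg j j.2 hji)]
      rcases h1 with ⟨rfl, rfl⟩ | ⟨hpos, h1⟩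
      · simp
      · have := mul_nonneg (((hx _).1 h1).2 j j.2 hji hw) hpos.le
        have e : (σ.dot 10 j + σ.dot 13 j * (b / a)) * a = σ.dot 10 j * a + σ.dot 13 j * b := by
          field_simp
        rw [e] at this
        linarith

end Polyhedron

namespace RealRAM

def recordFacet : Cmd :=
  .setNat 5 (nv 3) (nv 64) ;; .setNat 6 (nv 3) (nv 74 + 1) ;; setN 64 (nv 64 + (nv 74 + 1)) ;;
  .setNat 4 (nv 3) (nv 10) ;; setN 3 (nv 3 + 1)

def emitPolygon : Cmd :=
  apex ;; setup ;; clip ;; outline ;; writeCorners ;; recordFacet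

theorem dot_congr {σ τ : State} {b : ℕ}
    (h : ∀ c ∈ [0, 1, 2, b, b + 1, b + 2], τ.real c = σ.real c) (j : ℕ) :
    τ.dot b j = σ.dot b j := by
  simp only [State.dot, h 0 (by simp), h 1 (by simp), h 2 (by simp), h b (by simp),
    h (b + 1) (by simp), h (b + 2) (by simp)]

theorem Apex.congr {n : ℕ} {σ τ : State} (h : Apex n σ) (h10 : τ.nat 10 = σ.nat 10)
    (hr : ∀ b ∈ [0, 1, 2, 7, 8, 9, 10, 11, 12, 13, 14, 15], τ.real b = σ.real b) : Apex n τ := by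
  have d7 := dot_congr (b := 7) fun c hc => hr c (by
    simp only [List.mem_cons, List.not_mem_nil, or_false] at hc ⊢; omega)
  have d10 := dot_congr (b := 10) fun c hc => hr c (by
    simp only [List.mem_cons, List.not_mem_nil, or_false] at hc ⊢; omega)
  have d13 := dot_congr (b := 13) fun c hc => hr c (by
    simp only [List.mem_cons, List.not_mem_nil, or_false] at hc ⊢; omega)
  have v : ∀ b ∈ [7, 10, 13], τ.vec b 0 = σ.vec b 0 := by
    intro b hb
    simp only [List.mem_cons, List.not_mem_nil, or_false] at hb
    rcases hb with rfl | rfl | rfl <;> simp only [State.vec] <;> repeat rw [hr _ (by decide)]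
  obtain ⟨h1, h2, h3, h4⟩ := h
  refine ⟨?_, ?_, ?_, ?_⟩
  · simpa only [d7, h10] using h1
  · simpa only [d7, h10] using h2
  · rwa [v 7 (by simp), v 10 (by simp), v 13 (by simp)]
  · simpa only [d7, d10, d13, h10] using h4

end RealRAM

/-! ### Recording the polygons and the final time bounds -/

namespace Polyhedron

open RealRAM

variable {n : ℕ} (P : Polyhedron n)

/-- The memory contains boundary descriptions for the facets found so far; the cells from
`nv 64` on are free. -/
def Described (σ : State) : Prop :=
  ∀ k < σ.nat 3 0, σ.nat 5 k + σ.nat 6 k ≤ σ.nat 64 0 ∧ ∀ i : Fin n, σ.nat 4 k = (i : ℕ) →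
    IsBoundaryDescription {d | P.IsValidPair i d}
      (fun j : Fin (σ.nat 6 k) => σ.vec 3 (σ.nat 5 k + j))

variable {P} in
theorem Described.record {σ τ : State} (h : P.Described σ) {i : Fin n} (hi : τ.nat 10 0 = i)
    (hn : ∀ b ∈ [3, 4, 5, 6, 64], τ.nat b = σ.nat b)
    (hold : ∀ q < σ.nat 64 0, τ.vec 3 q = σ.vec 3 q)
    (hnew : IsBoundaryDescription {d | P.IsValidPair i d}
      (fun j : Fin (τ.nat 74 0 + 1) => τ.vec 3 (σ.nat 64 0 + j))) :
    P.Described (recordFacet.den τ) := by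
  intro k hk
  have e3 := hn 3 (by simp)
  have e4 := hn 4 (by simp)
  have e5 := hn 5 (by simp)
  have e6 := hn 6 (by simp)
  have e64 := hn 64 (by simp)
  have hvec : ∀ q, (recordFacet.den τ).vec 3 q = τ.vec 3 q := fun _ => rfl
  have d3 : (recordFacet.den τ).nat 3 0 = σ.nat 3 0 + 1 := by simp [recordFacet, e3]
  have d4 : (recordFacet.den τ).nat 4 = Function.update (σ.nat 4) (σ.nat 3 0) i := by
    simp [recordFacet, e3, e4, hi]
  have d5 : (recordFacet.den τ).nat 5 = Function.update (σ.nat 5) (σ.nat 3 0) (σ.nat 64 0) := by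
    simp [recordFacet, e3, e5, e64]
  have d6 : (recordFacet.den τ).nat 6 =
      Function.update (σ.nat 6) (σ.nat 3 0) (τ.nat 74 0 + 1) := by
    simp [recordFacet, e3, e6]
  have d64 : (recordFacet.den τ).nat 64 0 = σ.nat 64 0 + (τ.nat 74 0 + 1) := by
    simp [recordFacet, e64]
  rw [d3] at hk
  rcases Nat.lt_succ_iff_lt_or_eq.1 hk with hk | rfl
  · obtain ⟨h1, h2⟩ := h k hk
    have c4 : (recordFacet.den τ).nat 4 k = σ.nat 4 k := by rw [d4, Function.update_of_ne hk.ne]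
    have c5 : (recordFacet.den τ).nat 5 k = σ.nat 5 k := by rw [d5, Function.update_of_ne hk.ne]
    have c6 : (recordFacet.den τ).nat 6 k = σ.nat 6 k := by rw [d6, Function.update_of_ne hk.ne]
    refine ⟨by omega, fun j hj => (h2 j (by rw [← c4, hj])).congr c6 fun l => ?_⟩
    have hl : (l : ℕ) < σ.nat 6 k := by rw [← c6]; exact l.2
    rw [hvec, c5, Fin.val_cast, hold _ (by omega)]
  · have c4 : (recordFacet.den τ).nat 4 (σ.nat 3 0) = i := by rw [d4, Function.update_self]
    have c5 : (recordFacet.den τ).nat 5 (σ.nat 3 0) = σ.nat 64 0 := by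
      rw [d5, Function.update_self]
    have c6 : (recordFacet.den τ).nat 6 (σ.nat 3 0) = τ.nat 74 0 + 1 := by
      rw [d6, Function.update_self]
    refine ⟨by omega, fun j hj => ?_⟩
    obtain rfl : i = j := Fin.ext (by rw [← hj, c4])
    exact hnew.congr c6 fun l => by rw [hvec, c5, Fin.val_cast]

/-- Only the sort inside `outline` needs the logarithmic factor. The bound 2 n + 1 for the number of
breakpoints stems from the padding of the list of lines, and keeps the writing of the corners
linear. -/
theorem emits_polygon : ∃ A, ∀ (n : ℕ) (P : Polyhedron n),
    P.Emits emitPolygon P.Described (A * ((n + 1) * (Nat.log 2 n + 2))) := by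
  obtain ⟨C₁, hC₁⟩ := apex_run
  obtain ⟨C₂, hC₂⟩ := setup_run
  obtain ⟨C₃, hC₃⟩ := clip_run
  obtain ⟨C₄, hC₄⟩ := outline_run
  obtain ⟨C₅, hC₅⟩ := writeCorners_run
  refine ⟨C₁ + (C₂ + (C₃ + (C₄ + (2 * C₅ + recordFacet.bound)))), fun n P => ⟨by decide, by decide,
    fun σ τ hn hr h => ?_, fun σ h3 k hk => by omega, ?_⟩⟩
  · rw [Described, hn 3 (by simp)]
    intro k hk
    obtain ⟨h1, h2⟩ := h k hk
    rw [hn 4 (by simp), hn 5 (by simp), hn 64 (by simp)]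
    have e6 : τ.nat 6 k = σ.nat 6 k := by rw [hn 6 (by simp)]
    refine ⟨e6 ▸ h1, fun i hi => (h2 i hi).congr e6 fun j => ?_⟩
    simp only [State.vec, hr 3 (by simp), hr (3 + 1) (by simp), hr (3 + 2) (by simp), Fin.val_cast]
  intro σ hl hg i hi hd
  have hm0 : 0 < (n + 1) * (Nat.log 2 n + 2) := by positivity
  have hm : n + 1 ≤ (n + 1) * (Nat.log 2 n + 2) := Nat.le_mul_of_pos_right _ (by omega)
  have up : ∀ C, C * (n + 1) ≤ C * ((n + 1) * (Nat.log 2 n + 2)) :=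
    fun C => Nat.mul_le_mul_left _ hm
  refine Run.seqL ((hC₁ n P σ hl i hi hd).mono (up _) fun _ => id).frame ?_
  rintro τ₁ ⟨ha₁, hf₁⟩
  refine Run.seqL ((hC₂ τ₁ n (by rw [hf₁.1 0 (by decide)]; exact hl.size)).mono (up _)
    fun _ => id).frame ?_
  rintro τ₂ ⟨hc₂, hf₂⟩
  have hl₂ : P.Loaded τ₂ := by
    refine hl.congr ?_ fun b hb => ?_
    · rw [hf₂.1 0 (by decide), hf₁.1 0 (by decide)]
    · rw [hf₂.2 b (by revert b; decide), hf₁.2 b (by revert b; decide)]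
  have ha₂ : Apex n τ₂ := ha₁.congr (hf₂.1 10 (by decide)) fun b hb =>
    hf₂.2 b (by revert b; decide)
  have hi₂ : τ₂.nat 10 0 = i := by rw [hf₂.1 10 (by decide), hf₁.1 10 (by decide), hi]
  refine Run.seqL ((hC₃ τ₂ n hl₂.size).mono (up _) fun _ => id).frame ?_
  rintro τ₃ ⟨hx, hf₃⟩
  have e11 : τ₃.nat 11 = τ₂.nat 11 := hf₃.1 11 (by decide)
  have e12 : τ₃.nat 12 = τ₂.nat 12 := hf₃.1 12 (by decide)
  have hpos : 0 < τ₃.nat 12 0 := by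
    obtain ⟨j, hj⟩ := exists_dot_pos hl₂ ha₂ hi₂
    have := List.length_pos_of_mem ((hc₂.listL j).2 hj)
    rwa [State.list, length_seg, ← e12] at this
  have hle : τ₃.nat 12 0 ≤ n := by
    have := hc₂.card
    rw [e12]
    omega
  refine Run.seqL (hC₄ τ₃ n hpos hle).frame ?_
  rintro τ₄ ⟨⟨h74, hout⟩, hf₄⟩
  have hcost : C₅ * (τ₄.nat 74 0 + 1) ≤ 2 * C₅ * ((n + 1) * (Nat.log 2 n + 2)) := by
    calc C₅ * (τ₄.nat 74 0 + 1) ≤ C₅ * (2 * ((n + 1) * (Nat.log 2 n + 2))) :=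
          Nat.mul_le_mul_left _ (by omega)
      _ = _ := by ring
  refine Run.seqL ((hC₅ τ₄ _ rfl).mono hcost fun _ => id).frame ?_
  rintro τ₅ ⟨⟨hold, hnew⟩, hf₅⟩
  have keepN : ∀ b ∈ [3, 4, 5, 6, 64], τ₅.nat b = σ.nat b := fun b hb => by
    rw [hf₅.1 b (by revert b; decide), hf₄.1 b (by revert b; decide),
      hf₃.1 b (by revert b; decide), hf₂.1 b (by revert b; decide),
      hf₁.1 b (by revert b; decide)]
  have e64 : τ₄.nat 64 = σ.nat 64 := by
    rw [hf₄.1 64 (by decide), hf₃.1 64 (by decide), hf₂.1 64 (by decide), hf₁.1 64 (by decide)]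
  have hi₅ : τ₅.nat 10 0 = i := by
    rw [hf₅.1 10 (by decide), hf₄.1 10 (by decide), hf₃.1 10 (by decide), hi₂]
  have keepR : ∀ b ∈ [3, 4, 5], τ₄.real b = σ.real b := fun b hb => by
    rw [hf₄.2 b (by revert b; decide), hf₃.2 b (by revert b; decide),
      hf₂.2 b (by revert b; decide), hf₁.2 b (by revert b; decide)]
  have keepC : ∀ b ∈ [7, 8, 9, 10, 11, 12, 13, 14, 15, 20, 21], τ₄.real b = τ₂.real b :=
    fun b hb => by rw [hf₄.2 b (by revert b; decide), hf₃.2 b (by revert b; decide)]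
  have hBD := hout (τ₂.vec 7 0) (τ₂.vec 10 0) (τ₂.vec 13 0) {d | P.IsValidPair i d} ha₂.det
    fun d => by
      rw [Set.mem_ofPred_eq, isValidPair_iff_mem_polygonCone hl₂ ha₂ hc₂ hi₂ hx,
        hf₃.2 20 (by decide), hf₃.2 21 (by decide), State.list, State.list, e11, e12]
  refine Run.simpleL rfl hm0 ⟨hg.record hi₅ keepN (fun q hq => ?_) ?_, ?_, ?_⟩
  · rw [hold q (by rw [e64]; exact hq)]
    simp only [State.vec, keepR 3 (by simp), keepR (3 + 1) (by simp), keepR (3 + 2) (by simp)]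
  · have e74 : τ₅.nat 74 0 = τ₄.nat 74 0 := by rw [hf₅.1 74 (by decide)]
    refine hBD.congr (by rw [e74]) fun k => ?_
    rw [← e64, hnew k (by rw [← e74]; exact k.2), Fin.val_cast]
    simp only [State.corner, State.vec, keepC 7 (by simp), keepC (7 + 1) (by simp),
      keepC (7 + 2) (by simp), keepC 10 (by simp), keepC (10 + 1) (by simp),
      keepC (10 + 2) (by simp), keepC 13 (by simp), keepC (13 + 1) (by simp),
      keepC (13 + 2) (by simp), keepC 20 (by simp), keepC 21 (by simp), hf₃.2 20 (by decide),
      hf₃.2 21 (by decide)]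
  · simp [recordFacet, keepN 3 (by simp)]
  · simp [recordFacet, keepN 3 (by simp), keepN 4 (by simp), hi₅]

theorem exists_program_allFAD : ∃ (p : Program) (C : ℕ), ∀ (n : ℕ) (P : Polyhedron n),
    ∃ (t : ℕ) (σ : State), p.Runs P.input t σ ∧ (t : ℝ) ≤ C * (n * Real.log n) ∧
      P.OutputsCoveringSet σ ∧ P.OutputsAllFAD σ := by
  obtain ⟨C, hC⟩ := driver_run
  obtain ⟨A, hA⟩ := emits_polygon
  refine ⟨⟨[], driver emitPolygon⟩, (C + 13 * A) * 12, fun n P => ?_⟩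
  obtain ⟨t, ht, σ, h, h1, h2, h3⟩ := hC n P emitPolygon P.Described A _
    (Nat.le_mul_of_pos_right _ (Nat.succ_pos _)) (hA n P)
  refine ⟨t, σ, h, ?_, h1, h2, fun k hk => (h3 k hk).2⟩
  have hn := P.two_le
  have hn' : (2 : ℝ) ≤ n := by exact_mod_cast hn
  have hlog2 := Real.log_two_gt_d9
  have hlog : Real.log 2 ≤ Real.log n := Real.log_le_log (by norm_num) hn'
  have hpow : (Nat.log 2 n : ℝ) * Real.log 2 ≤ Real.log n := by
    rw [← Real.log_pow]
    exact Real.log_le_log (by positivity) (by exact_mod_cast Nat.pow_log_le_self 2 (by omega))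
  -- For n ≥ 2 the binary logarithm is at most log n / log 2 < (3 / 2) log n, and 2 is at most 2 log
  -- n / log 2 < 3 log n, so the factor 6 is ample.
  have hL : ((Nat.log 2 n + 2 : ℕ) : ℝ) ≤ 6 * Real.log n := by
    have : (0 : ℝ) ≤ Nat.log 2 n := Nat.cast_nonneg _
    push_cast
    nlinarith
  have hmul : (((n + 1) * (Nat.log 2 n + 2) : ℕ) : ℝ) ≤ 12 * (n * Real.log n) := by
    rw [Nat.cast_mul]
    calc ((n + 1 : ℕ) : ℝ) * ((Nat.log 2 n + 2 : ℕ) : ℝ) ≤ (2 * n) * (6 * Real.log n) :=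
          mul_le_mul (by push_cast; linarith) hL (Nat.cast_nonneg _) (by positivity)
      _ = _ := by ring
  calc (t : ℝ) ≤ (((C + 13 * A) * ((n + 1) * (Nat.log 2 n + 2)) : ℕ) : ℝ) := by exact_mod_cast ht
    _ = ((C + 13 * A : ℕ) : ℝ) * (((n + 1) * (Nat.log 2 n + 2) : ℕ) : ℝ) := Nat.cast_mul _ _
    _ ≤ ((C + 13 * A : ℕ) : ℝ) * (12 * (n * Real.log n)) :=
        mul_le_mul_of_nonneg_left hmul (Nat.cast_nonneg _)
    _ = _ := by push_cast; ring

end Polyhedron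

theorem mainTheorem2 :
    (∃ (p : RealRAM.Program) (C : ℕ), ∀ (n : ℕ) (P : Polyhedron n),
      ∃ (t : ℕ) (σ : RealRAM.State), p.Runs P.input t σ ∧ t ≤ C * n ∧
        P.OutputsCoveringSet σ ∧ P.OutputsAllFSD σ) ∧
    (∃ (p : RealRAM.Program) (C : ℕ), ∀ (n : ℕ) (P : Polyhedron n),
      ∃ (t : ℕ) (σ : RealRAM.State), p.Runs P.input t σ ∧
        (t : ℝ) ≤ C * (n * Real.log n) ∧
        P.OutputsCoveringSet σ ∧ P.OutputsAllFAD σ) := by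
  exact ⟨Polyhedron.exists_program_allFSD, Polyhedron.exists_program_allFAD⟩
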